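/- **Theorem 1.10 (pointwise bound).** Fix $\gamma\in(-2,0)$ and write $\langle v\rangle=\sqrt{1+|v|^2}$, $\|g\|_{L^1_s}=\int_{\mathbb R^3}|g|\langle v\rangle^s\,dv$, $m_s(g)=\int_{\mathbb R^3} g\langle v\rangle^s\,dv$, $H(g)=\int_{\mathbb R^3} g\log g\,dv$ and $$\mathcal S_\varepsilon(g)=-\varepsilon^{-1}\int_{\mathbb R^3}\big[\varepsilon g\log(\varepsilon g)+(1-\varepsilon g)\log(1-\varepsilon g)\big]dv .$$ Let $\varepsilon_0>0$ and let $0\le f_{\rm in}\in L^1_2(\mathbb R^3)$ satisfy $\|f_{\rm in}\|_{L^\infty}=\varepsilon_0^{-1}$, $\mathcal S_{\varepsilon_0}(f_{\rm in})>0$, $|H(f_{\rm in})|<\infty$, and $\int f_{\rm in}\,dv=1$, $\int f_{\rm in}v\,dv=0$, $\int f_{\rm in}|v|^2dv=3$. Let $\varepsilon\in(0,\varepsilon_0]$. With $$a_{ij}(z)=|z|^{\gamma+2}\Big(\delta_{ij}-\frac{z_iz_j}{|z|^2}\Big),\qquad b_i(z)=-2z_i|z|^\gamma,\qquad \Sigma_{ij}[g]=a_{ij}*\big(g(1-\varepsilon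 g)\big),\qquad b[g]=b*g,$$ a weak solution of the Landau–Fermi–Dirac equation $$\partial_t f=\nabla\cdot\big(\Sigma[f]\nabla f-b[f]\,f(1-\varepsilon f)\big),\qquad f(0)=f_{\rm in},$$ is a measurable function $f:[0,\infty)\times\mathbb R^3\to[0,\infty)$ such that 1. $f\in L^\infty([0,\infty);L^1_2(\mathbb R^3))\cap C([0,\infty);\mathcal D'(\mathbb R^3))$; 2. $f(0)=f_{\rm in}$ and, for all $t\ge0$, $f(t)\in L^1_2$, $0\le f(t)\le\varepsilon^{-1}$, $f(t)$ has the same mass, momentum and energy ($\int g\,dv$, $\int gv\,dv$, $\int g|v|^2dv$) as $f_{\rm in}$, and $\mathcal S_\varepsilon(f(t))\ge\mathcal S_\varepsilon(f_{\rm in})$; 3. $t\mapsto\mathcal S_\varepsilon(f(t))$ is non-decreasing; 4. for all $T>0$ and $\varphi\in C^2_c([0,T)\times\mathbb R^3)$, $$\begin{aligned}-\int_0^T\!\!\int_{\mathbb R^3} f\,\partial_t\varphi\,dv\,dt-\int_{\mathbb R^3} f_{\rm in}\varphi(0,\cdot)\,dv=&\int_0^T\!\!\int_{\mathbb R^3}\sum_{i,j}\Sigma_{ij}[f(t)]\,f\,\partial^2_{v_iv_j}\varphi\,dv\,dt\\&+\sum_{i=1}^3\int_0^T\!\!\int_{\mathbb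 R^6} f(t,v)f(t,w)(1-\varepsilon f(t,w))\,b_i(v-w)\big[\partial_{v_i}\varphi(t,v)-\partial_{w_i}\varphi(t,w)\big]dv\,dw\,dt.\end{aligned}$$ Let $s>\frac32|\gamma|$. Then there is a constant $C>0$, depending only on $\gamma$, $s$, $\|f_{\rm in}\|_{L^1_2}$ and $H(f_{\rm in})$ (in particular not on $\varepsilon$, $\varepsilon_0$, $T$ or $t_*$), such that, if moreover $f_{\rm in}\in L^1_s(\mathbb R^3)$, every weak solution $f$ satisfies, for all $T>t_*>0$, $$\sup_{t\in[t_*,T)}\|f(t)\|_{L^\infty}\le C\Big(1+t_*^{-\frac{3s}{4s-3|\gamma|}-\frac34}\Big)\Big[\sup_{t\in[0,T)}m_s(f(t))\Big]^{\frac{3|\gamma|}{4s-3|\gamma|}},$$ an inequality in $[0,\infty]$. -/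

import Mathlib

noncomputable section

namespace LFD

open MeasureTheory

/-- The velocity space `ℝ³` with its Euclidean norm. -/
abbrev V : Type := EuclideanSpace ℝ (Fin 3)

/-- The Japanese bracket `⟨v⟩ = √(1 + |v|²)`. -/
def bracket (v : V) : ℝ := Real.sqrt (1 + ‖v‖ ^ 2)

/-- Membership in the weighted space `L¹_s(ℝ³)`. -/
def MemL1 (s : ℝ) (g : V → ℝ) : Prop :=
  AEStronglyMeasurable g volume ∧ Integrable (fun v => g v * bracket v ^ s) volume

/-- The norm `‖g‖_{L¹_s} = ∫ |g(v)| ⟨v⟩^s dv` (meaningful for `g ∈ L¹_s`). -/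
def normL1 (s : ℝ) (g : V → ℝ) : ℝ := ∫ v, |g v| * bracket v ^ s

/-- The moment `m_s(g) = ∫ g(v) ⟨v⟩^s dv ∈ [0, ∞]` of a nonnegative function. -/
def moment (s : ℝ) (g : V → ℝ) : ENNReal :=
  ∫⁻ v, ENNReal.ofReal (g v * bracket v ^ s)

/-- The Boltzmann entropy `H(g) = ∫ g log g dv`. -/
def boltzmannEntropy (g : V → ℝ) : ℝ := ∫ v, g v * Real.log (g v)

/-- The Fermi-Dirac entropy
`S_ε(g) = -ε⁻¹ ∫ [ε g log (ε g) + (1 - ε g) log (1 - ε g)] dv`. The integrand is integrable as soon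
as `g ∈ L¹_2` and `0 ≤ g ≤ ε⁻¹`. -/
def fermiDiracEntropy (ε : ℝ) (g : V → ℝ) : ℝ :=
  -ε⁻¹ * ∫ v, (ε * g v * Real.log (ε * g v) + (1 - ε * g v) * Real.log (1 - ε * g v))

/-- The standing assumptions on the initial datum: `0 ≤ f_in ∈ L¹_2`, `‖f_in‖_∞ = ε₀⁻¹`,
`S_{ε₀}(f_in) > 0`, `H(f_in)` finite, and mass, momentum and energy normalised by
`ϱ = θ = 1`, `u = 0`. -/
structure IsInitialDatum (ε₀ : ℝ) (fin : V → ℝ) : Prop where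
  eps_pos : 0 < ε₀
  nonneg : ∀ᵐ v, 0 ≤ fin v
  memL1 : MemL1 2 fin
  norm_top : eLpNorm fin ⊤ volume = ENNReal.ofReal ε₀⁻¹
  entropy_pos : 0 < fermiDiracEntropy ε₀ fin
  boltzmann_finite : Integrable (fun v => fin v * Real.log (fin v)) volume
  mass : ∫ v, fin v = 1
  momentum : ∀ i : Fin 3, ∫ v, fin v * v i = 0
  energy : ∫ v, fin v * ‖v‖ ^ 2 = 3

/-- The class `𝒴_ε(f_in)`. -/
structure MemY (ε : ℝ) (fin g : V → ℝ) : Prop where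
  memL1 : MemL1 2 g
  bounds : ∀ᵐ v, 0 ≤ g v ∧ g v ≤ ε⁻¹
  mass : ∫ v, g v = ∫ v, fin v
  momentum : ∀ i : Fin 3, ∫ v, g v * v i = ∫ v, fin v * v i
  energy : ∫ v, g v * ‖v‖ ^ 2 = ∫ v, fin v * ‖v‖ ^ 2
  entropy_le : fermiDiracEntropy ε fin ≤ fermiDiracEntropy ε g

/-- The Landau matrix `a_{ij}(z) = |z|^{γ+2} (δ_{ij} - z_i z_j / |z|²)`. -/
def a (γ : ℝ) (i j : Fin 3) (z : V) : ℝ :=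
  ‖z‖ ^ (γ + 2) * ((if i = j then 1 else 0) - z i * z j / ‖z‖ ^ 2)

/-- The vector `b_i(z) = ∑_k ∂_k a_{ik}(z) = -2 z_i |z|^γ`. -/
def b (γ : ℝ) (i : Fin 3) (z : V) : ℝ := -2 * z i * ‖z‖ ^ γ

/-- `Σ_{ij}[g] = a_{ij} ∗ (g (1 - ε g))`. -/
def Sig (γ ε : ℝ) (i j : Fin 3) (g : V → ℝ) (v : V) : ℝ :=
  ∫ w, a γ i j (v - w) * (g w * (1 - ε * g w))

/-- The partial derivative `∂_{v_i} ψ`. -/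
def pd (i : Fin 3) (ψ : V → ℝ) (v : V) : ℝ := fderiv ℝ ψ v (EuclideanSpace.single i 1)

/-- Test functions `φ ∈ C_c²([0,T) × ℝ³)`, given as restrictions to `t ≥ 0` of compactly
supported `C²` functions on `(-∞,T) × ℝ³`. -/
structure IsTestFunction (T : ℝ) (φ : ℝ × V → ℝ) : Prop where
  contDiff : ContDiff ℝ 2 φ
  compactSupport : HasCompactSupport φ
  support_subset : tsupport φ ⊆ Set.Iio T ×ˢ Set.univ

/-- The weak formulation of
`∂_t f = ∇ · (Σ[f] ∇f - b[f] f (1 - ε f))`, `f(0) = f_in`, tested against `φ` on `[0,T)`. -/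
def WeakForm (γ ε T : ℝ) (fin : V → ℝ) (f : ℝ → V → ℝ) (φ : ℝ × V → ℝ) : Prop :=
  -(∫ t in Set.Ioo 0 T, ∫ v, f t v * deriv (fun τ => φ (τ, v)) t) - ∫ v, fin v * φ (0, v)
    = (∫ t in Set.Ioo 0 T, ∫ v, ∑ i, ∑ j,
        Sig γ ε i j (f t) v * f t v * pd i (pd j (fun u => φ (t, u))) v)
      + ∑ i, ∫ t in Set.Ioo 0 T, ∫ p : V × V,
        f t p.1 * f t p.2 * (1 - ε * f t p.2) * b γ i (p.1 - p.2)
          * (pd i (fun u => φ (t, u)) p.1 - pd i (fun u => φ (t, u)) p.2)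

/-- Weak solutions `f : ℝ⁺ × ℝ³ → ℝ⁺` of the Landau-Fermi-Dirac equation with initial datum `fin`.
Only the values `f t v` with `t ≥ 0` matter. -/
structure IsWeakSolution (γ ε : ℝ) (fin : V → ℝ) (f : ℝ → V → ℝ) : Prop where
  measurable : AEStronglyMeasurable (fun p : ℝ × V => f p.1 p.2)
    ((volume.restrict (Set.Ici 0)).prod volume)
  /-- `f ∈ L^∞(ℝ⁺; L¹_2)`; each `f(t)` lies in `L¹_2` by `memY`. -/
  bounded : ∃ M : ℝ, ∀ᵐ t ∂(volume.restrict (Set.Ici (0 : ℝ))), normL1 2 (f t) ≤ M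
  /-- `f ∈ C(ℝ⁺; 𝒟'(ℝ³))`. -/
  continuous : ∀ ψ : V → ℝ, ContDiff ℝ (⊤ : ℕ∞) ψ → HasCompactSupport ψ →
    ContinuousOn (fun t => ∫ v, f t v * ψ v) (Set.Ici 0)
  memY : ∀ t : ℝ, 0 ≤ t → MemY ε fin (f t)
  initial : f 0 =ᵐ[volume] fin
  entropy_mono : MonotoneOn (fun t => fermiDiracEntropy ε (f t)) (Set.Ici 0)
  weak : ∀ T : ℝ, 0 < T → ∀ φ : ℝ × V → ℝ, IsTestFunction T φ → WeakForm γ ε T fin f φ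

end LFD

end

/-! ### The Japanese bracket and its elementary inequalities. -/

noncomputable section
namespace LFD
open MeasureTheory Set Filter Topology

/-! The bound is a parabolic smoothing estimate: a Moser-type iteration on `∫ f ^ p`, run with
constants that do not see `ε`.

Ellipticity. The Fermi–Dirac entropy bound controls the Boltzmann entropy of `f t` by `H(f_in) + 1`,
uniformly in `ε` (`entropy_le_of_memY`). With unit mass and energy `3` this prevents concentration.
If `ε` lies below a threshold depending only on the entropy, `f (1 - ε f)` keeps a fixed mass in a
fixed ball outside every small set (`MemY.spread`), and the diffusion matrix is bounded below by `K
⟨v⟩ ^ γ` (`Adm.coercive`, `exists_coercive`). Above the threshold, `f ≤ ε⁻¹` is already a bound by a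
constant of the entropy.

Energy inequality. Formally the equation is tested with `p f ^ (p - 1)`. The diffusion and the
Sobolev inequality yield a weighted `L⁶` norm of `f ^ (p / 2)`. In the drift term the factor
multiplying `b * f` is an exact gradient, that of `drG p ε f ≤ (p - 1) f ^ p`. The distributional
divergence of `b` is at least `-6 |z| ^ γ`, so only the zero-order quantity `∫ (|·| ^ γ * f) f ^ p`
must be controlled. Cutting the kernel at a radius that is a negative power of `p`, its singular
part is absorbed by the dissipation, since `γ > -2`, and the rest costs a power of `p`
(`Adm.drift_le`, `exists_energyIneq`).

Justification. A weak solution is too rough for this test function. Testing with translates of a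
mollifier gives an equation for the mollified density, with a flux error `mE`. Its commutator kernel
has mean zero and size `δ⁻³` on a ball of radius `δ`, because the divergence of `a * h` is `b * h`
and `a * h` is locally Lipschitz; hence the error vanishes at common Lebesgue points of the
functions involved (`tendsto_mu_mE`). The mollification and a spatial cutoff are removed
successively (`Ev.energy_local`, `Ev.energy`). The constants of both errors depend on `ε`, but they
multiply quantities tending to zero.

Iteration. Interpolating `∫ f ^ p` between the weighted `L⁶` norm, a lower norm and the moment `m_s`
makes the dissipation superlinear in `∫ f ^ p`, and a barrier argument bounds the norm after any
positive time, whatever its initial size (`Adm.interpolation`, `le_of_superlinear_damping`,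
`EnergyIneq.gain`). The first step, to `L²`, uses mass and energy only. Along the exponents `2 ^ n
(2 + κ) - κ`, with time windows halving at each step, the constants stay geometric and the limit is
the supremum bound (`EnergyIneq.ae_le`, `exists_sup_const`). -/

lemma bracket_sq (v : V) : bracket v ^ 2 = 1 + ‖v‖ ^ 2 := by
  rw [bracket, Real.sq_sqrt (by positivity)]

lemma one_le_bracket (v : V) : 1 ≤ bracket v := by
  rw [bracket, Real.one_le_sqrt]; nlinarith [sq_nonneg ‖v‖]

lemma bracket_pos (v : V) : 0 < bracket v := zero_lt_one.trans_le (one_le_bracket v)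

lemma norm_le_bracket (v : V) : ‖v‖ ≤ bracket v :=
  Real.le_sqrt_of_sq_le (by linarith)

lemma continuous_bracket : Continuous bracket := by
  unfold bracket; fun_prop

lemma bracket_le_one_add_norm (v : V) : bracket v ≤ 1 + ‖v‖ := by
  rw [bracket, Real.sqrt_le_left (by positivity)]
  nlinarith [norm_nonneg v]

lemma bracket_le_add (x w : V) : bracket x ≤ bracket w + ‖x - w‖ := by
  have h1 : ‖x‖ ≤ ‖w‖ + ‖x - w‖ := by
    calc ‖x‖ = ‖w + (x - w)‖ := by congr 1; abel
      _ ≤ _ := norm_add_le _ _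
  have h2 := norm_le_bracket w
  have h3 := bracket_sq w
  have h4 := bracket_pos w
  rw [bracket, Real.sqrt_le_left (by positivity)]
  nlinarith [norm_nonneg x, norm_nonneg w, norm_nonneg (x - w),
    mul_le_mul_of_nonneg_right h2 (norm_nonneg (x - w))]

/-- The product form separates the variables: a kernel of polynomial growth can be integrated in `w`
against the energy, leaving a weight in `x`. -/
lemma norm_sub_le_bracket (x w : V) : ‖x - w‖ ≤ bracket x * bracket w * 2 := by
  have h1 := norm_sub_le x w
  nlinarith [norm_le_bracket x, norm_le_bracket w, one_le_bracket x, one_le_bracket w]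

lemma contDiff_bracket_rpow (s : ℝ) {n : WithTop ℕ∞} : ContDiff ℝ n (fun v => bracket v ^ s) := by
  have h1 : ContDiff ℝ n (fun v : V => 1 + ‖v‖ ^ 2) := contDiff_const.add (contDiff_norm_sq ℝ)
  have h2 : ContDiff ℝ n bracket := h1.sqrt (fun v => by positivity)
  exact h2.rpow_const_of_ne (fun v => (bracket_pos v).ne')

lemma bracket_rpow_eq (s : ℝ) (v : V) : bracket v ^ s = (1 + ‖v‖ ^ 2) ^ (s / 2) := by
  rw [bracket, Real.sqrt_eq_rpow, ← Real.rpow_mul (by positivity)]; congr 1; ring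

lemma abs_coord_le (v : V) (i : Fin 3) : |v i| ≤ ‖v‖ := by
  simpa using PiLp.norm_apply_le v i

lemma fderiv_norm_sq_add (c : ℝ) (x : V) :
    HasFDerivAt (fun v : V => c + ‖v‖ ^ 2) (2 • (innerSL ℝ x)) x := by
  simpa using (hasStrictFDerivAt_norm_sq x).hasFDerivAt.const_add c

lemma inner_single (x : V) (i : Fin 3) : inner ℝ x (EuclideanSpace.single i (1 : ℝ)) = x i := by
  simp [EuclideanSpace.inner_single_right]

/-- The derivative is `s v_i ⟨v⟩ ^ (s - 2)` and `|v_i| ≤ ⟨v⟩ ^ 2`, so differentiating a weight does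
not increase its growth. -/
lemma abs_pd_bracket_rpow (s : ℝ) (i : Fin 3) (v : V) :
    |pd i (fun v => bracket v ^ s) v| ≤ |s| * bracket v ^ s := by
  have h1 : (fun v => bracket v ^ s) = fun v => (1 + ‖v‖ ^ 2) ^ (s / 2) := by
    ext v; exact bracket_rpow_eq s v
  have hp : (0 : ℝ) < 1 + ‖v‖ ^ 2 := by positivity
  have h2 := (fderiv_norm_sq_add 1 v).rpow_const (p := s / 2) (Or.inl hp.ne')
  rw [pd, h1, h2.fderiv]
  simp only [smul_apply, innerSL_apply_apply, inner_single, smul_eq_mul,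
    nsmul_eq_mul]
  rw [Real.rpow_sub_one hp.ne', bracket_rpow_eq]
  have h3 : |v i| ≤ 1 + ‖v‖ ^ 2 := by
    have := abs_coord_le v i
    nlinarith [norm_nonneg v, sq_nonneg (‖v‖ - 1)]
  have : s / 2 * ((1 + ‖v‖ ^ 2) ^ (s / 2) / (1 + ‖v‖ ^ 2)) * (((2 : ℕ) : ℝ) * v i) =
      s * (1 + ‖v‖ ^ 2) ^ (s / 2) * (v i / (1 + ‖v‖ ^ 2)) := by push_cast; field_simp
  rw [this, abs_mul, abs_mul, abs_of_nonneg (Real.rpow_nonneg hp.le _)]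
  apply mul_le_of_le_one_right (by positivity)
  rw [abs_div, abs_of_pos hp, div_le_one hp]; exact h3

/-! ### Coordinate derivatives -/

lemma pd_mul {f g : V → ℝ} {x : V} (i : Fin 3) (hf : DifferentiableAt ℝ f x)
    (hg : DifferentiableAt ℝ g x) :
    pd i (fun v => f v * g v) x = f x * pd i g x + pd i f x * g x := by
  rw [pd, fderiv_fun_mul hf hg]; simp [pd]; ring

lemma continuous_pd {f : V → ℝ} (hf : ContDiff ℝ 1 f) (i : Fin 3) : Continuous (pd i f) :=
  (hf.continuous_fderiv one_ne_zero).clm_apply continuous_const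

lemma tsupport_pd_subset (i : Fin 3) (f : V → ℝ) : tsupport (pd i f) ⊆ tsupport f :=
  tsupport_fderiv_apply_subset ℝ (f := f) _

lemma hasCompactSupport_pd {f : V → ℝ} (hf : HasCompactSupport f) (i : Fin 3) :
    HasCompactSupport (pd i f) := hf.fderiv_apply ℝ _

lemma contDiff_pd {f : V → ℝ} (hf : ContDiff ℝ (⊤ : ℕ∞) f) (i : Fin 3) :
    ContDiff ℝ (⊤ : ℕ∞) (pd i f) :=
  (hf.fderiv_right (m := (⊤ : ℕ∞)) (by exact_mod_cast le_rfl)).clm_apply contDiff_const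

/-! ### Radial integrals -/

lemma finrank_V : Module.finrank ℝ V = 3 := by simp

lemma integrableOn_norm_rpow {β : ℝ} (hβ : -3 < β) (r : ℝ) :
    IntegrableOn (fun z : V => ‖z‖ ^ β) (Metric.ball 0 r) := by
  rw [integrableOn_fun_norm_addHaar volume (f := fun y : ℝ => y ^ β), finrank_V]
  rcases le_or_gt r 0 with h | h
  · rw [Ioo_eq_empty (by linarith)]; simp
  have : IntegrableOn (fun y : ℝ => y ^ (2 + β)) (Ioo 0 r) :=
    (intervalIntegral.integrableOn_Ioo_rpow_iff h).2 (by linarith)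
  refine this.congr_fun (fun y hy => ?_) measurableSet_Ioo
  simp only [smul_eq_mul]
  rw [Real.rpow_add hy.1]; norm_num

/-- The integral of `|z|^β` over the unit ball. -/
def radC (β : ℝ) : ℝ := 3 * (volume : Measure V).real (Metric.ball 0 1) / (3 + β)

lemma radC_nonneg {β : ℝ} (hβ : -3 < β) : 0 ≤ radC β := by
  unfold radC; have : 0 < 3 + β := by linarith
  positivity

lemma setIntegral_norm_rpow {β : ℝ} (hβ : -3 < β) {r : ℝ} (hr : 0 < r) :
    ∫ z : V in Metric.ball 0 r, ‖z‖ ^ β = radC β * r ^ (3 + β) := by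
  have h1 : ∀ z : V, (Metric.ball 0 r).indicator (fun z : V => ‖z‖ ^ β) z
      = (Iio r).indicator (fun y : ℝ => y ^ β) ‖z‖ := by
    intro z; simp [indicator]
  rw [← integral_indicator measurableSet_ball]
  simp_rw [h1]
  rw [integral_fun_norm_addHaar, finrank_V]
  have h2 : ∫ y in Ioi (0 : ℝ), y ^ (3 - 1) • (Iio r).indicator (fun y : ℝ => y ^ β) y
      = ∫ y in Ioo (0 : ℝ) r, y ^ (2 + β) := by
    rw [← integral_indicator measurableSet_Ioi, ← integral_indicator measurableSet_Ioo]
    congr 1; ext y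
    by_cases h0 : 0 < y <;> by_cases hr : y < r <;> simp [indicator, h0, hr]
    rw [Real.rpow_add h0]; norm_num
  rw [h2, ← integral_Ioc_eq_integral_Ioo, ← intervalIntegral.integral_of_le hr.le,
    integral_rpow (Or.inl (by linarith)), Real.zero_rpow (by linarith)]
  unfold radC
  have : (2 : ℝ) + β + 1 = 3 + β := by ring
  rw [this]
  simp; ring

end LFD
end

noncomputable section
namespace LFD
open MeasureTheory Set Filter Topology

/-! ### The Sobolev inequality -/

lemma sum_sq_coord (v : V) : ∑ i, v i ^ 2 = ‖v‖ ^ 2 := by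
  rw [EuclideanSpace.norm_sq_eq]; simp

lemma fderiv_apply_eq_sum (f : V → ℝ) (x h : V) :
    fderiv ℝ f x h = ∑ i, h i * pd i f x := by
  have : h = ∑ i, h i • EuclideanSpace.single i (1 : ℝ) := by
    ext j; simp [Finset.sum_apply, Pi.single_apply]
  conv_lhs => rw [this]
  simp [pd]

/-- Cauchy–Schwarz. It replaces the operator norm in the Sobolev inequality by the coordinate sum
appearing in the energy estimate. -/
lemma norm_fderiv_sq_le (f : V → ℝ) (x : V) : ‖fderiv ℝ f x‖ ^ 2 ≤ ∑ i, pd i f x ^ 2 := by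
  have h0 : 0 ≤ ∑ i, pd i f x ^ 2 := Finset.sum_nonneg fun i _ => sq_nonneg _
  have : ‖fderiv ℝ f x‖ ≤ √(∑ i, pd i f x ^ 2) := by
    refine ContinuousLinearMap.opNorm_le_bound _ (Real.sqrt_nonneg _) fun h => ?_
    rw [fderiv_apply_eq_sum, Real.norm_eq_abs]
    apply abs_le_of_sq_le_sq _ (by positivity)
    rw [mul_pow, Real.sq_sqrt h0, ← sum_sq_coord, mul_comm]
    exact Finset.sum_mul_sq_le_sq_mul_sq _ _ _
  calc _ ≤ √(∑ i, pd i f x ^ 2) ^ 2 := by gcongr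
    _ = _ := Real.sq_sqrt h0

/-- The constant of the Sobolev inequality on `ℝ³`. -/
def sobC : ℝ := (eLpNormLESNormFDerivOfEqInnerConst (volume : Measure V) 2 : ℝ) ^ 2 + 1

lemma sobC_pos : 0 < sobC := by unfold sobC; positivity

/-- The Gagliardo–Nirenberg–Sobolev inequality with exponents `2` and `6` in dimension three,
squared. -/
lemma sobolev {ψ : V → ℝ} (h1 : ContDiff ℝ 1 ψ) (h2 : HasCompactSupport ψ) :
    (∫ x, ψ x ^ 6) ^ (1 / 3 : ℝ) ≤ sobC * ∫ x, ∑ i, pd i ψ x ^ 2 := by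
  have key := eLpNorm_le_eLpNorm_fderiv_of_eq_inner (volume : Measure V) h1 h2 (p := 2) (p' := 6)
    (by norm_num) (by simp) (by rw [finrank_V]; norm_num)
  have m6 : MemLp ψ 6 := h1.continuous.memLp_of_hasCompactSupport h2
  have m2 : MemLp (fderiv ℝ ψ) 2 :=
    (h1.continuous_fderiv one_ne_zero).memLp_of_hasCompactSupport (h2.fderiv ℝ)
  have e6 := m6.eLpNorm_eq_integral_rpow_norm (by norm_num) (by norm_num)
  have e2 := m2.eLpNorm_eq_integral_rpow_norm (by norm_num) (by norm_num)
  have n6 : ((6 : NNReal) : ENNReal) = 6 := by norm_num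
  have n2 : ((2 : NNReal) : ENNReal) = 2 := by norm_num
  rw [n6, n2, e6, e2] at key
  set c := eLpNormLESNormFDerivOfEqInnerConst (volume : Measure V) 2
  have t6 : (6 : ENNReal).toReal = (6 : ℕ) := by norm_num
  have t2 : (2 : ENNReal).toReal = (2 : ℕ) := by norm_num
  simp only [t6, t2, Real.rpow_natCast] at key
  rw [← ENNReal.ofReal_coe_nnreal, ← ENNReal.ofReal_mul (by positivity),
    ENNReal.ofReal_le_ofReal_iff (by positivity)] at key
  have a6 : ∀ x, ‖ψ x‖ ^ 6 = ψ x ^ 6 := fun x => by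
    rw [Real.norm_eq_abs, Even.pow_abs (by decide)]
  simp only [a6] at key
  have i6 : 0 ≤ ∫ x, ψ x ^ 6 := integral_nonneg fun x => by positivity
  have i2 : 0 ≤ ∫ x, ‖fderiv ℝ ψ x‖ ^ 2 := integral_nonneg fun x => by positivity
  have k2 := pow_le_pow_left₀ (by positivity) key 2
  rw [mul_pow, ← Real.rpow_natCast, ← Real.rpow_mul i6, ← Real.rpow_natCast (_ ^ (_ : ℝ)),
    ← Real.rpow_mul i2] at k2
  norm_num at k2
  have i3 : ∫ x, ‖fderiv ℝ ψ x‖ ^ 2 ≤ ∫ x, ∑ i, pd i ψ x ^ 2 := by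
    refine integral_mono ?_ ?_ (fun x => norm_fderiv_sq_le ψ x)
    · exact Continuous.integrable_of_hasCompactSupport
        ((h1.continuous_fderiv one_ne_zero).norm.pow 2)
        ((h2.fderiv ℝ).comp_left (g := fun z => ‖z‖ ^ 2) (by simp))
    · refine integrable_finsetSum _ fun i _ => ?_
      exact Continuous.integrable_of_hasCompactSupport ((continuous_pd h1 i).pow 2)
        ((hasCompactSupport_pd h2 i).comp_left (g := fun z => z ^ 2) (by simp))
  have i4 : 0 ≤ ∫ x, ∑ i, pd i ψ x ^ 2 := i2.trans i3
  calc _ ≤ (c : ℝ) ^ 2 * ∫ x, ‖fderiv ℝ ψ x‖ ^ 2 := by simpa using k2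
    _ ≤ (c : ℝ) ^ 2 * ∫ x, ∑ i, pd i ψ x ^ 2 := by gcongr
    _ ≤ _ := by
      -- The summand `1` in `sobC` only makes the constant positive, so that it can be divided by
      -- later.
      unfold sobC; rw [add_mul]; linarith

/-! ### Bounded densities of finite mass and energy -/

/-- Densities with `0 ≤ f ≤ M` and `∫ f ⟨v⟩² ≤ m`. -/
structure Adm (M m : ℝ) (f : V → ℝ) : Prop where
  meas : AEStronglyMeasurable f volume
  nonneg : ∀ v, 0 ≤ f v
  le : ∀ v, f v ≤ M
  int : Integrable (fun v => f v * bracket v ^ 2) volume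
  int_le : ∫ v, f v * bracket v ^ 2 ≤ m

namespace Adm
variable {M m : ℝ} {f : V → ℝ}

lemma M_nonneg (hf : Adm M m f) : 0 ≤ M := (hf.nonneg 0).trans (hf.le 0)

lemma integrable_mul (hf : Adm M m f) {k : V → ℝ} (hk : AEStronglyMeasurable k volume) {C : ℝ}
    (h : ∀ v, |k v| ≤ C * bracket v ^ 2) : Integrable (fun v => k v * f v) := by
  refine (hf.int.const_mul C).mono (hk.mul hf.meas) (ae_of_all _ fun v => ?_)
  have h1 := hf.nonneg v
  have h2 : 0 ≤ C * bracket v ^ 2 := (abs_nonneg _).trans (h v)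
  rw [Real.norm_eq_abs, Real.norm_eq_abs, abs_mul, abs_of_nonneg h1]
  calc |k v| * f v ≤ C * bracket v ^ 2 * f v := by gcongr; exact h v
    _ = C * (f v * bracket v ^ 2) := by ring
    _ ≤ _ := le_abs_self _

lemma integral_mul_le (hf : Adm M m f) {k : V → ℝ} (hk : AEStronglyMeasurable k volume) {C : ℝ}
    (hC : 0 ≤ C) (h : ∀ v, |k v| ≤ C * bracket v ^ 2) : ∫ v, |k v| * f v ≤ C * m := by
  have h1 := hf.integrable_mul (k := fun v => |k v|) hk.norm (by simpa using h)
  calc ∫ v, |k v| * f v ≤ ∫ v, C * (f v * bracket v ^ 2) := by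
        refine integral_mono h1 (hf.int.const_mul C) fun v => ?_
        have := mul_le_mul_of_nonneg_right (h v) (hf.nonneg v)
        simp only; linarith
    _ = C * ∫ v, f v * bracket v ^ 2 := integral_const_mul _ _
    _ ≤ _ := by gcongr; exact hf.int_le

lemma integrable (hf : Adm M m f) : Integrable f := by
  simpa using hf.integrable_mul (k := fun _ => 1) aestronglyMeasurable_const (C := 1)
    (fun v => by have := one_le_bracket v; rw [abs_one, one_mul]; nlinarith)

lemma m_nonneg (hf : Adm M m f) : 0 ≤ m :=
  (integral_nonneg fun v => mul_nonneg (hf.nonneg v) (sq_nonneg _)).trans hf.int_le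

lemma integral_le (hf : Adm M m f) : ∫ v, f v ≤ m := by
  have := hf.integral_mul_le (k := fun _ => 1) aestronglyMeasurable_const (C := 1) zero_le_one
    (fun v => by have := one_le_bracket v; rw [abs_one, one_mul]; nlinarith)
  simpa using this

lemma mono (hf : Adm M m f) {g : V → ℝ} (hg : AEStronglyMeasurable g volume)
    (h0 : ∀ v, 0 ≤ g v) (h1 : ∀ v, g v ≤ f v) : Adm M m g := by
  have hi : Integrable (fun v => g v * bracket v ^ 2) := by
    refine hf.int.mono (hg.mul (continuous_bracket.pow 2).aestronglyMeasurable)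
      (ae_of_all _ fun v => ?_)
    rw [Real.norm_eq_abs, Real.norm_eq_abs, abs_mul, abs_mul, abs_of_nonneg (h0 v),
      abs_of_nonneg (hf.nonneg v)]
    gcongr; exact h1 v
  refine ⟨hg, h0, fun v => (h1 v).trans (hf.le v), hi, le_trans ?_ hf.int_le⟩
  exact integral_mono hi hf.int fun v => mul_le_mul_of_nonneg_right (h1 v) (sq_nonneg _)

/-- Singular kernels `|z|^β` with `-3 < β ≤ 0` against a bounded density. -/
lemma singular (hf : Adm M m f) {β : ℝ} (hβ : -3 < β) (hβ0 : β ≤ 0) (x : V) :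
    Integrable (fun w => ‖x - w‖ ^ β * f w) ∧
      ∫ w, ‖x - w‖ ^ β * f w ≤ M * radC β + m := by
  have hM := hf.M_nonneg
  have mk : AEStronglyMeasurable (fun w : V => ‖x - w‖ ^ β) volume :=
    ((measurable_const.sub measurable_id).norm.pow_const β).aestronglyMeasurable
  have i1 : Integrable (fun w : V => (Metric.ball x 1).indicator (fun w => ‖x - w‖ ^ β) w) := by
    have h := ((integrable_indicator_iff measurableSet_ball).2
      (integrableOn_norm_rpow hβ 1)).comp_sub_left x
    refine h.congr (ae_of_all _ fun w => ?_)
    simp only [indicator, Metric.mem_ball, dist_eq_norm, sub_zero, norm_sub_rev w x]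
  have e1 : ∫ w : V, (Metric.ball x 1).indicator (fun w => ‖x - w‖ ^ β) w = radC β := by
    have h := integral_sub_left_eq_self
      ((Metric.ball (0 : V) 1).indicator (fun z : V => ‖z‖ ^ β)) volume x
    rw [integral_indicator measurableSet_ball, setIntegral_norm_rpow hβ one_pos] at h
    rw [Real.one_rpow, mul_one] at h
    rw [← h]; congr 1; ext w
    simp only [indicator, Metric.mem_ball, dist_eq_norm, sub_zero, norm_sub_rev w x]
  have hb : ∀ w, ‖x - w‖ ^ β * f w ≤
      M * (Metric.ball x 1).indicator (fun w => ‖x - w‖ ^ β) w + f w := by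
    intro w
    by_cases hw : w ∈ Metric.ball x 1
    · rw [indicator_of_mem hw]
      have := mul_le_mul_of_nonneg_left (hf.le w) (Real.rpow_nonneg (norm_nonneg (x - w)) β)
      linarith [hf.nonneg w]
    · rw [indicator_of_notMem hw]
      have h1 : 1 ≤ ‖x - w‖ := by
        simpa [dist_eq_norm, norm_sub_rev w x] using hw
      have := mul_le_mul_of_nonneg_right (Real.rpow_le_one_of_one_le_of_nonpos h1 hβ0) (hf.nonneg w)
      linarith
  have hi : Integrable (fun w => ‖x - w‖ ^ β * f w) := by
    refine ((i1.const_mul M).add hf.integrable).mono' (mk.mul hf.meas) (ae_of_all _ fun w => ?_)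
    rw [Real.norm_eq_abs, abs_of_nonneg (mul_nonneg (Real.rpow_nonneg (norm_nonneg _) _)
      (hf.nonneg w))]
    exact hb w
  refine ⟨hi, (integral_mono hi ((i1.const_mul M).add hf.integrable) hb).trans ?_⟩
  simp only [Pi.add_apply]
  rw [integral_add (i1.const_mul M) hf.integrable, integral_const_mul, e1]
  linarith [hf.integral_le]

end Adm

/-- The kernel `|z|⁻¹ + |z| + 1`, which dominates `|z|^β` for `|β| ≤ 1`. -/
def K1 (z : V) : ℝ := ‖z‖ ^ (-1 : ℝ) + ‖z‖ + 1

lemma K1_nonneg (z : V) : 0 ≤ K1 z := by unfold K1; positivity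

lemma measurable_K1 : Measurable K1 :=
  ((measurable_norm.pow_const _).add measurable_norm).add_const _

lemma rpow_le_K1 {β : ℝ} (h1 : -1 ≤ β) (h2 : β ≤ 1) (z : V) : ‖z‖ ^ β ≤ K1 z := by
  unfold K1
  rcases eq_or_lt_of_le (norm_nonneg z) with h | h
  · rw [← h]
    have := Real.zero_rpow_le_one β
    have := Real.rpow_nonneg (le_refl (0 : ℝ)) (-1)
    linarith
  rcases le_or_gt ‖z‖ 1 with h3 | h3
  · have := Real.rpow_le_rpow_of_exponent_ge h h3 h1
    linarith
  · have := Real.rpow_le_rpow_of_exponent_le h3.le h2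
    rw [Real.rpow_one] at this
    have := Real.rpow_nonneg h.le (-1)
    linarith

/-- The growth constant of convolutions with `K1`. -/
def growC (M m : ℝ) : ℝ := M * radC (-1) + 4 * m

lemma Adm.growC_nonneg {M m : ℝ} {f : V → ℝ} (hf : Adm M m f) : 0 ≤ growC M m := by
  have := mul_nonneg hf.M_nonneg (radC_nonneg (β := -1) (by norm_num))
  unfold growC; linarith [hf.m_nonneg]

/-- Near the diagonal the singularity is integrated against the sup bound, elsewhere mass and energy
suffice. With `M = ε⁻¹` the constant depends on `ε`, so it may enter only integrability statements
and error terms that vanish in the limit. -/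
lemma Adm.K1_bound {M m : ℝ} {f : V → ℝ} (hf : Adm M m f) (x : V) :
    Integrable (fun w => K1 (x - w) * f w) ∧ ∫ w, K1 (x - w) * f w ≤ growC M m * bracket x := by
  obtain ⟨i1, b1⟩ := hf.singular (β := -1) (by norm_num) (by norm_num) x
  have hm : AEStronglyMeasurable (fun w : V => ‖x - w‖) volume := by fun_prop
  have hb : ∀ w : V, |‖x - w‖| ≤ 2 * bracket x * bracket w ^ 2 := fun w => by
    rw [abs_norm]
    have h1 := norm_sub_le_bracket x w
    have h2 := one_le_bracket w
    have h3 := bracket_pos x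
    nlinarith [mul_le_mul_of_nonneg_left h2 (mul_pos h3 (bracket_pos w)).le]
  have hx := bracket_pos x
  have i2 := hf.integrable_mul hm hb
  have b2 := hf.integral_mul_le hm (by positivity) hb
  simp only [abs_norm] at b2
  have e : (fun w => K1 (x - w) * f w) =
      fun w => ‖x - w‖ ^ (-1 : ℝ) * f w + ‖x - w‖ * f w + f w := by
    ext w; unfold K1; ring
  rw [e]
  refine ⟨(i1.add i2).add hf.integrable, ?_⟩
  have e2 := integral_add (i1.add i2) hf.integrable
  simp only [Pi.add_apply] at e2
  rw [e2, integral_add i1 i2]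
  have h3 := hf.integral_le
  have h4 := one_le_bracket x
  have h5 := hf.m_nonneg
  have h6 := mul_nonneg hf.M_nonneg (radC_nonneg (β := -1) (by norm_num))
  unfold growC
  nlinarith

lemma Adm.conv_bound {M m : ℝ} {f : V → ℝ} (hf : Adm M m f) {k : V → ℝ} (hk : Measurable k) {C : ℝ}
    (hC : ∀ z, |k z| ≤ C * K1 z) (x : V) :
    Integrable (fun w => k (x - w) * f w) ∧
      ∫ w, |k (x - w) * f w| ≤ C * growC M m * bracket x := by
  obtain ⟨i1, b1⟩ := hf.K1_bound x
  have hC0 : 0 ≤ C := by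
    have h1 := (abs_nonneg _).trans (hC 0)
    have h2 : 0 < K1 0 := by unfold K1; positivity
    by_contra hneg
    nlinarith [mul_neg_of_neg_of_pos (not_le.1 hneg) h2]
  have hb : ∀ w, |k (x - w) * f w| ≤ C * (K1 (x - w) * f w) := fun w => by
    rw [abs_mul, abs_of_nonneg (hf.nonneg w), ← mul_assoc]
    exact mul_le_mul_of_nonneg_right (hC _) (hf.nonneg w)
  have hi : Integrable (fun w => k (x - w) * f w) :=
    (i1.const_mul C).mono' ((hk.comp (measurable_const.sub measurable_id)).aestronglyMeasurable.mul
      hf.meas) (ae_of_all _ hb)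
  refine ⟨hi, (integral_mono hi.abs (i1.const_mul C) hb).trans ?_⟩
  rw [integral_const_mul, mul_assoc]
  gcongr

/-- The kernel has no singularity here, so the sup bound `M` does not enter the constant. -/
lemma Adm.conv_bound_sq {M m : ℝ} {f : V → ℝ} (hf : Adm M m f) {k : V → ℝ} (hk : Measurable k)
    {C : ℝ} (hC0 : 0 ≤ C) (hC : ∀ z, |k z| ≤ C * (1 + ‖z‖ ^ 2)) (x : V) :
    Integrable (fun w => k (x - w) * f w) ∧
      ∫ w, |k (x - w) * f w| ≤ 5 * C * m * bracket x ^ 2 := by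
  have hm : AEStronglyMeasurable (fun w : V => k (x - w)) volume :=
    (hk.comp (measurable_const.sub measurable_id)).aestronglyMeasurable
  have hb : ∀ w, |k (x - w)| ≤ 5 * C * bracket x ^ 2 * bracket w ^ 2 := fun w => by
    refine (hC _).trans ?_
    have h1 := pow_le_pow_left₀ (norm_nonneg _) (norm_sub_le_bracket x w) 2
    have h2 : 1 ≤ bracket x ^ 2 * bracket w ^ 2 := by
      have := one_le_bracket x; have := one_le_bracket w
      rw [← mul_pow]; exact one_le_pow₀ (by nlinarith)
    nlinarith
  have i := hf.integrable_mul hm hb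
  have b := hf.integral_mul_le hm (by positivity) hb
  refine ⟨i, ?_⟩
  have e : ∀ w, |k (x - w) * f w| = |k (x - w)| * f w := fun w => by
    rw [abs_mul, abs_of_nonneg (hf.nonneg w)]
  simp only [e]; linarith

/-! ### The weighted interpolation inequality for the singular drift -/

/-- Hölder with exponents `3/2` and `3`. The power `|z| ^ (3γ/2)` is locally integrable exactly when
`γ > -2`, and the factor `r ^ (2 + γ)` is the smallness that later absorbs the drift. -/
lemma integral_norm_rpow_mul_sq_le {γ : ℝ} (hγ : -2 < γ) (w : V) {r : ℝ} (hr : 0 < r)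
    {ψ : V → ℝ} (hc : Continuous ψ) (hs : HasCompactSupport ψ) :
    Integrable (fun x => (Metric.ball w r).indicator (fun x => ‖x - w‖ ^ γ) x * ψ x ^ 2) ∧
    ∫ x, (Metric.ball w r).indicator (fun x => ‖x - w‖ ^ γ) x * ψ x ^ 2 ≤
      radC (3 * γ / 2) ^ (2 / 3 : ℝ) * r ^ (2 + γ) * (∫ x, ψ x ^ 6) ^ (1 / 3 : ℝ) := by
  have hβ : -3 < 3 * γ / 2 := by linarith
  set k : V → ℝ := (Metric.ball w r).indicator (fun x => ‖x - w‖ ^ γ) with hkdef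
  have hk0 : ∀ x, 0 ≤ k x := fun x => indicator_nonneg (fun x _ => by positivity) x
  have hkm : AEStronglyMeasurable k volume :=
    (((measurable_id.sub measurable_const).norm.pow_const γ).indicator
      measurableSet_ball).aestronglyMeasurable
  have hpow : ∀ x, k x ^ (3 / 2 : ℝ) =
      (Metric.ball w r).indicator (fun x => ‖x - w‖ ^ (3 * γ / 2)) x := fun x => by
    by_cases hx : x ∈ Metric.ball w r
    · simp only [hkdef, indicator_of_mem hx]
      rw [← Real.rpow_mul (norm_nonneg _)]; congr 1; ring
    · simp only [hkdef, indicator_of_notMem hx]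
      rw [Real.zero_rpow (by norm_num)]
  have htr : ∀ x, (Metric.ball w r).indicator (fun x => ‖x - w‖ ^ (3 * γ / 2)) x =
      (Metric.ball (0 : V) r).indicator (fun z => ‖z‖ ^ (3 * γ / 2)) (x - w) := fun x => by
    simp only [indicator, Metric.mem_ball, dist_eq_norm, sub_zero]
  have ik : Integrable (fun x => k x ^ (3 / 2 : ℝ)) := by
    simp only [hpow, htr]
    exact ((integrable_indicator_iff measurableSet_ball).2
      (integrableOn_norm_rpow hβ r)).comp_sub_right w
  have ek : ∫ x, k x ^ (3 / 2 : ℝ) = radC (3 * γ / 2) * r ^ (3 + 3 * γ / 2) := by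
    simp only [hpow, htr]
    rw [integral_sub_right_eq_self (fun z : V =>
      (Metric.ball (0 : V) r).indicator (fun z => ‖z‖ ^ (3 * γ / 2)) z),
      integral_indicator measurableSet_ball, setIntegral_norm_rpow hβ hr]
  have mk : MemLp k (ENNReal.ofReal (3 / 2)) volume := by
    rw [← integrable_norm_rpow_iff hkm (by simp) (by simp)]
    rw [ENNReal.toReal_ofReal (by norm_num)]
    refine ik.congr (ae_of_all _ fun x => ?_)
    simp only [Real.norm_eq_abs, abs_of_nonneg (hk0 x)]
  have hc2 : Continuous (fun x => ψ x ^ 2) := hc.pow 2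
  have hs2 : HasCompactSupport (fun x => ψ x ^ 2) := hs.comp_left (g := fun z => z ^ 2) (by simp)
  have mψ : MemLp (fun x => ψ x ^ 2) (ENNReal.ofReal 3) volume :=
    hc2.memLp_of_hasCompactSupport hs2
  have hpq : Real.HolderConjugate (3 / 2) 3 := by
    rw [Real.holderConjugate_iff]; norm_num
  have hh := integral_mul_le_Lp_mul_Lq_of_nonneg hpq (ae_of_all _ hk0)
    (ae_of_all _ fun x => sq_nonneg (ψ x)) mk mψ
  refine ⟨?_, hh.trans (le_of_eq ?_)⟩
  · have : ENNReal.HolderTriple (ENNReal.ofReal (3 / 2)) (ENNReal.ofReal 3) 1 :=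
      hpq.ennrealOfReal
    exact MemLp.integrable_mul (p := ENNReal.ofReal (3 / 2)) (q := ENNReal.ofReal 3) mk mψ
  · rw [ek, Real.mul_rpow (radC_nonneg hβ) (by positivity), ← Real.rpow_mul hr.le]
    have e6 : ∀ x, (ψ x ^ 2) ^ (3 : ℝ) = ψ x ^ 6 := fun x => by
      rw [show (3 : ℝ) = (3 : ℕ) by norm_num, Real.rpow_natCast, ← pow_mul]
    simp only [e6]
    congr 3 <;> ring

lemma bracket_rpow_neg_le_sq {γ : ℝ} (hγ : -2 < γ) {t : ℝ} (ht : 1 ≤ t) : t ^ (-γ) ≤ t ^ 2 := by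
  rw [← Real.rpow_natCast]
  exact Real.rpow_le_rpow_of_exponent_le ht (by push_cast; linarith)

/-- Pointwise splitting of the weighted singular kernel. -/
lemma norm_rpow_split {γ : ℝ} (hγ : -2 < γ) (hγ0 : γ < 0) {r : ℝ} (hr : 0 < r) (hr1 : r ≤ 1)
    (x w : V) (hx : x ≠ w) :
    ‖x - w‖ ^ γ ≤ 4 * bracket w ^ 2 *
      ((Metric.ball w r).indicator (fun x => ‖x - w‖ ^ γ) x + r⁻¹ ^ 2) * bracket x ^ γ := by
  have hxw : 0 < ‖x - w‖ := norm_pos_iff.2 (sub_ne_zero.2 hx)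
  have bx := bracket_pos x
  have bw := one_le_bracket w
  have hle := bracket_le_add x w
  have key : ‖x - w‖ ^ γ * bracket x ^ (-γ) ≤ 4 * bracket w ^ 2 *
      ((Metric.ball w r).indicator (fun x => ‖x - w‖ ^ γ) x + r⁻¹ ^ 2) := by
    -- Inside the ball, `r ≤ 1` gives `⟨x⟩ ≤ 2⟨w⟩`; outside it, `⟨x⟩ / |x - w| ≤ 2⟨w⟩ / r`. Both
    -- upper bounds are at least `1` and `-γ ≤ 2`, so their powers are at most their squares and
    -- only the energy weight `⟨w⟩ ^ 2` is spent.
    by_cases hb : x ∈ Metric.ball w r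
    · rw [indicator_of_mem hb]
      have h1 : ‖x - w‖ < r := by simpa [dist_eq_norm] using hb
      have h2 : bracket x ≤ 2 * bracket w := by linarith
      have h3 : bracket x ^ (-γ) ≤ 4 * bracket w ^ 2 := by
        calc bracket x ^ (-γ) ≤ (2 * bracket w) ^ (-γ) :=
              Real.rpow_le_rpow bx.le h2 (by linarith)
          _ ≤ (2 * bracket w) ^ 2 := bracket_rpow_neg_le_sq hγ (by linarith)
          _ = _ := by ring
      have h4 : 0 ≤ ‖x - w‖ ^ γ := by positivity
      have h5 : 0 ≤ r⁻¹ ^ 2 := by positivity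
      calc _ ≤ ‖x - w‖ ^ γ * (4 * bracket w ^ 2) := by gcongr
        _ ≤ _ := by
          rw [mul_comm]; gcongr; linarith
    · rw [indicator_of_notMem hb, zero_add]
      have h1 : r ≤ ‖x - w‖ := by simpa [dist_eq_norm] using hb
      have h2 : bracket x / ‖x - w‖ ≤ 2 * bracket w * r⁻¹ := by
        rw [div_le_iff₀ hxw]
        have h3 : 1 ≤ r⁻¹ := (one_le_inv₀ hr).2 hr1
        have h4 : 1 ≤ r⁻¹ * ‖x - w‖ := by
          rw [← div_eq_inv_mul, le_div_iff₀ hr]; linarith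
        have h5 : bracket w ≤ bracket w * (r⁻¹ * ‖x - w‖) := le_mul_of_one_le_right (by linarith) h4
        have h6 : ‖x - w‖ ≤ bracket w * (r⁻¹ * ‖x - w‖) := by
          have : ‖x - w‖ ≤ r⁻¹ * ‖x - w‖ := le_mul_of_one_le_left hxw.le h3
          have : r⁻¹ * ‖x - w‖ ≤ bracket w * (r⁻¹ * ‖x - w‖) :=
            le_mul_of_one_le_left (by positivity) bw
          linarith
        nlinarith
      have e : ‖x - w‖ ^ γ * bracket x ^ (-γ) = (bracket x / ‖x - w‖) ^ (-γ) := by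
        rw [Real.div_rpow bx.le hxw.le, Real.rpow_neg hxw.le, div_inv_eq_mul, mul_comm]
      rw [e]
      calc _ ≤ (2 * bracket w * r⁻¹) ^ (-γ) :=
            Real.rpow_le_rpow (by positivity) h2 (by linarith)
        _ ≤ (2 * bracket w * r⁻¹) ^ 2 := bracket_rpow_neg_le_sq hγ (by
            have h3 : 1 ≤ r⁻¹ := (one_le_inv₀ hr).2 hr1
            nlinarith)
        _ = _ := by ring
  have hp : 0 < bracket x ^ γ := Real.rpow_pos_of_pos bx _
  have := mul_le_mul_of_nonneg_right key hp.le
  rwa [mul_assoc, ← Real.rpow_add bx, neg_add_cancel, Real.rpow_zero, mul_one] at this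

/-- The weighted `L⁶` quantity in the dissipation. -/
def wL6 (γ : ℝ) (φ : V → ℝ) : ℝ := (∫ x, (bracket x ^ (γ / 2) * φ x) ^ 6) ^ (1 / 3 : ℝ)

lemma wL6_nonneg (γ : ℝ) (φ : V → ℝ) : 0 ≤ wL6 γ φ :=
  Real.rpow_nonneg (integral_nonneg fun x => by positivity) _

lemma bracket_half_sq (γ : ℝ) (x : V) (t : ℝ) :
    (bracket x ^ (γ / 2) * t) ^ 2 = bracket x ^ γ * t ^ 2 := by
  rw [mul_pow, ← Real.rpow_natCast (bracket x ^ (γ / 2)), ← Real.rpow_mul (bracket_pos x).le]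
  congr 2; push_cast; ring

/-- A small multiple of the weighted `L⁶` quantity plus a large multiple of the weighted `L²`
quantity. The bound is integrable in `w` against any density of finite energy, without use of its
sup norm; this is what keeps the energy inequality independent of `ε`. -/
lemma integral_singular_mul_sq_le {γ : ℝ} (hγ : -2 < γ) (hγ0 : γ < 0) {r : ℝ} (hr : 0 < r)
    (hr1 : r ≤ 1) (w : V) {φ : V → ℝ} (hc : Continuous φ) (hs : HasCompactSupport φ) :
    Integrable (fun x => ‖x - w‖ ^ γ * φ x ^ 2) ∧
    ∫ x, ‖x - w‖ ^ γ * φ x ^ 2 ≤ 4 * bracket w ^ 2 *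
      (radC (3 * γ / 2) ^ (2 / 3 : ℝ) * r ^ (2 + γ) * wL6 γ φ
        + r⁻¹ ^ 2 * ∫ x, bracket x ^ γ * φ x ^ 2) := by
  set ψ : V → ℝ := fun x => bracket x ^ (γ / 2) * φ x
  have cb : Continuous (fun x => bracket x ^ (γ / 2)) :=
    (contDiff_bracket_rpow (n := 0) (γ / 2)).continuous
  have hcψ : Continuous ψ := cb.mul hc
  have hsψ : HasCompactSupport ψ := hs.mul_left
  obtain ⟨i1, b1⟩ := integral_norm_rpow_mul_sq_le hγ w hr hcψ hsψ
  have hψ2 : ∀ x, ψ x ^ 2 = bracket x ^ γ * φ x ^ 2 := fun x => bracket_half_sq γ x (φ x)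
  have i2 : Integrable (fun x => ψ x ^ 2) :=
    Continuous.integrable_of_hasCompactSupport (hcψ.pow 2)
      (hsψ.comp_left (g := fun z => z ^ 2) (by simp))
  have hpt : ∀ x, x ≠ w → ‖x - w‖ ^ γ * φ x ^ 2 ≤ 4 * bracket w ^ 2 *
      ((Metric.ball w r).indicator (fun x => ‖x - w‖ ^ γ) x * ψ x ^ 2 + r⁻¹ ^ 2 * ψ x ^ 2) := by
    intro x hx
    have h := mul_le_mul_of_nonneg_right (norm_rpow_split hγ hγ0 hr hr1 x w hx) (sq_nonneg (φ x))
    rw [hψ2]; linarith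
  have hae : ∀ᵐ x : V, x ≠ w := by
    simp [ae_iff]
  have i3 := ((i1.add (i2.const_mul (r⁻¹ ^ 2))).const_mul (4 * bracket w ^ 2))
  have hi : Integrable (fun x => ‖x - w‖ ^ γ * φ x ^ 2) := by
    refine i3.mono' (((measurable_id.sub measurable_const).norm.pow_const γ).aestronglyMeasurable.mul
      (hc.pow 2).aestronglyMeasurable) ?_
    filter_upwards [hae] with x hx
    rw [Real.norm_eq_abs, abs_of_nonneg (by positivity)]
    exact hpt x hx
  refine ⟨hi, ?_⟩
  calc _ ≤ ∫ x, 4 * bracket w ^ 2 *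
        ((Metric.ball w r).indicator (fun x => ‖x - w‖ ^ γ) x * ψ x ^ 2 + r⁻¹ ^ 2 * ψ x ^ 2) :=
        integral_mono_ae hi i3 (by filter_upwards [hae] with x hx using hpt x hx)
    _ = 4 * bracket w ^ 2 * (∫ x, (Metric.ball w r).indicator (fun x => ‖x - w‖ ^ γ) x * ψ x ^ 2)
        + 4 * bracket w ^ 2 * (r⁻¹ ^ 2 * ∫ x, ψ x ^ 2) := by
        rw [integral_const_mul, integral_add i1 (i2.const_mul _), integral_const_mul, mul_add]
    _ ≤ _ := by
        rw [mul_add]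
        simp only [hψ2] at b1 ⊢
        have : 0 ≤ 4 * bracket w ^ 2 := by positivity
        have := mul_le_mul_of_nonneg_left b1 this
        unfold wL6
        linarith

end LFD
end

noncomputable section
namespace LFD
open MeasureTheory Set Filter Topology

/-! ### Regularised kernels -/

/-- Kronecker's delta. -/
def kd (i j : Fin 3) : ℝ := if i = j then 1 else 0

lemma abs_kd_le (i j : Fin 3) : |kd i j| ≤ 1 := by unfold kd; split_ifs <;> simp

/-- Smooth regularisation of the Landau matrix. -/
def ra (η γ : ℝ) (i j : Fin 3) (z : V) : ℝ :=
  (η + ‖z‖ ^ 2) ^ (γ / 2) * (‖z‖ ^ 2 * kd i j - z i * z j)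

/-- Smooth regularisation of the drift kernel. -/
def rb (η γ : ℝ) (i : Fin 3) (z : V) : ℝ := (η + ‖z‖ ^ 2) ^ (γ / 2) * (-2 * z i)

lemma contDiff_coord (i : Fin 3) {n : WithTop ℕ∞} : ContDiff ℝ n (fun z : V => z i) :=
  (EuclideanSpace.proj (𝕜 := ℝ) i).contDiff

lemma contDiff_reg {η : ℝ} (hη : 0 < η) (s : ℝ) {n : WithTop ℕ∞} :
    ContDiff ℝ n (fun z : V => (η + ‖z‖ ^ 2) ^ s) :=
  (contDiff_const.add (contDiff_norm_sq ℝ)).rpow_const_of_ne fun z => by positivity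

lemma contDiff_ra {η : ℝ} (hη : 0 < η) (γ : ℝ) (i j : Fin 3) {n : WithTop ℕ∞} :
    ContDiff ℝ n (ra η γ i j) :=
  (contDiff_reg hη _).mul (((contDiff_norm_sq ℝ).mul contDiff_const).sub
    ((contDiff_coord i).mul (contDiff_coord j)))

lemma contDiff_rb {η : ℝ} (hη : 0 < η) (γ : ℝ) (i : Fin 3) {n : WithTop ℕ∞} :
    ContDiff ℝ n (rb η γ i) :=
  (contDiff_reg hη _).mul (contDiff_const.mul (contDiff_coord i))

lemma pd_coord (i k : Fin 3) (z : V) : pd k (fun z : V => z i) z = kd i k := by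
  have : HasFDerivAt (fun z : V => z i) (EuclideanSpace.proj (𝕜 := ℝ) i) z :=
    (EuclideanSpace.proj (𝕜 := ℝ) i).hasFDerivAt
  rw [pd, this.fderiv]
  simp [kd]

lemma pd_norm_sq (k : Fin 3) (c : ℝ) (z : V) : pd k (fun z : V => c + ‖z‖ ^ 2) z = 2 * z k := by
  rw [pd, (fderiv_norm_sq_add c z).fderiv]
  simp [inner_single]

lemma pd_reg {η : ℝ} (hη : 0 < η) (s : ℝ) (k : Fin 3) (z : V) :
    pd k (fun z : V => (η + ‖z‖ ^ 2) ^ s) z = 2 * s * z k * (η + ‖z‖ ^ 2) ^ (s - 1) := by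
  have hp : (0 : ℝ) < η + ‖z‖ ^ 2 := by positivity
  rw [pd, ((fderiv_norm_sq_add η z).rpow_const (p := s) (Or.inl hp.ne')).fderiv]
  simp [inner_single]; ring

lemma pd_ra {η : ℝ} (hη : 0 < η) (γ : ℝ) (i j k : Fin 3) (z : V) :
    pd k (ra η γ i j) z = (η + ‖z‖ ^ 2) ^ (γ / 2) *
        (2 * z k * kd i j - (z i * kd j k + kd i k * z j))
      + γ * z k * (η + ‖z‖ ^ 2) ^ (γ / 2 - 1) * (‖z‖ ^ 2 * kd i j - z i * z j) := by
  have d1 : DifferentiableAt ℝ (fun z : V => (η + ‖z‖ ^ 2) ^ (γ / 2)) z :=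
    (contDiff_reg hη (γ / 2) (n := 1)).differentiable one_ne_zero z
  have c2 : ContDiff ℝ 1 (fun z : V => z i * z j) := (contDiff_coord i).mul (contDiff_coord j)
  have c3 : ContDiff ℝ 1 (fun z : V => ‖z‖ ^ 2 * kd i j) := (contDiff_norm_sq ℝ).mul contDiff_const
  have d2 := c2.differentiable one_ne_zero z
  have d3 := c3.differentiable one_ne_zero z
  have e3 : pd k (fun z : V => ‖z‖ ^ 2 * kd i j) z = 2 * z k * kd i j := by
    rw [pd_mul k ((contDiff_norm_sq ℝ (n := 1)).differentiable one_ne_zero z)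
      (differentiableAt_const _)]
    have := pd_norm_sq k 0 z
    simp only [zero_add] at this
    rw [this]; simp [pd]
  have e2 : pd k (fun z : V => z i * z j) z = z i * kd j k + kd i k * z j := by
    rw [pd_mul k ((contDiff_coord i (n := 1)).differentiable one_ne_zero z)
      ((contDiff_coord j (n := 1)).differentiable one_ne_zero z), pd_coord, pd_coord]
  have e4 : pd k (fun z : V => ‖z‖ ^ 2 * kd i j - z i * z j) z =
      2 * z k * kd i j - (z i * kd j k + kd i k * z j) := by
    rw [← e2, ← e3]; simp only [pd]
    rw [fderiv_fun_sub d3 d2]; rfl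
  show pd k (fun z => (η + ‖z‖ ^ 2) ^ (γ / 2) * (‖z‖ ^ 2 * kd i j - z i * z j)) z = _
  rw [pd_mul k d1 (d3.fun_sub d2), e4, pd_reg hη]
  ring

lemma pd_rb {η : ℝ} (hη : 0 < η) (γ : ℝ) (i k : Fin 3) (z : V) :
    pd k (rb η γ i) z = (η + ‖z‖ ^ 2) ^ (γ / 2) * (-2 * kd i k)
      + γ * z k * (η + ‖z‖ ^ 2) ^ (γ / 2 - 1) * (-2 * z i) := by
  have d1 : DifferentiableAt ℝ (fun z : V => (η + ‖z‖ ^ 2) ^ (γ / 2)) z :=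
    (contDiff_reg hη (γ / 2) (n := 1)).differentiable one_ne_zero z
  have d2 : DifferentiableAt ℝ (fun z : V => z i) z :=
    (contDiff_coord i (n := 1)).differentiable one_ne_zero z
  have e4 : pd k (fun z : V => -2 * z i) z = -2 * kd i k := by
    rw [pd_mul k (differentiableAt_const _) d2, pd_coord]; simp [pd]
  show pd k (fun z => (η + ‖z‖ ^ 2) ^ (γ / 2) * (-2 * z i)) z = _
  rw [pd_mul k d1 ((differentiableAt_const _).fun_mul d2), e4, pd_reg hη]
  ring

lemma norm_sq_eq3 (z : V) : ‖z‖ ^ 2 = z 0 ^ 2 + z 1 ^ 2 + z 2 ^ 2 := by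
  rw [← sum_sq_coord, Fin.sum_univ_three]

/-- The derivative of the radial factor is proportional to `z`, which the matrix `|z|² I - z ⊗ z`
annihilates. Only the polynomial factor contributes, with divergence `2 z_i - 4 z_i`. -/
lemma sum_pd_ra {η : ℝ} (hη : 0 < η) (γ : ℝ) (i : Fin 3) (z : V) :
    ∑ j, pd j (ra η γ i j) z = rb η γ i z := by
  simp only [pd_ra hη, Fin.sum_univ_three, rb]
  have := norm_sq_eq3 z
  generalize (η + ‖z‖ ^ 2) ^ (γ / 2) = A
  generalize (η + ‖z‖ ^ 2) ^ (γ / 2 - 1) = B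
  rw [this]
  fin_cases i <;> simp [kd] <;> ring

/-- The term from the radial factor is nonnegative because `γ < 0` and is dropped. A lower bound is
enough, since the divergence is paired with nonnegative functions only. -/
lemma sum_pd_rb {η : ℝ} (hη : 0 < η) {γ : ℝ} (hγ0 : γ < 0) (z : V) (hz : z ≠ 0) :
    -(6 * ‖z‖ ^ γ) ≤ ∑ i, pd i (rb η γ i) z := by
  have hz0 : 0 < ‖z‖ := norm_pos_iff.2 hz
  have e : ∑ i, pd i (rb η γ i) z = -6 * (η + ‖z‖ ^ 2) ^ (γ / 2)
      + (-γ) * (η + ‖z‖ ^ 2) ^ (γ / 2 - 1) * (2 * ‖z‖ ^ 2) := by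
    simp only [pd_rb hη, Fin.sum_univ_three, kd]
    have := norm_sq_eq3 z
    generalize (η + ‖z‖ ^ 2) ^ (γ / 2) = A
    generalize (η + ‖z‖ ^ 2) ^ (γ / 2 - 1) = B
    rw [this]; simp; ring
  have h1 : (η + ‖z‖ ^ 2) ^ (γ / 2) ≤ ‖z‖ ^ γ := by
    calc _ ≤ (‖z‖ ^ 2) ^ (γ / 2) :=
          Real.rpow_le_rpow_of_nonpos (by positivity) (by linarith) (by linarith)
      _ = _ := by rw [← Real.rpow_natCast, ← Real.rpow_mul hz0.le]; congr 1; push_cast; ring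
  have h2 : 0 ≤ (-γ) * (η + ‖z‖ ^ 2) ^ (γ / 2 - 1) * (2 * ‖z‖ ^ 2) := by
    have : 0 < -γ := by linarith
    positivity
  rw [e]; linarith

lemma reg_mul_norm_le {η : ℝ} (hη : 0 ≤ η) {γ : ℝ} (hγ0 : γ < 0) (z : V) {β : ℝ} (hβ : 0 < β) :
    (η + ‖z‖ ^ 2) ^ (γ / 2) * ‖z‖ ^ β ≤ ‖z‖ ^ (γ + β) := by
  rcases eq_or_lt_of_le (norm_nonneg z) with h | h
  · rw [← h, Real.zero_rpow hβ.ne', mul_zero]; positivity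
  · rw [Real.rpow_add h]
    gcongr
    calc _ ≤ (‖z‖ ^ 2) ^ (γ / 2) :=
          Real.rpow_le_rpow_of_nonpos (by positivity) (by linarith) (by linarith)
      _ = _ := by rw [← Real.rpow_natCast, ← Real.rpow_mul h.le]; congr 1; push_cast; ring

lemma abs_coord_mul_le (z : V) (i j : Fin 3) : |z i * z j| ≤ ‖z‖ ^ 2 := by
  rw [abs_mul, pow_two]
  exact mul_le_mul (abs_coord_le z i) (abs_coord_le z j) (abs_nonneg _) (norm_nonneg _)

lemma abs_proj_le (z : V) (i j : Fin 3) : |‖z‖ ^ 2 * kd i j - z i * z j| ≤ 2 * ‖z‖ ^ 2 := by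
  have h1 := abs_coord_mul_le z i j
  have h2 : |‖z‖ ^ 2 * kd i j| ≤ ‖z‖ ^ 2 := by
    rw [abs_mul, abs_of_nonneg (sq_nonneg _)]
    exact mul_le_of_le_one_right (sq_nonneg _) (abs_kd_le i j)
  have := abs_sub (‖z‖ ^ 2 * kd i j) (z i * z j)
  linarith

/-- The gradient has order `γ + 1`, which lies between `-1` and `1`, hence is dominated by `K1`,
uniformly in `η`. -/
lemma abs_pd_ra_le {η : ℝ} (hη : 0 < η) {γ : ℝ} (hγ : -2 < γ) (hγ0 : γ < 0) (i j k : Fin 3)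
    (z : V) : |pd k (ra η γ i j) z| ≤ 8 * K1 z := by
  have hp : (0 : ℝ) < η + ‖z‖ ^ 2 := by positivity
  have h0 : (η + ‖z‖ ^ 2) ^ (γ / 2) * ‖z‖ ≤ K1 z := by
    have := reg_mul_norm_le hη.le hγ0 z (β := 1) one_pos
    rw [Real.rpow_one] at this
    exact this.trans (rpow_le_K1 (by linarith) (by linarith) z)
  have hk := abs_coord_le z k
  have t1 : |2 * z k * kd i j - (z i * kd j k + kd i k * z j)| ≤ 4 * ‖z‖ := by
    have a1 : |2 * z k * kd i j| ≤ 2 * ‖z‖ := by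
      rw [abs_mul, abs_mul, abs_two]
      have := mul_le_mul hk (abs_kd_le i j) (abs_nonneg _) (norm_nonneg _)
      linarith
    have a2 : |z i * kd j k| ≤ ‖z‖ := by
      rw [abs_mul]
      have := mul_le_mul (abs_coord_le z i) (abs_kd_le j k) (abs_nonneg _) (norm_nonneg _)
      linarith
    have a3 : |kd i k * z j| ≤ ‖z‖ := by
      rw [abs_mul]
      have := mul_le_mul (abs_kd_le i k) (abs_coord_le z j) (abs_nonneg _) zero_le_one
      linarith
    have b1 := abs_sub (2 * z k * kd i j) (z i * kd j k + kd i k * z j)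
    have b2 := abs_add_le (z i * kd j k) (kd i k * z j)
    linarith
  have e2 : (η + ‖z‖ ^ 2) ^ (γ / 2 - 1) * ‖z‖ ^ 2 ≤ (η + ‖z‖ ^ 2) ^ (γ / 2) := by
    rw [Real.rpow_sub_one hp.ne', div_mul_eq_mul_div, div_le_iff₀ hp]
    gcongr; linarith
  have t2 : |γ * z k * (η + ‖z‖ ^ 2) ^ (γ / 2 - 1) * (‖z‖ ^ 2 * kd i j - z i * z j)| ≤
      4 * ((η + ‖z‖ ^ 2) ^ (γ / 2) * ‖z‖) := by
    have hq : 0 ≤ (η + ‖z‖ ^ 2) ^ (γ / 2 - 1) := by positivity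
    rw [abs_mul, abs_mul, abs_mul, abs_of_nonneg hq]
    have hg : |γ| ≤ 2 := by rw [abs_le]; constructor <;> linarith
    calc _ ≤ 2 * ‖z‖ * (η + ‖z‖ ^ 2) ^ (γ / 2 - 1) * (2 * ‖z‖ ^ 2) := by
          gcongr; exact abs_proj_le z i j
      _ = 4 * (((η + ‖z‖ ^ 2) ^ (γ / 2 - 1) * ‖z‖ ^ 2) * ‖z‖) := by ring
      _ ≤ _ := by gcongr
  rw [pd_ra hη]
  refine (abs_add_le _ _).trans ?_
  rw [abs_mul, abs_of_nonneg (by positivity : 0 ≤ (η + ‖z‖ ^ 2) ^ (γ / 2))]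
  have : (η + ‖z‖ ^ 2) ^ (γ / 2) * |2 * z k * kd i j - (z i * kd j k + kd i k * z j)| ≤
      4 * ((η + ‖z‖ ^ 2) ^ (γ / 2) * ‖z‖) := by
    calc _ ≤ (η + ‖z‖ ^ 2) ^ (γ / 2) * (4 * ‖z‖) := by gcongr
      _ = _ := by ring
  linarith

/-! ### Bounds and limits for the kernels -/

lemma a_eq (γ : ℝ) (hγ : -2 < γ) (i j : Fin 3) (z : V) :
    a γ i j z = ‖z‖ ^ γ * (‖z‖ ^ 2 * kd i j - z i * z j) := by
  unfold a kd
  rcases eq_or_lt_of_le (norm_nonneg z) with h | h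
  · have hz : z = 0 := norm_eq_zero.1 h.symm
    subst hz
    simp [Real.zero_rpow (by linarith : γ + 2 ≠ 0)]
  · rw [Real.rpow_add h, Real.rpow_two]
    field_simp

lemma abs_ra_le {η : ℝ} (hη : 0 ≤ η) {γ : ℝ} (hγ : -2 < γ) (hγ0 : γ < 0) (i j : Fin 3) (z : V) :
    |ra η γ i j z| ≤ 2 * (1 + ‖z‖ ^ 2) := by
  have h1 := reg_mul_norm_le hη hγ0 z (β := 2) two_pos
  rw [Real.rpow_two] at h1
  have h2 : ‖z‖ ^ (γ + 2) ≤ 1 + ‖z‖ ^ 2 := by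
    rcases le_or_gt ‖z‖ 1 with h | h
    · have := Real.rpow_le_one (norm_nonneg z) h (by linarith : 0 ≤ γ + 2)
      nlinarith [sq_nonneg ‖z‖]
    · have := Real.rpow_le_rpow_of_exponent_le h.le (by linarith : γ + 2 ≤ 2)
      rw [Real.rpow_two] at this; linarith
  unfold ra
  rw [abs_mul, abs_of_nonneg (by positivity : 0 ≤ (η + ‖z‖ ^ 2) ^ (γ / 2))]
  calc _ ≤ (η + ‖z‖ ^ 2) ^ (γ / 2) * (2 * ‖z‖ ^ 2) := by gcongr; exact abs_proj_le z i j
    _ ≤ _ := by linarith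

lemma reg_zero (γ : ℝ) (z : V) : (0 + ‖z‖ ^ 2) ^ (γ / 2) = ‖z‖ ^ γ := by
  rw [zero_add, ← Real.rpow_natCast, ← Real.rpow_mul (norm_nonneg z)]; congr 1; push_cast; ring

/-- Bounds proved for all `η ≥ 0` thereby cover the original kernels and the regularised ones at
once, and serve as dominating functions in the limit. -/
lemma ra_zero {γ : ℝ} (hγ : -2 < γ) (i j : Fin 3) : ra 0 γ i j = a γ i j := by
  ext z; rw [a_eq γ hγ, ra, reg_zero]

lemma rb_zero (γ : ℝ) (i : Fin 3) : rb 0 γ i = b γ i := by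
  ext z; rw [b, rb, reg_zero]; ring

lemma abs_rb_le {η : ℝ} (hη : 0 ≤ η) {γ : ℝ} (hγ : -2 < γ) (hγ0 : γ < 0) (i : Fin 3) (z : V) :
    |rb η γ i z| ≤ 2 * K1 z := by
  have h1 := reg_mul_norm_le hη hγ0 z (β := 1) one_pos
  rw [Real.rpow_one] at h1
  have h2 := rpow_le_K1 (β := γ + 1) (by linarith) (by linarith) z
  unfold rb
  rw [abs_mul, abs_of_nonneg (by positivity : 0 ≤ (η + ‖z‖ ^ 2) ^ (γ / 2)), abs_mul]
  have := abs_coord_le z i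
  calc _ ≤ (η + ‖z‖ ^ 2) ^ (γ / 2) * (2 * ‖z‖) := by
        gcongr; norm_num
    _ ≤ _ := by linarith

lemma abs_a_le {γ : ℝ} (hγ : -2 < γ) (hγ0 : γ < 0) (i j : Fin 3) (z : V) :
    |a γ i j z| ≤ 2 * (1 + ‖z‖ ^ 2) := by
  rw [← ra_zero hγ]; exact abs_ra_le le_rfl hγ hγ0 i j z

lemma abs_b_le {γ : ℝ} (hγ : -2 < γ) (hγ0 : γ < 0) (i : Fin 3) (z : V) :
    |b γ i z| ≤ 2 * K1 z := by
  rw [← rb_zero]; exact abs_rb_le le_rfl hγ hγ0 i z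

lemma measurable_coord (i : Fin 3) : Measurable (fun z : V => z i) :=
  (contDiff_coord i (n := 0)).continuous.measurable

lemma measurable_ra (η γ : ℝ) (i j : Fin 3) : Measurable (ra η γ i j) := by
  have := measurable_coord i; have := measurable_coord j
  unfold ra; fun_prop

lemma measurable_rb (η γ : ℝ) (i : Fin 3) : Measurable (rb η γ i) := by
  have := measurable_coord i
  unfold rb; fun_prop

lemma measurable_a {γ : ℝ} (hγ : -2 < γ) (i j : Fin 3) : Measurable (a γ i j) := by
  rw [← ra_zero hγ]; exact measurable_ra 0 γ i j

lemma measurable_b (γ : ℝ) (i : Fin 3) : Measurable (b γ i) := by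
  rw [← rb_zero]; exact measurable_rb 0 γ i

/-- The sequence of regularisation parameters. -/
def ηs (n : ℕ) : ℝ := 1 / ((n : ℝ) + 1)

lemma ηs_pos (n : ℕ) : 0 < ηs n := by unfold ηs; positivity

lemma tendsto_reg (γ : ℝ) {z : V} (hz : z ≠ 0) :
    Tendsto (fun n => (ηs n + ‖z‖ ^ 2) ^ (γ / 2)) atTop (𝓝 ((0 + ‖z‖ ^ 2) ^ (γ / 2))) := by
  have hz0 : 0 < ‖z‖ := norm_pos_iff.2 hz
  have h : Tendsto ηs atTop (𝓝 0) := tendsto_one_div_add_atTop_nhds_zero_nat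
  exact (h.add_const _).rpow_const (Or.inl (by positivity))

lemma tendsto_ra {γ : ℝ} (hγ : -2 < γ) (i j : Fin 3) (z : V) :
    Tendsto (fun n => ra (ηs n) γ i j z) atTop (𝓝 (a γ i j z)) := by
  rw [← ra_zero hγ]
  by_cases hz : z = 0
  · subst hz; simp [ra]
  · exact (tendsto_reg γ hz).mul_const _

lemma tendsto_rb (γ : ℝ) (i : Fin 3) (z : V) :
    Tendsto (fun n => rb (ηs n) γ i z) atTop (𝓝 (b γ i z)) := by
  rw [← rb_zero]
  by_cases hz : z = 0
  · subst hz; simp [rb]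
  · exact (tendsto_reg γ hz).mul_const _

/-! ### Weak divergence identities -/

lemma locallyIntegrable_K1 (w : V) : LocallyIntegrable (fun x => K1 (x - w)) := by
  have h1 : LocallyIntegrable (fun x : V => ‖x - w‖ ^ (-1 : ℝ)) := by
    intro x
    refine ⟨Metric.ball w (‖x - w‖ + 1), ?_, ?_⟩
    · exact Metric.isOpen_ball.mem_nhds (by simp [dist_eq_norm])
    · have h := ((integrable_indicator_iff measurableSet_ball).2
        (integrableOn_norm_rpow (β := -1) (by norm_num) (‖x - w‖ + 1))).comp_sub_right w
      rw [← integrable_indicator_iff measurableSet_ball]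
      refine h.congr (ae_of_all _ fun y => ?_)
      simp only [indicator, Metric.mem_ball, dist_eq_norm, sub_zero]
  have h2 : LocallyIntegrable (fun x : V => ‖x - w‖ + 1) :=
    Continuous.locallyIntegrable (by fun_prop)
  refine (h1.add h2).congr (ae_of_all _ fun x => ?_)
  simp only [K1, Pi.add_apply]; ring

lemma integrable_mul_of_le_K1 {k : V → ℝ} (hk : Measurable k) {C : ℝ} (hC : ∀ z, |k z| ≤ C * K1 z)
    (w : V) {φ : V → ℝ} (hc : Continuous φ) (hs : HasCompactSupport φ) :
    Integrable (fun x => k (x - w) * φ x) := by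
  have h : Integrable (fun x => φ x * K1 (x - w)) :=
    (locallyIntegrable_K1 w).integrable_smul_left_of_hasCompactSupport hc hs
  refine (h.norm.const_mul C).mono'
    ((hk.comp (measurable_id.sub_const w)).aestronglyMeasurable.mul hc.aestronglyMeasurable)
    (ae_of_all _ fun x => ?_)
  rw [norm_mul, norm_mul, Real.norm_eq_abs (K1 _), abs_of_nonneg (K1_nonneg _), mul_comm ‖φ x‖,
    ← mul_assoc]
  gcongr
  exact hC _

lemma integral_ra_pd {η : ℝ} (hη : 0 < η) (γ : ℝ) (i : Fin 3) (w : V) {ψ : V → ℝ}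
    (h1 : ContDiff ℝ 1 ψ) (h2 : HasCompactSupport ψ) :
    ∫ x, ∑ j, ra η γ i j (x - w) * pd j ψ x = -∫ x, rb η γ i (x - w) * ψ x := by
  have hc : ∀ j, ContDiff ℝ 1 (fun x => ra η γ i j (x - w)) := fun j =>
    (contDiff_ra hη γ i j).comp (contDiff_id.sub contDiff_const)
  have hpd : ∀ j x, pd j (fun x => ra η γ i j (x - w)) x = pd j (ra η γ i j) (x - w) :=
    fun j x => by simp only [pd]; rw [fderiv_comp_sub]
  have I1 : ∀ j, Integrable (fun x => pd j (fun x => ra η γ i j (x - w)) x * ψ x) := fun j =>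
    Continuous.integrable_of_hasCompactSupport ((continuous_pd (hc j) j).mul h1.continuous)
      h2.mul_left
  have I2 : ∀ j, Integrable (fun x => ra η γ i j (x - w) * pd j ψ x) := fun j =>
    Continuous.integrable_of_hasCompactSupport ((hc j).continuous.mul (continuous_pd h1 j))
      (hasCompactSupport_pd h2 j).mul_left
  have I3 : ∀ j, Integrable (fun x => ra η γ i j (x - w) * ψ x) := fun j =>
    Continuous.integrable_of_hasCompactSupport ((hc j).continuous.mul h1.continuous) h2.mul_left
  rw [integral_finsetSum _ fun j _ => I2 j]
  have : ∀ j, ∫ x, ra η γ i j (x - w) * pd j ψ x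
      = -∫ x, pd j (fun x => ra η γ i j (x - w)) x * ψ x := fun j =>
    integral_mul_fderiv_eq_neg_fderiv_mul_of_integrable (I1 j) (I2 j) (I3 j)
      (fun x _ => (hc j).differentiable one_ne_zero x)
      (fun x _ => h1.differentiable one_ne_zero x)
  simp only [this]
  rw [Finset.sum_neg_distrib, ← integral_finsetSum _ fun j _ => I1 j]
  congr 2; ext x
  rw [← sum_pd_ra hη, Finset.sum_mul]
  simp only [hpd]

/-- The identity `div a = b` holds in the sense of distributions although `a` may fail to be
differentiable at the origin: it is exact for the regularised kernels, and dominated convergence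
removes the regularisation. -/
lemma integral_a_pd {γ : ℝ} (hγ : -2 < γ) (hγ0 : γ < 0) (i : Fin 3) (w : V) {ψ : V → ℝ}
    (h1 : ContDiff ℝ 1 ψ) (h2 : HasCompactSupport ψ) :
    ∫ x, ∑ j, a γ i j (x - w) * pd j ψ x = -∫ x, b γ i (x - w) * ψ x := by
  have L : Tendsto (fun n => ∫ x, ∑ j, ra (ηs n) γ i j (x - w) * pd j ψ x) atTop
      (𝓝 (∫ x, ∑ j, a γ i j (x - w) * pd j ψ x)) := by
    refine tendsto_integral_of_dominated_convergence
      (fun x => ∑ j, 2 * (1 + ‖x - w‖ ^ 2) * |pd j ψ x|) (fun n => ?_) ?_ (fun n => ?_) ?_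
    · exact (Continuous.aestronglyMeasurable (by
        refine continuous_finsetSum _ fun j _ => ?_
        exact ((contDiff_ra (n := 0) (ηs_pos n) γ i j).continuous.comp
          (continuous_id.sub continuous_const)).mul (continuous_pd h1 j)))
    · refine integrable_finsetSum _ fun j _ => ?_
      have := continuous_pd h1 j
      exact Continuous.integrable_of_hasCompactSupport (by fun_prop)
        ((hasCompactSupport_pd h2 j).norm.mul_left)
    · refine ae_of_all _ fun x => (norm_sum_le _ _).trans (Finset.sum_le_sum fun j _ => ?_)
      rw [norm_mul]
      gcongr
      · exact abs_ra_le (ηs_pos n).le hγ hγ0 i j _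
      · exact le_rfl
    · exact ae_of_all _ fun x => tendsto_finsetSum _ fun j _ =>
        (tendsto_ra hγ i j _).mul_const _
  have R : Tendsto (fun n => ∫ x, rb (ηs n) γ i (x - w) * ψ x) atTop
      (𝓝 (∫ x, b γ i (x - w) * ψ x)) := by
    refine tendsto_integral_of_dominated_convergence
      (fun x => 2 * |K1 (x - w) * ψ x|) (fun n => ?_) ?_ (fun n => ?_) ?_
    · exact ((measurable_rb _ γ i).comp (measurable_id.sub_const w)).aestronglyMeasurable.mul
        h1.continuous.aestronglyMeasurable
    · exact (integrable_mul_of_le_K1 measurable_K1 (C := 1)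
        (fun z => by rw [one_mul, abs_of_nonneg (K1_nonneg z)]) w h1.continuous h2).abs.const_mul 2
    · refine ae_of_all _ fun x => ?_
      rw [norm_mul, abs_mul, abs_of_nonneg (K1_nonneg _), ← mul_assoc]
      exact mul_le_mul_of_nonneg_right (abs_rb_le (ηs_pos n).le hγ hγ0 i _) (norm_nonneg _)
    · exact ae_of_all _ fun x => (tendsto_rb γ i _).mul_const _
  have e : (fun n => ∫ x, ∑ j, ra (ηs n) γ i j (x - w) * pd j ψ x)
      = fun n => -∫ x, rb (ηs n) γ i (x - w) * ψ x := by
    ext n; exact integral_ra_pd (ηs_pos n) γ i w h1 h2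
  rw [e] at L
  exact tendsto_nhds_unique L R.neg

lemma integrable_norm_rpow_mul {γ : ℝ} (hγ : -3 < γ) (w : V) {φ : V → ℝ} (hc : Continuous φ)
    (hs : HasCompactSupport φ) : Integrable (fun x => ‖x - w‖ ^ γ * φ x) := by
  obtain ⟨R, hR⟩ := hs.isCompact.isBounded.subset_ball w
  have hi : Integrable ((Metric.ball w R).indicator (fun x => ‖x - w‖ ^ γ)) := by
    have h := ((integrable_indicator_iff measurableSet_ball).2
        (integrableOn_norm_rpow hγ R)).comp_sub_right w
    refine h.congr (ae_of_all _ fun y => ?_)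
    simp only [indicator, Metric.mem_ball, dist_eq_norm, sub_zero]
  obtain ⟨C, hC⟩ := hc.bounded_above_of_compact_support hs
  have := hi.mul_bdd hc.aestronglyMeasurable (ae_of_all _ hC)
  refine this.congr (ae_of_all _ fun x => ?_)
  by_cases hx : x ∈ Metric.ball w R
  · simp only [indicator_of_mem hx]
  · have : φ x = 0 := image_eq_zero_of_notMem_tsupport fun h => hx (hR h)
    simp [this]

/-- Integration by parts for the regularised drift and the one-sided divergence bound, which is
uniform in `η`; the sign of `ψ` is what allows a one-sided bound. -/
lemma integral_b_pd_le {γ : ℝ} (hγ : -2 < γ) (hγ0 : γ < 0) (w : V) {ψ : V → ℝ}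
    (h1 : ContDiff ℝ 1 ψ) (h2 : HasCompactSupport ψ) (h0 : ∀ x, 0 ≤ ψ x) :
    ∫ x, ∑ i, b γ i (x - w) * pd i ψ x ≤ 6 * ∫ x, ‖x - w‖ ^ γ * ψ x := by
  have hIγ := integrable_norm_rpow_mul (by linarith : -3 < γ) w h1.continuous h2
  have L : Tendsto (fun n => ∫ x, ∑ i, rb (ηs n) γ i (x - w) * pd i ψ x) atTop
      (𝓝 (∫ x, ∑ i, b γ i (x - w) * pd i ψ x)) := by
    refine tendsto_integral_of_dominated_convergence
      (fun x => ∑ i, 2 * |K1 (x - w) * pd i ψ x|) (fun n => ?_) ?_ (fun n => ?_) ?_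
    · exact (Continuous.aestronglyMeasurable (by
        refine continuous_finsetSum _ fun j _ => ?_
        exact ((contDiff_rb (n := 0) (ηs_pos n) γ j).continuous.comp
          (continuous_id.sub continuous_const)).mul (continuous_pd h1 j)))
    · refine integrable_finsetSum _ fun j _ => ?_
      exact (integrable_mul_of_le_K1 measurable_K1 (C := 1)
        (fun z => by rw [one_mul, abs_of_nonneg (K1_nonneg z)]) w (continuous_pd h1 j)
          (hasCompactSupport_pd h2 j)).abs.const_mul 2
    · refine ae_of_all _ fun x => (norm_sum_le _ _).trans (Finset.sum_le_sum fun j _ => ?_)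
      rw [norm_mul, abs_mul, abs_of_nonneg (K1_nonneg _), ← mul_assoc]
      exact mul_le_mul_of_nonneg_right (abs_rb_le (ηs_pos n).le hγ hγ0 j _) (norm_nonneg _)
    · exact ae_of_all _ fun x => tendsto_finsetSum _ fun j _ =>
        (tendsto_rb γ j _).mul_const _
  refine le_of_tendsto' L fun n => ?_
  have hη := ηs_pos n
  have hc : ∀ j, ContDiff ℝ 1 (fun x => rb (ηs n) γ j (x - w)) := fun j =>
    (contDiff_rb hη γ j).comp (contDiff_id.sub contDiff_const)
  have hpd : ∀ j x, pd j (fun x => rb (ηs n) γ j (x - w)) x = pd j (rb (ηs n) γ j) (x - w) :=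
    fun j x => by simp only [pd]; rw [fderiv_comp_sub]
  have I1 : ∀ j, Integrable (fun x => pd j (fun x => rb (ηs n) γ j (x - w)) x * ψ x) := fun j =>
    Continuous.integrable_of_hasCompactSupport ((continuous_pd (hc j) j).mul h1.continuous)
      h2.mul_left
  have I2 : ∀ j, Integrable (fun x => rb (ηs n) γ j (x - w) * pd j ψ x) := fun j =>
    Continuous.integrable_of_hasCompactSupport ((hc j).continuous.mul (continuous_pd h1 j))
      (hasCompactSupport_pd h2 j).mul_left
  have I3 : ∀ j, Integrable (fun x => rb (ηs n) γ j (x - w) * ψ x) := fun j =>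
    Continuous.integrable_of_hasCompactSupport ((hc j).continuous.mul h1.continuous) h2.mul_left
  rw [integral_finsetSum _ fun j _ => I2 j]
  have : ∀ j, ∫ x, rb (ηs n) γ j (x - w) * pd j ψ x
      = -∫ x, pd j (fun x => rb (ηs n) γ j (x - w)) x * ψ x := fun j =>
    integral_mul_fderiv_eq_neg_fderiv_mul_of_integrable (I1 j) (I2 j) (I3 j)
      (fun x _ => (hc j).differentiable one_ne_zero x)
      (fun x _ => h1.differentiable one_ne_zero x)
  simp only [this]
  rw [Finset.sum_neg_distrib, ← integral_finsetSum _ fun j _ => I1 j, ← integral_neg,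
    ← integral_const_mul]
  have hae : ∀ᵐ x : V, x ≠ w := by simp [ae_iff]
  refine integral_mono_ae ((integrable_finsetSum _ fun j _ => I1 j).neg) (hIγ.const_mul 6) ?_
  filter_upwards [hae] with x hx
  have h := sum_pd_rb hη hγ0 (x - w) (sub_ne_zero.2 hx)
  simp only [hpd]
  rw [← Finset.sum_mul]
  have := mul_le_mul_of_nonneg_right h (h0 x)
  linarith

/-! ### Modulus of continuity of the Landau matrix -/

/-- Integration of the gradient along the segment. The segment may pass through the origin, where
`|z|⁻¹` is not integrable on a line, so the bound is kept as an extended integral until it is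
averaged against a density. -/
lemma enorm_a_sub_le {γ : ℝ} (hγ : -2 < γ) (hγ0 : γ < 0) (i j : Fin 3) (z h : V) :
    ‖a γ i j (z + h) - a γ i j z‖ₑ ≤
      ∫⁻ s in Icc (0 : ℝ) 1, ENNReal.ofReal (24 * ‖h‖ * K1 (z + s • h)) := by
  have key : ∀ n, ‖ra (ηs n) γ i j (z + h) - ra (ηs n) γ i j z‖ₑ ≤
      ∫⁻ s in Icc (0 : ℝ) 1, ENNReal.ofReal (24 * ‖h‖ * K1 (z + s • h)) := by
    intro n
    have hc := contDiff_ra (n := 1) (ηs_pos n) γ i j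
    have hd : ∀ s ∈ uIcc (0 : ℝ) 1, HasDerivAt (fun s : ℝ => ra (ηs n) γ i j (z + s • h))
        (fderiv ℝ (ra (ηs n) γ i j) (z + s • h) h) s := by
      intro s _
      have h1 : HasDerivAt (fun s : ℝ => z + s • h) h s := by
        simpa using ((hasDerivAt_id s).smul_const h).const_add z
      exact (hc.differentiable one_ne_zero _).hasFDerivAt.comp_hasDerivAt s h1
    have hcont : Continuous (fun s : ℝ => fderiv ℝ (ra (ηs n) γ i j) (z + s • h) h) :=
      ((hc.continuous_fderiv one_ne_zero).comp (by fun_prop)).clm_apply continuous_const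
    have e := intervalIntegral.integral_eq_sub_of_hasDerivAt hd (hcont.intervalIntegrable _ _)
    simp only [one_smul, zero_smul, add_zero] at e
    rw [← e, intervalIntegral.integral_of_le zero_le_one, ← integral_Icc_eq_integral_Ioc]
    refine (enorm_integral_le_lintegral_enorm _).trans (lintegral_mono fun s => ?_)
    rw [← ofReal_norm]
    refine ENNReal.ofReal_le_ofReal ?_
    rw [fderiv_apply_eq_sum]
    refine (norm_sum_le _ _).trans ?_
    have hb : ∀ k, ‖h k * pd k (ra (ηs n) γ i j) (z + s • h)‖ ≤ ‖h‖ * (8 * K1 (z + s • h)) := by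
      intro k
      rw [norm_mul]
      exact mul_le_mul (abs_coord_le h k) (abs_pd_ra_le (ηs_pos n) hγ hγ0 i j k _)
        (norm_nonneg _) (norm_nonneg _)
    refine (Finset.sum_le_sum fun k _ => hb k).trans ?_
    simp; linarith
  have lim : Tendsto (fun n => ‖ra (ηs n) γ i j (z + h) - ra (ηs n) γ i j z‖ₑ) atTop
      (𝓝 ‖a γ i j (z + h) - a γ i j z‖ₑ) :=
    ((tendsto_ra hγ i j _).sub (tendsto_ra hγ i j _)).enorm
  exact le_of_tendsto' lim key

end LFD
end

noncomputable section
namespace LFD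
open MeasureTheory Set Filter Topology

/-! ### Convolution coefficients -/

/-- The matrix `a * h`. -/
def Sm (γ : ℝ) (h : V → ℝ) (i j : Fin 3) (x : V) : ℝ := ∫ w, a γ i j (x - w) * h w

/-- The vector `b * h`. -/
def Bv (γ : ℝ) (h : V → ℝ) (i : Fin 3) (x : V) : ℝ := ∫ w, b γ i (x - w) * h w

lemma Sig_eq (γ ε : ℝ) (i j : Fin 3) (f : V → ℝ) :
    Sig γ ε i j f = Sm γ (fun w => f w * (1 - ε * f w)) i j := rfl

section
variable {M m γ : ℝ} {h : V → ℝ}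

lemma aestronglyMeasurable_kernel_prod {k : V → ℝ} (hk : Measurable k)
    (hh : AEStronglyMeasurable h volume) :
    AEStronglyMeasurable (fun p : V × V => k (p.1 - p.2) * h p.2) (volume.prod volume) :=
  (hk.comp (measurable_fst.sub measurable_snd)).aestronglyMeasurable.mul hh.comp_snd

lemma aestronglyMeasurable_conv {k : V → ℝ} (hk : Measurable k)
    (hh : AEStronglyMeasurable h volume) :
    AEStronglyMeasurable (fun x => ∫ w, k (x - w) * h w) volume :=
  (aestronglyMeasurable_kernel_prod hk hh).integral_prod_right'

/-- Fubini for a kernel with at most quadratic growth. -/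
lemma integrable_kernel_prod {k : V → ℝ} (hk : Measurable k) (hh : AEStronglyMeasurable h volume)
    {C : ℝ} (hC : ∀ x, Integrable (fun w => k (x - w) * h w) ∧
      ∫ w, |k (x - w) * h w| ≤ C * bracket x ^ 2)
    {φ : V → ℝ} (hm : AEStronglyMeasurable φ volume)
    (hφ : Integrable (fun x => bracket x ^ 2 * φ x)) :
    Integrable (fun p : V × V => k (p.1 - p.2) * h p.2 * φ p.1) (volume.prod volume) := by
  have hmeas : AEStronglyMeasurable (fun p : V × V => k (p.1 - p.2) * h p.2 * φ p.1)
      (volume.prod volume) := (aestronglyMeasurable_kernel_prod hk hh).mul hm.comp_fst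
  rw [integrable_prod_iff hmeas]
  refine ⟨ae_of_all _ fun x => (hC x).1.mul_const (φ x), ?_⟩
  refine (hφ.norm.const_mul C).mono' hmeas.norm.integral_prod_right' (ae_of_all _ fun x => ?_)
  rw [Real.norm_eq_abs, abs_of_nonneg (integral_nonneg fun _ => norm_nonneg _)]
  simp only [norm_mul (_ * _) (φ x)]
  rw [integral_mul_const, norm_mul, ← mul_assoc, Real.norm_of_nonneg (sq_nonneg (bracket x))]
  gcongr
  exact (hC x).2

lemma integral_kernel_swap {k : V → ℝ} (hk : Measurable k) (hh : AEStronglyMeasurable h volume)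
    {C : ℝ} (hC : ∀ x, Integrable (fun w => k (x - w) * h w) ∧
      ∫ w, |k (x - w) * h w| ≤ C * bracket x ^ 2)
    {φ : V → ℝ} (hm : AEStronglyMeasurable φ volume)
    (hφ : Integrable (fun x => bracket x ^ 2 * φ x)) :
    Integrable (fun x => (∫ w, k (x - w) * h w) * φ x) ∧
    Integrable (fun w => h w * ∫ x, k (x - w) * φ x) ∧
    ∫ x, (∫ w, k (x - w) * h w) * φ x = ∫ w, h w * ∫ x, k (x - w) * φ x := by
  have hi := integrable_kernel_prod hk hh hC hm hφ
  have e1 : ∀ x, ∫ w, k (x - w) * h w * φ x = (∫ w, k (x - w) * h w) * φ x :=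
    fun x => integral_mul_const _ _
  have e2 : ∀ w, ∫ x, k (x - w) * h w * φ x = h w * ∫ x, k (x - w) * φ x := fun w => by
    rw [← integral_const_mul]; congr 1; ext x; ring
  have i1 := hi.integral_prod_left
  have i2 := hi.integral_prod_right
  have sw := integral_integral_swap (f := fun x w => k (x - w) * h w * φ x) hi
  simp only [e1] at i1 sw
  simp only [e2] at i2 sw
  exact ⟨i1, i2, sw⟩

lemma bracket_le_sq (x : V) : bracket x ≤ bracket x ^ 2 := by
  nlinarith [one_le_bracket x]

lemma Adm.a_conv (hh : Adm M m h) (hγ : -2 < γ) (hγ0 : γ < 0) (i j : Fin 3) (x : V) :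
    Integrable (fun w => a γ i j (x - w) * h w) ∧
      ∫ w, |a γ i j (x - w) * h w| ≤ 10 * m * bracket x ^ 2 := by
  have := hh.conv_bound_sq (measurable_a hγ i j) zero_le_two (abs_a_le hγ hγ0 i j) x
  exact ⟨this.1, this.2.trans (by linarith)⟩

lemma Adm.b_conv (hh : Adm M m h) (hγ : -2 < γ) (hγ0 : γ < 0) (i : Fin 3) (x : V) :
    Integrable (fun w => b γ i (x - w) * h w) ∧
      ∫ w, |b γ i (x - w) * h w| ≤ 2 * growC M m * bracket x :=
  hh.conv_bound (measurable_b γ i) (abs_b_le hγ hγ0 i) x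

lemma Adm.b_conv_sq (hh : Adm M m h) (hγ : -2 < γ) (hγ0 : γ < 0) (i : Fin 3) (x : V) :
    Integrable (fun w => b γ i (x - w) * h w) ∧
      ∫ w, |b γ i (x - w) * h w| ≤ 2 * growC M m * bracket x ^ 2 := by
  refine ⟨(hh.b_conv hγ hγ0 i x).1, (hh.b_conv hγ hγ0 i x).2.trans ?_⟩
  have := hh.growC_nonneg
  have := bracket_le_sq x
  gcongr

lemma Adm.abs_Sm_le (hh : Adm M m h) (hγ : -2 < γ) (hγ0 : γ < 0) (i j : Fin 3) (x : V) :
    |Sm γ h i j x| ≤ 10 * m * bracket x ^ 2 :=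
  (abs_integral_le_integral_abs).trans (hh.a_conv hγ hγ0 i j x).2

lemma Adm.abs_Bv_le (hh : Adm M m h) (hγ : -2 < γ) (hγ0 : γ < 0) (i : Fin 3) (x : V) :
    |Bv γ h i x| ≤ 2 * growC M m * bracket x :=
  (abs_integral_le_integral_abs).trans (hh.b_conv hγ hγ0 i x).2

lemma Adm.aesm_Bv (hh : Adm M m h) (i : Fin 3) : AEStronglyMeasurable (Bv γ h i) volume :=
  aestronglyMeasurable_conv (measurable_b γ i) hh.meas

/-- By Tonelli the segment parameter can be integrated last; at each of its points the convolution
with `K1` is finite, and the bracket there is at most `2⟨x⟩`, whence `48 = 2 · 24`. One power of the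
distance is needed to compensate the derivative on the mollifier in the commutator. -/
lemma Adm.Sm_lipschitz (hh : Adm M m h) (hγ : -2 < γ) (hγ0 : γ < 0) (i j : Fin 3) (x y : V)
    (hxy : ‖y - x‖ ≤ 1) :
    |Sm γ h i j y - Sm γ h i j x| ≤ 48 * growC M m * bracket x * ‖y - x‖ := by
  set d := y - x with hd
  have hG := hh.growC_nonneg
  have e : Sm γ h i j y - Sm γ h i j x =
      ∫ w, (a γ i j ((x - w) + d) - a γ i j (x - w)) * h w := by
    unfold Sm
    rw [← integral_sub (hh.a_conv hγ hγ0 i j y).1 (hh.a_conv hγ hγ0 i j x).1]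
    congr 1; ext w
    rw [show (x - w) + d = y - w by rw [hd]; abel]; ring
  have hmh := hh.meas.aemeasurable.ennreal_ofReal
  have hbx := bracket_pos x
  have key : ‖Sm γ h i j y - Sm γ h i j x‖ₑ ≤
      ENNReal.ofReal (48 * growC M m * bracket x * ‖d‖) := by
    rw [e]
    calc _ ≤ ∫⁻ w, ‖(a γ i j ((x - w) + d) - a γ i j (x - w)) * h w‖ₑ :=
          enorm_integral_le_lintegral_enorm _
      _ ≤ ∫⁻ w, ∫⁻ s in Icc (0 : ℝ) 1,
            ENNReal.ofReal (24 * ‖d‖ * K1 ((x - w) + s • d)) * ENNReal.ofReal (h w) := by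
          refine lintegral_mono fun w => ?_
          rw [enorm_mul, Real.enorm_of_nonneg (hh.nonneg w), lintegral_mul_const']
          · gcongr; exact enorm_a_sub_le hγ hγ0 i j _ _
          · exact ENNReal.ofReal_ne_top
      _ = ∫⁻ s in Icc (0 : ℝ) 1, ∫⁻ w,
            ENNReal.ofReal (24 * ‖d‖ * K1 ((x - w) + s • d)) * ENNReal.ofReal (h w) := by
          have hK : Measurable (fun p : V × ℝ => K1 ((x - p.1) + p.2 • d)) :=
            measurable_K1.comp (by fun_prop)
          have A1 : AEMeasurable (fun p : V × ℝ => ENNReal.ofReal (24 * ‖d‖ *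
              K1 ((x - p.1) + p.2 • d))) (volume.prod (volume.restrict (Icc (0 : ℝ) 1))) :=
            (hK.const_mul _).ennreal_ofReal.aemeasurable
          have A2 : AEMeasurable (fun p : V × ℝ => ENNReal.ofReal (h p.1))
              (volume.prod (volume.restrict (Icc (0 : ℝ) 1))) := hmh.comp_fst
          exact lintegral_lintegral_swap (A1.mul A2)
      _ ≤ ∫⁻ s in Icc (0 : ℝ) 1, ENNReal.ofReal (48 * growC M m * bracket x * ‖d‖) := by
          refine setLIntegral_mono measurable_const fun s hs => ?_
          obtain ⟨i1, b1⟩ := hh.K1_bound (x + s • d)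
          have e2 : ∀ w, ENNReal.ofReal (24 * ‖d‖ * K1 ((x - w) + s • d)) * ENNReal.ofReal (h w)
              = ENNReal.ofReal (24 * ‖d‖ * (K1 ((x + s • d) - w) * h w)) := fun w => by
            rw [← ENNReal.ofReal_mul (mul_nonneg (by positivity) (K1_nonneg _)),
              show (x - w) + s • d = (x + s • d) - w by abel, mul_assoc]
          simp only [e2]
          rw [← ofReal_integral_eq_lintegral_ofReal (i1.const_mul _)
            (ae_of_all _ fun w => mul_nonneg (by positivity)
              (mul_nonneg (K1_nonneg _) (hh.nonneg w))), integral_const_mul]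
          refine ENNReal.ofReal_le_ofReal ?_
          have hb : bracket (x + s • d) ≤ 2 * bracket x := by
            have h1 := bracket_le_add (x + s • d) x
            have h2 : ‖x + s • d - x‖ ≤ 1 := by
              rw [add_sub_cancel_left, norm_smul, Real.norm_of_nonneg hs.1]
              exact mul_le_one₀ hs.2 (norm_nonneg _) hxy
            linarith [one_le_bracket x]
          calc 24 * ‖d‖ * ∫ w, K1 (x + s • d - w) * h w
              ≤ 24 * ‖d‖ * (growC M m * (2 * bracket x)) := by
                gcongr; exact b1.trans (by gcongr)
            _ = _ := by ring
      _ = _ := by simp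
  rw [← ofReal_norm, ENNReal.ofReal_le_ofReal_iff (by positivity)] at key
  exact key

lemma Adm.continuous_Sm (hh : Adm M m h) (hγ : -2 < γ) (hγ0 : γ < 0) (i j : Fin 3) :
    Continuous (Sm γ h i j) := by
  rw [continuous_iff_continuousAt]
  intro x
  have h1 : Tendsto (fun y => 48 * growC M m * bracket x * ‖y - x‖) (𝓝 x) (𝓝 0) := by
    have : Continuous (fun y : V => 48 * growC M m * bracket x * ‖y - x‖) := by fun_prop
    simpa using this.tendsto x
  have h2 : ∀ᶠ y in 𝓝 x, ‖Sm γ h i j y - Sm γ h i j x‖ ≤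
      48 * growC M m * bracket x * ‖y - x‖ := by
    filter_upwards [Metric.closedBall_mem_nhds x one_pos] with y hy
    exact hh.Sm_lipschitz hγ hγ0 i j x y (by simpa [dist_eq_norm] using hy)
  exact tendsto_iff_norm_sub_tendsto_zero.2
    (squeeze_zero' (Eventually.of_forall fun y => norm_nonneg _) h2 h1)

lemma integrable_bracket_sq_mul {φ : V → ℝ} (hc : Continuous φ) (hs : HasCompactSupport φ) :
    Integrable (fun x => bracket x ^ 2 * φ x) :=
  Continuous.integrable_of_hasCompactSupport ((continuous_bracket.pow 2).mul hc) hs.mul_left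

lemma Adm.Sm_weak (hh : Adm M m h) (hγ : -2 < γ) (hγ0 : γ < 0) (i : Fin 3) {ψ : V → ℝ}
    (h1 : ContDiff ℝ 1 ψ) (h2 : HasCompactSupport ψ) :
    ∫ x, ∑ j, Sm γ h i j x * pd j ψ x = -∫ x, Bv γ h i x * ψ x := by
  have F : ∀ j, _ := fun j => integral_kernel_swap (measurable_a hγ i j) hh.meas
    (hh.a_conv hγ hγ0 i j) (continuous_pd h1 j).aestronglyMeasurable
    (integrable_bracket_sq_mul (continuous_pd h1 j) (hasCompactSupport_pd h2 j))
  have G := integral_kernel_swap (measurable_b γ i) hh.meas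
    (hh.b_conv_sq hγ hγ0 i) h1.continuous.aestronglyMeasurable
    (integrable_bracket_sq_mul h1.continuous h2)
  unfold Sm Bv
  rw [integral_finsetSum _ fun j _ => (F j).1, G.2.2]
  simp only [(F _).2.2]
  rw [← integral_finsetSum _ fun j _ => (F j).2.1, ← integral_neg]
  congr 1; ext w
  rw [← Finset.mul_sum, ← mul_neg, ← integral_a_pd hγ hγ0 i w h1 h2, integral_finsetSum]
  intro j _
  have hbd : Integrable (fun x => 2 * (1 + ‖x - w‖ ^ 2) * |pd j ψ x|) := by
    have := continuous_pd h1 j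
    exact Continuous.integrable_of_hasCompactSupport (by fun_prop)
      ((hasCompactSupport_pd h2 j).norm.mul_left)
  refine hbd.mono' (((measurable_a hγ i j).comp (measurable_id.sub_const w)).aestronglyMeasurable.mul
    (continuous_pd h1 j).aestronglyMeasurable) (ae_of_all _ fun x => ?_)
  rw [norm_mul]
  exact mul_le_mul_of_nonneg_right (abs_a_le hγ hγ0 i j _) (norm_nonneg _)

/-- The weighted estimate of the drift by a small part of the dissipation. -/
lemma Adm.drift_le (hh : Adm M m h) (hγ : -2 < γ) (hγ0 : γ < 0) {r : ℝ} (hr : 0 < r) (hr1 : r ≤ 1)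
    {G φ : V → ℝ} (h1 : ContDiff ℝ 1 G) (h2 : HasCompactSupport G) (h0 : ∀ x, 0 ≤ G x)
    (hc : Continuous φ) (hs : HasCompactSupport φ) {l : ℝ} (hl : 0 ≤ l)
    (hG : ∀ x, G x ≤ l * φ x ^ 2) :
    ∫ x, ∑ i, Bv γ h i x * pd i G x ≤ 24 * l * m *
      (radC (3 * γ / 2) ^ (2 / 3 : ℝ) * r ^ (2 + γ) * wL6 γ φ
        + r⁻¹ ^ 2 * ∫ x, bracket x ^ γ * φ x ^ 2) := by
  set X := radC (3 * γ / 2) ^ (2 / 3 : ℝ) * r ^ (2 + γ) * wL6 γ φ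
        + r⁻¹ ^ 2 * ∫ x, bracket x ^ γ * φ x ^ 2
  have hX : 0 ≤ X := by
    have h3 := radC_nonneg (β := 3 * γ / 2) (by linarith)
    have h4 := wL6_nonneg γ φ
    have h5 : 0 ≤ ∫ x, bracket x ^ γ * φ x ^ 2 := integral_nonneg fun x =>
      mul_nonneg (Real.rpow_nonneg (bracket_pos x).le _) (sq_nonneg _)
    positivity
  have F : ∀ i, _ := fun i => integral_kernel_swap (measurable_b γ i) hh.meas
    (hh.b_conv_sq hγ hγ0 i) (continuous_pd h1 i).aestronglyMeasurable
    (integrable_bracket_sq_mul (continuous_pd h1 i) (hasCompactSupport_pd h2 i))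
  have Ib : ∀ w i, Integrable (fun x => b γ i (x - w) * pd i G x) := fun w i =>
    integrable_mul_of_le_K1 (measurable_b γ i) (abs_b_le hγ hγ0 i) w (continuous_pd h1 i)
      (hasCompactSupport_pd h2 i)
  unfold Bv
  rw [integral_finsetSum _ fun i _ => (F i).1]
  simp only [(F _).2.2]
  rw [← integral_finsetSum _ fun i _ => (F i).2.1]
  -- For fixed `w`, the divergence bound contributes `6` and the singular interpolation `4 ⟨w⟩ ^ 2`;
  -- the remaining weight is paid by the energy of `h`.
  have step : ∀ w, ∑ i, h w * ∫ x, b γ i (x - w) * pd i G x ≤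
      24 * l * X * (h w * bracket w ^ 2) := by
    intro w
    rw [← Finset.mul_sum, ← integral_finsetSum _ fun i _ => Ib w i]
    have e1 := integral_b_pd_le hγ hγ0 w h1 h2 h0
    obtain ⟨i2, e2⟩ := integral_singular_mul_sq_le hγ hγ0 hr hr1 w hc hs
    have e3 : ∫ x, ‖x - w‖ ^ γ * G x ≤ l * ∫ x, ‖x - w‖ ^ γ * φ x ^ 2 := by
      rw [← integral_const_mul]
      refine integral_mono (integrable_norm_rpow_mul (by linarith) w h1.continuous h2)
        (i2.const_mul l) fun x => ?_
      have := mul_le_mul_of_nonneg_left (hG x) (Real.rpow_nonneg (norm_nonneg (x - w)) γ)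
      simp only; linarith
    have e4 := mul_le_mul_of_nonneg_left e2 hl
    have e5 : ∫ x, ∑ i, b γ i (x - w) * pd i G x ≤ 24 * l * X * bracket w ^ 2 := by
      calc _ ≤ 6 * (l * (4 * bracket w ^ 2 * X)) := by linarith
        _ = _ := by ring
    have := mul_le_mul_of_nonneg_left e5 (hh.nonneg w)
    linarith
  calc _ ≤ ∫ w, 24 * l * X * (h w * bracket w ^ 2) :=
        integral_mono (integrable_finsetSum _ fun i _ => (F i).2.1) (hh.int.const_mul _) step
    _ = 24 * l * X * ∫ w, h w * bracket w ^ 2 := integral_const_mul _ _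
    _ ≤ 24 * l * X * m := by gcongr; exact hh.int_le
    _ = _ := by ring

/-! ### Positivity -/

/-- Lagrange's identity: the quadratic form is `|z| ^ γ |z × ξ| ^ 2`, degenerate only along the
direction of `z`. -/
lemma sum_a_quad (hγ : -2 < γ) (z ξ : V) :
    ∑ i, ∑ j, a γ i j z * ξ i * ξ j = ‖z‖ ^ γ *
      ((z 0 * ξ 1 - z 1 * ξ 0) ^ 2 + (z 0 * ξ 2 - z 2 * ξ 0) ^ 2 + (z 1 * ξ 2 - z 2 * ξ 1) ^ 2) := by
  simp only [a_eq γ hγ, Fin.sum_univ_three, norm_sq_eq3 z, kd]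
  simp
  ring

lemma Adm.sum_Sm_quad (hh : Adm M m h) (hγ : -2 < γ) (hγ0 : γ < 0) (x ξ : V) :
    Integrable (fun w => (∑ i, ∑ j, a γ i j (x - w) * ξ i * ξ j) * h w) ∧
    ∑ i, ∑ j, Sm γ h i j x * ξ i * ξ j = ∫ w, (∑ i, ∑ j, a γ i j (x - w) * ξ i * ξ j) * h w := by
  have I : ∀ i j, Integrable (fun w => a γ i j (x - w) * h w * (ξ i * ξ j)) := fun i j =>
    (hh.a_conv hγ hγ0 i j x).1.mul_const _
  have e : (fun w => (∑ i, ∑ j, a γ i j (x - w) * ξ i * ξ j) * h w) =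
      fun w => ∑ i, ∑ j, a γ i j (x - w) * h w * (ξ i * ξ j) := by
    ext w; simp only [Finset.sum_mul]
    refine Finset.sum_congr rfl fun i _ => Finset.sum_congr rfl fun j _ => by ring
  rw [e]
  refine ⟨integrable_finsetSum _ fun i _ => integrable_finsetSum _ fun j _ => I i j, ?_⟩
  rw [integral_finsetSum _ fun i _ => integrable_finsetSum _ fun j _ => I i j]
  refine Finset.sum_congr rfl fun i _ => ?_
  rw [integral_finsetSum _ fun j _ => I i j]
  refine Finset.sum_congr rfl fun j _ => ?_
  rw [integral_mul_const, Sm, mul_assoc]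

lemma Sm_symm (i j : Fin 3) (x : V) : Sm γ h i j x = Sm γ h j i x := by
  unfold Sm; congr 1; ext w; unfold a
  rw [mul_comm ((x - w) i) ((x - w) j)]
  simp only [eq_comm]

/-- Nondegeneracy of a density: it keeps mass `κ` in a ball away from any small set. -/
structure Spread (R η κ : ℝ) (h : V → ℝ) : Prop where
  lower : ∀ A : Set V, MeasurableSet A → volume A ≤ ENNReal.ofReal η →
    κ ≤ ∫ w in Metric.ball 0 R \ A, h w

/-- The volume of a slab inside a ball. -/
lemma volume_slab_le {R : ℝ} {N : ℕ} (hN : 0 < N) (i k : Fin 3) (hik : i ≠ k)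
    (t c : ℝ) : (N : ENNReal) * volume {w : V | w ∈ Metric.ball (0 : V) R ∧
      |w i - t * w k - c| < R / (2 * N)} ≤ volume (Metric.ball (0 : V) (2 * R)) := by
  rcases le_or_gt R 0 with hR | hR
  · have : {w : V | w ∈ Metric.ball (0 : V) R ∧ |w i - t * w k - c| < R / (2 * N)} = ∅ := by
      rw [Metric.ball_eq_empty.2 hR]; simp
    rw [this]; simp
  have hN' : (0 : ℝ) < N := by exact_mod_cast hN
  set ρ := R / (2 * N) with hρ
  have hρ0 : 0 < ρ := by positivity
  set T := {w : V | w ∈ Metric.ball (0 : V) R ∧ |w i - t * w k - c| < ρ}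
  have hTm : MeasurableSet T := by
    refine measurableSet_ball.inter ?_
    have h1 : Measurable (fun w : V => |w i - t * w k - c|) := by
      have := measurable_coord i; have := measurable_coord k
      fun_prop
    exact h1 measurableSet_Iio
  -- Translating along `e_i` leaves `w k` unchanged, so `N` translates by multiples of `2ρ` are
  -- disjoint. The total displacement is at most `R`, hence all of them lie in the doubled ball.
  let e : V := EuclideanSpace.single i 1
  let T' : ℕ → Set V := fun n => (fun w => w + (-(2 * ρ * n)) • e) ⁻¹' T
  have hvol : ∀ n, volume (T' n) = volume T := fun n => measure_preimage_add_right _ _ _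
  have hm : ∀ n, MeasurableSet (T' n) := fun n => (measurable_add_const _) hTm
  have hcoord : ∀ (w : V) (n : ℕ), (w + (-(2 * ρ * n)) • e) i = w i - 2 * ρ * n := by
    intro w n; simp [e]; ring
  have hcoordk : ∀ (w : V) (n : ℕ), (w + (-(2 * ρ * n)) • e) k = w k := by
    intro w n; simp [e, hik.symm]
  have hdisj : Pairwise (Function.onFun Disjoint T') := by
    intro n n' hne
    rw [Function.onFun, Set.disjoint_left]
    rintro w ⟨-, h1⟩ ⟨-, h2⟩
    rw [hcoord, hcoordk, abs_lt] at h1 h2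
    have h3 : |((n : ℤ) - n' : ℤ)| < 1 := by
      have : |((n : ℝ) - n')| < 1 := by
        rw [abs_lt]; constructor <;> nlinarith
      exact_mod_cast this
    rw [Int.abs_lt_one_iff] at h3
    omega
  have hsub : ⋃ n ∈ Finset.range N, T' n ⊆ Metric.ball (0 : V) (2 * R) := by
    refine iUnion₂_subset fun n hn w hw => ?_
    have h1 : ‖w + (-(2 * ρ * n)) • e‖ < R := by simpa using hw.1
    have h2 : ‖(-(2 * ρ * n)) • e‖ ≤ R := by
      have : ‖e‖ = 1 := by simp [e]
      rw [norm_smul, this, mul_one, norm_neg, Real.norm_of_nonneg (by positivity)]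
      have hn' : (n : ℝ) ≤ N := by exact_mod_cast (Finset.mem_range.1 hn).le
      calc 2 * ρ * n ≤ 2 * ρ * N := by gcongr
        _ = R := by rw [hρ]; field_simp
    have h3 : ‖w‖ ≤ ‖w + (-(2 * ρ * n)) • e‖ + ‖(-(2 * ρ * n)) • e‖ := by
      have := norm_sub_le (w + (-(2 * ρ * n)) • e) ((-(2 * ρ * n)) • e)
      rwa [add_sub_cancel_right] at this
    rw [mem_ball_zero_iff]; linarith
  calc (N : ENNReal) * volume T = ∑ n ∈ Finset.range N, volume (T' n) := by simp [hvol]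
    _ = volume (⋃ n ∈ Finset.range N, T' n) :=
        (measure_biUnion_finset (fun i _ j _ hij => hdisj hij) (fun n _ => hm n)).symm
    _ ≤ _ := measure_mono hsub

/-- Here `k` is a coordinate of largest modulus. A single component of `z × ξ` involving it already
suffices for ellipticity, and it permits division by `ξ k`. -/
lemma exists_dominant_coord (ξ : V) : ∃ i k : Fin 3, i ≠ k ∧ ‖ξ‖ ^ 2 ≤ 3 * ξ k ^ 2 ∧
    ∀ z : V, (z i * ξ k - z k * ξ i) ^ 2 ≤ (z 0 * ξ 1 - z 1 * ξ 0) ^ 2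
      + (z 0 * ξ 2 - z 2 * ξ 0) ^ 2 + (z 1 * ξ 2 - z 2 * ξ 1) ^ 2 := by
  rw [norm_sq_eq3]
  have hz : ∀ z : V, 0 ≤ (z 0 * ξ 1 - z 1 * ξ 0) ^ 2 ∧ 0 ≤ (z 0 * ξ 2 - z 2 * ξ 0) ^ 2 ∧
    0 ≤ (z 1 * ξ 2 - z 2 * ξ 1) ^ 2 := fun z => ⟨sq_nonneg _, sq_nonneg _, sq_nonneg _⟩
  rcases le_total (ξ 0 ^ 2) (ξ 1 ^ 2) with h01 | h01
  · rcases le_total (ξ 1 ^ 2) (ξ 2 ^ 2) with h12 | h12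
    · exact ⟨0, 2, by decide, by linarith, fun z => by linarith [hz z]⟩
    · exact ⟨0, 1, by decide, by linarith, fun z => by linarith [hz z]⟩
  · rcases le_total (ξ 0 ^ 2) (ξ 2 ^ 2) with h02 | h02
    · exact ⟨0, 2, by decide, by linarith, fun z => by linarith [hz z]⟩
    · refine ⟨1, 0, by decide, by linarith, fun z => ?_⟩
      have : (z 1 * ξ 0 - z 0 * ξ 1) ^ 2 = (z 0 * ξ 1 - z 1 * ξ 0) ^ 2 := by ring
      linarith [hz z]

/-- The ellipticity constant. -/
def ellC (γ R κ : ℝ) (N : ℕ) : ℝ := (2 * (1 + R)) ^ γ * (R / (2 * N)) ^ 2 / 3 * κ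

/-- With `z = x - w` and `t = ξ i / ξ k`, the chosen component of `z × ξ` is `ξ k (z i - t z k)`. It
is small only for `w` in a slab of half-width `R / (2 N)`, whose part in the ball has volume at most
`η`. The density keeps mass `κ` off the slab, and there `|z| ≤ 2 (1 + R) ⟨x⟩` turns `|z| ^ γ` into
the weight `⟨x⟩ ^ γ`. -/
lemma Adm.coercive (hh : Adm M m h) (hγ : -2 < γ) (hγ0 : γ < 0) {R η κ : ℝ} (hR : 0 < R)
    {N : ℕ} (hN : 0 < N) (hNη : volume (Metric.ball (0 : V) (2 * R)) ≤ N * ENNReal.ofReal η)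
    (hsp : Spread R η κ h) (x ξ : V) :
    ellC γ R κ N * bracket x ^ γ * ‖ξ‖ ^ 2 ≤ ∑ i, ∑ j, Sm γ h i j x * ξ i * ξ j := by
  obtain ⟨hi, he⟩ := hh.sum_Sm_quad hγ hγ0 x ξ
  rw [he]
  obtain ⟨i, k, hik, hk, hz⟩ := exists_dominant_coord ξ
  have hN' : (0 : ℝ) < N := by exact_mod_cast hN
  set ρ := R / (2 * N) with hρ
  have hρ0 : 0 < ρ := by positivity
  rcases eq_or_ne (ξ k) 0 with h0 | h0
  · have : ‖ξ‖ ^ 2 = 0 := by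
      rw [h0] at hk; nlinarith [sq_nonneg ‖ξ‖]
    rw [this, mul_zero]
    refine integral_nonneg fun w => mul_nonneg ?_ (hh.nonneg w)
    rw [sum_a_quad hγ]; positivity
  set t := ξ i / ξ k
  set A : Set V := {w : V | w ∈ Metric.ball (0 : V) R ∧ |w i - t * w k - (x i - t * x k)| < ρ}
    with hA
  have hAm : MeasurableSet A := by
    refine measurableSet_ball.inter ?_
    have h1 : Measurable (fun w : V => |w i - t * w k - (x i - t * x k)|) := by
      have := measurable_coord i; have := measurable_coord k
      fun_prop
    exact h1 measurableSet_Iio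
  have hAv : volume A ≤ ENNReal.ofReal η := by
    have h1 := (volume_slab_le (R := R) hN i k hik t (x i - t * x k)).trans hNη
    refine (ENNReal.mul_le_mul_iff_right ?_ ?_).1 h1
    · exact_mod_cast hN.ne'
    · exact ENNReal.natCast_ne_top N
  have hlow := hsp.lower A hAm hAv
  have hbx := bracket_pos x
  have hpt : ∀ w ∈ Metric.ball (0 : V) R \ A,
      (2 * (1 + R)) ^ γ * ρ ^ 2 / 3 * bracket x ^ γ * ‖ξ‖ ^ 2 * h w ≤
      (∑ i, ∑ j, a γ i j (x - w) * ξ i * ξ j) * h w := by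
    rintro w ⟨hw, hwA⟩
    have h1 : ρ ≤ |w i - t * w k - (x i - t * x k)| := by
      by_contra hlt; exact hwA ⟨hw, not_le.1 hlt⟩
    set z := x - w with hzdef
    have e1 : w i - t * w k - (x i - t * x k) = -(z i - t * z k) := by
      simp [hzdef]; ring
    rw [e1, abs_neg] at h1
    have h2 : ρ ^ 2 ≤ (z i - t * z k) ^ 2 := by
      rw [← sq_abs (z i - t * z k)]; gcongr
    have hz0 : z ≠ 0 := by
      intro hz0; rw [hz0] at h1; simp at h1; linarith
    have hzn : 0 < ‖z‖ := norm_pos_iff.2 hz0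
    have hw' : ‖w‖ < R := by simpa using hw
    have h3 : ‖z‖ ≤ 2 * (1 + R) * bracket x := by
      have h4 := norm_sub_le_bracket x w
      have h5 := bracket_le_one_add_norm w
      have h6 : bracket x * bracket w ≤ bracket x * (1 + R) := by gcongr; linarith
      linarith
    have h4 : (2 * (1 + R)) ^ γ * bracket x ^ γ ≤ ‖z‖ ^ γ := by
      rw [← Real.mul_rpow (by positivity) hbx.le]
      exact Real.rpow_le_rpow_of_nonpos hzn h3 hγ0.le
    have h5 : ρ ^ 2 / 3 * ‖ξ‖ ^ 2 ≤ (z i * ξ k - z k * ξ i) ^ 2 := by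
      have : z i * ξ k - z k * ξ i = ξ k * (z i - t * z k) := by
        simp only [t]; field_simp
      rw [this, mul_pow]
      nlinarith [mul_le_mul hk h2 (sq_nonneg _) (by positivity)]
    refine mul_le_mul_of_nonneg_right ?_ (hh.nonneg w)
    rw [sum_a_quad hγ]
    calc _ = ((2 * (1 + R)) ^ γ * bracket x ^ γ) * (ρ ^ 2 / 3 * ‖ξ‖ ^ 2) := by ring
      _ ≤ _ := mul_le_mul h4 (h5.trans (hz z)) (by positivity) (by positivity)
  have hnn : ∀ w, 0 ≤ (∑ i, ∑ j, a γ i j (x - w) * ξ i * ξ j) * h w := fun w => by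
    refine mul_nonneg ?_ (hh.nonneg w)
    rw [sum_a_quad hγ]; positivity
  calc ellC γ R κ N * bracket x ^ γ * ‖ξ‖ ^ 2
      = (2 * (1 + R)) ^ γ * ρ ^ 2 / 3 * bracket x ^ γ * ‖ξ‖ ^ 2 * κ := by
        unfold ellC; rw [← hρ]; ring
    _ ≤ (2 * (1 + R)) ^ γ * ρ ^ 2 / 3 * bracket x ^ γ * ‖ξ‖ ^ 2 *
          ∫ w in Metric.ball 0 R \ A, h w := by gcongr
    _ = ∫ w in Metric.ball 0 R \ A,
          (2 * (1 + R)) ^ γ * ρ ^ 2 / 3 * bracket x ^ γ * ‖ξ‖ ^ 2 * h w :=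
        (integral_const_mul _ _).symm
    _ ≤ ∫ w in Metric.ball 0 R \ A, (∑ i, ∑ j, a γ i j (x - w) * ξ i * ξ j) * h w :=
        setIntegral_mono_on (hh.integrable.const_mul _).integrableOn hi.integrableOn
          (measurableSet_ball.diff hAm) hpt
    _ ≤ _ := setIntegral_le_integral hi (ae_of_all _ hnn)

end
end LFD
end

noncomputable section
namespace LFD
open MeasureTheory Set Filter Topology

/-! ### Consequences of the entropy bound -/

/-- An integrable comparison function for the negative part of `u log u`. -/
def Jf (v : V) : ℝ := (1 + ‖v‖ ^ 2) ^ (-(4 : ℝ) / 2)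

lemma integrable_Jf : Integrable Jf :=
  integrable_rpow_neg_one_add_norm_sq (by rw [finrank_V]; norm_num)

lemma Jf_nonneg (v : V) : 0 ≤ Jf v := by unfold Jf; positivity

/-- The mass of the comparison function. -/
def cJ : ℝ := ∫ v, Jf v

lemma cJ_nonneg : 0 ≤ cJ := integral_nonneg Jf_nonneg

/-- The relative entropy inequality `u log (u / J) ≥ u - J`, together with `log J ≥ -2 |v| ^ 2`. It
makes the negative part of `u log u` cost only the energy and a fixed integrable function. -/
lemma mul_log_lower {u : ℝ} (hu : 0 ≤ u) (v : V) :
    0 ≤ u * Real.log u + 2 * (u * ‖v‖ ^ 2) + Jf v := by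
  rcases hu.eq_or_lt with h | h
  · rw [← h]; simpa using Jf_nonneg v
  have hJ : 0 < Jf v := by unfold Jf; positivity
  have h1 : Real.log (Jf v) = -2 * Real.log (1 + ‖v‖ ^ 2) := by
    unfold Jf; rw [Real.log_rpow (by positivity)]; norm_num
  have h2 : Real.log (1 + ‖v‖ ^ 2) ≤ ‖v‖ ^ 2 := by
    have := Real.log_le_sub_one_of_pos (by positivity : (0 : ℝ) < 1 + ‖v‖ ^ 2); linarith
  have h3 : Real.log (Jf v / u) ≤ Jf v / u - 1 := Real.log_le_sub_one_of_pos (by positivity)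
  rw [Real.log_div hJ.ne' h.ne', h1] at h3
  have h4 : u * (Jf v / u - 1) = Jf v - u := by field_simp
  have h5 := mul_le_mul_of_nonneg_left h3 h.le
  rw [h4] at h5
  have h6 := mul_le_mul_of_nonneg_left h2 h.le
  linarith

/-- The hole part of the Fermi–Dirac entropy is linear in `y = ε u`; after division by `ε` it costs
one unit of mass, uniformly in `ε`. -/
lemma one_sub_mul_log_bounds {y : ℝ} (h0 : 0 ≤ y) (h1 : y ≤ 1) :
    -y ≤ (1 - y) * Real.log (1 - y) ∧ (1 - y) * Real.log (1 - y) ≤ 0 := by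
  rcases h1.eq_or_lt with h | h
  · rw [h]; simp
  have hp : 0 < 1 - y := by linarith
  constructor
  · have := mul_le_mul_of_nonneg_left (Real.one_sub_inv_le_log_of_pos hp) hp.le
    have e : (1 - y) * (1 - (1 - y)⁻¹) = -y := by field_simp; ring
    linarith
  · exact mul_nonpos_of_nonneg_of_nonpos hp.le (Real.log_nonpos hp.le (by linarith))

lemma measurable_mul_log : Measurable (fun u : ℝ => u * Real.log u) :=
  measurable_id.mul Real.measurable_log

/-- Expanding `log (ε u) = log ε + log u` isolates a term depending on the mass alone, so it cancels
when two densities of equal mass are compared. -/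
lemma entropy_estimates {ε : ℝ} (hε : 0 < ε) {u : V → ℝ} (hm : AEStronglyMeasurable u volume)
    (hu : ∀ᵐ v, 0 ≤ u v ∧ u v ≤ ε⁻¹) (hi : Integrable u)
    (h2 : Integrable (fun v => u v * ‖v‖ ^ 2)) :
    Integrable (fun v => u v * Real.log (u v)) ∧
    ε * Real.log ε * (∫ v, u v) + ε * (∫ v, u v * Real.log (u v)) - ε * ∫ v, u v
      ≤ ∫ v, (ε * u v * Real.log (ε * u v) + (1 - ε * u v) * Real.log (1 - ε * u v)) ∧
    ∫ v, (ε * u v * Real.log (ε * u v) + (1 - ε * u v) * Real.log (1 - ε * u v))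
      ≤ ε * Real.log ε * (∫ v, u v) + ε * (∫ v, u v * Real.log (u v)) := by
  have I1 : Integrable (fun v => u v * Real.log (u v)) := by
    refine (((hi.const_mul |Real.log ε|).add (h2.const_mul 2)).add integrable_Jf).mono'
      (measurable_mul_log.comp_aemeasurable hm.aemeasurable).aestronglyMeasurable ?_
    filter_upwards [hu] with v hv
    have hl := mul_log_lower hv.1 v
    have hJ := Jf_nonneg v
    have h3 : 0 ≤ u v * ‖v‖ ^ 2 := mul_nonneg hv.1 (sq_nonneg _)
    have h4 : 0 ≤ |Real.log ε| * u v := mul_nonneg (abs_nonneg _) hv.1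
    simp only [Pi.add_apply, Real.norm_eq_abs]
    rw [abs_le]
    refine ⟨by linarith, ?_⟩
    rcases hv.1.eq_or_lt with h | h
    · rw [← h]; simpa using hJ
    · have h5 : Real.log (u v) ≤ |Real.log ε| := by
        have := Real.log_le_log h hv.2
        rw [Real.log_inv] at this
        exact this.trans (neg_le_abs _)
      have := mul_le_mul_of_nonneg_left h5 h.le
      linarith
  have hy : ∀ᵐ v, 0 ≤ ε * u v ∧ ε * u v ≤ 1 := by
    filter_upwards [hu] with v hv
    refine ⟨mul_nonneg hε.le hv.1, ?_⟩
    calc ε * u v ≤ ε * ε⁻¹ := by gcongr; exact hv.2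
      _ = 1 := mul_inv_cancel₀ hε.ne'
  have I2 : Integrable (fun v => (1 - ε * u v) * Real.log (1 - ε * u v)) := by
    refine (hi.const_mul ε).mono' (measurable_mul_log.comp_aemeasurable
      ((hm.aemeasurable.const_mul ε).const_sub 1)).aestronglyMeasurable ?_
    filter_upwards [hy] with v hv
    obtain ⟨a1, a2⟩ := one_sub_mul_log_bounds hv.1 hv.2
    rw [Real.norm_eq_abs, abs_le]; constructor <;> linarith [hv.1]
  have e : ∫ v, (ε * u v * Real.log (ε * u v) + (1 - ε * u v) * Real.log (1 - ε * u v)) =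
      ε * Real.log ε * (∫ v, u v) + ε * (∫ v, u v * Real.log (u v))
        + ∫ v, (1 - ε * u v) * Real.log (1 - ε * u v) := by
    have i01 : Integrable (fun v => ε * Real.log ε * u v + ε * (u v * Real.log (u v))) :=
      (hi.const_mul _).add (I1.const_mul _)
    rw [← integral_const_mul, ← integral_const_mul, ← integral_add (hi.const_mul _) (I1.const_mul _),
      ← integral_add i01 I2]
    congr 1; ext v
    by_cases h : u v = 0
    · simp [h]
    · rw [Real.log_mul hε.ne' h]; ring
  have b1 : -(ε * ∫ v, u v) ≤ ∫ v, (1 - ε * u v) * Real.log (1 - ε * u v) := by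
    rw [← integral_const_mul, ← integral_neg]
    refine integral_mono_ae (hi.const_mul _).neg I2 ?_
    filter_upwards [hy] with v hv using (one_sub_mul_log_bounds hv.1 hv.2).1
  have b2 : ∫ v, (1 - ε * u v) * Real.log (1 - ε * u v) ≤ 0 := by
    refine integral_nonpos_of_ae ?_
    filter_upwards [hy] with v hv using (one_sub_mul_log_bounds hv.1 hv.2).2
  refine ⟨I1, ?_, ?_⟩ <;> rw [e] <;> linarith

lemma MemL1.integrable_sq {g : V → ℝ} (hg : MemL1 2 g) :
    Integrable (fun v => g v * bracket v ^ 2) := by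
  simpa using hg.2

lemma MemL1.integrable {g : V → ℝ} (hg : MemL1 2 g) : Integrable g := by
  refine hg.integrable_sq.mono hg.1 (ae_of_all _ fun v => ?_)
  rw [norm_mul]
  refine le_mul_of_one_le_right (norm_nonneg _) ?_
  have := one_le_bracket v
  rw [Real.norm_of_nonneg (by positivity)]; nlinarith

lemma MemL1.integrable_norm_sq {g : V → ℝ} (hg : MemL1 2 g) :
    Integrable (fun v => g v * ‖v‖ ^ 2) := by
  have := hg.integrable_sq.sub hg.integrable
  refine this.congr (ae_of_all _ fun v => ?_)
  simp only [Pi.sub_apply, bracket_sq]; ring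

lemma integral_bracket_sq {g : V → ℝ} (hg : MemL1 2 g) (h1 : ∫ v, g v = 1)
    (h3 : ∫ v, g v * ‖v‖ ^ 2 = 3) : ∫ v, g v * bracket v ^ 2 = 4 := by
  have : (fun v => g v * bracket v ^ 2) = fun v => g v + g v * ‖v‖ ^ 2 := by
    ext v; rw [bracket_sq]; ring
  rw [this, integral_add hg.integrable hg.integrable_norm_sq, h1, h3]; norm_num

/-- The level above which densities of bounded entropy carry little mass. -/
def Lev (h : ℝ) : ℝ := Real.exp (4 * (|h| + 7 + cJ))

lemma Lev_pos (h : ℝ) : 0 < Lev h := Real.exp_pos _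

section
variable {ε₀ ε : ℝ} {fin g : V → ℝ}

lemma IsInitialDatum.ae_bounds (hI : IsInitialDatum ε₀ fin) (hε : 0 < ε) (hle : ε ≤ ε₀) :
    ∀ᵐ v, 0 ≤ fin v ∧ fin v ≤ ε⁻¹ := by
  have h1 : ∀ᵐ v, ‖fin v‖ₑ ≤ ENNReal.ofReal ε₀⁻¹ := by
    rw [← hI.norm_top, eLpNorm_exponent_top]; exact ae_le_eLpNormEssSup
  filter_upwards [h1, hI.nonneg] with v h2 h3
  refine ⟨h3, ?_⟩
  rw [Real.enorm_of_nonneg h3,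
    ENNReal.ofReal_le_ofReal_iff (inv_nonneg.2 hI.eps_pos.le)] at h2
  exact h2.trans (inv_anti₀ hε hle)

/-- The masses agree, so the `ε log ε` terms cancel, and after division by `ε` the hole entropy
leaves the additive `1`. This is where the entropy inequality in the solution class enters. -/
lemma entropy_le_of_memY (hI : IsInitialDatum ε₀ fin) (hε : 0 < ε) (hle : ε ≤ ε₀)
    (hg : MemY ε fin g) : Integrable (fun v => g v * Real.log (g v)) ∧
      ∫ v, g v * Real.log (g v) ≤ boltzmannEntropy fin + 1 := by
  obtain ⟨i1, l1, -⟩ := entropy_estimates hε hg.memL1.1 hg.bounds hg.memL1.integrable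
    hg.memL1.integrable_norm_sq
  obtain ⟨-, -, u2⟩ := entropy_estimates hε hI.memL1.1 (hI.ae_bounds hε hle) hI.memL1.integrable
    hI.memL1.integrable_norm_sq
  refine ⟨i1, ?_⟩
  have h := hg.entropy_le
  unfold fermiDiracEntropy at h
  have hinv : 0 < ε⁻¹ := inv_pos.2 hε
  have h2 : ∫ v, (ε * g v * Real.log (ε * g v) + (1 - ε * g v) * Real.log (1 - ε * g v)) ≤
      ∫ v, (ε * fin v * Real.log (ε * fin v) + (1 - ε * fin v) * Real.log (1 - ε * fin v)) := by
    by_contra hlt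
    have := mul_lt_mul_of_pos_left (not_le.1 hlt) hinv
    linarith
  rw [hg.mass, hI.mass] at l1
  rw [hI.mass] at u2
  have h3 : ε * ∫ v, g v * Real.log (g v) ≤ ε * (boltzmannEntropy fin + 1) := by
    unfold boltzmannEntropy; linarith
  exact le_of_mul_le_mul_left h3 hε

lemma MemY.adm (hI : IsInitialDatum ε₀ fin) (hg : MemY ε fin g)
    (h0 : ∀ v, 0 ≤ g v) (h1 : ∀ v, g v ≤ ε⁻¹) : Adm ε⁻¹ 4 g :=
  ⟨hg.memL1.1, h0, h1, hg.memL1.integrable_sq, (integral_bracket_sq hg.memL1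
    (hg.mass.trans hI.mass) (hg.energy.trans hI.energy)).le⟩

/-- The unit mass is distributed over four regions. Values above the level `L` carry at most `1/4`,
by entropy; the exterior of the ball of radius `4` carries at most `3/16`, by energy; values below
`L` on `A` carry at most `L |A| ≤ 1/8`. In the remaining region `ε g ≤ 1/2`, so `g ≤ 2 g (1 - ε g)`,
and more than the required `1/8` is left. The function `F` below is the pointwise form of this
splitting. -/
lemma MemY.spread (hI : IsInitialDatum ε₀ fin) (hε : 0 < ε) (hle : ε ≤ ε₀)
    (hg : MemY ε fin g) (h0 : ∀ v, 0 ≤ g v) (h1 : ∀ v, g v ≤ ε⁻¹)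
    (hsmall : ε ≤ 1 / (2 * Lev (boltzmannEntropy fin))) :
    Spread 4 (1 / (8 * Lev (boltzmannEntropy fin))) (1 / 8) (fun v => g v * (1 - ε * g v)) := by
  obtain ⟨iH, bH⟩ := entropy_le_of_memY hI hε hle hg
  set h := boltzmannEntropy fin
  set L := Lev h
  have hL : 0 < L := Lev_pos h
  have ig := hg.memL1.integrable
  have ig2 := hg.memL1.integrable_norm_sq
  set Λ := 4 * (|h| + 7 + cJ) with hΛ
  have hΛp : 0 < Λ := by have := abs_nonneg h; have := cJ_nonneg; positivity
  have hlogL : Real.log L = Λ := Real.log_exp _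
  have hεg : ∀ v, 0 ≤ 1 - ε * g v := fun v => by
    have : ε * g v ≤ ε * ε⁻¹ := by gcongr; exact h1 v
    rw [mul_inv_cancel₀ hε.ne'] at this; linarith
  have hq0 : ∀ v, 0 ≤ g v * (1 - ε * g v) := fun v => mul_nonneg (h0 v) (hεg v)
  have iq : Integrable (fun v => g v * (1 - ε * g v)) := by
    refine ig.mono' (hg.memL1.1.mul (aestronglyMeasurable_const.sub (hg.memL1.1.const_mul ε)))
      (ae_of_all _ fun v => ?_)
    rw [Real.norm_of_nonneg (hq0 v)]
    have := mul_nonneg hε.le (h0 v)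
    exact mul_le_of_le_one_right (h0 v) (by linarith)
  refine ⟨fun A hA hAv => ?_⟩
  have hAfin : volume A ≠ ⊤ := (hAv.trans_lt ENNReal.ofReal_lt_top).ne
  have hAr : volume.real A ≤ 1 / (8 * L) := by
    rw [Measure.real]
    exact (ENNReal.toReal_mono ENNReal.ofReal_ne_top hAv).trans
      (by rw [ENNReal.toReal_ofReal (by positivity)])
  have hB : MeasurableSet (Metric.ball (0 : V) 4 \ A) := measurableSet_ball.diff hA
  set F : V → ℝ := fun v => 2 * (Metric.ball (0 : V) 4 \ A).indicator
      (fun v => g v * (1 - ε * g v)) v + (1 / 16) * (g v * ‖v‖ ^ 2)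
      + Λ⁻¹ * (g v * Real.log (g v) + 2 * (g v * ‖v‖ ^ 2) + Jf v)
      + L * A.indicator (fun _ => (1 : ℝ)) v with hF
  have hpt : ∀ v, g v ≤ F v := by
    intro v
    have t1 : 0 ≤ 2 * (Metric.ball (0 : V) 4 \ A).indicator (fun v => g v * (1 - ε * g v)) v :=
      mul_nonneg zero_le_two (indicator_nonneg (fun v _ => hq0 v) v)
    have t2 : 0 ≤ (1 / 16) * (g v * ‖v‖ ^ 2) :=
      mul_nonneg (by norm_num) (mul_nonneg (h0 v) (sq_nonneg _))
    have t3 : 0 ≤ Λ⁻¹ * (g v * Real.log (g v) + 2 * (g v * ‖v‖ ^ 2) + Jf v) :=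
      mul_nonneg (inv_nonneg.2 hΛp.le) (mul_log_lower (h0 v) v)
    have t4 : 0 ≤ L * A.indicator (fun _ => (1 : ℝ)) v :=
      mul_nonneg hL.le (indicator_nonneg (fun _ _ => zero_le_one) v)
    simp only [hF]
    rcases le_or_gt (g v) L with hgL | hgL
    · by_cases hvA : v ∈ A
      · rw [indicator_of_mem hvA] at t4 ⊢
        linarith
      · by_cases hvB : v ∈ Metric.ball (0 : V) 4
        · rw [indicator_of_mem (show v ∈ Metric.ball (0 : V) 4 \ A from ⟨hvB, hvA⟩)]
          have h3 : ε * g v ≤ 1 / 2 := by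
            calc ε * g v ≤ 1 / (2 * L) * L := mul_le_mul hsmall hgL (h0 v) (by positivity)
              _ = 1 / 2 := by field_simp
          have : g v * (1 / 2) ≤ g v * (1 - ε * g v) :=
            mul_le_mul_of_nonneg_left (by linarith) (h0 v)
          linarith
        · have h3 : 4 ≤ ‖v‖ := by simpa using hvB
          have h4 : 16 ≤ ‖v‖ ^ 2 := by nlinarith
          have := mul_le_mul_of_nonneg_left h4 (h0 v)
          linarith
    · have hgp : 0 < g v := hL.trans hgL
      have h3 : Λ ≤ Real.log (g v) := by
        rw [← hlogL]; exact Real.log_le_log hL hgL.le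
      have h4 : g v * Λ ≤ g v * Real.log (g v) + 2 * (g v * ‖v‖ ^ 2) + Jf v := by
        have := mul_le_mul_of_nonneg_left h3 hgp.le
        have := Jf_nonneg v
        have : 0 ≤ g v * ‖v‖ ^ 2 := by positivity
        linarith
      have h5 : g v ≤ Λ⁻¹ * (g v * Real.log (g v) + 2 * (g v * ‖v‖ ^ 2) + Jf v) := by
        rw [← div_eq_inv_mul, le_div_iff₀ hΛp]; exact h4
      linarith
  have iA : Integrable (A.indicator (fun _ => (1 : ℝ))) :=
    (integrable_indicator_iff hA).2 (integrableOn_const hAfin)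
  have iB : Integrable ((Metric.ball (0 : V) 4 \ A).indicator (fun v => g v * (1 - ε * g v))) :=
    iq.indicator hB
  have i1 := iB.const_mul 2
  have i2 := ig2.const_mul (1 / 16)
  have i3' := (iH.add (ig2.const_mul 2)).add integrable_Jf
  have i3 := i3'.const_mul Λ⁻¹
  have i4 := iA.const_mul L
  have e := integral_add ((i1.add i2).add i3) i4
  rw [integral_add' (i1.add i2) i3, integral_add' i1 i2] at e
  have e3 : ∫ v, ((((fun v => g v * Real.log (g v)) + fun v => 2 * (g v * ‖v‖ ^ 2)) + Jf : V → ℝ)) v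
      = (∫ v, g v * Real.log (g v)) + 2 * 3 + cJ := by
    rw [integral_add' (iH.add (ig2.const_mul 2)) integrable_Jf, integral_add' iH (ig2.const_mul 2),
      integral_const_mul, hg.energy, hI.energy]; rfl
  have eA : ∫ v, A.indicator (fun _ => (1 : ℝ)) v = volume.real A := integral_indicator_one hA
  have hle2 := integral_mono ig (((i1.add i2).add i3).add i4) hpt
  have key : 1 ≤ 2 * (∫ w in Metric.ball 0 4 \ A, g w * (1 - ε * g w)) + 1 / 16 * 3
      + Λ⁻¹ * ((∫ v, g v * Real.log (g v)) + 2 * 3 + cJ) + L * volume.real A := by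
    rw [hg.mass, hI.mass] at hle2
    refine hle2.trans (le_of_eq ?_)
    refine Eq.trans ?_ (e.trans ?_)
    · rfl
    · rw [integral_const_mul, integral_const_mul, integral_const_mul, integral_const_mul,
        integral_indicator hB, eA, hg.energy, hI.energy, e3]
  -- The `7` in the definition of the level is `1` from `entropy_le_of_memY` plus twice the energy
  -- `3`.
  have k1 : Λ⁻¹ * ((∫ v, g v * Real.log (g v)) + 2 * 3 + cJ) ≤ 1 / 4 := by
    rw [← div_eq_inv_mul, div_le_iff₀ hΛp, hΛ]
    have := le_abs_self h
    linarith
  have k2 : L * volume.real A ≤ 1 / 8 := by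
    calc _ ≤ L * (1 / (8 * L)) := by gcongr
      _ = 1 / 8 := by field_simp
  linarith

end
end LFD
end

noncomputable section
namespace LFD
open MeasureTheory Set Filter Topology
open scoped Convolution

/-! ### Convolution with a test function -/

/-- The convolution `k ⋆ ρ` of scalar functions. -/
def cv (k ρ : V → ℝ) (x : V) : ℝ := ∫ v, k v * ρ (x - v)

lemma cv_eq (k ρ : V → ℝ) : cv k ρ = k ⋆[ContinuousLinearMap.mul ℝ ℝ, volume] ρ := by
  ext x; simp [cv, convolution_def]

lemma hasCompactSupport_comp_sub {ρ : V → ℝ} (hs : HasCompactSupport ρ) (x : V) :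
    HasCompactSupport (fun v => ρ (x - v)) :=
  hs.comp_homeomorph (Homeomorph.subLeft x)

lemma integrable_mul_comp_sub {k ρ : V → ℝ} (hk : LocallyIntegrable k) (hc : Continuous ρ)
    (hs : HasCompactSupport ρ) (x : V) : Integrable (fun v => k v * ρ (x - v)) := by
  have := hk.integrable_smul_left_of_hasCompactSupport (hc.comp (continuous_const.sub continuous_id))
    (hasCompactSupport_comp_sub hs x)
  refine this.congr (ae_of_all _ fun v => ?_)
  simp [mul_comm]

lemma contDiff_cv {k ρ : V → ℝ} (hk : LocallyIntegrable k) (h1 : ContDiff ℝ (⊤ : ℕ∞) ρ)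
    (hs : HasCompactSupport ρ) : ContDiff ℝ (⊤ : ℕ∞) (cv k ρ) := by
  rw [cv_eq]; exact hs.contDiff_convolution_right _ hk h1

lemma pd_cv {k ρ : V → ℝ} (hk : LocallyIntegrable k) (h1 : ContDiff ℝ 1 ρ)
    (hs : HasCompactSupport ρ) (i : Fin 3) (x : V) : pd i (cv k ρ) x = cv k (pd i ρ) x := by
  have h := hs.hasFDerivAt_convolution_right (ContinuousLinearMap.mul ℝ ℝ) hk h1 x
  rw [← cv_eq] at h
  rw [pd, h.fderiv, convolution_precompR_apply (ContinuousLinearMap.mul ℝ ℝ) hk (hs.fderiv ℝ)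
    (h1.continuous_fderiv one_ne_zero), ← cv_eq]
  rfl

lemma locallyIntegrable_of_le {k : V → ℝ} (hk : AEStronglyMeasurable k volume) {C : ℝ}
    (h : ∀ x, |k x| ≤ C * bracket x ^ 2) : LocallyIntegrable k := by
  have : LocallyIntegrable (fun x : V => C * bracket x ^ 2) :=
    (continuous_const.mul (continuous_bracket.pow 2)).locallyIntegrable
  exact this.mono hk (ae_of_all _ fun x => (h x).trans (le_abs_self _))

/-! ### The mollifier -/

/-- A fixed smooth bump of unit mass. -/
def ρ₀ : V → ℝ :=
  (⟨1 / 2, 1, by norm_num, by norm_num⟩ : ContDiffBump (0 : V)).normed volume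

lemma contDiff_ρ₀ : ContDiff ℝ (⊤ : ℕ∞) ρ₀ := ContDiffBump.contDiff_normed _
lemma ρ₀_nonneg (x : V) : 0 ≤ ρ₀ x := ContDiffBump.nonneg_normed _ x
lemma integral_ρ₀ : ∫ x, ρ₀ x = 1 := ContDiffBump.integral_normed _
lemma tsupport_ρ₀ : tsupport ρ₀ = Metric.closedBall 0 1 := ContDiffBump.tsupport_normed_eq _
lemma hasCompactSupport_ρ₀ : HasCompactSupport ρ₀ := ContDiffBump.hasCompactSupport_normed _

lemma exists_bound_ρ₀ : ∃ C : ℝ, 0 ≤ C ∧ ∀ x, |ρ₀ x| ≤ C ∧ ∀ i, |pd i ρ₀ x| ≤ C := by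
  have h1 : ContDiff ℝ 1 ρ₀ := contDiff_ρ₀.of_le (by exact_mod_cast le_top)
  obtain ⟨C, hC⟩ := h1.continuous.bounded_above_of_compact_support hasCompactSupport_ρ₀
  have hb : ∀ i, ∃ D, ∀ x, ‖pd i ρ₀ x‖ ≤ D := fun i =>
    (continuous_pd h1 i).bounded_above_of_compact_support (hasCompactSupport_pd hasCompactSupport_ρ₀ i)
  choose D hD using hb
  have hD0 : ∀ i, 0 ≤ D i := fun i => (norm_nonneg _).trans (hD i 0)
  have hC0 : 0 ≤ C := (norm_nonneg _).trans (hC 0)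
  have hs : 0 ≤ ∑ i, D i := Finset.sum_nonneg fun i _ => hD0 i
  refine ⟨C + ∑ i, D i, by linarith, fun x => ⟨?_, fun i => ?_⟩⟩
  · have := hC x; rw [Real.norm_eq_abs] at this; linarith
  · have h2 := hD i x; rw [Real.norm_eq_abs] at h2
    have := Finset.single_le_sum (fun i _ => hD0 i) (Finset.mem_univ i)
    linarith

/-- A bound for the bump and its first derivatives. -/
def Cρ : ℝ := exists_bound_ρ₀.choose
lemma Cρ_nonneg : 0 ≤ Cρ := exists_bound_ρ₀.choose_spec.1
lemma ρ₀_le (x : V) : |ρ₀ x| ≤ Cρ := (exists_bound_ρ₀.choose_spec.2 x).1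
lemma pd_ρ₀_le (x : V) (i : Fin 3) : |pd i ρ₀ x| ≤ Cρ := (exists_bound_ρ₀.choose_spec.2 x).2 i

/-- The rescaled mollifier. -/
def mol (δ : ℝ) (x : V) : ℝ := δ⁻¹ ^ 3 * ρ₀ (δ⁻¹ • x)

section
variable {δ : ℝ}

lemma contDiff_mol (δ : ℝ) : ContDiff ℝ (⊤ : ℕ∞) (mol δ) :=
  contDiff_const.mul (contDiff_ρ₀.comp (contDiff_const_smul _))

lemma contDiff_mol_one (δ : ℝ) : ContDiff ℝ 1 (mol δ) :=
  (contDiff_mol δ).of_le (by exact_mod_cast le_top)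

lemma mol_nonneg (hδ : 0 < δ) (x : V) : 0 ≤ mol δ x :=
  mul_nonneg (by positivity) (ρ₀_nonneg _)

lemma hasCompactSupport_mol (hδ : 0 < δ) : HasCompactSupport (mol δ) :=
  (hasCompactSupport_ρ₀.comp_smul (inv_ne_zero hδ.ne')).mul_left

lemma integral_mol (hδ : 0 < δ) : ∫ x, mol δ x = 1 := by
  unfold mol
  rw [integral_const_mul, Measure.integral_comp_smul, integral_ρ₀, finrank_V,
    abs_of_nonneg (by positivity)]
  simp only [smul_eq_mul, mul_one]
  field_simp

lemma mol_le (hδ : 0 < δ) (x : V) : |mol δ x| ≤ Cρ * δ⁻¹ ^ 3 := by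
  unfold mol
  rw [abs_mul, abs_of_nonneg (by positivity), mul_comm]
  gcongr; exact ρ₀_le _

lemma pd_mol (δ : ℝ) (i : Fin 3) (x : V) : pd i (mol δ) x = δ⁻¹ ^ 4 * pd i ρ₀ (δ⁻¹ • x) := by
  have hd : DifferentiableAt ℝ ρ₀ (δ⁻¹ • x) :=
    contDiff_ρ₀.differentiable (by simp) _
  have h1 : HasFDerivAt (fun y : V => δ⁻¹ • y) (δ⁻¹ • ContinuousLinearMap.id ℝ V) x :=
    (hasFDerivAt_id x).const_smul δ⁻¹
  have h2 := (hd.hasFDerivAt.comp x h1).const_mul (δ⁻¹ ^ 3)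
  rw [pd, show mol δ = fun y => δ⁻¹ ^ 3 * (ρ₀ ∘ fun y => δ⁻¹ • y) y from rfl, h2.fderiv]
  simp [pd]; ring

lemma pd_mol_le (hδ : 0 < δ) (i : Fin 3) (x : V) : |pd i (mol δ) x| ≤ Cρ * δ⁻¹ ^ 4 := by
  rw [pd_mol, abs_mul, abs_of_nonneg (by positivity), mul_comm]
  gcongr; exact pd_ρ₀_le _ _

lemma tsupport_mol_subset (hδ : 0 < δ) : tsupport (mol δ) ⊆ Metric.closedBall 0 δ := by
  refine closure_minimal (fun x hx => ?_) Metric.isClosed_closedBall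
  have h1 : ρ₀ (δ⁻¹ • x) ≠ 0 := fun h => hx (by simp [mol, h])
  have h2 : δ⁻¹ • x ∈ Metric.closedBall (0 : V) 1 := by
    rw [← tsupport_ρ₀]; exact subset_tsupport _ h1
  rw [mem_closedBall_zero_iff, norm_smul, Real.norm_of_nonneg (by positivity),
    ← div_eq_inv_mul, div_le_one hδ] at h2
  simpa using h2

lemma mol_eq_zero (hδ : 0 < δ) {x v : V} (hv : v ∉ Metric.closedBall x δ) : mol δ (x - v) = 0 := by
  refine image_eq_zero_of_notMem_tsupport fun h => hv ?_
  have := tsupport_mol_subset hδ h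
  simpa [dist_eq_norm, norm_sub_rev x v] using this

lemma pd_mol_eq_zero (hδ : 0 < δ) (i : Fin 3) {x v : V} (hv : v ∉ Metric.closedBall x δ) :
    pd i (mol δ) (x - v) = 0 := by
  refine image_eq_zero_of_notMem_tsupport fun h => hv ?_
  have := tsupport_mol_subset hδ (tsupport_pd_subset i _ h)
  simpa [dist_eq_norm, norm_sub_rev x v] using this

/-- The volume of the unit ball. -/
def v₁ : ℝ := (volume : Measure V).real (Metric.ball 0 1)

lemma volume_closedBall (hδ : 0 < δ) (x : V) :
    (volume : Measure V).real (Metric.closedBall x δ) = δ ^ 3 * v₁ := by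
  rw [Measure.addHaar_real_closedBall _ _ hδ.le, finrank_V]; rfl

lemma abs_integral_loc_le (hδ : 0 < δ) {x : V} {k : V → ℝ} {Q : ℝ}
    (hk : ∀ v ∈ Metric.closedBall x δ, |k v| ≤ Q * δ⁻¹ ^ 3)
    (hz : ∀ v ∉ Metric.closedBall x δ, k v = 0) : |∫ v, k v| ≤ Q * v₁ := by
  rw [← setIntegral_eq_integral_of_forall_compl_eq_zero hz]
  have hk' : ∀ v ∈ Metric.closedBall x δ, ‖k v‖ ≤ Q * δ⁻¹ ^ 3 := hk
  have := norm_setIntegral_le_of_norm_le_const (μ := (volume : Measure V))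
    (measure_closedBall_lt_top (x := x) (r := δ)) hk'
  rw [volume_closedBall hδ] at this
  refine this.trans (le_of_eq ?_)
  field_simp

/-- A kernel of size `δ⁻³` on a ball of radius `δ` sees only the mean oscillation of `F`, which
tends to zero at Lebesgue points. -/
lemma abs_integral_loc_sub_le (hδ : 0 < δ) {x : V} {F k : V → ℝ} {Q : ℝ}
    (hF : LocallyIntegrable F) (hk : ∀ v ∈ Metric.closedBall x δ, |k v| ≤ Q * δ⁻¹ ^ 3)
    (hz : ∀ v ∉ Metric.closedBall x δ, k v = 0) :
    |∫ v, (F v - F x) * k v| ≤ Q * v₁ * ⨍ v in Metric.closedBall x δ, ‖F v - F x‖ := by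
  rw [← setIntegral_eq_integral_of_forall_compl_eq_zero
    (s := Metric.closedBall x δ) fun v hv => by rw [hz v hv, mul_zero]]
  have hi : IntegrableOn (fun v => ‖F v - F x‖) (Metric.closedBall x δ) :=
    ((hF.integrableOn_isCompact (isCompact_closedBall x δ)).sub
      (integrableOn_const (measure_closedBall_lt_top.ne))).norm
  have h1 : |∫ v in Metric.closedBall x δ, (F v - F x) * k v| ≤
      ∫ v in Metric.closedBall x δ, Q * δ⁻¹ ^ 3 * ‖F v - F x‖ := by
    rw [← Real.norm_eq_abs]
    refine norm_integral_le_of_norm_le (hi.const_mul _) ?_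
    filter_upwards [ae_restrict_mem measurableSet_closedBall] with v hv
    rw [norm_mul, mul_comm]
    gcongr; exact hk v hv
  refine h1.trans (le_of_eq ?_)
  rw [integral_const_mul, setAverage_eq, volume_closedBall hδ, smul_eq_mul]
  by_cases hv : v₁ = 0
  · exfalso
    have : 0 < v₁ := ENNReal.toReal_pos (Metric.measure_ball_pos _ _ one_pos).ne' measure_ball_lt_top.ne
    linarith
  · field_simp

lemma tendsto_avg {F : V → ℝ} (hF : LocallyIntegrable F) :
    ∀ᵐ x, Tendsto (fun n => ⨍ v in Metric.closedBall x (ηs n), ‖F v - F x‖) atTop (𝓝 0) := by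
  filter_upwards [IsUnifLocDoublingMeasure.ae_tendsto_average_norm_sub volume hF 1] with x hx
  refine hx (fun _ => x) ηs ?_ (Eventually.of_forall fun n => ?_)
  · rw [tendsto_nhdsWithin_iff]
    exact ⟨tendsto_one_div_add_atTop_nhds_zero_nat, Eventually.of_forall fun n => ηs_pos n⟩
  · rw [one_mul]; exact Metric.mem_closedBall_self (ηs_pos n).le

lemma tendsto_cv_mol {F : V → ℝ} (hF : LocallyIntegrable F) {x : V}
    (hx : Tendsto (fun n => ⨍ v in Metric.closedBall x (ηs n), ‖F v - F x‖) atTop (𝓝 0)) :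
    Tendsto (fun n => cv F (mol (ηs n)) x) atTop (𝓝 (F x)) := by
  rw [tendsto_iff_norm_sub_tendsto_zero]
  refine squeeze_zero (fun _ => norm_nonneg _) (fun n => ?_) (by simpa using hx.const_mul (Cρ * v₁))
  have hδ := ηs_pos n
  have e : cv F (mol (ηs n)) x - F x = ∫ v, (F v - F x) * mol (ηs n) (x - v) := by
    have h1 : ∫ v, F x * mol (ηs n) (x - v) = F x := by
      rw [integral_const_mul, integral_sub_left_eq_self (mol (ηs n)) volume x, integral_mol hδ,
        mul_one]
    have h2 := integrable_mul_comp_sub hF (contDiff_mol_one (ηs n)).continuous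
      (hasCompactSupport_mol hδ) x
    have h3 := integrable_mul_comp_sub (k := fun _ => F x) (continuous_const.locallyIntegrable)
      (contDiff_mol_one (ηs n)).continuous (hasCompactSupport_mol hδ) x
    simp only [sub_mul]
    rw [integral_sub h2 h3, h1, cv]
  rw [e]
  exact abs_integral_loc_sub_le hδ hF (fun v _ => mol_le hδ _) (fun v hv => mol_eq_zero hδ hv)

lemma integral_pd_eq_zero {ψ : V → ℝ} (h1 : ContDiff ℝ 1 ψ) (h2 : HasCompactSupport ψ) (i : Fin 3) :
    ∫ x, pd i ψ x = 0 := by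
  have h := integral_mul_fderiv_eq_neg_fderiv_mul_of_integrable (μ := (volume : Measure V))
    (f := fun _ => (1 : ℝ)) (g := ψ) (v := EuclideanSpace.single i 1) (by simp)
    (by
      simp only [one_mul]
      exact (continuous_pd h1 i).integrable_of_hasCompactSupport (hasCompactSupport_pd h2 i))
    (by simpa using h1.continuous.integrable_of_hasCompactSupport h2)
    (fun x _ => differentiableAt_const _) (fun x _ => h1.differentiable one_ne_zero x)
  simpa [pd] using h

lemma pd_comp_const_sub {ψ : V → ℝ} (h1 : ContDiff ℝ 1 ψ) (i : Fin 3) (x v : V) :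
    pd i (fun v => ψ (x - v)) v = -pd i ψ (x - v) := by
  have h2 : HasFDerivAt (fun v : V => x - v) (-ContinuousLinearMap.id ℝ V) v :=
    (hasFDerivAt_id v).const_sub x
  have h3 := (h1.differentiable one_ne_zero (x - v)).hasFDerivAt.comp v h2
  rw [pd, show (fun v => ψ (x - v)) = ψ ∘ fun v => x - v from rfl, h3.fderiv]
  simp [pd]

/-! ### The mollified flux -/

/-- The quadratic density `f (1 - ε f)`. -/
def fl (ε : ℝ) (f : V → ℝ) (v : V) : ℝ := f v * (1 - ε * f v)

/-- The mollified density. -/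
def mu (f : V → ℝ) (δ : ℝ) : V → ℝ := cv f (mol δ)

/-- The mollified flux. -/
def mJ (γ ε : ℝ) (f : V → ℝ) (δ : ℝ) (i : Fin 3) (x : V) : ℝ :=
  ∑ j, cv (fun v => f v * Sm γ (fl ε f) i j v) (pd j (mol δ)) x
    - cv (fun v => f v * Bv γ (fl ε f) i v) (mol δ) x
    - cv (fun v => fl ε f v * Bv γ f i v) (mol δ) x

/-- The commutator kernel. -/
def mK (γ : ℝ) (h : V → ℝ) (δ : ℝ) (i : Fin 3) (x v : V) : ℝ :=
  ∑ j, (Sm γ h i j v - Sm γ h i j x) * pd j (mol δ) (x - v) - Bv γ h i v * mol δ (x - v)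

/-- The error in the mollified flux. -/
def mE (γ ε : ℝ) (f : V → ℝ) (δ : ℝ) (i : Fin 3) (x : V) : ℝ :=
  (∫ v, f v * mK γ (fl ε f) δ i x v)
    - (cv (fun v => fl ε f v * Bv γ f i v) (mol δ) x - fl ε (mu f δ) x * Bv γ f i x)

variable {γ ε m : ℝ} {f : V → ℝ}

lemma Adm.eps_mul_le (hf : Adm ε⁻¹ m f) (hε : 0 < ε) (v : V) : ε * f v ≤ 1 := by
  calc ε * f v ≤ ε * ε⁻¹ := by gcongr; exact hf.le v
    _ = 1 := mul_inv_cancel₀ hε.ne'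

lemma Adm.fl_nonneg (hf : Adm ε⁻¹ m f) (hε : 0 < ε) (v : V) : 0 ≤ fl ε f v :=
  mul_nonneg (hf.nonneg v) (by linarith [hf.eps_mul_le hε v])

lemma Adm.fl_le (hf : Adm ε⁻¹ m f) (hε : 0 < ε) (v : V) : fl ε f v ≤ f v :=
  mul_le_of_le_one_right (hf.nonneg v) (by linarith [mul_nonneg hε.le (hf.nonneg v)])

lemma Adm.fl (hf : Adm ε⁻¹ m f) (hε : 0 < ε) : Adm ε⁻¹ m (fl ε f) :=
  hf.mono (hf.meas.mul (aestronglyMeasurable_const.sub (hf.meas.const_mul ε)))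
    (hf.fl_nonneg hε) (hf.fl_le hε)

lemma Adm.locallyIntegrable (hf : Adm ε⁻¹ m f) : LocallyIntegrable f :=
  hf.integrable.locallyIntegrable

lemma Adm.locInt_mul {M M' m' : ℝ} {f : V → ℝ} (hf : Adm M' m' f) {k : V → ℝ}
    (hk : AEStronglyMeasurable k volume) (h : ∀ x, |k x| ≤ M * bracket x ^ 2) :
    LocallyIntegrable (fun v => f v * k v) := by
  refine locallyIntegrable_of_le (hf.meas.mul hk) (C := M' * M) fun x => ?_
  rw [abs_mul, abs_of_nonneg (hf.nonneg x), mul_assoc]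
  exact mul_le_mul (hf.le x) (h x) (abs_nonneg _) hf.M_nonneg

lemma Adm.abs_Bv_le_sq {M : ℝ} {h : V → ℝ} (hh : Adm M m h) (hγ : -2 < γ) (hγ0 : γ < 0) (i : Fin 3)
    (x : V) : |Bv γ h i x| ≤ 2 * growC M m * bracket x ^ 2 := by
  refine (hh.abs_Bv_le hγ hγ0 i x).trans ?_
  have := hh.growC_nonneg
  have := bracket_le_sq x
  gcongr

section
variable (hf : Adm ε⁻¹ m f) (hε : 0 < ε) (hγ : -2 < γ) (hγ0 : γ < 0)
include hf hε hγ hγ0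

lemma locInt_S (i j : Fin 3) : LocallyIntegrable (fun v => f v * Sm γ (fl ε f) i j v) :=
  hf.locInt_mul ((hf.fl hε).continuous_Sm hγ hγ0 i j).aestronglyMeasurable
    ((hf.fl hε).abs_Sm_le hγ hγ0 i j)

lemma locInt_B (i : Fin 3) : LocallyIntegrable (fun v => f v * Bv γ (fl ε f) i v) :=
  hf.locInt_mul ((hf.fl hε).aesm_Bv i) ((hf.fl hε).abs_Bv_le_sq hγ hγ0 i)

lemma locInt_c (i : Fin 3) : LocallyIntegrable (fun v => fl ε f v * Bv γ f i v) :=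
  (hf.fl hε).locInt_mul (hf.aesm_Bv i) (hf.abs_Bv_le_sq hγ hγ0 i)

omit hε hγ hγ0 in
lemma contDiff_mu (hδ : 0 < δ) : ContDiff ℝ (⊤ : ℕ∞) (mu f δ) :=
  contDiff_cv hf.locallyIntegrable (contDiff_mol δ) (hasCompactSupport_mol hδ)

lemma contDiff_mJ (hδ : 0 < δ) (i : Fin 3) : ContDiff ℝ (⊤ : ℕ∞) (mJ γ ε f δ i) := by
  have hs := hasCompactSupport_mol hδ
  exact ((ContDiff.sum fun j _ => contDiff_cv (locInt_S hf hε hγ hγ0 i j)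
    (contDiff_pd (contDiff_mol δ) j) (hasCompactSupport_pd hs j)).sub
    (contDiff_cv (locInt_B hf hε hγ hγ0 i) (contDiff_mol δ) hs)).sub
    (contDiff_cv (locInt_c hf hε hγ hγ0 i) (contDiff_mol δ) hs)

omit hε hγ hγ0 in
lemma mu_bounds (hδ : 0 < δ) (x : V) : 0 ≤ mu f δ x ∧ mu f δ x ≤ ε⁻¹ := by
  have hi := integrable_mul_comp_sub hf.locallyIntegrable (contDiff_mol_one δ).continuous
    (hasCompactSupport_mol hδ) x
  have hi2 := integrable_mul_comp_sub (k := fun _ => ε⁻¹) (continuous_const.locallyIntegrable)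
      (contDiff_mol_one δ).continuous (hasCompactSupport_mol hδ) x
  refine ⟨integral_nonneg fun v => mul_nonneg (hf.nonneg v) (mol_nonneg hδ _), ?_⟩
  calc mu f δ x ≤ ∫ v, ε⁻¹ * mol δ (x - v) := integral_mono hi hi2 fun v =>
        mul_le_mul_of_nonneg_right (hf.le v) (mol_nonneg hδ _)
    _ = ε⁻¹ := by
        rw [integral_const_mul, integral_sub_left_eq_self (mol δ) volume x, integral_mol hδ, mul_one]

/-- The diffusion coefficient is frozen at the centre `x` of the convolution. The flux then has the
structure of the original one with the mollified density in place of `f`, and all that is left over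
is collected in `mE`. -/
lemma mJ_eq (hδ : 0 < δ) (i : Fin 3) (x : V) :
    mJ γ ε f δ i x = ∑ j, Sm γ (fl ε f) i j x * pd j (mu f δ) x
      - fl ε (mu f δ) x * Bv γ f i x + mE γ ε f δ i x := by
  have hs := hasCompactSupport_mol hδ
  have hc := (contDiff_mol_one δ)
  have I1 : ∀ j, Integrable (fun v => f v * Sm γ (fl ε f) i j v * pd j (mol δ) (x - v)) := fun j =>
    integrable_mul_comp_sub (locInt_S hf hε hγ hγ0 i j) (continuous_pd hc j)
      (hasCompactSupport_pd hs j) x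
  have I2 := integrable_mul_comp_sub (locInt_B hf hε hγ hγ0 i) hc.continuous hs x
  have I3 : ∀ j, Integrable (fun v => Sm γ (fl ε f) i j x * (f v * pd j (mol δ) (x - v))) := fun j =>
    (integrable_mul_comp_sub hf.locallyIntegrable (continuous_pd hc j)
      (hasCompactSupport_pd hs j) x).const_mul _
  have e : ∫ v, f v * mK γ (fl ε f) δ i x v =
      ∑ j, cv (fun v => f v * Sm γ (fl ε f) i j v) (pd j (mol δ)) x
      - ∑ j, Sm γ (fl ε f) i j x * cv f (pd j (mol δ)) x
      - cv (fun v => f v * Bv γ (fl ε f) i v) (mol δ) x := by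
    unfold cv
    simp only [← integral_const_mul]
    rw [← integral_finsetSum _ fun j _ => I1 j, ← integral_finsetSum _ fun j _ => I3 j,
      ← integral_sub (integrable_finsetSum _ fun j _ => I1 j)
        (integrable_finsetSum _ fun j _ => I3 j), ← integral_sub _ I2]
    · congr 1; ext v
      unfold mK
      rw [mul_sub, Finset.mul_sum, ← Finset.sum_sub_distrib, mul_assoc]
      congr 1
      exact Finset.sum_congr rfl fun j _ => by ring
    · exact (integrable_finsetSum _ fun j _ => I1 j).sub (integrable_finsetSum _ fun j _ => I3 j)
  have hu : ∀ j, pd j (mu f δ) x = cv f (pd j (mol δ)) x := fun j =>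
    pd_cv hf.locallyIntegrable hc hs j x
  unfold mE mJ
  simp only [hu]
  rw [e]; ring

omit hγ hγ0 in
-- The frozen coefficient drops out because derivatives of the mollifier integrate to zero. What
-- remains is the weak identity between the divergence of `a * h` and `b * h`, tested with a
-- translate of the mollifier. Mean zero is what permits subtracting `f x` in the commutator
-- integral.
lemma integrable_mK_aux (hγ : -2 < γ) (hγ0 : γ < 0) (hδ : 0 < δ) (i : Fin 3) (x : V) :
    ∫ v, mK γ (fl ε f) δ i x v = 0 := by
  have hs := hasCompactSupport_mol hδ
  have hc := (contDiff_mol_one δ)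
  have hg := hf.fl hε
  have LS : ∀ j, LocallyIntegrable (Sm γ (fl ε f) i j) := fun j =>
    (hg.continuous_Sm hγ hγ0 i j).locallyIntegrable
  have LB : LocallyIntegrable (Bv γ (fl ε f) i) :=
    locallyIntegrable_of_le (hg.aesm_Bv i) (hg.abs_Bv_le_sq hγ hγ0 i)
  have I1 : ∀ j, Integrable (fun v => Sm γ (fl ε f) i j v * pd j (mol δ) (x - v)) := fun j =>
    integrable_mul_comp_sub (LS j) (continuous_pd hc j) (hasCompactSupport_pd hs j) x
  have I2 := integrable_mul_comp_sub LB hc.continuous hs x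
  have I3 : ∀ j, Integrable (fun v => Sm γ (fl ε f) i j x * pd j (mol δ) (x - v)) := fun j =>
    integrable_mul_comp_sub (k := fun _ => Sm γ (fl ε f) i j x) continuous_const.locallyIntegrable
      (continuous_pd hc j) (hasCompactSupport_pd hs j) x
  have I13 : ∀ j, Integrable
      (fun v => (Sm γ (fl ε f) i j v - Sm γ (fl ε f) i j x) * pd j (mol δ) (x - v)) := fun j => by
    refine ((I1 j).sub (I3 j)).congr (ae_of_all _ fun v => ?_)
    simp only [Pi.sub_apply]; ring
  unfold mK
  rw [integral_sub (integrable_finsetSum _ fun j _ => I13 j) I2,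
    integral_finsetSum _ fun j _ => I13 j]
  have e1 : ∀ j, ∫ v, (Sm γ (fl ε f) i j v - Sm γ (fl ε f) i j x) * pd j (mol δ) (x - v) =
      ∫ v, Sm γ (fl ε f) i j v * pd j (mol δ) (x - v) := fun j => by
    simp only [sub_mul]
    rw [integral_sub (I1 j) (I3 j), integral_const_mul,
      integral_sub_left_eq_self (pd j (mol δ)) volume x, integral_pd_eq_zero hc hs j, mul_zero,
      sub_zero]
  simp only [e1]
  rw [← integral_finsetSum _ fun j _ => I1 j]
  have hw := hg.Sm_weak hγ hγ0 i (ψ := fun v => mol δ (x - v))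
    (hc.comp (contDiff_const.sub contDiff_id)) (hasCompactSupport_comp_sub hs x)
  simp only [pd_comp_const_sub hc, mul_neg, Finset.sum_neg_distrib] at hw
  rw [integral_neg, neg_inj] at hw
  rw [hw, sub_self]

omit hγ hγ0 in
-- The Lipschitz bound supplies a factor `δ` that cancels the extra `δ⁻¹` of the differentiated
-- mollifier. The constant is `148 = 3 · 48 + 4`.
lemma abs_mK_le (hγ : -2 < γ) (hγ0 : γ < 0) (hδ : 0 < δ) (hδ1 : δ ≤ 1) (i : Fin 3) (x v : V)
    (hv : v ∈ Metric.closedBall x δ) :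
    |mK γ (fl ε f) δ i x v| ≤ 148 * growC ε⁻¹ m * Cρ * bracket x * δ⁻¹ ^ 3 := by
  have hg := hf.fl hε
  have hG := hg.growC_nonneg
  have hC := Cρ_nonneg
  have hb := bracket_pos x
  have hvx : ‖v - x‖ ≤ δ := by simpa [dist_eq_norm] using hv
  have t1 : ∀ j, |(Sm γ (fl ε f) i j v - Sm γ (fl ε f) i j x) * pd j (mol δ) (x - v)| ≤
      48 * growC ε⁻¹ m * Cρ * bracket x * δ⁻¹ ^ 3 := fun j => by
    rw [abs_mul]
    calc _ ≤ (48 * growC ε⁻¹ m * bracket x * δ) * (Cρ * δ⁻¹ ^ 4) := by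
          refine mul_le_mul ?_ (pd_mol_le hδ j _) (abs_nonneg _) (by positivity)
          exact (hg.Sm_lipschitz hγ hγ0 i j x v (hvx.trans hδ1)).trans (by gcongr)
      _ = _ := by field_simp
  have t2 : |Bv γ (fl ε f) i v * mol δ (x - v)| ≤ 4 * growC ε⁻¹ m * Cρ * bracket x * δ⁻¹ ^ 3 := by
    rw [abs_mul]
    have hbv : bracket v ≤ 2 * bracket x := by
      have := bracket_le_add v x; linarith [one_le_bracket x]
    calc _ ≤ (2 * growC ε⁻¹ m * (2 * bracket x)) * (Cρ * δ⁻¹ ^ 3) := by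
          refine mul_le_mul ?_ (mol_le hδ _) (abs_nonneg _) (by positivity)
          exact (hg.abs_Bv_le hγ hγ0 i v).trans (by gcongr)
      _ = _ := by ring
  unfold mK
  refine (abs_sub _ _).trans ?_
  have t3 := (Finset.abs_sum_le_sum_abs (fun j => (Sm γ (fl ε f) i j v - Sm γ (fl ε f) i j x) *
    pd j (mol δ) (x - v)) Finset.univ).trans (Finset.sum_le_sum fun j _ => t1 j)
  simp only [Finset.sum_const, Finset.card_univ, Fintype.card_fin, nsmul_eq_mul] at t3
  push_cast at t3
  linarith

omit hf hε hγ hγ0 in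
lemma mK_eq_zero (hδ : 0 < δ) (h : V → ℝ) (i : Fin 3) (x v : V) (hv : v ∉ Metric.closedBall x δ) :
    mK γ h δ i x v = 0 := by
  simp [mK, mol_eq_zero hδ hv, pd_mol_eq_zero hδ _ hv]

/-- The growth constant of the flux error. -/
def errC (ε m : ℝ) : ℝ :=
  148 * growC ε⁻¹ m * Cρ * ε⁻¹ * v₁ + 4 * growC ε⁻¹ m * Cρ * ε⁻¹ * v₁ + 2 * growC ε⁻¹ m * ε⁻¹

lemma abs_mE_le (hδ : 0 < δ) (hδ1 : δ ≤ 1) (i : Fin 3) (x : V) :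
    |mE γ ε f δ i x| ≤ errC ε m * bracket x := by
  have hG := hf.growC_nonneg
  have hC := Cρ_nonneg
  have hb := bracket_pos x
  have hε' : 0 < ε⁻¹ := inv_pos.2 hε
  have t1 : |∫ v, f v * mK γ (fl ε f) δ i x v| ≤
      148 * growC ε⁻¹ m * Cρ * bracket x * ε⁻¹ * v₁ := by
    refine abs_integral_loc_le hδ (x := x) (fun v hv => ?_) (fun v hv => ?_)
    · rw [abs_mul, abs_of_nonneg (hf.nonneg v)]
      calc _ ≤ ε⁻¹ * (148 * growC ε⁻¹ m * Cρ * bracket x * δ⁻¹ ^ 3) :=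
            mul_le_mul (hf.le v) (abs_mK_le hf hε hγ hγ0 hδ hδ1 i x v hv) (abs_nonneg _) hε'.le
        _ = _ := by ring
    · rw [mK_eq_zero hδ _ i x v hv, mul_zero]
  have t2 : |cv (fun v => fl ε f v * Bv γ f i v) (mol δ) x| ≤
      4 * growC ε⁻¹ m * Cρ * bracket x * ε⁻¹ * v₁ := by
    refine abs_integral_loc_le hδ (x := x) (fun v hv => ?_) (fun v hv => ?_)
    · have hvx : ‖v - x‖ ≤ δ := by simpa [dist_eq_norm] using hv
      have hbv : bracket v ≤ 2 * bracket x := by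
        have := bracket_le_add v x; linarith [one_le_bracket x]
      rw [abs_mul, abs_mul, abs_of_nonneg (hf.fl_nonneg hε v)]
      calc _ ≤ ε⁻¹ * (2 * growC ε⁻¹ m * (2 * bracket x)) * (Cρ * δ⁻¹ ^ 3) := by
            refine mul_le_mul (mul_le_mul ((hf.fl hε).le v) ?_ (abs_nonneg _) hε'.le)
              (mol_le hδ _) (abs_nonneg _) (by positivity)
            exact (hf.abs_Bv_le hγ hγ0 i v).trans (by gcongr)
        _ = _ := by ring
    · rw [mol_eq_zero hδ hv, mul_zero]
  have t3 : |fl ε (mu f δ) x * Bv γ f i x| ≤ 2 * growC ε⁻¹ m * ε⁻¹ * bracket x := by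
    obtain ⟨h0, h1⟩ := mu_bounds hf hδ x
    have h2 : ε * mu f δ x ≤ 1 := by
      calc _ ≤ ε * ε⁻¹ := by gcongr
        _ = 1 := mul_inv_cancel₀ hε.ne'
    have h3 : 0 ≤ ε * mu f δ x := by positivity
    have h4 : |fl ε (mu f δ) x| ≤ ε⁻¹ := by
      unfold LFD.fl
      rw [abs_mul, abs_of_nonneg h0, abs_of_nonneg (by linarith)]
      exact (mul_le_of_le_one_right h0 (by linarith)).trans h1
    rw [abs_mul]
    calc _ ≤ ε⁻¹ * (2 * growC ε⁻¹ m * bracket x) :=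
          mul_le_mul h4 (hf.abs_Bv_le hγ hγ0 i x) (abs_nonneg _) hε'.le
      _ = _ := by ring
  unfold mE
  have a1 := abs_sub (∫ v, f v * mK γ (fl ε f) δ i x v)
    (cv (fun v => fl ε f v * Bv γ f i v) (mol δ) x - fl ε (mu f δ) x * Bv γ f i x)
  have a2 := abs_sub (cv (fun v => fl ε f v * Bv γ f i v) (mol δ) x)
    (fl ε (mu f δ) x * Bv γ f i x)
  have e : errC ε m * bracket x = 148 * growC ε⁻¹ m * Cρ * bracket x * ε⁻¹ * v₁ +
    4 * growC ε⁻¹ m * Cρ * bracket x * ε⁻¹ * v₁ + 2 * growC ε⁻¹ m * ε⁻¹ * bracket x := by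
    unfold errC; ring
  linarith

/-- The points are common Lebesgue points of `f` and of the products `f (1 - ε f) (b * f)_i`. No
regularity of `f` beyond boundedness and integrability is used. -/
lemma tendsto_mu_mE : ∀ᵐ x, Tendsto (fun n => mu f (ηs n) x) atTop (𝓝 (f x)) ∧
    ∀ i, Tendsto (fun n => mE γ ε f (ηs n) i x) atTop (𝓝 0) := by
  have hc : ∀ i, ∀ᵐ x, Tendsto (fun n => ⨍ v in Metric.closedBall x (ηs n),
      ‖fl ε f v * Bv γ f i v - fl ε f x * Bv γ f i x‖) atTop (𝓝 0) := fun i =>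
    tendsto_avg (locInt_c hf hε hγ hγ0 i)
  filter_upwards [tendsto_avg hf.locallyIntegrable, ae_all_iff.2 hc] with x hx hcx
  have hu := tendsto_cv_mol hf.locallyIntegrable hx
  refine ⟨hu, fun i => ?_⟩
  have l1 : Tendsto (fun n => ∫ v, f v * mK γ (fl ε f) (ηs n) i x v) atTop (𝓝 0) := by
    refine squeeze_zero_norm (fun n => ?_)
      (by simpa using hx.const_mul (148 * growC ε⁻¹ m * Cρ * bracket x * v₁))
    have hδ := ηs_pos n
    have hδ1 : ηs n ≤ 1 := by
      unfold ηs; rw [div_le_one (by positivity)]; linarith [(Nat.cast_nonneg n : (0 : ℝ) ≤ n)]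
    -- The mean-zero property of the kernel replaces `f v` by `f v - f x`, so that the mean
    -- oscillation controls the integral.
    have hmK : ∫ v, f v * mK γ (fl ε f) (ηs n) i x v =
        ∫ v, (f v - f x) * mK γ (fl ε f) (ηs n) i x v := by
      have I0 : Integrable (mK γ (fl ε f) (ηs n) i x) ∧
          Integrable (fun v => f v * mK γ (fl ε f) (ηs n) i x v) := by
        have hm : AEStronglyMeasurable (mK γ (fl ε f) (ηs n) i x) volume := by
          refine AEStronglyMeasurable.sub ?_ ?_
          · refine Continuous.aestronglyMeasurable (continuous_finsetSum _ fun j _ => ?_)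
            exact (((hf.fl hε).continuous_Sm hγ hγ0 i j).sub continuous_const).mul
              ((continuous_pd (contDiff_mol_one _) j).comp (continuous_const.sub continuous_id))
          · exact ((hf.fl hε).aesm_Bv i).mul ((contDiff_mol_one (ηs n)).continuous.comp
              (continuous_const.sub continuous_id)).aestronglyMeasurable
        have hb : ∀ v, ‖mK γ (fl ε f) (ηs n) i x v‖ ≤ (Metric.closedBall x (ηs n)).indicator
            (fun _ => 148 * growC ε⁻¹ m * Cρ * bracket x * (ηs n)⁻¹ ^ 3) v := fun v => by
          by_cases hv : v ∈ Metric.closedBall x (ηs n)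
          · rw [indicator_of_mem hv]; exact abs_mK_le hf hε hγ hγ0 hδ hδ1 i x v hv
          · rw [indicator_of_notMem hv, mK_eq_zero hδ _ i x v hv, norm_zero]
        have hi : Integrable (mK γ (fl ε f) (ηs n) i x) :=
          ((integrable_indicator_iff measurableSet_closedBall).2
            (integrableOn_const measure_closedBall_lt_top.ne)).mono' hm (ae_of_all _ hb)
        refine ⟨hi, ?_⟩
        refine hi.bdd_mul hf.meas (c := ε⁻¹) (ae_of_all _ fun v => ?_)
        rw [Real.norm_of_nonneg (hf.nonneg v)]; exact hf.le v
      simp only [sub_mul]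
      rw [integral_sub I0.2 (I0.1.const_mul _), integral_const_mul,
        integrable_mK_aux hf hε hγ hγ0 hδ, mul_zero, sub_zero]
    rw [hmK]
    exact abs_integral_loc_sub_le hδ hf.locallyIntegrable
      (abs_mK_le hf hε hγ hγ0 hδ hδ1 i x) (fun v hv => mK_eq_zero hδ _ i x v hv)
  have l2 := tendsto_cv_mol (locInt_c hf hε hγ hγ0 i) (hcx i)
  have l3 : Tendsto (fun n => fl ε (mu f (ηs n)) x * Bv γ f i x) atTop
      (𝓝 (fl ε f x * Bv γ f i x)) :=
    (hu.mul (tendsto_const_nhds.sub (hu.const_mul ε))).mul_const _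
  have h := l1.sub (l2.sub l3)
  simp only [sub_self] at h
  exact h

end
end
end LFD
end

noncomputable section
namespace LFD
open MeasureTheory Set Filter Topology

/-! ### Spatial energy inequality -/

/-- Pointwise algebra of testing with `p ζ² u ^ (p - 1)`. In the application `q = u ^ (p - 2)`, `d`
and `η` are the gradients of `u` and `ζ`, `S` is the diffusion matrix with lower bound `s`, `c` is
the drift and `E` the flux error. The drift is rewritten as `c · ∇(ζ² drG)` plus a cutoff term, and
half of the available coercivity is spent on `E`. -/
lemma flux_alg {p s ζ u q ε : ℝ} (hp : 2 ≤ p) (hs : 0 < s) (hζ : 0 ≤ ζ) (hζ1 : ζ ≤ 1) (hu : 0 ≤ u)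
    (hq : 0 ≤ q) (hε : 0 ≤ ε) (hεu : ε * u ≤ 1) (S : Fin 3 → Fin 3 → ℝ)
    (hS : ∀ i j, S i j = S j i) (hco : ∀ ξ : Fin 3 → ℝ, s * ∑ i, ξ i ^ 2 ≤ ∑ i, ∑ j, S i j * ξ i * ξ j)
    (η d E c : Fin 3 → ℝ) :
    p ^ 2 / 8 * s * ζ ^ 2 * q * ∑ i, d i ^ 2 - 4 * (u ^ 2 * q) * ∑ i, ∑ j, S i j * η i * η j
      - ∑ i, c i * (2 * ζ * η i * ((p - 1) * (u ^ 2 * q) - ε * p * (p - 1) / (p + 1) * (u ^ 3 * q))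
        + ζ ^ 2 * (p * (p - 1) * q * (u * (1 - ε * u)) * d i))
      - 4 * p * (u ^ 2 * q) * ∑ i, |η i| * |c i|
      - (2 * p * (u * q) * ∑ i, |η i| * |E i| + 2 * p ^ 2 / s * ζ ^ 2 * q * ∑ i, E i ^ 2)
    ≤ ∑ i, (p * (2 * ζ * η i * (u * q) + ζ ^ 2 * ((p - 1) * q * d i))) *
        (∑ j, S i j * d j - u * (1 - ε * u) * c i + E i) := by
  have hp1 : 0 < p - 1 := by linarith
  have hp0 : 0 < p := by linarith
  have hU : 0 ≤ u ^ 2 * q := by positivity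
  -- diffusion
  have hSd : p * (p - 1) / 2 * (ζ ^ 2 * q) * (∑ i, ∑ j, S i j * d i * d j)
      - 4 * (u ^ 2 * q) * (∑ i, ∑ j, S i j * η i * η j) ≤
      ∑ i, (p * (2 * ζ * η i * (u * q) + ζ ^ 2 * ((p - 1) * q * d i))) * ∑ j, S i j * d j := by
    -- Completing the square: nonnegativity of the form on this vector controls the mixed term in
    -- `d` and `η` by half of the diffusion and a term in `η` alone.
    have h1 := hco (fun i => (p - 1) * ζ * d i + 2 * u * η i)
    have h2 : 0 ≤ ∑ i, ∑ j, S i j * ((p - 1) * ζ * d i + 2 * u * η i) *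
        ((p - 1) * ζ * d j + 2 * u * η j) :=
      le_trans (mul_nonneg hs.le (Finset.sum_nonneg fun i _ => sq_nonneg _)) h1
    have h3 : 0 ≤ ∑ i, ∑ j, S i j * η i * η j :=
      le_trans (mul_nonneg hs.le (Finset.sum_nonneg fun i _ => sq_nonneg _)) (hco η)
    have h4 : 0 ≤ p * q / (2 * (p - 1)) := by positivity
    have h5 := mul_nonneg h4 h2
    have h6 : 2 * p / (p - 1) ≤ 4 := by rw [div_le_iff₀ hp1]; linarith
    have h7 := mul_le_mul_of_nonneg_right h6 (mul_nonneg hU h3)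
    have e : p * q / (2 * (p - 1)) * (∑ i, ∑ j, S i j * ((p - 1) * ζ * d i + 2 * u * η i) *
        ((p - 1) * ζ * d j + 2 * u * η j)) =
        (∑ i, (p * (2 * ζ * η i * (u * q) + ζ ^ 2 * ((p - 1) * q * d i))) * ∑ j, S i j * d j)
        - p * (p - 1) / 2 * (ζ ^ 2 * q) * (∑ i, ∑ j, S i j * d i * d j)
        + 2 * p / (p - 1) * (u ^ 2 * q * ∑ i, ∑ j, S i j * η i * η j) := by
      simp only [Fin.sum_univ_three, hS 1 0, hS 2 0, hS 2 1]
      field_simp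
      ring
    rw [e] at h5
    linarith
  have hdd : p ^ 2 / 4 * s * ζ ^ 2 * q * (∑ i, d i ^ 2) ≤
      p * (p - 1) / 2 * (ζ ^ 2 * q) * (∑ i, ∑ j, S i j * d i * d j) := by
    have h1 := mul_le_mul_of_nonneg_left (hco d)
      (show 0 ≤ p * (p - 1) / 2 * (ζ ^ 2 * q) by positivity)
    refine le_trans ?_ h1
    have h2 : 0 ≤ s * ζ ^ 2 * q * ∑ i, d i ^ 2 :=
      mul_nonneg (by positivity) (Finset.sum_nonneg fun i _ => sq_nonneg _)
    have h3 : p ^ 2 / 4 ≤ p * (p - 1) / 2 := by nlinarith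
    have := mul_le_mul_of_nonneg_right h3 h2
    linarith
  -- error
  have hE : ∀ i, -(p ^ 2 / 8 * s * ζ ^ 2 * q * d i ^ 2) - 2 * p * (u * q) * (|η i| * |E i|)
      - 2 * p ^ 2 / s * ζ ^ 2 * q * E i ^ 2 ≤
      (p * (2 * ζ * η i * (u * q) + ζ ^ 2 * ((p - 1) * q * d i))) * E i := fun i => by
    have h1 : -(|η i| * |E i|) ≤ ζ * (η i * E i) := by
      have h := neg_abs_le (ζ * (η i * E i))
      rw [abs_mul, abs_of_nonneg hζ, abs_mul] at h
      have : ζ * (|η i| * |E i|) ≤ 1 * (|η i| * |E i|) := by gcongr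
      linarith
    have h2 := mul_le_mul_of_nonneg_left h1 (show 0 ≤ 2 * p * (u * q) by positivity)
    have h3 : -(p ^ 2 / 8 * s * d i ^ 2) - 2 * p ^ 2 / s * E i ^ 2 ≤ p * (p - 1) * (d i * E i) := by
      have h4 : 0 ≤ (p ^ 2 / (8 * s)) * (s * d i + 4 * E i) ^ 2 := by positivity
      have h5 : 0 ≤ (p ^ 2 / (8 * s)) * (s * d i - 4 * E i) ^ 2 := by positivity
      have e4 : (p ^ 2 / (8 * s)) * (s * d i + 4 * E i) ^ 2 =
          p ^ 2 / 8 * s * d i ^ 2 + p ^ 2 * (d i * E i) + 2 * p ^ 2 / s * E i ^ 2 := by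
        field_simp; ring
      have e5 : (p ^ 2 / (8 * s)) * (s * d i - 4 * E i) ^ 2 =
          p ^ 2 / 8 * s * d i ^ 2 - p ^ 2 * (d i * E i) + 2 * p ^ 2 / s * E i ^ 2 := by
        field_simp; ring
      rw [e4] at h4; rw [e5] at h5
      -- The completed square carries `p ^ 2` where `p (p - 1)` is wanted. The replacement has the
      -- right sign when the product is nonpositive; otherwise the right-hand side is nonnegative
      -- and there is nothing to prove.
      rcases le_total 0 (d i * E i) with h | h
      · have := mul_nonneg (mul_pos hp0 hp1).le h
        have : 0 ≤ p ^ 2 / 8 * s * d i ^ 2 := by positivity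
        have : 0 ≤ 2 * p ^ 2 / s * E i ^ 2 := by positivity
        linarith
      · nlinarith [mul_nonneg hp0.le (neg_nonneg.2 h)]
    have h6 := mul_le_mul_of_nonneg_left h3 (show 0 ≤ ζ ^ 2 * q by positivity)
    linarith
  -- drift
  have hc : ∀ i, - (c i * (2 * ζ * η i *
        ((p - 1) * (u ^ 2 * q) - ε * p * (p - 1) / (p + 1) * (u ^ 3 * q))
        + ζ ^ 2 * (p * (p - 1) * q * (u * (1 - ε * u)) * d i))) - 4 * p * (u ^ 2 * q) * (|η i| * |c i|)
      ≤ (p * (2 * ζ * η i * (u * q) + ζ ^ 2 * ((p - 1) * q * d i))) * (-(u * (1 - ε * u) * c i)) :=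
    fun i => by
    have h1 : |ζ * (η i * c i)| ≤ |η i| * |c i| := by
      rw [abs_mul, abs_of_nonneg hζ, abs_mul]
      exact mul_le_of_le_one_left (by positivity) hζ1
    set θ := ε * p * (p - 1) / (p + 1) * u with hθ
    have h2 : 0 ≤ θ := by positivity
    have h3 : θ ≤ p - 1 := by
      have : θ = (ε * u) * (p / (p + 1)) * (p - 1) := by rw [hθ]; ring
      rw [this]
      have h4 : p / (p + 1) ≤ 1 := by rw [div_le_one (by linarith)]; linarith
      have h5 : ε * u * (p / (p + 1)) ≤ 1 * 1 := mul_le_mul hεu h4 (by positivity) zero_le_one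
      nlinarith
    -- The first coefficient comes from the derivative of `ζ²` in the test function, the second from
    -- the same derivative in `∇(ζ² drG)`. Both lie between `0` and `p`, so the mismatch is only a
    -- cutoff term.
    have h4 : |p * (1 - ε * u) - ((p - 1) - θ)| ≤ 2 * p := by
      have : 0 ≤ ε * u := by positivity
      rw [abs_le]; constructor <;> nlinarith
    have h5 : |(p * (1 - ε * u) - ((p - 1) - θ)) * (ζ * (η i * c i))| ≤
        2 * p * (|η i| * |c i|) := by
      rw [abs_mul]; exact mul_le_mul h4 h1 (abs_nonneg _) (by positivity)
    have h6 := mul_le_mul_of_nonneg_left ((le_abs_self _).trans h5)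
      (show 0 ≤ 2 * (u ^ 2 * q) by positivity)
    have e : 2 * (u ^ 2 * q) * ((p * (1 - ε * u) - ((p - 1) - θ)) * (ζ * (η i * c i))) =
      - (c i * (2 * ζ * η i *
        ((p - 1) * (u ^ 2 * q) - ε * p * (p - 1) / (p + 1) * (u ^ 3 * q))
        + ζ ^ 2 * (p * (p - 1) * q * (u * (1 - ε * u)) * d i)))
      - (p * (2 * ζ * η i * (u * q) + ζ ^ 2 * ((p - 1) * q * d i))) * (-(u * (1 - ε * u) * c i)) := by
      rw [hθ]; ring
    linarith
  have hE' := Finset.sum_le_sum fun i (_ : i ∈ Finset.univ) => hE i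
  have hc' := Finset.sum_le_sum fun i (_ : i ∈ Finset.univ) => hc i
  simp only [Finset.sum_sub_distrib, Finset.sum_neg_distrib, ← Finset.mul_sum] at hE' hc'
  have e : ∑ i, (p * (2 * ζ * η i * (u * q) + ζ ^ 2 * ((p - 1) * q * d i))) *
        (∑ j, S i j * d j - u * (1 - ε * u) * c i + E i) =
      ∑ i, (p * (2 * ζ * η i * (u * q) + ζ ^ 2 * ((p - 1) * q * d i))) * (∑ j, S i j * d j)
      + ∑ i, (p * (2 * ζ * η i * (u * q) + ζ ^ 2 * ((p - 1) * q * d i))) * (-(u * (1 - ε * u) * c i))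
      + ∑ i, (p * (2 * ζ * η i * (u * q) + ζ ^ 2 * ((p - 1) * q * d i))) * E i := by
    rw [← Finset.sum_add_distrib, ← Finset.sum_add_distrib]
    exact Finset.sum_congr rfl fun i _ => by ring
  rw [e]
  simp only [mul_neg, Finset.sum_neg_distrib] at hc' ⊢
  linarith

lemma pd_rpow {u : V → ℝ} {x : V} (hu : DifferentiableAt ℝ u x) {r : ℝ} (hr : 1 ≤ r) (i : Fin 3) :
    pd i (fun x => u x ^ r) x = r * u x ^ (r - 1) * pd i u x := by
  have h := hu.hasFDerivAt.rpow_const (p := r) (Or.inr hr)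
  rw [pd, h.fderiv]; simp [pd]

lemma integrable_of_bound_of_support {k : V → ℝ} (hk : AEStronglyMeasurable k volume) {C ρ : ℝ}
    (hb : ∀ x, |k x| ≤ C) (hz : ∀ x ∉ Metric.closedBall (0 : V) ρ, k x = 0) : Integrable k := by
  have h1 : Integrable ((Metric.closedBall (0 : V) ρ).indicator fun _ => C) :=
    (integrable_indicator_iff measurableSet_closedBall).2
      (integrableOn_const measure_closedBall_lt_top.ne)
  refine h1.mono' hk (ae_of_all _ fun x => ?_)
  by_cases hx : x ∈ Metric.closedBall (0 : V) ρ
  · rw [indicator_of_mem hx]; exact hb x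
  · rw [hz x hx, norm_zero, indicator_of_notMem hx]

/-- A smooth cutoff with gradient controlled on the bounded set `A`. -/
structure Cutoff (ζ : V → ℝ) (A : Set V) (ρ Λ : ℝ) : Prop where
  contDiff : ContDiff ℝ (⊤ : ℕ∞) ζ
  zero : ∀ x ∉ Metric.closedBall (0 : V) ρ, ζ x = 0
  nonneg : ∀ x, 0 ≤ ζ x
  le_one : ∀ x, ζ x ≤ 1
  meas : MeasurableSet A
  sub : A ⊆ Metric.closedBall 0 ρ
  const_nonneg : 0 ≤ Λ
  grad : ∀ i x, |pd i ζ x| * bracket x ≤ A.indicator (fun _ => Λ) x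

namespace Cutoff
variable {ζ : V → ℝ} {A : Set V} {ρ Λ : ℝ} (hζ : Cutoff ζ A ρ Λ)
include hζ

lemma hasCompactSupport : HasCompactSupport ζ :=
  HasCompactSupport.intro (isCompact_closedBall 0 ρ) hζ.zero

lemma contDiff_one : ContDiff ℝ 1 ζ := hζ.contDiff.of_le (by exact_mod_cast le_top)

lemma abs_pd_le (i : Fin 3) (x : V) : |pd i ζ x| ≤ A.indicator (fun _ => Λ) x :=
  (le_mul_of_one_le_right (abs_nonneg _) (one_le_bracket x)).trans (hζ.grad i x)

end Cutoff

/-- The divergence of the mollified flux. -/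
def mL (γ ε : ℝ) (f : V → ℝ) (δ : ℝ) (x : V) : ℝ := ∑ i, pd i (mJ γ ε f δ i) x

/-- The error density in the energy inequality. -/
def errD (γ ε p K Λ : ℝ) (A : Set V) (ζ f : V → ℝ) (δ : ℝ) (x : V) : ℝ :=
  2 * p * mu f δ x ^ (p - 1) * ∑ i, A.indicator (fun _ => Λ) x * |mE γ ε f δ i x|
    + 2 * p ^ 2 / K * bracket x ^ (-γ) * ζ x ^ 2 * mu f δ x ^ (p - 2) * ∑ i, mE γ ε f δ i x ^ 2

/-- The constant of the cutoff error. -/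
def cutC (p K Λ M m : ℝ) : ℝ := 360 * m * Λ ^ 2 + 24 * p * growC M m * Λ + 3 / 2 * K * Λ ^ 2

section
variable {γ ε m δ p K Λ ρ : ℝ} {f ζ : V → ℝ} {A : Set V}

lemma integral_mul_mL (hf : Adm ε⁻¹ m f) (hε : 0 < ε) (hγ : -2 < γ) (hγ0 : γ < 0) (hδ : 0 < δ)
    {Φ : V → ℝ} (h1 : ContDiff ℝ 1 Φ) (h2 : HasCompactSupport Φ) :
    ∫ x, Φ x * mL γ ε f δ x = -∫ x, ∑ i, pd i Φ x * mJ γ ε f δ i x := by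
  have hJ : ∀ i, ContDiff ℝ 1 (mJ γ ε f δ i) := fun i =>
    (contDiff_mJ hf hε hγ hγ0 hδ i).of_le (by exact_mod_cast le_top)
  have e : ∀ i, ∫ x, (Φ x * pd i (mJ γ ε f δ i) x + pd i Φ x * mJ γ ε f δ i x) = 0 := fun i => by
    rw [← integral_pd_eq_zero (h1.mul (hJ i)) h2.mul_right i]
    congr 1; ext x
    rw [pd_mul i (h1.differentiable one_ne_zero x) ((hJ i).differentiable one_ne_zero x)]
  have I1 : ∀ i, Integrable fun x => Φ x * pd i (mJ γ ε f δ i) x := fun i =>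
    (h1.continuous.mul (continuous_pd (hJ i) i)).integrable_of_hasCompactSupport h2.mul_right
  have I2 : ∀ i, Integrable fun x => pd i Φ x * mJ γ ε f δ i x := fun i =>
    ((continuous_pd h1 i).mul (hJ i).continuous).integrable_of_hasCompactSupport
      (hasCompactSupport_pd h2 i).mul_right
  unfold mL
  simp only [Finset.mul_sum]
  rw [integral_finsetSum _ fun i _ => I1 i, integral_finsetSum _ fun i _ => I2 i,
    ← Finset.sum_neg_distrib]
  refine Finset.sum_congr rfl fun i _ => ?_
  have := e i
  rw [integral_add (I1 i) (I2 i)] at this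
  linarith

/-- The antiderivative occurring in the drift term. -/
def drG (p ε u : ℝ) : ℝ := (p - 1) * u ^ p - ε * p * (p - 1) / (p + 1) * u ^ (p + 1)

lemma rpow_identities {p u : ℝ} (hp : 2 ≤ p) (hu : 0 ≤ u) :
    u ^ (p - 1) = u * u ^ (p - 2) ∧ u ^ p = u ^ 2 * u ^ (p - 2) ∧
      u ^ (p + 1) = u ^ 3 * u ^ (p - 2) ∧ (u ^ (p / 2 - 1)) ^ 2 = u ^ (p - 2) ∧
      (u ^ (p / 2)) ^ 2 = u ^ p := by
  have h1 : u ^ (p - 1) = u * u ^ (p - 2) := by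
    rw [mul_comm, ← Real.rpow_add_one' hu (by linarith)]; congr 1; ring
  have h2 : u ^ p = u ^ 2 * u ^ (p - 2) := by
    have : u ^ p = u ^ (p - 1) * u := by
      rw [← Real.rpow_add_one' hu (by linarith)]; congr 1; ring
    rw [this, h1]; ring
  refine ⟨h1, h2, ?_, ?_, ?_⟩
  · rw [Real.rpow_add_one' hu (by linarith), h2]; ring
  · rw [← Real.rpow_natCast, ← Real.rpow_mul hu]; congr 1; push_cast; ring
  · rw [← Real.rpow_natCast, ← Real.rpow_mul hu]; congr 1; push_cast; ring

lemma pd_cutoff_mul {ζ g : V → ℝ} (h1 : ContDiff ℝ 1 ζ) (h2 : ContDiff ℝ 1 g) (i : Fin 3) (x : V) :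
    pd i (fun x => ζ x ^ 2 * g x) x = 2 * ζ x * pd i ζ x * g x + ζ x ^ 2 * pd i g x := by
  have hd := h1.differentiable one_ne_zero x
  rw [pd_mul (f := fun x => ζ x ^ 2) i (hd.pow 2) (h2.differentiable one_ne_zero x)]
  have : pd i (fun x => ζ x ^ 2) x = 2 * ζ x * pd i ζ x := by
    have e : (fun x => ζ x ^ 2) = fun x => ζ x * ζ x := by ext; ring
    rw [e, pd_mul i hd hd]; ring
  rw [this]; ring

lemma contDiff_rpow {u : V → ℝ} (hu : ContDiff ℝ 1 u) {r : ℝ} (hr : 1 ≤ r) :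
    ContDiff ℝ 1 fun x => u x ^ r :=
  hu.rpow_const_of_le (m := 1) (by simpa using hr)

/-- The derivative of `drG` reproduces the nonlinear factor of the drift, so the tested drift is an
exact gradient and can be integrated by parts. -/
lemma pd_drG {u : V → ℝ} (hu : ContDiff ℝ 1 u) (h0 : ∀ x, 0 ≤ u x) (hp : 2 ≤ p) (i : Fin 3) (x : V) :
    ContDiff ℝ 1 (fun x => drG p ε (u x)) ∧ pd i (fun x => drG p ε (u x)) x =
      p * (p - 1) * u x ^ (p - 2) * (u x * (1 - ε * u x)) * pd i u x := by
  have c1 := contDiff_rpow hu (r := p) (by linarith)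
  have c2 := contDiff_rpow hu (r := p + 1) (by linarith)
  have d := hu.differentiable one_ne_zero x
  refine ⟨(contDiff_const.mul c1).sub (contDiff_const.mul c2), ?_⟩
  have h1 := d.hasFDerivAt.rpow_const (p := p) (Or.inr (by linarith))
  have h2 := d.hasFDerivAt.rpow_const (p := p + 1) (Or.inr (by linarith))
  have h3 := (h1.const_mul (p - 1)).sub (h2.const_mul (ε * p * (p - 1) / (p + 1)))
  have h4 := congrArg (fun L => L (EuclideanSpace.single i 1)) h3.fderiv
  change pd i (fun x => drG p ε (u x)) x = _ at h4
  rw [h4]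
  obtain ⟨e1, e2, -⟩ := rpow_identities hp (h0 x)
  simp only [FunLike.coe_sub, FunLike.coe_smul, Pi.sub_apply, Pi.smul_apply, smul_eq_mul, pd,
    add_sub_cancel_right, e1, e2]
  have : p + 1 ≠ 0 := by linarith
  field_simp
end
end LFD
end

/-! ### The pointwise energy inequality for the mollified density. -/

noncomputable section
namespace LFD
open MeasureTheory Set Filter Topology

section
variable {γ ε m δ p K Λ ρ : ℝ} {f ζ : V → ℝ} {A : Set V}

lemma bracket_rpow_le_one (hγ0 : γ < 0) (x : V) : bracket x ^ γ ≤ 1 :=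
  Real.rpow_le_one_of_one_le_of_nonpos (one_le_bracket x) hγ0.le

lemma abs_half_le_one (hγ : -2 < γ) (hγ0 : γ < 0) : |γ / 2| ≤ 1 := by
  rw [abs_le]; constructor <;> linarith

lemma sq_three_le (a b c : ℝ) : (a + b + c) ^ 2 ≤ 3 * (a ^ 2 + b ^ 2 + c ^ 2) := by
  nlinarith [sq_nonneg (a - b), sq_nonneg (b - c), sq_nonneg (a - c)]

/-- The gradient of the weighted function entering the Sobolev inequality. -/
lemma sum_sq_pd_weighted_le (hγ : -2 < γ) (hγ0 : γ < 0) (hp : 2 ≤ p) (hζ : Cutoff ζ A ρ Λ)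
    {u : V → ℝ} (hu : ContDiff ℝ 1 u) (hu0 : ∀ x, 0 ≤ u x) (x : V) :
    ∑ i, pd i (fun x => bracket x ^ (γ / 2) * (ζ x * u x ^ (p / 2))) x ^ 2 ≤
      3 * (bracket x ^ γ * (p ^ 2 / 4) * ζ x ^ 2 * u x ^ (p - 2) * ∑ i, pd i u x ^ 2)
        + 9 * Λ ^ 2 * (A.indicator 1 x * u x ^ p) + 9 * (bracket x ^ γ * (ζ x ^ 2 * u x ^ p)) := by
  obtain ⟨-, -, -, e4, e5⟩ := rpow_identities hp (hu0 x)
  have hd := hu.differentiable one_ne_zero x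
  have hw := contDiff_rpow hu (r := p / 2) (by linarith)
  have hb : ContDiff ℝ 1 fun x : V => bracket x ^ (γ / 2) := contDiff_bracket_rpow _
  have hi : ∀ i, pd i (fun x => bracket x ^ (γ / 2) * (ζ x * u x ^ (p / 2))) x ^ 2 ≤
      3 * (bracket x ^ γ * (p ^ 2 / 4) * ζ x ^ 2 * u x ^ (p - 2) * pd i u x ^ 2)
        + 3 * Λ ^ 2 * (A.indicator 1 x * u x ^ p) + 3 * (bracket x ^ γ * (ζ x ^ 2 * u x ^ p)) := by
    intro i
    rw [pd_mul (f := fun x => bracket x ^ (γ / 2)) i (hb.differentiable one_ne_zero x)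
      ((hζ.contDiff_one.mul hw).differentiable one_ne_zero x),
      pd_mul (g := fun x => u x ^ (p / 2)) i (hζ.contDiff_one.differentiable one_ne_zero x)
      (hw.differentiable one_ne_zero x), pd_rpow hd (by linarith)]
    have h1 := sq_three_le (bracket x ^ (γ / 2) * (ζ x * (p / 2 * u x ^ (p / 2 - 1) * pd i u x)))
      (bracket x ^ (γ / 2) * (pd i ζ x * u x ^ (p / 2)))
      (pd i (fun x => bracket x ^ (γ / 2)) x * (ζ x * u x ^ (p / 2)))
    rw [bracket_half_sq, bracket_half_sq] at h1
    have t1 : (ζ x * (p / 2 * u x ^ (p / 2 - 1) * pd i u x)) ^ 2 =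
        (p ^ 2 / 4) * ζ x ^ 2 * u x ^ (p - 2) * pd i u x ^ 2 := by rw [← e4]; ring
    have hup : 0 ≤ u x ^ p := Real.rpow_nonneg (hu0 x) _
    have t2 : bracket x ^ γ * (pd i ζ x * u x ^ (p / 2)) ^ 2 ≤ Λ ^ 2 * (A.indicator 1 x * u x ^ p) := by
      rw [mul_pow, e5]
      have h2 : pd i ζ x ^ 2 ≤ Λ ^ 2 * A.indicator 1 x := by
        have h := hζ.abs_pd_le i x
        rw [← sq_abs]
        by_cases hx : x ∈ A
        · rw [indicator_of_mem hx] at h ⊢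
          simp only [Pi.one_apply, mul_one]; gcongr
        · rw [indicator_of_notMem hx] at h ⊢
          rw [abs_nonpos_iff.1 h]; simp
      have h3 : bracket x ^ γ * (pd i ζ x ^ 2 * u x ^ p) ≤ 1 * (pd i ζ x ^ 2 * u x ^ p) := by
        gcongr; exact bracket_rpow_le_one hγ0 x
      have := mul_le_mul_of_nonneg_right h2 hup
      linarith
    have t3 : (pd i (fun x => bracket x ^ (γ / 2)) x * (ζ x * u x ^ (p / 2))) ^ 2 ≤
        bracket x ^ γ * (ζ x ^ 2 * u x ^ p) := by
      have h2 : |pd i (fun x : V => bracket x ^ (γ / 2)) x| ≤ bracket x ^ (γ / 2) :=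
        (abs_pd_bracket_rpow _ i x).trans (mul_le_of_le_one_left
          (Real.rpow_nonneg (bracket_pos x).le _) (abs_half_le_one hγ hγ0))
      have h3 : (pd i (fun x => bracket x ^ (γ / 2)) x * (ζ x * u x ^ (p / 2))) ^ 2 ≤
          (bracket x ^ (γ / 2) * (ζ x * u x ^ (p / 2))) ^ 2 := by
        rw [mul_pow, mul_pow (bracket x ^ (γ / 2)), ← sq_abs (pd i _ x)]; gcongr
      rw [bracket_half_sq, mul_pow (ζ x) (u x ^ (p / 2)), e5] at h3
      exact h3
    rw [t1] at h1
    calc _ = (bracket x ^ (γ / 2) * (ζ x * (p / 2 * u x ^ (p / 2 - 1) * pd i u x)) +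
      bracket x ^ (γ / 2) * (pd i ζ x * u x ^ (p / 2)) +
      pd i (fun x => bracket x ^ (γ / 2)) x * (ζ x * u x ^ (p / 2))) ^ 2 := by ring
      _ ≤ _ := h1
      _ ≤ _ := by linarith
  refine (Finset.sum_le_sum fun i _ => hi i).trans (le_of_eq ?_)
  simp only [Fin.sum_univ_three]; ring

/-- The factor `K / 6` is chosen so that `(K / 6) · 3 · p ^ 2 / 4` equals the coefficient `K p ^ 2 /
8` left over by `flux_alg`; thus the diffusion controls the gradient of the very function to which
the Sobolev inequality is applied. -/
lemma energy_pointwise (hf : Adm ε⁻¹ m f) (hε : 0 < ε) (hγ : -2 < γ) (hγ0 : γ < 0) (hδ : 0 < δ)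
    (hp : 2 ≤ p) (hK : 0 < K)
    (hco : ∀ x ξ : V, K * bracket x ^ γ * ‖ξ‖ ^ 2 ≤ ∑ i, ∑ j, Sm γ (fl ε f) i j x * ξ i * ξ j)
    (hζ : Cutoff ζ A ρ Λ) (x : V) :
    K / 6 * ∑ i, pd i (fun x => bracket x ^ (γ / 2) * (ζ x * mu f δ x ^ (p / 2))) x ^ 2
      - 3 / 2 * K * (bracket x ^ γ * (ζ x ^ 2 * mu f δ x ^ p))
      - cutC p K Λ ε⁻¹ m * (A.indicator 1 x * mu f δ x ^ p)
      - ∑ i, Bv γ f i x * pd i (fun x => ζ x ^ 2 * drG p ε (mu f δ x)) x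
      - errD γ ε p K Λ A ζ f δ x
    ≤ ∑ i, pd i (fun x => p * (ζ x ^ 2 * mu f δ x ^ (p - 1))) x * mJ γ ε f δ i x := by
  have hu : ContDiff ℝ 1 (mu f δ) := (contDiff_mu hf hδ).of_le (by exact_mod_cast le_top)
  have hu0 : ∀ x, 0 ≤ mu f δ x := fun x => (mu_bounds hf hδ x).1
  have hux := hu0 x
  have hεu : ε * mu f δ x ≤ 1 := by
    calc _ ≤ ε * ε⁻¹ := by gcongr; exact (mu_bounds hf hδ x).2
      _ = 1 := mul_inv_cancel₀ hε.ne'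
  have hs : 0 < K * bracket x ^ γ := mul_pos hK (Real.rpow_pos_of_pos (bracket_pos x) _)
  obtain ⟨e1, e2, e3, -, -⟩ := rpow_identities hp hux
  have halg := flux_alg (p := p) (s := K * bracket x ^ γ) (ζ := ζ x) (u := mu f δ x)
    (q := mu f δ x ^ (p - 2)) (ε := ε) hp hs (hζ.nonneg x) (hζ.le_one x) hux
    (Real.rpow_nonneg hux _) hε.le hεu (fun i j => Sm γ (fl ε f) i j x)
    (fun i j => Sm_symm i j x)
    (fun ξ => by
      have := hco x (WithLp.toLp 2 ξ)
      rw [EuclideanSpace.norm_sq_eq] at this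
      simpa [sq_abs] using this)
    (fun i => pd i ζ x) (fun i => pd i (mu f δ) x) (fun i => mE γ ε f δ i x) (fun i => Bv γ f i x)
  have hgrad := sum_sq_pd_weighted_le hγ hγ0 hp hζ hu hu0 x
  have hΦ : ∀ i, pd i (fun x => p * (ζ x ^ 2 * mu f δ x ^ (p - 1))) x =
      p * (2 * ζ x * pd i ζ x * (mu f δ x * mu f δ x ^ (p - 2)) +
        ζ x ^ 2 * ((p - 1) * mu f δ x ^ (p - 2) * pd i (mu f δ) x)) := fun i => by
    have c1 := contDiff_rpow hu (r := p - 1) (by linarith)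
    rw [pd_mul (f := fun _ => p) i (differentiableAt_const _)
      (((hζ.contDiff_one.pow 2).mul c1).differentiable one_ne_zero x),
      pd_cutoff_mul hζ.contDiff_one c1, pd_rpow (hu.differentiable one_ne_zero x) (by linarith), e1,
      show p - 1 - 1 = p - 2 by ring]
    simp [pd]
  have hG : ∀ i, pd i (fun x => ζ x ^ 2 * drG p ε (mu f δ x)) x =
      2 * ζ x * pd i ζ x * ((p - 1) * (mu f δ x ^ 2 * mu f δ x ^ (p - 2)) -
        ε * p * (p - 1) / (p + 1) * (mu f δ x ^ 3 * mu f δ x ^ (p - 2))) +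
      ζ x ^ 2 * (p * (p - 1) * mu f δ x ^ (p - 2) * (mu f δ x * (1 - ε * mu f δ x)) *
        pd i (mu f δ) x) := fun i => by
    obtain ⟨c, hc⟩ := pd_drG (ε := ε) hu hu0 hp i x
    rw [pd_cutoff_mul hζ.contDiff_one c, hc, drG, e2, e3]
  have hJ : ∀ i, mJ γ ε f δ i x = ∑ j, Sm γ (fl ε f) i j x * pd j (mu f δ) x
      - mu f δ x * (1 - ε * mu f δ x) * Bv γ f i x + mE γ ε f δ i x := fun i =>
    mJ_eq hf hε hγ hγ0 hδ i x
  simp only [hΦ, hG, hJ]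
  refine le_trans ?_ halg
  have hup : 0 ≤ mu f δ x ^ p := Real.rpow_nonneg hux _
  rw [← e2]
  have hbp := bracket_pos x
  -- cutoff terms
  have hc1 : 4 * mu f δ x ^ p * ∑ i, ∑ j, Sm γ (fl ε f) i j x * pd i ζ x * pd j ζ x ≤
      360 * m * Λ ^ 2 * (A.indicator 1 x * mu f δ x ^ p) := by
    have h1 : ∀ i j, Sm γ (fl ε f) i j x * pd i ζ x * pd j ζ x ≤ 10 * m * Λ ^ 2 * A.indicator 1 x :=
      fun i j => by
      have hS := (hf.fl hε).abs_Sm_le hγ hγ0 i j x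
      have gi := hζ.grad i x
      have gj := hζ.grad j x
      refine (le_abs_self _).trans ?_
      rw [abs_mul, abs_mul]
      have hm := hf.m_nonneg
      by_cases hx : x ∈ A
      · rw [indicator_of_mem hx] at gi gj ⊢
        calc |Sm γ (fl ε f) i j x| * |pd i ζ x| * |pd j ζ x|
            ≤ 10 * m * bracket x ^ 2 * |pd i ζ x| * |pd j ζ x| := by gcongr
          _ = 10 * m * ((|pd i ζ x| * bracket x) * (|pd j ζ x| * bracket x)) := by ring
          _ ≤ 10 * m * (Λ * Λ) := by gcongr; exact hζ.const_nonneg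
          _ = _ := by rw [Pi.one_apply]; ring
      · have := hζ.abs_pd_le i x
        rw [indicator_of_notMem hx] at this ⊢
        rw [le_antisymm this (abs_nonneg _)]; simp
    have h2 := Finset.sum_le_sum fun i (_ : i ∈ Finset.univ) =>
      Finset.sum_le_sum fun j (_ : j ∈ Finset.univ) => h1 i j
    have h3 := mul_le_mul_of_nonneg_left h2 (show 0 ≤ 4 * mu f δ x ^ p by positivity)
    refine h3.trans (le_of_eq ?_)
    simp only [Finset.sum_const, Finset.card_univ, Fintype.card_fin, nsmul_eq_mul]
    push_cast; ring
  have hc2 : 4 * p * mu f δ x ^ p * ∑ i, |pd i ζ x| * |Bv γ f i x| ≤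
      24 * p * growC ε⁻¹ m * Λ * (A.indicator 1 x * mu f δ x ^ p) := by
    have h1 : ∀ i, |pd i ζ x| * |Bv γ f i x| ≤ 2 * growC ε⁻¹ m * Λ * A.indicator 1 x := fun i => by
      have hB := hf.abs_Bv_le hγ hγ0 i x
      have hg := hf.growC_nonneg
      have gi := hζ.grad i x
      calc |pd i ζ x| * |Bv γ f i x| ≤ |pd i ζ x| * (2 * growC ε⁻¹ m * bracket x) := by gcongr
        _ = 2 * growC ε⁻¹ m * (|pd i ζ x| * bracket x) := by ring
        _ ≤ 2 * growC ε⁻¹ m * A.indicator (fun _ => Λ) x := by gcongr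
        _ = _ := by
          by_cases hx : x ∈ A
          · simp [indicator_of_mem hx]
          · simp [indicator_of_notMem hx]
    have h2 := Finset.sum_le_sum fun i (_ : i ∈ Finset.univ) => h1 i
    have h3 := mul_le_mul_of_nonneg_left h2 (show 0 ≤ 4 * p * mu f δ x ^ p by positivity)
    refine h3.trans (le_of_eq ?_)
    simp only [Finset.sum_const, Finset.card_univ, Fintype.card_fin, nsmul_eq_mul]
    push_cast; ring
  -- error terms
  have herr : 2 * p * (mu f δ x * mu f δ x ^ (p - 2)) * ∑ i, |pd i ζ x| * |mE γ ε f δ i x|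
      + 2 * p ^ 2 / (K * bracket x ^ γ) * ζ x ^ 2 * mu f δ x ^ (p - 2) * ∑ i, mE γ ε f δ i x ^ 2
      ≤ errD γ ε p K Λ A ζ f δ x := by
    unfold errD
    rw [← e1]
    refine add_le_add ?_ (le_of_eq ?_)
    · have : 0 ≤ mu f δ x ^ (p - 1) := Real.rpow_nonneg hux _
      gcongr with i
      exact hζ.abs_pd_le i x
    · rw [Real.rpow_neg hbp.le]; field_simp
  unfold cutC
  have hg := mul_le_mul_of_nonneg_left hgrad (show 0 ≤ K / 6 by positivity)
  nlinarith [hg, hc1, hc2, herr]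
end
end LFD
end

/-! ### The localised energy inequality at a fixed time, and its limit as the mollification is
removed. -/

noncomputable section
namespace LFD
open MeasureTheory Set Filter Topology

lemma tendsto_integral_of_bound_of_support {F : ℕ → V → ℝ} {G : V → ℝ} {C ρ : ℝ}
    (hm : ∀ n, AEStronglyMeasurable (F n) volume) (hb : ∀ n x, |F n x| ≤ C)
    (hz : ∀ n, ∀ x ∉ Metric.closedBall (0 : V) ρ, F n x = 0)
    (hl : ∀ᵐ x, Tendsto (fun n => F n x) atTop (𝓝 (G x))) :
    Tendsto (fun n => ∫ x, F n x) atTop (𝓝 (∫ x, G x)) := by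
  refine tendsto_integral_of_dominated_convergence
    ((Metric.closedBall (0 : V) ρ).indicator fun _ => C) hm
    ((integrable_indicator_iff measurableSet_closedBall).2
      (integrableOn_const measure_closedBall_lt_top.ne)) (fun n => ae_of_all _ fun x => ?_) hl
  by_cases hx : x ∈ Metric.closedBall (0 : V) ρ
  · rw [indicator_of_mem hx]; exact hb n x
  · rw [hz n x hx, norm_zero, indicator_of_notMem hx]

lemma integral_le_of_bound_of_support {k : V → ℝ} (hk : AEStronglyMeasurable k volume) {C ρ : ℝ}
    (hb : ∀ x, |k x| ≤ C) (hz : ∀ x ∉ Metric.closedBall (0 : V) ρ, k x = 0) :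
    ∫ x, k x ≤ C * (volume : Measure V).real (Metric.closedBall 0 ρ) := by
  have h1 : Integrable ((Metric.closedBall (0 : V) ρ).indicator fun _ => C) :=
    (integrable_indicator_iff measurableSet_closedBall).2
      (integrableOn_const measure_closedBall_lt_top.ne)
  have h2 := integral_mono (integrable_of_bound_of_support hk hb hz) h1 fun x => by
    by_cases hx : x ∈ Metric.closedBall (0 : V) ρ
    · rw [indicator_of_mem hx]; exact (le_abs_self _).trans (hb x)
    · rw [hz x hx, indicator_of_notMem hx]
  rw [integral_indicator measurableSet_closedBall, setIntegral_const, smul_eq_mul] at h2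
  linarith

lemma abs_indicator_one_le (A : Set V) (x : V) : |A.indicator (1 : V → ℝ) x| ≤ 1 := by
  by_cases hx : x ∈ A
  · simp [indicator_of_mem hx]
  · simp [indicator_of_notMem hx]

lemma integral_sub_four_le {a b c d e F : V → ℝ} (ha : Integrable a) (hb : Integrable b)
    (hc : Integrable c) (hd : Integrable d) (he : Integrable e) (hF : Integrable F)
    (h : ∀ x, a x - b x - c x - d x - e x ≤ F x) :
    (∫ x, a x) - (∫ x, b x) - (∫ x, c x) - (∫ x, d x) - (∫ x, e x) ≤ ∫ x, F x := by
  rw [← integral_sub' ha hb, ← integral_sub' (ha.sub hb) hc,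
    ← integral_sub' ((ha.sub hb).sub hc) hd, ← integral_sub' (((ha.sub hb).sub hc).sub hd) he]
  exact integral_mono ((((ha.sub hb).sub hc).sub hd).sub he) hF h

/-- The right-hand side of the localised energy inequality. -/
def enH (γ p k₁ k₂ k₃ : ℝ) (A : Set V) (ζ u : V → ℝ) : ℝ :=
  -k₁ * wL6 γ (fun x => ζ x * u x ^ (p / 2)) + k₂ * (∫ x, bracket x ^ γ * (ζ x ^ 2 * u x ^ p))
    + k₃ * ∫ x, A.indicator 1 x * u x ^ p

section
variable {γ ε m δ p K Λ ρ : ℝ} {f ζ : V → ℝ} {A : Set V}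

section
variable (hf : Adm ε⁻¹ m f) (hε : 0 < ε) (hγ : -2 < γ) (hγ0 : γ < 0)
include hf hε hγ hγ0

lemma errC_nonneg : 0 ≤ errC ε m := by
  have := (abs_nonneg _).trans (abs_mE_le hf hε hγ hγ0 one_pos le_rfl 0 0)
  exact nonneg_of_mul_nonneg_left this (bracket_pos 0)

/-- Read off from the flux identity, where every other term is visibly measurable; the commutator
kernel need not be examined in both variables. -/
lemma aesm_mE (hδ : 0 < δ) (i : Fin 3) : AEStronglyMeasurable (mE γ ε f δ i) volume := by
  have e : mE γ ε f δ i = fun x => mJ γ ε f δ i x - (∑ j, Sm γ (fl ε f) i j x * pd j (mu f δ) x)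
      + fl ε (mu f δ) x * Bv γ f i x := by
    ext x; rw [mJ_eq hf hε hγ hγ0 hδ i x]; ring
  have hu : ContDiff ℝ 1 (mu f δ) := (contDiff_mu hf hδ).of_le (by exact_mod_cast le_top)
  rw [e]
  have c1 : Continuous fun x => ∑ j, Sm γ (fl ε f) i j x * pd j (mu f δ) x :=
    continuous_finsetSum _ fun j _ => ((hf.fl hε).continuous_Sm hγ hγ0 i j).mul (continuous_pd hu j)
  have c2 : Continuous (fl ε (mu f δ)) :=
    hu.continuous.mul (continuous_const.sub (continuous_const.mul hu.continuous))
  exact (((contDiff_mJ hf hε hγ hγ0 hδ i).continuous.sub c1).aestronglyMeasurable).add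
    (c2.aestronglyMeasurable.mul (hf.aesm_Bv i))

end

/-- A uniform bound for the error density. -/
def errB (γ ε m p K Λ ρ : ℝ) : ℝ :=
  2 * p * ε⁻¹ ^ (p - 1) * (3 * (Λ * (errC ε m * (1 + ρ))))
    + 2 * p ^ 2 / K * (1 + ρ) ^ (-γ) * 1 * ε⁻¹ ^ (p - 2) * (3 * (errC ε m * (1 + ρ)) ^ 2)

lemma errD_eq_zero (hζ : Cutoff ζ A ρ Λ) {x : V} (hx : x ∉ Metric.closedBall (0 : V) ρ) :
    errD γ ε p K Λ A ζ f δ x = 0 := by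
  have h1 : x ∉ A := fun h => hx (hζ.sub h)
  simp [errD, hζ.zero x hx, indicator_of_notMem h1]

section
variable (hf : Adm ε⁻¹ m f) (hε : 0 < ε) (hγ : -2 < γ) (hγ0 : γ < 0) (hp : 2 ≤ p)
  (hK : 0 < K) (hζ : Cutoff ζ A ρ Λ)
include hf hε hγ hγ0 hp hK hζ

omit hK in
lemma aesm_errD (hδ : 0 < δ) :
    AEStronglyMeasurable (errD γ ε p K Λ A ζ f δ) volume := by
  have hu : ContDiff ℝ 1 (mu f δ) := (contDiff_mu hf hδ).of_le (by exact_mod_cast le_top)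
  have hE := fun i => aesm_mE hf hε hγ hγ0 hδ i
  have hi : AEStronglyMeasurable (A.indicator fun _ => Λ) (volume : Measure V) :=
    aestronglyMeasurable_const.indicator hζ.meas
  have s1 : AEStronglyMeasurable (fun x => ∑ i, A.indicator (fun _ => Λ) x * |mE γ ε f δ i x|)
      (volume : Measure V) :=
    Finset.aestronglyMeasurable_fun_sum _ fun i _ => hi.mul (hE i).norm
  have s2 : AEStronglyMeasurable (fun x => ∑ i, mE γ ε f δ i x ^ 2) (volume : Measure V) :=
    Finset.aestronglyMeasurable_fun_sum _ fun i _ => (hE i).pow 2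
  have c1 : Continuous fun x => 2 * p * mu f δ x ^ (p - 1) :=
    continuous_const.mul (hu.continuous.rpow_const fun x => Or.inr (by linarith))
  have c2 : Continuous fun x => 2 * p ^ 2 / K * bracket x ^ (-γ) * ζ x ^ 2 * mu f δ x ^ (p - 2) :=
    ((continuous_const.mul (contDiff_bracket_rpow (-γ) (n := 0)).continuous).mul
      (hζ.contDiff_one.continuous.pow 2)).mul
      (hu.continuous.rpow_const fun x => Or.inr (by linarith))
  exact (c1.aestronglyMeasurable.mul s1).add (c2.aestronglyMeasurable.mul s2)

lemma abs_errD_le (hδ : 0 < δ) (hδ1 : δ ≤ 1) (x : V) (hρ : 0 ≤ ρ) :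
    |errD γ ε p K Λ A ζ f δ x| ≤ errB γ ε m p K Λ ρ := by
  have hC := errC_nonneg hf hε hγ hγ0
  have hΛ := hζ.const_nonneg
  have hεi : 0 < ε⁻¹ := inv_pos.2 hε
  have hp1 : 0 ≤ p := by linarith
  have hB : 0 ≤ errB γ ε m p K Λ ρ := by unfold errB; positivity
  by_cases hx : x ∈ Metric.closedBall (0 : V) ρ
  swap
  · rw [errD_eq_zero hζ hx, abs_zero]; exact hB
  have hbx : bracket x ≤ 1 + ρ := (bracket_le_one_add_norm x).trans (by
    rw [mem_closedBall_zero_iff] at hx; linarith)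
  have hbp := bracket_pos x
  obtain ⟨u0, u1⟩ := mu_bounds hf hδ x
  have hE : ∀ i, |mE γ ε f δ i x| ≤ errC ε m * (1 + ρ) := fun i =>
    (abs_mE_le hf hε hγ hγ0 hδ hδ1 i x).trans (by gcongr)
  have hi : A.indicator (fun _ => Λ) x ≤ Λ := indicator_le_self' (fun _ _ => hΛ) x
  have hi0 : 0 ≤ A.indicator (fun _ => Λ) x := indicator_nonneg (fun _ _ => hΛ) x
  have n1 : 0 ≤ mu f δ x ^ (p - 1) := Real.rpow_nonneg u0 _
  have n2 : 0 ≤ mu f δ x ^ (p - 2) := Real.rpow_nonneg u0 _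
  have n3 : 0 ≤ bracket x ^ (-γ) := Real.rpow_nonneg hbp.le _
  have s1 : ∑ i, A.indicator (fun _ => Λ) x * |mE γ ε f δ i x| ≤ 3 * (Λ * (errC ε m * (1 + ρ))) := by
    have := Finset.sum_le_card_nsmul (Finset.univ : Finset (Fin 3))
      (fun i => A.indicator (fun _ => Λ) x * |mE γ ε f δ i x|) (Λ * (errC ε m * (1 + ρ)))
      fun i _ => mul_le_mul hi (hE i) (abs_nonneg _) hΛ
    simpa using this
  have s2 : ∑ i, mE γ ε f δ i x ^ 2 ≤ 3 * (errC ε m * (1 + ρ)) ^ 2 := by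
    have := Finset.sum_le_card_nsmul (Finset.univ : Finset (Fin 3))
      (fun i => mE γ ε f δ i x ^ 2) ((errC ε m * (1 + ρ)) ^ 2)
      fun i _ => by rw [← sq_abs]; exact pow_le_pow_left₀ (abs_nonneg _) (hE i) 2
    simpa using this
  have s1' : 0 ≤ ∑ i, A.indicator (fun _ => Λ) x * |mE γ ε f δ i x| :=
    Finset.sum_nonneg fun i _ => by positivity
  have s2' : 0 ≤ ∑ i, mE γ ε f δ i x ^ 2 := Finset.sum_nonneg fun i _ => sq_nonneg _
  have hζ2 : ζ x ^ 2 ≤ 1 := pow_le_one₀ (hζ.nonneg x) (hζ.le_one x)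
  unfold errD errB
  rw [abs_of_nonneg (by positivity)]
  gcongr <;> linarith

lemma tendsto_integral_errD (hρ : 0 ≤ ρ) :
    Tendsto (fun n => ∫ x, errD γ ε p K Λ A ζ f (ηs n) x) atTop (𝓝 0) := by
  have h := tendsto_integral_of_bound_of_support (G := fun _ => 0)
    (fun n => aesm_errD hf hε hγ hγ0 hp hζ (ηs_pos n))
    (fun n x => abs_errD_le hf hε hγ hγ0 hp hK hζ (ηs_pos n) (by
      unfold ηs; rw [div_le_one (by positivity)]; linarith [Nat.cast_nonneg (α := ℝ) n]) x hρ)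
    (fun n x hx => errD_eq_zero hζ hx) ?_
  · simpa using h
  filter_upwards [tendsto_mu_mE hf hε hγ hγ0] with x hx
  obtain ⟨hu, hE⟩ := hx
  have t1 := (hu.rpow_const (p := p - 1) (Or.inr (by linarith))).const_mul (2 * p)
  have t2 := (hu.rpow_const (p := p - 2) (Or.inr (by linarith))).const_mul
    (2 * p ^ 2 / K * bracket x ^ (-γ) * ζ x ^ 2)
  have t3 := tendsto_finsetSum Finset.univ fun i (_ : i ∈ Finset.univ) =>
    ((hE i).abs.const_mul (A.indicator (fun _ => Λ) x))
  have t4 := tendsto_finsetSum Finset.univ fun i (_ : i ∈ Finset.univ) => ((hE i).pow 2)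
  have := (t1.mul t3).add (t2.mul t4)
  simpa [errD] using this

set_option maxHeartbeats 400000 in
-- Integration of the pointwise inequality, with Sobolev for the gradient term and `Adm.drift_le`
-- for the drift. The smallness condition on `r` lets the singular part of the drift be absorbed by
-- the dissipation.
lemma energy_ineq (hδ : 0 < δ) (hδ1 : δ ≤ 1) (hρ : 0 ≤ ρ)
    (hco : ∀ x ξ : V, K * bracket x ^ γ * ‖ξ‖ ^ 2 ≤ ∑ i, ∑ j, Sm γ (fl ε f) i j x * ξ i * ξ j)
    {r : ℝ} (hr : 0 < r) (hr1 : r ≤ 1)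
    (hrK : 24 * (p - 1) * m * (radC (3 * γ / 2) ^ (2 / 3 : ℝ) * r ^ (2 + γ)) ≤ K / (12 * sobC)) :
    ∫ x, p * (ζ x ^ 2 * mu f δ x ^ (p - 1)) * mL γ ε f δ x ≤
      enH γ p (K / (12 * sobC)) (3 / 2 * K + 24 * (p - 1) * m * r⁻¹ ^ 2) (cutC p K Λ ε⁻¹ m) A ζ (mu f δ)
        + ∫ x, errD γ ε p K Λ A ζ f δ x := by
  have hu : ContDiff ℝ 1 (mu f δ) := (contDiff_mu hf hδ).of_le (by exact_mod_cast le_top)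
  have hu0 : ∀ x, 0 ≤ mu f δ x := fun x => (mu_bounds hf hδ x).1
  have hs := hζ.hasCompactSupport
  have hs2 : HasCompactSupport fun x => ζ x ^ 2 := hs.comp_left (g := fun z => z ^ 2) (by simp)
  have hcζ := hζ.contDiff_one
  have cp : ∀ {r : ℝ}, 1 ≤ r → ContDiff ℝ 1 fun x => mu f δ x ^ r := fun hr => contDiff_rpow hu hr
  -- the functions involved
  set Φ : V → ℝ := fun x => p * (ζ x ^ 2 * mu f δ x ^ (p - 1)) with hΦ
  have Φ1 : ContDiff ℝ 1 Φ := contDiff_const.mul ((hcζ.pow 2).mul (cp (by linarith)))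
  have Φ2 : HasCompactSupport Φ := HasCompactSupport.mul_left (f := fun _ => p) hs2.mul_right
  set ψ : V → ℝ := fun x => bracket x ^ (γ / 2) * (ζ x * mu f δ x ^ (p / 2)) with hψ
  have ψ1 : ContDiff ℝ 1 ψ := (contDiff_bracket_rpow _).mul (hcζ.mul (cp (by linarith)))
  have ψ2 : HasCompactSupport ψ :=
    HasCompactSupport.mul_left (f := fun x => bracket x ^ (γ / 2)) hs.mul_right
  set G : V → ℝ := fun x => ζ x ^ 2 * drG p ε (mu f δ x) with hG
  have G1 : ContDiff ℝ 1 G := (hcζ.pow 2).mul (pd_drG hu hu0 hp 0 0).1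
  have G2 : HasCompactSupport G := hs2.mul_right
  set φ : V → ℝ := fun x => ζ x * mu f δ x ^ (p / 2) with hφ
  have φ1 : Continuous φ := (hcζ.mul (cp (by linarith))).continuous
  have φ2 : HasCompactSupport φ := hs.mul_right
  have hφ2 : ∀ x, φ x ^ 2 = ζ x ^ 2 * mu f δ x ^ p := fun x => by
    rw [hφ, mul_pow, (rpow_identities hp (hu0 x)).2.2.2.2]
  -- The sign comes from `p / (p + 1) · ε u ≤ 1`. It is needed because the divergence of the drift
  -- kernel is bounded from one side only.
  have G0 : ∀ x, 0 ≤ G x := fun x => by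
    have hux := hu0 x
    refine mul_nonneg (sq_nonneg _) ?_
    have hεu : ε * mu f δ x ≤ 1 := by
      calc _ ≤ ε * ε⁻¹ := by gcongr; exact (mu_bounds hf hδ x).2
        _ = 1 := mul_inv_cancel₀ hε.ne'
    have e : drG p ε (mu f δ x) = (p - 1) * mu f δ x ^ p * (1 - p / (p + 1) * (ε * mu f δ x)) := by
      unfold drG; rw [Real.rpow_add_one' hux (by linarith)]; ring
    rw [e]
    have h1 : p / (p + 1) ≤ 1 := by rw [div_le_one (by linarith)]; linarith
    have h2 : p / (p + 1) * (ε * mu f δ x) ≤ 1 * 1 :=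
      mul_le_mul h1 hεu (by positivity) zero_le_one
    have h3 : 0 ≤ mu f δ x ^ p := Real.rpow_nonneg hux _
    have h4 : 0 ≤ p - 1 := by linarith
    exact mul_nonneg (mul_nonneg h4 h3) (by linarith)
  have hGφ : ∀ x, G x ≤ (p - 1) * φ x ^ 2 := fun x => by
    have hux := hu0 x
    rw [hφ2]
    have h1 : 0 ≤ ε * p * (p - 1) / (p + 1) * mu f δ x ^ (p + 1) := by
      have := Real.rpow_nonneg hux (p + 1)
      have : 0 ≤ p - 1 := by linarith
      have : 0 ≤ p := by linarith
      positivity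
    have h2 : drG p ε (mu f δ x) ≤ (p - 1) * mu f δ x ^ p := by unfold drG; linarith
    have := mul_le_mul_of_nonneg_left h2 (sq_nonneg (ζ x))
    simp only [hG]; linarith
  -- integrability
  have I1 : Integrable fun x => ∑ i, pd i ψ x ^ 2 :=
    integrable_finsetSum _ fun i _ => by
      have c := ((continuous_pd ψ1 i).mul (continuous_pd ψ1 i)).integrable_of_hasCompactSupport
        (μ := volume) (hasCompactSupport_pd ψ2 i).mul_right
      refine c.congr (ae_of_all _ fun x => ?_)
      exact (sq _).symm
  have I2 : Integrable fun x => bracket x ^ γ * (ζ x ^ 2 * mu f δ x ^ p) := by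
    have c : Continuous fun x => bracket x ^ γ * (ζ x ^ 2 * mu f δ x ^ p) :=
      (contDiff_bracket_rpow γ (n := 0)).continuous.mul ((hcζ.pow 2).mul (cp (by linarith))).continuous
    exact c.integrable_of_hasCompactSupport
      (HasCompactSupport.mul_left (f := fun x => bracket x ^ γ) hs2.mul_right)
  have I3 : Integrable fun x => A.indicator 1 x * mu f δ x ^ p := by
    refine integrable_of_bound_of_support (k := fun x => A.indicator 1 x * mu f δ x ^ p)
      (C := 1 * ε⁻¹ ^ p) (ρ := ρ)
      ((aestronglyMeasurable_const (b := (1 : ℝ)).indicator hζ.meas).mul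
      (cp (by linarith)).continuous.aestronglyMeasurable) (fun x => ?_) (fun x hx => ?_)
    · rw [abs_mul, abs_of_nonneg (Real.rpow_nonneg (hu0 x) p)]
      exact mul_le_mul (abs_indicator_one_le A x)
        (Real.rpow_le_rpow (hu0 x) (mu_bounds hf hδ x).2 (by linarith))
        (Real.rpow_nonneg (hu0 x) _) zero_le_one
    · rw [indicator_of_notMem fun h => hx (hζ.sub h), zero_mul]
  have I4 : Integrable fun x => ∑ i, Bv γ f i x * pd i G x :=
    integrable_finsetSum _ fun i _ => by
      have L : LocallyIntegrable (Bv γ f i) :=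
        locallyIntegrable_of_le (hf.aesm_Bv i) (hf.abs_Bv_le_sq hγ hγ0 i)
      have := L.integrable_smul_left_of_hasCompactSupport (continuous_pd G1 i)
        (hasCompactSupport_pd G2 i)
      refine this.congr (ae_of_all _ fun v => ?_)
      simp [mul_comm]
  have I5 : Integrable (errD γ ε p K Λ A ζ f δ) :=
    integrable_of_bound_of_support (aesm_errD hf hε hγ hγ0 hp hζ hδ)
      (fun x => abs_errD_le hf hε hγ hγ0 hp hK hζ hδ hδ1 x hρ) (fun x hx => errD_eq_zero hζ hx)
  have I6 : Integrable fun x => ∑ i, pd i Φ x * mJ γ ε f δ i x :=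
    integrable_finsetSum _ fun i _ =>
      ((continuous_pd Φ1 i).mul (contDiff_mJ hf hε hγ hγ0 hδ i).continuous).integrable_of_hasCompactSupport
        (hasCompactSupport_pd Φ2 i).mul_right
  have hpt := energy_pointwise hf hε hγ hγ0 hδ hp hK hco hζ
  have hint := integral_sub_four_le (I1.const_mul (K / 6)) (I2.const_mul (3 / 2 * K))
    (I3.const_mul (cutC p K Λ ε⁻¹ m)) I4 I5 I6 hpt
  rw [integral_const_mul, integral_const_mul, integral_const_mul] at hint
  have hsob := sobolev ψ1 ψ2
  have hdr := hf.drift_le hγ hγ0 hr hr1 G1 G2 G0 φ1 φ2 (l := p - 1) (by linarith) hGφ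
  have hsC := sobC_pos
  rw [integral_mul_mL hf hε hγ hγ0 hδ Φ1 Φ2]
  have hw : wL6 γ φ = (∫ x, ψ x ^ 6) ^ (1 / 3 : ℝ) := rfl
  rw [← hw] at hsob
  simp only [hφ2] at hdr
  have hw0 := wL6_nonneg γ φ
  have h1 := mul_le_mul_of_nonneg_right hrK hw0
  have h2 : K / (6 * sobC) * wL6 γ φ ≤ K / 6 * ∫ x, ∑ i, pd i ψ x ^ 2 := by
    rw [show K / 6 * ∫ x, ∑ i, pd i ψ x ^ 2 =
      K / (6 * sobC) * (sobC * ∫ x, ∑ i, pd i ψ x ^ 2) by field_simp]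
    gcongr
  -- One half of the dissipation absorbs the singular drift through `hrK`; the other half survives
  -- as the coefficient in `enH`.
  have h3 : K / (6 * sobC) = K / (12 * sobC) + K / (12 * sobC) := by field_simp; norm_num
  rw [h3] at h2
  unfold enH
  change _ ≤ -(K / (12 * sobC)) * wL6 γ φ + _ + _ + _
  linarith

omit hK in
lemma tendsto_enH (k₁ k₂ k₃ : ℝ) :
    Tendsto (fun n => enH γ p k₁ k₂ k₃ A ζ (mu f (ηs n))) atTop (𝓝 (enH γ p k₁ k₂ k₃ A ζ f)) := by
  have hb : ∀ n {r : ℝ}, 0 ≤ r → ∀ x, |mu f (ηs n) x ^ r| ≤ ε⁻¹ ^ r := fun n r hr x => by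
    obtain ⟨u0, u1⟩ := mu_bounds hf (ηs_pos n) x
    rw [abs_of_nonneg (Real.rpow_nonneg u0 _)]
    exact Real.rpow_le_rpow u0 u1 hr
  have hc : ∀ n {r : ℝ}, 0 ≤ r → Continuous fun x => mu f (ηs n) x ^ r := fun n r hr =>
    (contDiff_mu hf (ηs_pos n)).continuous.rpow_const fun x => Or.inr hr
  have hζc := hζ.contDiff_one.continuous
  have hζa : ∀ x, |ζ x| ≤ 1 := fun x => by rw [abs_of_nonneg (hζ.nonneg x)]; exact hζ.le_one x
  have hεi : 0 < ε⁻¹ := inv_pos.2 hε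
  have hbr : ∀ x {r : ℝ}, r ≤ 0 → |bracket x ^ r| ≤ 1 := fun x r hr => by
    rw [abs_of_nonneg (Real.rpow_nonneg (bracket_pos x).le _)]
    exact Real.rpow_le_one_of_one_le_of_nonpos (one_le_bracket x) hr
  have hlim := tendsto_mu_mE hf hε hγ hγ0
  have hp2 : 0 ≤ p / 2 := by linarith
  have hp0 : 0 ≤ p := by linarith
  have t1 := tendsto_integral_of_bound_of_support (ρ := ρ) (C := (1 * (1 * ε⁻¹ ^ (p / 2))) ^ 6)
    (F := fun n x => (bracket x ^ (γ / 2) * (ζ x * mu f (ηs n) x ^ (p / 2))) ^ 6)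
    (G := fun x => (bracket x ^ (γ / 2) * (ζ x * f x ^ (p / 2))) ^ 6)
    (fun n => (((contDiff_bracket_rpow _ (n := 0)).continuous.mul
      (hζc.mul (hc n hp2))).pow 6).aestronglyMeasurable)
    (fun n x => by
      rw [abs_pow, abs_mul, abs_mul]
      gcongr
      · exact hbr x (by linarith)
      · exact hζa x
      · exact hb n hp2 x)
    (fun n x hx => by simp [hζ.zero x hx])
    (by
      filter_upwards [hlim] with x hx
      exact (((hx.1.rpow_const (Or.inr hp2)).const_mul _).const_mul _).pow 6)
  have t2 := tendsto_integral_of_bound_of_support (ρ := ρ) (C := 1 * (1 ^ 2 * ε⁻¹ ^ p))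
    (F := fun n x => bracket x ^ γ * (ζ x ^ 2 * mu f (ηs n) x ^ p))
    (G := fun x => bracket x ^ γ * (ζ x ^ 2 * f x ^ p))
    (fun n => ((contDiff_bracket_rpow _ (n := 0)).continuous.mul
      ((hζc.pow 2).mul (hc n hp0))).aestronglyMeasurable)
    (fun n x => by
      rw [abs_mul, abs_mul, abs_pow]
      gcongr
      · exact hbr x hγ0.le
      · exact hζa x
      · exact hb n hp0 x)
    (fun n x hx => by simp [hζ.zero x hx])
    (by
      filter_upwards [hlim] with x hx
      exact ((hx.1.rpow_const (Or.inr hp0)).const_mul _).const_mul _)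
  have t3 := tendsto_integral_of_bound_of_support (ρ := ρ) (C := 1 * ε⁻¹ ^ p)
    (F := fun n x => A.indicator 1 x * mu f (ηs n) x ^ p)
    (G := fun x => A.indicator 1 x * f x ^ p)
    (fun n => (aestronglyMeasurable_const (b := (1 : ℝ)).indicator hζ.meas).mul
      (hc n hp0).aestronglyMeasurable)
    (fun n x => by
      rw [abs_mul]
      gcongr
      · exact abs_indicator_one_le A x
      · exact hb n hp0 x)
    (fun n x hx => by rw [indicator_of_notMem fun h => hx (hζ.sub h), zero_mul])
    (by
      filter_upwards [hlim] with x hx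
      exact (hx.1.rpow_const (Or.inr hp0)).const_mul _)
  exact (((t1.rpow_const (Or.inr (by norm_num))).const_mul _).add (t2.const_mul _)).add
    (t3.const_mul _)

omit hγ hK in
-- The dissipation has a favourable sign and is discarded. This upper bound, uniform in `δ`, is the
-- one-sided domination required by Fatou's lemma in time.
lemma enH_le {k₁ k₂ k₃ : ℝ} (hk₁ : 0 ≤ k₁) (hk₂ : 0 ≤ k₂) (hk₃ : 0 ≤ k₃) (hδ : 0 < δ) :
    enH γ p k₁ k₂ k₃ A ζ (mu f δ) ≤
      (k₂ + k₃) * (ε⁻¹ ^ p * (volume : Measure V).real (Metric.closedBall 0 ρ)) := by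
  have hp0 : 0 ≤ p := by linarith
  have hb : ∀ x, 0 ≤ mu f δ x ^ p ∧ mu f δ x ^ p ≤ ε⁻¹ ^ p := fun x => by
    obtain ⟨u0, u1⟩ := mu_bounds hf hδ x
    exact ⟨Real.rpow_nonneg u0 _, Real.rpow_le_rpow u0 u1 hp0⟩
  have hεi : 0 < ε⁻¹ := inv_pos.2 hε
  have hc : Continuous fun x => mu f δ x ^ p :=
    (contDiff_mu hf hδ).continuous.rpow_const fun x => Or.inr hp0
  have h2 : ∫ x, bracket x ^ γ * (ζ x ^ 2 * mu f δ x ^ p) ≤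
      ε⁻¹ ^ p * (volume : Measure V).real (Metric.closedBall 0 ρ) := by
    refine integral_le_of_bound_of_support (k := fun x => bracket x ^ γ * (ζ x ^ 2 * mu f δ x ^ p))
      ((contDiff_bracket_rpow _ (n := 0)).continuous.mul
      ((hζ.contDiff_one.continuous.pow 2).mul hc)).aestronglyMeasurable (fun x => ?_)
      (fun x hx => by simp [hζ.zero x hx])
    have n1 := Real.rpow_nonneg (bracket_pos x).le γ
    rw [abs_of_nonneg (mul_nonneg n1 (mul_nonneg (sq_nonneg _) (hb x).1))]
    calc _ ≤ 1 * (1 * ε⁻¹ ^ p) := mul_le_mul (bracket_rpow_le_one hγ0 x)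
          (mul_le_mul (pow_le_one₀ (hζ.nonneg x) (hζ.le_one x)) (hb x).2 (hb x).1 zero_le_one)
          (mul_nonneg (sq_nonneg _) (hb x).1) zero_le_one
      _ = _ := by ring
  have h3 : ∫ x, A.indicator 1 x * mu f δ x ^ p ≤
      ε⁻¹ ^ p * (volume : Measure V).real (Metric.closedBall 0 ρ) := by
    refine integral_le_of_bound_of_support (k := fun x => A.indicator 1 x * mu f δ x ^ p)
      ((aestronglyMeasurable_const (b := (1 : ℝ)).indicator hζ.meas).mul hc.aestronglyMeasurable)
      (fun x => ?_) (fun x hx => by rw [indicator_of_notMem fun h => hx (hζ.sub h), zero_mul])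
    have n1 : 0 ≤ A.indicator (1 : V → ℝ) x := indicator_nonneg (fun _ _ => zero_le_one) x
    rw [abs_of_nonneg (mul_nonneg n1 (hb x).1)]
    calc _ ≤ 1 * ε⁻¹ ^ p := mul_le_mul (indicator_le_self' (fun _ _ => zero_le_one) x) (hb x).2
          (hb x).1 zero_le_one
      _ = _ := one_mul _
  have h1 := mul_nonneg hk₁ (wL6_nonneg γ fun x => ζ x * mu f δ x ^ (p / 2))
  have h2' := mul_le_mul_of_nonneg_left h2 hk₂
  have h3' := mul_le_mul_of_nonneg_left h3 hk₃
  unfold enH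
  linarith
end
end
end LFD
end

/-! ### The weak formulation tested with translates of the mollifier. -/

noncomputable section
namespace LFD
open MeasureTheory Set Filter Topology

lemma b_neg (γ : ℝ) (i : Fin 3) (z : V) : b γ i (-z) = -b γ i z := by simp [b]

section
variable {γ ε m δ : ℝ} {f : V → ℝ}

lemma integrable_bracket_sq_mul_mul {M : ℝ} (hf : Adm M m f) {φ : V → ℝ} (hc : Continuous φ)
    (hs : HasCompactSupport φ) : Integrable (fun x => bracket x ^ 2 * (f x * φ x)) := by
  have h := (integrable_bracket_sq_mul hc hs).bdd_mul hf.meas (c := M)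
    (ae_of_all _ fun x => by rw [Real.norm_of_nonneg (hf.nonneg x)]; exact hf.le x)
  refine h.congr (ae_of_all _ fun x => ?_)
  ring

section
variable (hf : Adm ε⁻¹ m f) (hε : 0 < ε) (hγ : -2 < γ) (hγ0 : γ < 0)
include hf hε hγ hγ0

/-- Splitting of the drift integral over `V × V`. -/
lemma integral_drift_prod (i : Fin 3) {φ : V → ℝ} (hc : Continuous φ) (hs : HasCompactSupport φ) :
    ∫ p : V × V, f p.1 * f p.2 * (1 - ε * f p.2) * b γ i (p.1 - p.2) * (φ p.1 - φ p.2) =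
      (∫ v, f v * Bv γ (fl ε f) i v * φ v) + ∫ v, fl ε f v * Bv γ f i v * φ v := by
  have hg := hf.fl hε
  have J1 := integrable_kernel_prod (measurable_b γ i) hg.meas (hg.b_conv_sq hγ hγ0 i)
    (hf.meas.mul hc.aestronglyMeasurable) (integrable_bracket_sq_mul_mul hf hc hs)
  have J2 := integrable_kernel_prod (measurable_b γ i) hf.meas (hf.b_conv_sq hγ hγ0 i)
    (hg.meas.mul hc.aestronglyMeasurable) (integrable_bracket_sq_mul_mul hg hc hs)
  have e1 : ∫ p : V × V, b γ i (p.1 - p.2) * fl ε f p.2 * (f * φ) p.1 =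
      ∫ v, f v * Bv γ (fl ε f) i v * φ v := by
    rw [Measure.volume_eq_prod, integral_prod _ J1]
    congr 1; ext v
    simp only [Pi.mul_apply]
    rw [integral_mul_const, Bv]; ring
  have e2 : ∫ p : V × V, b γ i (p.1 - p.2) * f p.2 * (fl ε f * φ) p.1 =
      ∫ v, fl ε f v * Bv γ f i v * φ v := by
    rw [Measure.volume_eq_prod, integral_prod _ J2]
    congr 1; ext v
    simp only [Pi.mul_apply]
    rw [integral_mul_const, Bv]; ring
  -- The part with the test function at the second variable is exchanged by symmetry; `b` is odd,
  -- which turns the difference of test values into a sum of two drift terms.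
  have e3 := integral_prod_swap (μ := (volume : Measure V)) (ν := (volume : Measure V))
    (fun p : V × V => b γ i (p.1 - p.2) * f p.2 * (fl ε f * φ) p.1)
  have J2' : Integrable (fun p : V × V => b γ i (p.swap.1 - p.swap.2) * f p.swap.2 *
      (fl ε f * φ) p.swap.1) (volume.prod volume) := J2.swap
  rw [← e1, ← e2, Measure.volume_eq_prod, ← e3, ← integral_add J1 J2']
  congr 1; ext p
  have : b γ i (p.2 - p.1) = -b γ i (p.1 - p.2) := by rw [← b_neg, neg_sub]
  simp only [Pi.mul_apply, Prod.fst_swap, Prod.snd_swap, this, fl]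
  ring

/-- The divergence of the mollified flux, with all derivatives on the mollifier. -/
lemma mL_eq (hδ : 0 < δ) (x : V) :
    mL γ ε f δ x = ∑ i, (∑ j, cv (fun v => f v * Sm γ (fl ε f) i j v) (pd i (pd j (mol δ))) x
      - cv (fun v => f v * Bv γ (fl ε f) i v) (pd i (mol δ)) x
      - cv (fun v => fl ε f v * Bv γ f i v) (pd i (mol δ)) x) := by
  have hs := hasCompactSupport_mol hδ
  have hC : ∀ {k ρ : V → ℝ}, LocallyIntegrable k → ContDiff ℝ (⊤ : ℕ∞) ρ → HasCompactSupport ρ →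
      Differentiable ℝ (cv k ρ) := fun hk h1 h2 => (contDiff_cv hk h1 h2).differentiable (by simp)
  unfold mL
  refine Finset.sum_congr rfl fun i _ => ?_
  have hS := fun j => hC (locInt_S hf hε hγ hγ0 i j) (contDiff_pd (contDiff_mol δ) j)
    (hasCompactSupport_pd hs j)
  have hB := hC (locInt_B hf hε hγ hγ0 i) (contDiff_mol δ) hs
  have hc := hC (locInt_c hf hε hγ hγ0 i) (contDiff_mol δ) hs
  have hsum := HasFDerivAt.fun_sum (u := Finset.univ) fun j _ => (hS j x).hasFDerivAt
  have h := ((hsum.sub (hB x).hasFDerivAt).sub (hc x).hasFDerivAt).fderiv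
  have h' := congrArg (fun L => L (EuclideanSpace.single i 1)) h
  change pd i (mJ γ ε f δ i) x = _ at h'
  rw [h']
  simp only [FunLike.coe_sub, Pi.sub_apply, FunLike.coe_sum, Finset.sum_apply]
  change ∑ j, pd i (cv _ (pd j (mol δ))) x - pd i (cv _ (mol δ)) x - pd i (cv _ (mol δ)) x = _
  have one : ∀ {ρ : V → ℝ}, ContDiff ℝ (⊤ : ℕ∞) ρ → ContDiff ℝ 1 ρ := fun h =>
    h.of_le (by exact_mod_cast le_top)
  rw [pd_cv (locInt_B hf hε hγ hγ0 i) (contDiff_mol_one δ) hs,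
    pd_cv (locInt_c hf hε hγ hγ0 i) (contDiff_mol_one δ) hs]
  congr 2
  exact Finset.sum_congr rfl fun j _ => pd_cv (locInt_S hf hε hγ hγ0 i j)
    (one (contDiff_pd (contDiff_mol δ) j)) (hasCompactSupport_pd hs j) i x

omit hf hε hγ hγ0 in
lemma pd_mol_sub (δ : ℝ) (i : Fin 3) (x : V) :
    pd i (fun v => mol δ (x - v)) = fun v => -pd i (mol δ) (x - v) := by
  ext v; exact pd_comp_const_sub (contDiff_mol_one δ) i x v

omit hf hε hγ hγ0 in
lemma pd_pd_mol_sub (δ : ℝ) (i j : Fin 3) (x : V) :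
    pd i (pd j (fun v => mol δ (x - v))) = fun v => pd i (pd j (mol δ)) (x - v) := by
  have h1 : ContDiff ℝ 1 (pd j (mol δ)) :=
    (contDiff_pd (contDiff_mol δ) j).of_le (by exact_mod_cast le_top)
  ext v
  have h2 := pd_comp_const_sub h1 i x v
  have e : pd j (fun v => mol δ (x - v)) = fun v => -pd j (mol δ) (x - v) := by
    ext v; exact pd_comp_const_sub (contDiff_mol_one δ) j x v
  rw [e]
  have : pd i (fun v => -pd j (mol δ) (x - v)) v = -pd i (fun v => pd j (mol δ) (x - v)) v := by
    simp only [pd]; rw [fderiv_fun_neg]; simp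
  rw [this, h2, neg_neg]

/-- The right-hand side of the weak formulation tested with a translate of the mollifier. -/
lemma weak_rhs_mol (hδ : 0 < δ) (x : V) :
    Integrable (fun v => ∑ i, ∑ j, Sig γ ε i j f v * f v *
      pd i (pd j (fun v => mol δ (x - v))) v) ∧
    (∫ v, ∑ i, ∑ j, Sig γ ε i j f v * f v * pd i (pd j (fun v => mol δ (x - v))) v)
      + ∑ i, ∫ p : V × V, f p.1 * f p.2 * (1 - ε * f p.2) * b γ i (p.1 - p.2) *
        (pd i (fun v => mol δ (x - v)) p.1 - pd i (fun v => mol δ (x - v)) p.2)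
      = mL γ ε f δ x := by
  have hs := hasCompactSupport_mol hδ
  have h1 : ContDiff ℝ 1 (fun v => mol δ (x - v)) :=
    (contDiff_mol_one δ).comp (contDiff_const.sub contDiff_id)
  have h2 := hasCompactSupport_comp_sub hs x
  have h3 : ∀ i j, Continuous (pd i (pd j (mol δ))) := fun i j =>
    continuous_pd ((contDiff_pd (contDiff_mol δ) j).of_le (by exact_mod_cast le_top)) i
  have IS : ∀ i j, Integrable fun v => f v * Sm γ (fl ε f) i j v * pd i (pd j (mol δ)) (x - v) :=
    fun i j => integrable_mul_comp_sub (locInt_S hf hε hγ hγ0 i j) (h3 i j)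
      (hasCompactSupport_pd (hasCompactSupport_pd hs j) i) x
  have eS : ∀ v, ∑ i, ∑ j, Sig γ ε i j f v * f v * pd i (pd j (fun v => mol δ (x - v))) v =
      ∑ i, ∑ j, f v * Sm γ (fl ε f) i j v * pd i (pd j (mol δ)) (x - v) := fun v => by
    refine Finset.sum_congr rfl fun i _ => Finset.sum_congr rfl fun j _ => ?_
    rw [pd_pd_mol_sub]
    change Sm γ (fl ε f) i j v * f v * _ = _
    ring
  simp only [eS]
  have IS' := fun i => integrable_finsetSum Finset.univ fun j (_ : j ∈ Finset.univ) => IS i j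
  refine ⟨integrable_finsetSum _ fun i _ => IS' i, ?_⟩
  rw [integral_finsetSum _ fun i _ => IS' i, mL_eq hf hε hγ hγ0 hδ x, ← Finset.sum_add_distrib]
  refine Finset.sum_congr rfl fun i _ => ?_
  rw [integral_finsetSum _ fun j _ => IS i j,
    integral_drift_prod hf hε hγ hγ0 i (continuous_pd h1 i) (hasCompactSupport_pd h2 i),
    pd_mol_sub]
  simp only [mul_neg, integral_neg, cv]
  ring

end

/-- The Peetre-type inequality `⟨v⟩ ≤ 2 ⟨x⟩ ⟨x - v⟩` moves the quadratic growth onto the compactly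
supported factor. -/
lemma abs_cv_le {g k : V → ℝ} {C : ℝ} (hC : ∀ v, |g v| ≤ C * bracket v ^ 2) (hk : Continuous k)
    (hs : HasCompactSupport k) (x : V) :
    |cv g k x| ≤ 4 * C * (∫ y, bracket y ^ 2 * |k y|) * bracket x ^ 2 := by
  have hC0 : 0 ≤ C := by
    have := (abs_nonneg _).trans (hC 0)
    exact nonneg_of_mul_nonneg_left this (pow_pos (bracket_pos 0) 2)
  have hi : Integrable fun y => bracket y ^ 2 * |k y| := by
    have := integrable_bracket_sq_mul hk.abs (hs.comp_left (g := fun z => |z|) abs_zero)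
    exact this
  have hi2 : Integrable fun v => 4 * C * bracket x ^ 2 * (bracket (x - v) ^ 2 * |k (x - v)|) :=
    (hi.comp_sub_left x).const_mul _
  unfold cv
  rw [← Real.norm_eq_abs]
  refine (norm_integral_le_of_norm_le hi2 (ae_of_all _ fun v => ?_)).trans (le_of_eq ?_)
  · rw [norm_mul, Real.norm_eq_abs, Real.norm_eq_abs]
    have h1 : bracket v ≤ 2 * (bracket x * bracket (x - v)) := by
      have h2 := bracket_le_add v x
      rw [norm_sub_rev] at h2
      have h3 := norm_le_bracket (x - v)
      nlinarith [one_le_bracket x, one_le_bracket (x - v)]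
    have h4 : bracket v ^ 2 ≤ 4 * (bracket x ^ 2 * bracket (x - v) ^ 2) := by
      calc bracket v ^ 2 ≤ (2 * (bracket x * bracket (x - v))) ^ 2 :=
            pow_le_pow_left₀ (bracket_pos v).le h1 2
        _ = _ := by ring
    calc |g v| * |k (x - v)| ≤ C * (4 * (bracket x ^ 2 * bracket (x - v) ^ 2)) * |k (x - v)| := by
          gcongr; exact (hC v).trans (by gcongr)
      _ = _ := by ring
  · rw [integral_const_mul, integral_sub_left_eq_self (fun y => bracket y ^ 2 * |k y|) volume x]
    ring

/-- A bound for the mollified right-hand side. -/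
def mLB (ε m δ : ℝ) : ℝ := ∑ i : Fin 3, (∑ j : Fin 3,
  4 * (ε⁻¹ * (10 * m)) * (∫ y, bracket y ^ 2 * |pd i (pd j (mol δ)) y|)
    + 4 * (ε⁻¹ * (2 * growC ε⁻¹ m)) * (∫ y, bracket y ^ 2 * |pd i (mol δ) y|)
    + 4 * (ε⁻¹ * (2 * growC ε⁻¹ m)) * (∫ y, bracket y ^ 2 * |pd i (mol δ) y|))

/-- Qualitative: no uniformity in `δ` is claimed. The bound gives integrability in time and the
Lipschitz property behind the chain rule, at fixed `δ`. -/
lemma abs_mL_le (hf : Adm ε⁻¹ m f) (hε : 0 < ε) (hγ : -2 < γ) (hγ0 : γ < 0) (hδ : 0 < δ) (x : V) :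
    |mL γ ε f δ x| ≤ mLB ε m δ * bracket x ^ 2 := by
  have hs := hasCompactSupport_mol hδ
  have hg := hf.fl hε
  have h3 : ∀ i j, Continuous (pd i (pd j (mol δ))) := fun i j =>
    continuous_pd ((contDiff_pd (contDiff_mol δ) j).of_le (by exact_mod_cast le_top)) i
  have key : ∀ {g k : V → ℝ} {C : ℝ}, Adm ε⁻¹ m g → (∀ v, |k v| ≤ C * bracket v ^ 2) →
      ∀ v, |g v * k v| ≤ ε⁻¹ * C * bracket v ^ 2 := fun hg hk v => by
    rw [abs_mul, abs_of_nonneg (hg.nonneg v), mul_assoc]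
    exact mul_le_mul (hg.le v) (hk v) (abs_nonneg _) (inv_pos.2 hε).le
  rw [mL_eq hf hε hγ hγ0 hδ, mLB, Finset.sum_mul]
  refine (Finset.abs_sum_le_sum_abs _ _).trans (Finset.sum_le_sum fun i _ => ?_)
  have hB := abs_cv_le (key hf (hg.abs_Bv_le_sq hγ hγ0 i)) (continuous_pd (contDiff_mol_one δ) i)
    (hasCompactSupport_pd hs i) x
  have hc := abs_cv_le (key hg (hf.abs_Bv_le_sq hγ hγ0 i)) (continuous_pd (contDiff_mol_one δ) i)
    (hasCompactSupport_pd hs i) x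
  have hS : |∑ j, cv (fun v => f v * Sm γ (fl ε f) i j v) (pd i (pd j (mol δ))) x| ≤
      ∑ j : Fin 3, 4 * (ε⁻¹ * (10 * m)) * (∫ y, bracket y ^ 2 * |pd i (pd j (mol δ)) y|)
        * bracket x ^ 2 :=
    (Finset.abs_sum_le_sum_abs _ _).trans (Finset.sum_le_sum fun j _ =>
      abs_cv_le (key hf (hg.abs_Sm_le hγ hγ0 i j)) (h3 i j)
        (hasCompactSupport_pd (hasCompactSupport_pd hs j) i) x)
  rw [← Finset.sum_mul] at hS
  refine (abs_sub _ _).trans ?_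
  refine (add_le_add (abs_sub _ _) le_rfl).trans ?_
  rw [add_mul, add_mul]
  exact add_le_add (add_le_add hS hB) hc

end

/-! ### Joint measurability in time and velocity, and invariance under change on null sets. -/

section
variable {γ ε δ : ℝ} {F : ℝ × V → ℝ}

/-- Parametric convolutions are jointly measurable. -/
lemma stronglyMeasurable_conv {k : V → ℝ} (hk : Measurable k) {H : ℝ × V → ℝ}
    (hH : StronglyMeasurable H) :
    StronglyMeasurable fun q : ℝ × V => ∫ w, k (q.2 - w) * H (q.1, w) := by
  have h : StronglyMeasurable fun q : (ℝ × V) × V => k (q.1.2 - q.2) * H (q.1.1, q.2) := by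
    refine (Measurable.stronglyMeasurable ?_).mul (hH.comp_measurable
      ((measurable_fst.comp measurable_fst).prodMk measurable_snd))
    exact hk.comp ((measurable_snd.comp measurable_fst).sub measurable_snd)
  exact h.integral_prod_right

lemma stronglyMeasurable_fl (hF : StronglyMeasurable F) :
    StronglyMeasurable fun q : ℝ × V => fl ε (fun v => F (q.1, v)) q.2 :=
  hF.mul (stronglyMeasurable_const.sub (hF.const_mul ε))

lemma stronglyMeasurable_cv {k : V → ℝ} (hk : Measurable k) {H : ℝ × V → ℝ}
    (hH : StronglyMeasurable H) :
    StronglyMeasurable fun q : ℝ × V => cv (fun v => H (q.1, v)) k q.2 := by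
  have := stronglyMeasurable_conv hk hH
  simpa only [cv, mul_comm] using this

lemma stronglyMeasurable_mu (hF : StronglyMeasurable F) :
    StronglyMeasurable fun q : ℝ × V => mu (fun v => F (q.1, v)) δ q.2 :=
  stronglyMeasurable_cv (contDiff_mol δ).continuous.measurable hF

/-- The jointly measurable form of the mollified right-hand side. -/
def mLm (γ ε : ℝ) (f : V → ℝ) (δ : ℝ) (x : V) : ℝ :=
  ∑ i, (∑ j, cv (fun v => f v * Sm γ (fl ε f) i j v) (pd i (pd j (mol δ))) x
      - cv (fun v => f v * Bv γ (fl ε f) i v) (pd i (mol δ)) x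
      - cv (fun v => fl ε f v * Bv γ f i v) (pd i (mol δ)) x)

lemma stronglyMeasurable_mLm (hγ : -2 < γ) (hF : StronglyMeasurable F) :
    StronglyMeasurable fun q : ℝ × V => mLm γ ε (fun v => F (q.1, v)) δ q.2 := by
  have hfl := stronglyMeasurable_fl (ε := ε) hF
  have h3 : ∀ i j, Measurable (pd i (pd j (mol δ))) := fun i j =>
    (continuous_pd ((contDiff_pd (contDiff_mol δ) j).of_le (by exact_mod_cast le_top)) i).measurable
  have h4 : ∀ i, Measurable (pd i (mol δ)) := fun i =>
    (continuous_pd (contDiff_mol_one δ) i).measurable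
  refine Finset.stronglyMeasurable_fun_sum _ fun i _ => StronglyMeasurable.sub
    (StronglyMeasurable.sub (Finset.stronglyMeasurable_fun_sum _ fun j _ => ?_) ?_) ?_
  · exact stronglyMeasurable_cv (h3 i j) (hF.mul (stronglyMeasurable_conv (measurable_a hγ i j) hfl))
  · exact stronglyMeasurable_cv (h4 i) (hF.mul (stronglyMeasurable_conv (measurable_b γ i) hfl))
  · exact stronglyMeasurable_cv (h4 i) (hfl.mul (stronglyMeasurable_conv (measurable_b γ i) hF))

/-- The mollified quantities depend only on the class of the density, so at almost every time the
jointly measurable modification may replace it. -/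
lemma cv_congr {g g' k : V → ℝ} (h : g =ᵐ[volume] g') : cv g k = cv g' k := by
  ext x; exact integral_congr_ae (by filter_upwards [h] with v hv; rw [hv])

lemma fl_congr {g g' : V → ℝ} (h : g =ᵐ[volume] g') : fl ε g =ᵐ[volume] fl ε g' := by
  filter_upwards [h] with v hv; simp only [fl, hv]

lemma Sm_congr {g g' : V → ℝ} (h : g =ᵐ[volume] g') (i j : Fin 3) : Sm γ g i j = Sm γ g' i j := by
  ext x; exact integral_congr_ae (by filter_upwards [h] with v hv; rw [hv])

lemma Bv_congr {g g' : V → ℝ} (h : g =ᵐ[volume] g') (i : Fin 3) : Bv γ g i = Bv γ g' i := by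
  ext x; exact integral_congr_ae (by filter_upwards [h] with v hv; rw [hv])

lemma mu_congr {g g' : V → ℝ} (h : g =ᵐ[volume] g') : mu g δ = mu g' δ := cv_congr h

lemma mLm_congr {g g' : V → ℝ} (h : g =ᵐ[volume] g') : mLm γ ε g δ = mLm γ ε g' δ := by
  have hfl := fl_congr (ε := ε) h
  have e1 : ∀ i j k, cv (fun v => g v * Sm γ (fl ε g) i j v) k =
      cv (fun v => g' v * Sm γ (fl ε g') i j v) k := fun i j k => by
    rw [Sm_congr hfl]; exact cv_congr (by filter_upwards [h] with v hv; rw [hv])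
  have e2 : ∀ i k, cv (fun v => g v * Bv γ (fl ε g) i v) k =
      cv (fun v => g' v * Bv γ (fl ε g') i v) k := fun i k => by
    rw [Bv_congr hfl]; exact cv_congr (by filter_upwards [h] with v hv; rw [hv])
  have e3 : ∀ i k, cv (fun v => fl ε g v * Bv γ g i v) k =
      cv (fun v => fl ε g' v * Bv γ g' i v) k := fun i k => by
    rw [Bv_congr h]; exact cv_congr (by filter_upwards [hfl] with v hv; rw [hv])
  ext x
  simp only [mLm, e1, e2, e3]

end
end LFD
end

noncomputable section
namespace LFD
open MeasureTheory Set Filter Topology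

/-! ### One-dimensional lemmas in time -/

lemma integral_deriv_smoothTransition : ∫ s, deriv Real.smoothTransition s = 1 := by
  have hc : ContDiff ℝ 1 Real.smoothTransition := Real.smoothTransition.contDiff (n := 1)
  have hz : ∀ s ∉ Ioc (0 : ℝ) 1, deriv Real.smoothTransition s = 0 := fun s hs => by
    rcases le_or_gt s 0 with h | h
    · have hmin : IsLocalMin Real.smoothTransition s := Eventually.of_forall fun y => by
        rw [Real.smoothTransition.zero_of_nonpos h]; exact Real.smoothTransition.nonneg y
      exact hmin.deriv_eq_zero
    · have h1 : 1 ≤ s := by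
        by_contra h2; exact hs ⟨h, (not_le.1 h2).le⟩
      have hmax : IsLocalMax Real.smoothTransition s := Eventually.of_forall fun y => by
        rw [Real.smoothTransition.one_of_one_le h1]; exact Real.smoothTransition.le_one y
      exact hmax.deriv_eq_zero
  rw [← setIntegral_eq_integral_of_forall_compl_eq_zero hz,
    ← intervalIntegral.integral_of_le zero_le_one,
    intervalIntegral.integral_deriv_eq_sub (fun x _ => hc.differentiable one_ne_zero x)
      ((hc.continuous_deriv le_rfl).intervalIntegrable _ _),
    Real.smoothTransition.one, Real.smoothTransition.zero, sub_zero]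

lemma deriv_smoothTransition_eq_zero {s : ℝ} (hs : s ∉ Icc (0 : ℝ) 1) :
    deriv Real.smoothTransition s = 0 := by
  rcases lt_or_ge s 0 with h | h
  · have hmin : IsLocalMin Real.smoothTransition s := Eventually.of_forall fun y => by
      rw [Real.smoothTransition.zero_of_nonpos h.le]; exact Real.smoothTransition.nonneg y
    exact hmin.deriv_eq_zero
  · have h1 : 1 ≤ s := by
      by_contra h2; exact hs ⟨h, (not_le.1 h2).le⟩
    have hmax : IsLocalMax Real.smoothTransition s := Eventually.of_forall fun y => by
      rw [Real.smoothTransition.one_of_one_le h1]; exact Real.smoothTransition.le_one y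
    exact hmax.deriv_eq_zero

/-- The smooth approximation of the indicator of `(c, ∞)`. -/
def ramp (c : ℝ) (n : ℕ) (t : ℝ) : ℝ := Real.smoothTransition ((n + 1) * (t - c))

lemma contDiff_ramp (c : ℝ) (n : ℕ) : ContDiff ℝ (⊤ : ℕ∞) (ramp c n) :=
  (Real.smoothTransition.contDiff (n := ⊤)).comp
    (contDiff_const.mul (contDiff_id.sub contDiff_const))

lemma deriv_ramp (c : ℝ) (n : ℕ) (t : ℝ) :
    deriv (ramp c n) t = (n + 1) * deriv Real.smoothTransition ((n + 1) * (t - c)) := by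
  have h1 : DifferentiableAt ℝ Real.smoothTransition ((n + 1) * (t - c)) :=
    (Real.smoothTransition.contDiff (n := 1)).differentiable (by simp) _
  have h2 : HasDerivAt (fun t : ℝ => ((n : ℝ) + 1) * (t - c)) ((n + 1) * 1) t :=
    ((hasDerivAt_id t).sub_const c).const_mul _
  have := (h1.hasDerivAt.comp t h2).deriv
  rw [show ramp c n = Real.smoothTransition ∘ fun t : ℝ => ((n : ℝ) + 1) * (t - c) from rfl, this]
  ring

lemma ramp_eq_zero {c t : ℝ} (h : t ≤ c) (n : ℕ) : ramp c n t = 0 :=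
  Real.smoothTransition.zero_of_nonpos
    (mul_nonpos_of_nonneg_of_nonpos (by positivity) (by linarith))

lemma ramp_eq_one {c t : ℝ} {n : ℕ} (h : 1 ≤ (n + 1) * (t - c)) : ramp c n t = 1 :=
  Real.smoothTransition.one_of_one_le h

lemma tendsto_ramp (c t : ℝ) :
    Tendsto (fun n => ramp c n t) atTop (𝓝 ((Ioi c).indicator 1 t)) := by
  rcases le_or_gt t c with h | h
  · rw [indicator_of_notMem (by simpa using h)]
    simp [ramp_eq_zero h]
  · rw [indicator_of_mem (by simpa using h)]
    refine tendsto_const_nhds.congr' ?_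
    obtain ⟨N, hN⟩ := exists_nat_gt (1 / (t - c))
    filter_upwards [eventually_ge_atTop N] with n hn
    rw [ramp_eq_one, Pi.one_apply]
    have h1 : (N : ℝ) ≤ n := by exact_mod_cast hn
    rw [div_lt_iff₀ (by linarith)] at hN
    nlinarith

/-- The derivatives of the ramps form an approximate identity concentrating at `c` from the right.
-/
lemma tendsto_integral_deriv_ramp {μ : ℝ → ℝ} (hμ : Continuous μ) (c : ℝ) :
    Tendsto (fun n => ∫ t, μ t * deriv (ramp c n) t) atTop (𝓝 (μ c)) := by
  have hc : Continuous (deriv Real.smoothTransition) :=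
    (Real.smoothTransition.contDiff (n := 1)).continuous_deriv (by simp)
  have e : ∀ n : ℕ, ∫ t, μ t * deriv (ramp c n) t =
      ∫ s, μ (c + s / (n + 1)) * deriv Real.smoothTransition s := fun n => by
    have hn : (0 : ℝ) < n + 1 := by positivity
    set g : ℝ → ℝ := fun s => μ (c + s / (n + 1)) * deriv Real.smoothTransition s with hg
    have h1 : ∀ t, μ t * deriv (ramp c n) t = (n + 1) * g ((n + 1) * (t - c)) := fun t => by
      rw [deriv_ramp, hg]
      simp only
      rw [mul_div_cancel_left₀ _ hn.ne', add_sub_cancel]; ring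
    simp only [h1]
    rw [integral_const_mul, integral_sub_right_eq_self (fun t => g ((n + 1) * t)) c,
      Measure.integral_comp_mul_left, abs_of_pos (inv_pos.2 hn), smul_eq_mul, ← mul_assoc,
      mul_inv_cancel₀ hn.ne', one_mul]
  simp only [e]
  obtain ⟨B, hB⟩ := (isCompact_Icc (a := c - 1) (b := c + 1)).exists_bound_of_continuousOn
    hμ.continuousOn
  have hs : HasCompactSupport (deriv Real.smoothTransition) :=
    HasCompactSupport.intro isCompact_Icc fun s hs => deriv_smoothTransition_eq_zero hs
  have hlim : ∫ s, μ c * deriv Real.smoothTransition s = μ c := by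
    rw [integral_const_mul, integral_deriv_smoothTransition, mul_one]
  rw [← hlim]
  refine tendsto_integral_of_dominated_convergence (fun s => B * ‖deriv Real.smoothTransition s‖)
    (fun n => ?_) ((hc.integrable_of_hasCompactSupport hs).norm.const_mul B)
    (fun n => ae_of_all _ fun s => ?_) (ae_of_all _ fun s => ?_)
  · exact ((hμ.comp (continuous_const.add (continuous_id.div_const _))).mul hc).aestronglyMeasurable
  · rw [norm_mul]
    by_cases h : s ∈ Icc (0 : ℝ) 1
    · gcongr
      refine hB _ ⟨?_, ?_⟩
      · have : 0 ≤ s / ((n : ℝ) + 1) := div_nonneg h.1 (by positivity)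
        linarith
      · have : s / ((n : ℝ) + 1) ≤ 1 := by
          rw [div_le_one (by positivity)]; have := Nat.cast_nonneg (α := ℝ) n; linarith [h.2]
        linarith
    · rw [deriv_smoothTransition_eq_zero h]; simp
  · refine Tendsto.mul_const _ ?_
    have h1 : Tendsto (fun n : ℕ => c + s / ((n : ℝ) + 1)) atTop (𝓝 (c + 0)) := by
      refine tendsto_const_nhds.add ?_
      have := (tendsto_one_div_add_atTop_nhds_zero_nat (𝕜 := ℝ)).const_mul s
      simpa [div_eq_mul_inv] using this
    rw [add_zero] at h1
    exact (hμ.tendsto c).comp h1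

/-- A function with an integrable weak derivative is its integral. -/
lemma sub_eq_integral_of_weak {μ Λ : ℝ → ℝ} (hμ : ContinuousOn μ (Ici 0))
    (hΛ : ∀ T, 0 < T → IntegrableOn Λ (Ioo 0 T))
    (hw : ∀ T, 0 < T → ∀ θ : ℝ → ℝ, ContDiff ℝ (⊤ : ℕ∞) θ → HasCompactSupport θ →
      tsupport θ ⊆ Ioo 0 T →
      -∫ t in Ioo 0 T, μ t * deriv θ t = ∫ t in Ioo 0 T, θ t * Λ t)
    {t₁ t₂ : ℝ} (h0 : 0 < t₁) (h12 : t₁ ≤ t₂) : μ t₂ - μ t₁ = ∫ t in t₁..t₂, Λ t := by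
  set T := t₂ + 2 with hT
  have hT0 : 0 < T := by linarith
  -- Continuity is known on `[0, ∞)` only; a constant extension to negative times makes the
  -- approximate identity applicable.
  set ν : ℝ → ℝ := fun t => μ (max t 0) with hν
  have hνc : Continuous ν :=
    hμ.comp_continuous (continuous_id.max continuous_const) fun t => mem_Ici.2 (le_max_right t 0)
  have hνμ : ∀ t, 0 ≤ t → ν t = μ t := fun t ht => by simp only [hν, max_eq_left ht]
  -- Smooth approximations of the indicator of `(t₁, t₂]`, with support in `[t₁, t₂ + 1]`; this
  -- explains the choice `T = t₂ + 2`.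
  set θ : ℕ → ℝ → ℝ := fun n t => ramp t₁ n t - ramp t₂ n t with hθ
  have hz : ∀ n, ∀ t ∉ Icc t₁ (t₂ + 1), θ n t = 0 := fun n t ht => by
    rcases lt_or_ge t t₁ with h | h
    · simp only [hθ, ramp_eq_zero h.le, ramp_eq_zero (h.le.trans h12), sub_zero]
    · have h1 : t₂ + 1 < t := by by_contra h2; exact ht ⟨h, not_lt.1 h2⟩
      have hn := Nat.cast_nonneg (α := ℝ) n
      simp only [hθ]
      rw [ramp_eq_one (by nlinarith), ramp_eq_one (by nlinarith), sub_self]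
  have hts : ∀ n, tsupport (θ n) ⊆ Icc t₁ (t₂ + 1) := fun n =>
    closure_minimal (fun t ht => by_contra fun h => ht (hz n t h)) isClosed_Icc
  have hsub : Icc t₁ (t₂ + 1) ⊆ Ioo 0 T := fun t ht => ⟨by linarith [ht.1], by linarith [ht.2]⟩
  have hder : ∀ n t, deriv (θ n) t = deriv (ramp t₁ n) t - deriv (ramp t₂ n) t := fun n t =>
    deriv_fun_sub ((contDiff_ramp _ n).differentiable (by simp) t)
      ((contDiff_ramp _ n).differentiable (by simp) t)
  have hdz : ∀ c n, Continuous (deriv (ramp c n)) ∧ HasCompactSupport (deriv (ramp c n)) :=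
    fun c n => by
    refine ⟨(contDiff_ramp c n).continuous_deriv (by simp),
      HasCompactSupport.intro (isCompact_Icc (a := c) (b := c + 1)) fun t ht => ?_⟩
    have hn := Nat.cast_nonneg (α := ℝ) n
    rw [deriv_ramp, deriv_smoothTransition_eq_zero, mul_zero]
    rintro ⟨h1, h2⟩
    refine ht ⟨?_, ?_⟩
    · by_contra h; nlinarith
    · by_contra h; nlinarith
  have key : ∀ n, -((∫ t, ν t * deriv (ramp t₁ n) t) - ∫ t, ν t * deriv (ramp t₂ n) t) =
      ∫ t in Ioo 0 T, θ n t * Λ t := fun n => by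
    rw [← hw T hT0 (θ n) ((contDiff_ramp _ n).sub (contDiff_ramp _ n))
      (HasCompactSupport.of_support_subset_isCompact isCompact_Icc
        ((subset_tsupport _).trans (hts n))) ((hts n).trans hsub)]
    congr 1
    have hi : ∀ c, Integrable fun t => ν t * deriv (ramp c n) t := fun c =>
      (hνc.mul (hdz c n).1).integrable_of_hasCompactSupport (hdz c n).2.mul_left
    rw [← integral_sub (hi t₁) (hi t₂)]
    rw [← setIntegral_eq_integral_of_forall_compl_eq_zero (s := Ioo 0 T)]
    · refine setIntegral_congr_fun measurableSet_Ioo fun t ht => ?_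
      simp only [hder, hνμ t ht.1.le]; ring
    · intro t ht
      have h1 : deriv (θ n) t = 0 := by
        by_contra h
        exact ht (hsub (hts n (support_deriv_subset (f := θ n) h)))
      rw [← mul_sub, ← hder, h1, mul_zero]
  have l1 : Tendsto (fun n => -((∫ t, ν t * deriv (ramp t₁ n) t) - ∫ t, ν t * deriv (ramp t₂ n) t))
      atTop (𝓝 (-(ν t₁ - ν t₂))) :=
    ((tendsto_integral_deriv_ramp hνc t₁).sub (tendsto_integral_deriv_ramp hνc t₂)).neg
  have l2 : Tendsto (fun n => ∫ t in Ioo 0 T, θ n t * Λ t) atTop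
      (𝓝 (∫ t in Ioo 0 T, ((Ioi t₁).indicator 1 t - (Ioi t₂).indicator 1 t) * Λ t)) := by
    refine tendsto_integral_of_dominated_convergence (fun t => 1 * ‖Λ t‖) (fun n => ?_)
      ((hΛ T hT0).norm.const_mul 1) (fun n => ae_of_all _ fun t => ?_) (ae_of_all _ fun t => ?_)
    · exact (((contDiff_ramp _ n).continuous.sub (contDiff_ramp _ n).continuous).aestronglyMeasurable).mul
        (hΛ T hT0).aestronglyMeasurable
    · rw [norm_mul]
      gcongr
      rw [Real.norm_eq_abs, abs_le]
      have := Real.smoothTransition.nonneg ((n + 1) * (t - t₁))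
      have := Real.smoothTransition.nonneg ((n + 1) * (t - t₂))
      have := Real.smoothTransition.le_one ((n + 1) * (t - t₁))
      have := Real.smoothTransition.le_one ((n + 1) * (t - t₂))
      simp only [hθ, ramp]
      constructor <;> linarith
    · exact ((tendsto_ramp t₁ t).sub (tendsto_ramp t₂ t)).mul_const _
  simp only [key] at l1
  have h := tendsto_nhds_unique l1 l2
  rw [hνμ t₁ h0.le, hνμ t₂ (h0.le.trans h12)] at h
  have e : ∫ t in Ioo 0 T, ((Ioi t₁).indicator 1 t - (Ioi t₂).indicator 1 t) * Λ t =
      ∫ t in t₁..t₂, Λ t := by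
    rw [intervalIntegral.integral_of_le h12, ← integral_indicator measurableSet_Ioo,
      ← integral_indicator measurableSet_Ioc]
    congr 1; ext t
    by_cases ht : t ∈ Ioc t₁ t₂
    · have h1 : t ∈ Ioo 0 T := ⟨by linarith [ht.1], by linarith [ht.2]⟩
      have h2 : t ∉ Ioi t₂ := not_lt.2 ht.2
      rw [indicator_of_mem h1, indicator_of_mem ht, indicator_of_mem (mem_Ioi.2 ht.1),
        indicator_of_notMem h2]
      simp
    · rw [indicator_of_notMem ht]
      refine indicator_apply_eq_zero.2 fun _ => ?_
      rcases le_or_gt t t₁ with h1 | h1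
      · have a1 : t ∉ Ioi t₁ := not_lt.2 h1
        have a2 : t ∉ Ioi t₂ := not_lt.2 (h1.trans h12)
        rw [indicator_of_notMem a1, indicator_of_notMem a2]
        simp
      · have h2 : t₂ < t := by by_contra h3; exact ht ⟨h1, not_lt.1 h3⟩
        rw [indicator_of_mem (mem_Ioi.2 h1), indicator_of_mem (mem_Ioi.2 h2)]
        simp
  rw [e] at h
  linarith

/-- Fatou's lemma for functions dominated from above by a convergent sequence. -/
lemma le_integral_of_tendsto_of_le {α : Type*} [MeasurableSpace α] {μ : Measure α}
    [IsFiniteMeasure μ] {g h : ℕ → α → ℝ} {H : α → ℝ} {C D : ℝ} (hg : ∀ n, Integrable (g n) μ)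
    (hgh : ∀ n, ∀ᵐ t ∂μ, g n t ≤ h n t) (hC : ∀ n, ∀ᵐ t ∂μ, h n t ≤ C)
    (hlim : ∀ᵐ t ∂μ, Tendsto (fun n => h n t) atTop (𝓝 (H t)))
    (hD : Tendsto (fun n => ∫ t, g n t ∂μ) atTop (𝓝 D)) (hH : Integrable H μ) :
    D ≤ ∫ t, H t ∂μ := by
  have hC' := ae_all_iff.2 hC
  have hgh' := ae_all_iff.2 hgh
  -- Fatou is applied to `C - g n`, which dominates `C - h n`; only the latter has a pointwise
  -- limit, the former needs just convergent integrals.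
  have hgC : ∀ n, 0 ≤ᵐ[μ] fun t => C - g n t := fun n => by
    filter_upwards [hgh n, hC n] with t h1 h2
    simp only [Pi.zero_apply]; linarith
  have hHC : 0 ≤ᵐ[μ] fun t => C - H t := by
    filter_upwards [hlim, hC'] with t h1 h2
    have := le_of_tendsto h1 (Eventually.of_forall h2)
    simp only [Pi.zero_apply]; linarith
  have i1 : ∀ n, Integrable (fun t => C - g n t) μ := fun n => (integrable_const C).sub (hg n)
  have i2 : Integrable (fun t => C - H t) μ := (integrable_const C).sub hH
  have e1 : ∀ n, ∫⁻ t, ENNReal.ofReal (C - g n t) ∂μ = ENNReal.ofReal (C * μ.real univ - ∫ t, g n t ∂μ) :=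
    fun n => by
    rw [← ofReal_integral_eq_lintegral_ofReal (i1 n) (hgC n), integral_sub (integrable_const C) (hg n),
      integral_const, smul_eq_mul, mul_comm]
  have e2 : ∫⁻ t, ENNReal.ofReal (C - H t) ∂μ = ENNReal.ofReal (C * μ.real univ - ∫ t, H t ∂μ) := by
    rw [← ofReal_integral_eq_lintegral_ofReal i2 hHC, integral_sub (integrable_const C) hH,
      integral_const, smul_eq_mul, mul_comm]
  have fatou := lintegral_liminf_le' (μ := μ) (u := atTop)
    (f := fun n t => ENNReal.ofReal (C - g n t))
    fun n => (i1 n).aestronglyMeasurable.aemeasurable.ennreal_ofReal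
  have lim : Tendsto (fun n => ∫⁻ t, ENNReal.ofReal (C - g n t) ∂μ) atTop
      (𝓝 (ENNReal.ofReal (C * μ.real univ - D))) := by
    simp only [e1]
    exact ENNReal.tendsto_ofReal (tendsto_const_nhds.sub hD)
  rw [lim.liminf_eq] at fatou
  have low : ∫⁻ t, ENNReal.ofReal (C - H t) ∂μ ≤
      ∫⁻ t, liminf (fun n => ENNReal.ofReal (C - g n t)) atTop ∂μ := by
    refine lintegral_mono_ae ?_
    filter_upwards [hlim, hgh'] with t h1 h2
    have h3 : Tendsto (fun n => ENNReal.ofReal (C - h n t)) atTop (𝓝 (ENNReal.ofReal (C - H t))) :=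
      ENNReal.tendsto_ofReal (tendsto_const_nhds.sub h1)
    rw [← h3.liminf_eq]
    exact liminf_le_liminf (Eventually.of_forall fun n =>
      ENNReal.ofReal_le_ofReal (by linarith [h2 n]))
  have hDC : 0 ≤ C * μ.real univ - D := by
    refine ge_of_tendsto (tendsto_const_nhds.sub hD) (Eventually.of_forall fun n => ?_)
    have := integral_nonneg_of_ae (hgC n)
    rw [integral_sub (integrable_const C) (hg n), integral_const, smul_eq_mul, mul_comm] at this
    exact this
  have := low.trans fatou
  rw [e2, ENNReal.ofReal_le_ofReal_iff hDC] at this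
  linarith

/-- Chain rule for a power of the primitive of a bounded function. -/
lemma rpow_sub_rpow_eq_integral {g h : ℝ → ℝ} {a b C M p : ℝ} (hab : a ≤ b) (hp : 1 ≤ p)
    (hg : IntervalIntegrable g volume a b) (hgC : ∀ t ∈ Icc a b, |g t| ≤ C)
    (hh : ∀ t ∈ Icc a b, h t - h a = ∫ s in a..t, g s)
    (h0 : ∀ t ∈ Icc a b, 0 ≤ h t ∧ h t ≤ M) :
    h b ^ p - h a ^ p = ∫ t in a..b, p * h t ^ (p - 1) * g t := by
  -- This primitive agrees with `h` on `[a, b]` and is differentiable almost everywhere. Its power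
  -- is Lipschitz there, hence absolutely continuous, so the fundamental theorem of calculus
  -- applies.
  set k : ℝ → ℝ := fun t => h a + ∫ s in a..t, g s with hk
  have hkh : ∀ t ∈ Icc a b, k t = h t := fun t ht => by
    simp only [hk]; linarith [hh t ht]
  have hM : 0 ≤ M := (h0 a ⟨le_rfl, hab⟩).1.trans (h0 a ⟨le_rfl, hab⟩).2
  have hC : 0 ≤ C := (abs_nonneg _).trans (hgC a ⟨le_rfl, hab⟩)
  have hp1 : 0 ≤ p - 1 := by linarith
  have hpow : ∀ x ∈ Icc 0 M, ∀ y ∈ Icc 0 M, |y ^ p - x ^ p| ≤ p * M ^ (p - 1) * |y - x| := by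
    intro x hx y hy
    refine (convex_Icc (0 : ℝ) M).norm_image_sub_le_of_norm_hasDerivWithin_le
      (f := fun x : ℝ => x ^ p) (f' := fun x => p * x ^ (p - 1))
      (fun z hz => (Real.hasDerivAt_rpow_const (Or.inr hp)).hasDerivWithinAt) (fun z hz => ?_) hx hy
    rw [Real.norm_of_nonneg (mul_nonneg (by linarith) (Real.rpow_nonneg hz.1 _))]
    have := Real.rpow_le_rpow hz.1 hz.2 hp1
    have : 0 ≤ p := by linarith
    gcongr
  have hlip : LipschitzOnWith (Real.toNNReal (p * M ^ (p - 1) * C)) (fun t => k t ^ p) (uIcc a b) := by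
    rw [uIcc_of_le hab]
    refine LipschitzOnWith.of_dist_le_mul fun x hx y hy => ?_
    have hMp : 0 ≤ M ^ (p - 1) := Real.rpow_nonneg hM _
    have hp0 : 0 ≤ p := by linarith
    rw [Real.coe_toNNReal _ (by positivity), Real.dist_eq, Real.dist_eq, hkh x hx, hkh y hy]
    refine (hpow _ (h0 y hy) _ (h0 x hx)).trans ?_
    rw [mul_assoc (p * M ^ (p - 1))]
    gcongr
    have e : h x - h y = ∫ s in y..x, g s := by
      have hx' := hh x hx
      have hy' := hh y hy
      have i1 : IntervalIntegrable g volume a x :=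
        hg.mono_set (by rw [uIcc_of_le hx.1, uIcc_of_le hab]; exact Icc_subset_Icc_right hx.2)
      have i2 : IntervalIntegrable g volume a y :=
        hg.mono_set (by rw [uIcc_of_le hy.1, uIcc_of_le hab]; exact Icc_subset_Icc_right hy.2)
      rw [← intervalIntegral.integral_interval_sub_left i1 i2]
      linarith
    rw [e, ← Real.norm_eq_abs]
    refine intervalIntegral.norm_integral_le_of_norm_le_const fun s hs => ?_
    refine hgC s ?_
    have := uIoc_subset_uIcc hs
    rw [mem_uIcc] at this
    rcases this with h1 | h1
    · exact ⟨hy.1.trans h1.1, h1.2.trans hx.2⟩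
    · exact ⟨hx.1.trans h1.1, h1.2.trans hy.2⟩
  have hftc := hlip.absolutelyContinuousOnInterval.integral_deriv_eq_sub
  rw [hkh a ⟨le_rfl, hab⟩, hkh b ⟨hab, le_rfl⟩] at hftc
  rw [← hftc]
  refine intervalIntegral.integral_congr_ae ?_
  filter_upwards [hg.ae_hasDerivAt_integral] with t ht htI
  rw [uIoc_of_le hab] at htI
  have htI' : t ∈ Icc a b := Ioc_subset_Icc_self htI
  have hd := ht (by rw [uIcc_of_le hab]; exact htI') a (left_mem_uIcc)
  have hd2 : HasDerivAt k (g t) t := hd.const_add (h a)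
  have := hd2.rpow_const (p := p) (Or.inr hp)
  rw [this.deriv, hkh t htI']; ring
end LFD
end

/-! ### Evolutions and the integrated energy identity for their mollifications. -/

noncomputable section
namespace LFD
open MeasureTheory Set Filter Topology

/-- An evolution whose mollifications solve the mollified equation. The jointly measurable function
`F` is a modification of `f`. -/
structure Ev (γ ε m : ℝ) (f : ℝ → V → ℝ) (F : ℝ × V → ℝ) : Prop where
  adm : ∀ t, 0 < t → Adm ε⁻¹ m (f t)
  smeas : StronglyMeasurable F
  ae : ∀ᵐ t : ℝ, 0 < t → (fun v => F (t, v)) =ᵐ[volume] f t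
  step : ∀ δ, 0 < δ → ∀ x t₁ t₂, 0 < t₁ → t₁ ≤ t₂ →
    mu (f t₂) δ x - mu (f t₁) δ x = ∫ t in t₁..t₂, mL γ ε (f t) δ x

section
variable {γ ε m δ p ρ Λ K : ℝ} {f : ℝ → V → ℝ} {F : ℝ × V → ℝ} {ζ : V → ℝ} {A : Set V}

lemma ae_restrict_of_pos {P : ℝ → Prop} (h : ∀ᵐ t : ℝ, 0 < t → P t) {t₁ t₂ : ℝ} (h0 : 0 < t₁) :
    ∀ᵐ t ∂(volume.restrict (Ioc t₁ t₂)), P t := by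
  filter_upwards [ae_restrict_of_ae h, ae_restrict_mem measurableSet_Ioc] with t h1 h2
  exact h1 (h0.trans h2.1)

lemma mLm_eq_mL {g : V → ℝ} (hg : Adm ε⁻¹ m g) (hε : 0 < ε) (hγ : -2 < γ) (hγ0 : γ < 0)
    (hδ : 0 < δ) : mLm γ ε g δ = mL γ ε g δ := by
  ext x; rw [mL_eq hg hε hγ hγ0 hδ]; rfl

/-- The time derivative of the localised norm of the mollification. -/
def dEn (γ ε p δ : ℝ) (ζ g : V → ℝ) : ℝ :=
  ∫ x, p * (ζ x ^ 2 * mu g δ x ^ (p - 1)) * mL γ ε g δ x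

/-- For each fixed `x` the mollified density is Lipschitz in time, so the chain rule for its power
holds; Fubini on the support of the cutoff turns this into an identity for the integrals. -/
lemma Ev.energy_identity (hE : Ev γ ε m f F) (hε : 0 < ε) (hγ : -2 < γ) (hγ0 : γ < 0)
    (hp : 2 ≤ p) (hδ : 0 < δ) (hζ : Cutoff ζ A ρ Λ) {t₁ t₂ : ℝ} (h0 : 0 < t₁) (h12 : t₁ ≤ t₂) :
    Integrable (fun t => dEn γ ε p δ ζ (f t)) (volume.restrict (Ioc t₁ t₂)) ∧
    (∫ x, ζ x ^ 2 * mu (f t₂) δ x ^ p) - ∫ x, ζ x ^ 2 * mu (f t₁) δ x ^ p =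
      ∫ t in Ioc t₁ t₂, dEn γ ε p δ ζ (f t) := by
  set μ := (volume : Measure ℝ).restrict (Ioc t₁ t₂) with hμ
  -- Built from the modification `F`, to have joint measurability for Fubini; at almost every time
  -- of the interval it equals the integrand formed with `f t`.
  set G : ℝ × V → ℝ := fun q => p * (ζ q.2 ^ 2 * mu (fun v => F (q.1, v)) δ q.2 ^ (p - 1)) *
    mLm γ ε (fun v => F (q.1, v)) δ q.2 with hG
  have hGm : StronglyMeasurable G := by
    have h1 : StronglyMeasurable fun q : ℝ × V => ζ q.2 :=
      hζ.contDiff_one.continuous.stronglyMeasurable.comp_measurable measurable_snd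
    have h2 := (stronglyMeasurable_mu (δ := δ) hE.smeas).measurable.pow_const (p - 1)
    exact (((h1.pow 2).mul h2.stronglyMeasurable).const_mul p).mul (stronglyMeasurable_mLm hγ hE.smeas)
  have hae : ∀ᵐ t ∂μ, ∀ x, G (t, x) = p * (ζ x ^ 2 * mu (f t) δ x ^ (p - 1)) * mL γ ε (f t) δ x := by
    filter_upwards [ae_restrict_of_pos hE.ae h0, ae_restrict_mem measurableSet_Ioc] with t h1 h2 x
    simp only [hG, mu_congr h1, mLm_congr h1,
      mLm_eq_mL (hE.adm t (h0.trans h2.1)) hε hγ hγ0 hδ]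
  set B : ℝ := p * (1 * ε⁻¹ ^ (p - 1)) * (mLB ε m δ * (1 + ρ) ^ 2) with hB
  have hbd : ∀ g, Adm ε⁻¹ m g → ∀ x, ‖p * (ζ x ^ 2 * mu g δ x ^ (p - 1)) * mL γ ε g δ x‖ ≤
      (Metric.closedBall (0 : V) ρ).indicator (fun _ => B) x := fun g hg x => by
    by_cases hx : x ∈ Metric.closedBall (0 : V) ρ
    · rw [indicator_of_mem hx, norm_mul, hB]
      obtain ⟨u0, u1⟩ := mu_bounds hg hδ x
      have n1 : 0 ≤ mu g δ x ^ (p - 1) := Real.rpow_nonneg u0 _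
      have hp0 : 0 ≤ p := by linarith
      have hLB := abs_mL_le hg hε hγ hγ0 hδ x
      have hLB0 : 0 ≤ mLB ε m δ :=
        nonneg_of_mul_nonneg_left ((abs_nonneg _).trans hLB) (pow_pos (bracket_pos x) 2)
      have hbx : bracket x ≤ 1 + ρ := (bracket_le_one_add_norm x).trans (by
        rw [mem_closedBall_zero_iff] at hx; linarith)
      have hεi : 0 ≤ ε⁻¹ := (inv_pos.2 hε).le
      rw [Real.norm_of_nonneg (by positivity)]
      refine mul_le_mul ?_ (hLB.trans ?_) (norm_nonneg _) (by positivity)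
      · gcongr
        · exact pow_le_one₀ (hζ.nonneg x) (hζ.le_one x)
        · linarith
      · have := (bracket_pos x).le
        gcongr
    · rw [indicator_of_notMem hx, hζ.zero x hx]; simp
  have hind : Integrable ((Metric.closedBall (0 : V) ρ).indicator fun _ => B) :=
    (integrable_indicator_iff measurableSet_closedBall).2
      (integrableOn_const measure_closedBall_lt_top.ne)
  have hGi : Integrable G (μ.prod volume) := by
    have h1 : Integrable (fun q : ℝ × V => (fun _ : ℝ => (1 : ℝ)) q.1 *
        (Metric.closedBall (0 : V) ρ).indicator (fun _ => B) q.2) (μ.prod volume) :=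
      (integrable_const 1).mul_prod hind
    refine h1.mono' hGm.aestronglyMeasurable ?_
    have h2 : ∀ᵐ t ∂μ, ∀ x, ‖G (t, x)‖ ≤ (Metric.closedBall (0 : V) ρ).indicator (fun _ => B) x := by
      filter_upwards [hae, ae_restrict_mem measurableSet_Ioc] with t h1 h2 x
      rw [h1 x]; exact hbd _ (hE.adm t (h0.trans h2.1)) x
    filter_upwards [Measure.quasiMeasurePreserving_fst.ae h2] with q hq
    rw [one_mul]; exact hq q.2
  have e1 : (fun t => ∫ x, G (t, x)) =ᵐ[μ] fun t => dEn γ ε p δ ζ (f t) := by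
    filter_upwards [hae] with t ht
    exact integral_congr_ae (ae_of_all _ ht)
  refine ⟨hGi.integral_prod_left.congr e1, ?_⟩
  rw [← integral_congr_ae e1, integral_integral_swap (f := fun t x => G (t, x)) hGi]
  have hc : ∀ t, 0 < t → Integrable fun x => ζ x ^ 2 * mu (f t) δ x ^ p := fun t ht => by
    have c : Continuous fun x => ζ x ^ 2 * mu (f t) δ x ^ p :=
      (hζ.contDiff_one.continuous.pow 2).mul ((contDiff_mu (hE.adm t ht) hδ).continuous.rpow_const
        fun x => Or.inr (by linarith))
    refine c.integrable_of_hasCompactSupport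
      (HasCompactSupport.intro (isCompact_closedBall 0 ρ) fun x hx => ?_)
    simp [hζ.zero x hx]
  rw [← integral_sub (hc t₂ (h0.trans_le h12)) (hc t₁ h0)]
  congr 1; ext x
  rw [← mul_sub]
  have hgi : Integrable (fun t => mL γ ε (f t) δ x) μ := by
    have hm : AEStronglyMeasurable (fun t => mL γ ε (f t) δ x) μ := by
      refine ((stronglyMeasurable_mLm (δ := δ) (ε := ε) hγ hE.smeas).comp_measurable
        (measurable_prodMk_right (y := x))).aestronglyMeasurable.congr ?_
      filter_upwards [ae_restrict_of_pos hE.ae h0, ae_restrict_mem measurableSet_Ioc] with t h1 h2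
      simp only [Function.comp_apply, mLm_congr h1,
        mLm_eq_mL (hE.adm t (h0.trans h2.1)) hε hγ hγ0 hδ]
    refine (integrable_const (mLB ε m δ * bracket x ^ 2)).mono' hm ?_
    filter_upwards [ae_restrict_mem measurableSet_Ioc] with t h2
    exact abs_mL_le (hE.adm t (h0.trans h2.1)) hε hγ hγ0 hδ x
  have hpow := rpow_sub_rpow_eq_integral (g := fun t => mL γ ε (f t) δ x)
    (h := fun t => mu (f t) δ x) (C := mLB ε m δ * bracket x ^ 2) (M := ε⁻¹) h12
    (p := p) (by linarith)
    ((intervalIntegrable_iff_integrableOn_Ioc_of_le h12).2 hgi)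
    (fun t ht => abs_mL_le (hE.adm t (h0.trans_le ht.1)) hε hγ hγ0 hδ x)
    (fun t ht => hE.step δ hδ x t₁ t h0 ht.1)
    (fun t ht => mu_bounds (hE.adm t (h0.trans_le ht.1)) hδ x)
  rw [hpow, intervalIntegral.integral_of_le h12, ← integral_const_mul]
  refine integral_congr_ae ?_
  filter_upwards [hae] with t ht
  rw [ht x]; ring

lemma integral_cutoff_tendsto {g : V → ℝ} (hg : Adm ε⁻¹ m g) (hε : 0 < ε) (hγ : -2 < γ) (hγ0 : γ < 0)
    (hp : 2 ≤ p) (hζ : Cutoff ζ A ρ Λ) :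
    Tendsto (fun n => ∫ x, ζ x ^ 2 * mu g (ηs n) x ^ p) atTop (𝓝 (∫ x, ζ x ^ 2 * g x ^ p)) := by
  have hp0 : 0 ≤ p := by linarith
  refine tendsto_integral_of_bound_of_support (ρ := ρ) (C := 1 ^ 2 * ε⁻¹ ^ p)
    (fun n => ((hζ.contDiff_one.continuous.pow 2).mul ((contDiff_mu hg (ηs_pos n)).continuous.rpow_const
      fun x => Or.inr hp0)).aestronglyMeasurable) (fun n x => ?_)
    (fun n x hx => by simp [hζ.zero x hx]) ?_
  · obtain ⟨u0, u1⟩ := mu_bounds hg (ηs_pos n) x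
    rw [abs_mul, abs_pow, abs_of_nonneg (hζ.nonneg x), abs_of_nonneg (Real.rpow_nonneg u0 _)]
    have := hζ.nonneg x
    have := Real.rpow_nonneg u0 p
    gcongr
    exact hζ.le_one x
  · filter_upwards [tendsto_mu_mE hg hε hγ hγ0] with x hx
    exact (hx.1.rpow_const (Or.inr hp0)).const_mul _

lemma enH_congr {k₁ k₂ k₃ : ℝ} {g g' : V → ℝ} (h : g =ᵐ[volume] g') :
    enH γ p k₁ k₂ k₃ A ζ g = enH γ p k₁ k₂ k₃ A ζ g' := by
  unfold enH wL6
  congr 1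
  · congr 1
    · congr 2; exact integral_congr_ae (by filter_upwards [h] with x hx; rw [hx])
    · congr 1; exact integral_congr_ae (by filter_upwards [h] with x hx; rw [hx])
  · congr 1; exact integral_congr_ae (by filter_upwards [h] with x hx; rw [hx])

lemma stronglyMeasurable_enH (hF : StronglyMeasurable F) (hζ : Cutoff ζ A ρ Λ) (k₁ k₂ k₃ : ℝ) :
    Measurable fun t => enH γ p k₁ k₂ k₃ A ζ fun v => F (t, v) := by
  have hζm : StronglyMeasurable fun q : ℝ × V => ζ q.2 :=
    hζ.contDiff_one.continuous.stronglyMeasurable.comp_measurable measurable_snd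
  have hb : ∀ s : ℝ, StronglyMeasurable fun q : ℝ × V => bracket q.2 ^ s := fun s =>
    (contDiff_bracket_rpow s (n := 0)).continuous.stronglyMeasurable.comp_measurable measurable_snd
  have hA : StronglyMeasurable fun q : ℝ × V => A.indicator (1 : V → ℝ) q.2 :=
    (stronglyMeasurable_one.indicator hζ.meas).comp_measurable measurable_snd
  have hr : ∀ s : ℝ, StronglyMeasurable fun q : ℝ × V => F q ^ s := fun s =>
    (hF.measurable.pow_const s).stronglyMeasurable
  have m1 : StronglyMeasurable fun t => ∫ x, (bracket x ^ (γ / 2) * (ζ x * F (t, x) ^ (p / 2))) ^ 6 :=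
    StronglyMeasurable.integral_prod_right'
      (f := fun q : ℝ × V => (bracket q.2 ^ (γ / 2) * (ζ q.2 * F q ^ (p / 2))) ^ 6)
      (((hb _).mul (hζm.mul (hr _))).pow 6)
  have m2 : StronglyMeasurable fun t => ∫ x, bracket x ^ γ * (ζ x ^ 2 * F (t, x) ^ p) :=
    StronglyMeasurable.integral_prod_right'
      (f := fun q : ℝ × V => bracket q.2 ^ γ * (ζ q.2 ^ 2 * F q ^ p))
      ((hb _).mul ((hζm.pow 2).mul (hr _)))
  have m3 : StronglyMeasurable fun t => ∫ x, A.indicator 1 x * F (t, x) ^ p :=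
    StronglyMeasurable.integral_prod_right'
      (f := fun q : ℝ × V => A.indicator 1 q.2 * F q ^ p) (hA.mul (hr _))
  exact (((m1.measurable.pow_const _).const_mul _).add (m2.measurable.const_mul _)).add
    (m3.measurable.const_mul _)
end
end LFD
end

/-! ### The energy inequality for the solution itself: localised, and after removal of the cutoff.
-/

noncomputable section
namespace LFD
open MeasureTheory Set Filter Topology

section
variable {γ ε m p ρ Λ K r k₁ k₂ k₃ : ℝ} {f : ℝ → V → ℝ} {F : ℝ × V → ℝ} {g ζ : V → ℝ} {A : Set V}

/-- Interpolation of mass with the sup bound. The constant degenerates as `ε → 0`, so it serves only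
for finiteness and domination. -/
lemma Adm.rpow_bounds (hg : Adm ε⁻¹ m g) (hε : 0 < ε) {q : ℝ} (hq : 1 ≤ q) :
    Integrable (fun x => g x ^ q) ∧ ∫ x, g x ^ q ≤ ε⁻¹ ^ (q - 1) * m := by
  have hle : ∀ x, g x ^ q ≤ ε⁻¹ ^ (q - 1) * g x := fun x => by
    have h0 := hg.nonneg x
    have : g x ^ q = g x ^ (q - 1) * g x := by
      rw [← Real.rpow_add_one' h0 (by linarith)]; congr 1; ring
    rw [this]
    have := Real.rpow_le_rpow h0 (hg.le x) (by linarith : 0 ≤ q - 1)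
    gcongr
  have hi : Integrable fun x => ε⁻¹ ^ (q - 1) * g x := hg.integrable.const_mul _
  have hn : ∀ x, 0 ≤ g x ^ q := fun x => Real.rpow_nonneg (hg.nonneg x) _
  have hi2 : Integrable fun x => g x ^ q :=
    hi.mono' (hg.meas.aemeasurable.pow_const q).aestronglyMeasurable
      (ae_of_all _ fun x => by rw [Real.norm_of_nonneg (hn x)]; exact hle x)
  refine ⟨hi2, (integral_mono hi2 hi hle).trans ?_⟩
  rw [integral_const_mul]
  have := hg.integral_le
  have : 0 ≤ ε⁻¹ ^ (q - 1) := Real.rpow_nonneg (inv_pos.2 hε).le _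
  gcongr

lemma rpow_half_pow_six {t : ℝ} (ht : 0 ≤ t) (p : ℝ) : (t ^ (p / 2)) ^ 6 = t ^ (3 * p) := by
  rw [← Real.rpow_natCast, ← Real.rpow_mul ht]; congr 1; push_cast; ring

lemma integrand_six_le (hγ0 : γ < 0) {z t : ℝ} (hz : 0 ≤ z) (hz1 : z ≤ 1) (ht : 0 ≤ t) (x : V) :
    0 ≤ (bracket x ^ (γ / 2) * (z * t ^ (p / 2))) ^ 6 ∧
      (bracket x ^ (γ / 2) * (z * t ^ (p / 2))) ^ 6 ≤ t ^ (3 * p) := by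
  have h1 := Real.rpow_nonneg (bracket_pos x).le (γ / 2)
  have h2 : bracket x ^ (γ / 2) ≤ 1 :=
    Real.rpow_le_one_of_one_le_of_nonpos (one_le_bracket x) (by linarith)
  have h3 := Real.rpow_nonneg ht (p / 2)
  refine ⟨by positivity, ?_⟩
  rw [← rpow_half_pow_six ht]
  refine pow_le_pow_left₀ (by positivity) ?_ 6
  calc _ ≤ 1 * (1 * t ^ (p / 2)) := by gcongr
    _ = _ := by ring

lemma weight_cutoff_le (hγ0 : γ < 0) {z t : ℝ} (hz : 0 ≤ z) (hz1 : z ≤ 1) (ht : 0 ≤ t) (x : V) :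
    0 ≤ bracket x ^ γ * (z ^ 2 * t ^ p) ∧ bracket x ^ γ * (z ^ 2 * t ^ p) ≤ t ^ p := by
  have h1 := Real.rpow_nonneg (bracket_pos x).le γ
  have h3 := Real.rpow_nonneg ht p
  refine ⟨by positivity, ?_⟩
  calc _ ≤ 1 * (1 * t ^ p) := by
        gcongr
        · exact bracket_rpow_le_one hγ0 x
        · exact pow_le_one₀ hz hz1
    _ = _ := by ring

/-- Two-sided bounds for the right-hand side, uniform in the cutoff. -/
lemma enH_bounds (hg : Adm ε⁻¹ m g) (hε : 0 < ε) (hγ0 : γ < 0) (hp : 2 ≤ p)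
    (hζ : Cutoff ζ A ρ Λ) (hk₁ : 0 ≤ k₁) (hk₂ : 0 ≤ k₂) (hk₃ : 0 ≤ k₃) :
    |enH γ p k₁ k₂ k₃ A ζ g| ≤
      k₁ * (ε⁻¹ ^ (3 * p - 1) * m) ^ (1 / 3 : ℝ) + (k₂ + k₃) * (ε⁻¹ ^ (p - 1) * m) := by
  obtain ⟨i1, b1⟩ := hg.rpow_bounds hε (q := 3 * p) (by linarith)
  obtain ⟨i2, b2⟩ := hg.rpow_bounds hε (q := p) (by linarith)
  have s := fun x => integrand_six_le (γ := γ) (p := p) hγ0 (hζ.nonneg x) (hζ.le_one x) (hg.nonneg x) x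
  have t := fun x => weight_cutoff_le (γ := γ) (p := p) hγ0 (hζ.nonneg x) (hζ.le_one x) (hg.nonneg x) x
  have n1 : 0 ≤ wL6 γ (fun x => ζ x * g x ^ (p / 2)) := wL6_nonneg _ _
  have u1 : wL6 γ (fun x => ζ x * g x ^ (p / 2)) ≤ (ε⁻¹ ^ (3 * p - 1) * m) ^ (1 / 3 : ℝ) := by
    refine Real.rpow_le_rpow (integral_nonneg fun x => (s x).1) ?_ (by norm_num)
    refine (integral_mono_of_nonneg (ae_of_all _ fun x => (s x).1) i1
      (ae_of_all _ fun x => (s x).2)).trans b1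
  have n2 : 0 ≤ ∫ x, bracket x ^ γ * (ζ x ^ 2 * g x ^ p) := integral_nonneg fun x => (t x).1
  have u2 : ∫ x, bracket x ^ γ * (ζ x ^ 2 * g x ^ p) ≤ ε⁻¹ ^ (p - 1) * m :=
    (integral_mono_of_nonneg (ae_of_all _ fun x => (t x).1) i2 (ae_of_all _ fun x => (t x).2)).trans b2
  have v : ∀ x, 0 ≤ A.indicator 1 x * g x ^ p ∧ A.indicator 1 x * g x ^ p ≤ g x ^ p := fun x => by
    have h1 : 0 ≤ A.indicator (1 : V → ℝ) x := indicator_nonneg (fun _ _ => zero_le_one) x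
    have h2 := (le_abs_self _).trans (abs_indicator_one_le A x)
    have h3 := Real.rpow_nonneg (hg.nonneg x) p
    exact ⟨mul_nonneg h1 h3, mul_le_of_le_one_left h3 h2⟩
  have n3 : 0 ≤ ∫ x, A.indicator 1 x * g x ^ p := integral_nonneg fun x => (v x).1
  have u3 : ∫ x, A.indicator 1 x * g x ^ p ≤ ε⁻¹ ^ (p - 1) * m :=
    (integral_mono_of_nonneg (ae_of_all _ fun x => (v x).1) i2 (ae_of_all _ fun x => (v x).2)).trans b2
  have a1 := mul_le_mul_of_nonneg_left u1 hk₁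
  have a2 := mul_le_mul_of_nonneg_left u2 hk₂
  have a3 := mul_le_mul_of_nonneg_left u3 hk₃
  have c1 := mul_nonneg hk₁ n1
  have c2 := mul_nonneg hk₂ n2
  have c3 := mul_nonneg hk₃ n3
  have d2 := c2.trans a2
  have d3 := c3.trans a3
  have d1 := c1.trans a1
  unfold enH
  rw [abs_le]
  constructor <;> nlinarith

/-- The localised energy inequality. -/
lemma Ev.energy_local (hE : Ev γ ε m f F) (hε : 0 < ε) (hγ : -2 < γ) (hγ0 : γ < 0)
    (hp : 2 ≤ p) (hζ : Cutoff ζ A ρ Λ) (hρ : 0 ≤ ρ) (hK : 0 < K)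
    (hco : ∀ t, 0 < t → ∀ x ξ : V, K * bracket x ^ γ * ‖ξ‖ ^ 2 ≤
      ∑ i, ∑ j, Sm γ (fl ε (f t)) i j x * ξ i * ξ j) (hr : 0 < r) (hr1 : r ≤ 1)
    (hrK : 24 * (p - 1) * m * (radC (3 * γ / 2) ^ (2 / 3 : ℝ) * r ^ (2 + γ)) ≤ K / (12 * sobC))
    {t₁ t₂ : ℝ} (h0 : 0 < t₁) (h12 : t₁ ≤ t₂) :
    AEStronglyMeasurable (fun t => enH γ p (K / (12 * sobC)) (3 / 2 * K + 24 * (p - 1) * m * r⁻¹ ^ 2)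
        (cutC p K Λ ε⁻¹ m) A ζ (f t)) (volume.restrict (Ioc t₁ t₂)) ∧
    (∫ x, ζ x ^ 2 * f t₂ x ^ p) - ∫ x, ζ x ^ 2 * f t₁ x ^ p ≤
      ∫ t in Ioc t₁ t₂, enH γ p (K / (12 * sobC)) (3 / 2 * K + 24 * (p - 1) * m * r⁻¹ ^ 2)
        (cutC p K Λ ε⁻¹ m) A ζ (f t) := by
  have hpos : ∀ᵐ t ∂(volume.restrict (Ioc t₁ t₂)), 0 < t := by
    filter_upwards [ae_restrict_mem measurableSet_Ioc] with t ht using h0.trans ht.1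
  have hm0 : 0 ≤ m := (hE.adm t₁ h0).m_nonneg
  have hgr := (hE.adm t₁ h0).growC_nonneg
  have hΛ := hζ.const_nonneg
  have hsC := sobC_pos
  have hp1 : 0 ≤ p - 1 := by linarith
  have hp0 : 0 ≤ p := by linarith
  set k₁ := K / (12 * sobC) with hk₁
  set k₂ := 3 / 2 * K + 24 * (p - 1) * m * r⁻¹ ^ 2 with hk₂
  set k₃ := cutC p K Λ ε⁻¹ m with hk₃
  have k₁0 : 0 ≤ k₁ := by positivity
  have k₂0 : 0 ≤ k₂ := by positivity
  have k₃0 : 0 ≤ k₃ := by rw [hk₃, cutC]; positivity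
  have hmeas : AEStronglyMeasurable (fun t => enH γ p k₁ k₂ k₃ A ζ (f t))
      (volume.restrict (Ioc t₁ t₂)) := by
    refine (stronglyMeasurable_enH (γ := γ) (p := p) hE.smeas hζ k₁ k₂ k₃).aestronglyMeasurable.congr ?_
    filter_upwards [ae_restrict_of_pos hE.ae h0] with t ht using enH_congr ht
  refine ⟨hmeas, ?_⟩
  have hδ1 : ∀ n, ηs n ≤ 1 := fun n => by
    unfold ηs; rw [div_le_one (by positivity)]; linarith [Nat.cast_nonneg (α := ℝ) n]
  -- The integrals of `g` are increments given exactly by the energy identity and converge to the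
  -- increment for `f`. The majorant `h` comes from `energy_ineq`; it is bounded above uniformly in
  -- `δ`, and its flux error disappears in the limit.
  refine le_integral_of_tendsto_of_le
    (g := fun n t => dEn γ ε p (ηs n) ζ (f t))
    (h := fun n t => enH γ p k₁ k₂ k₃ A ζ (mu (f t) (ηs n))
      + ∫ x, errD γ ε p K Λ A ζ (f t) (ηs n) x)
    (C := (k₂ + k₃) * (ε⁻¹ ^ p * (volume : Measure V).real (Metric.closedBall 0 ρ)) +
      errB γ ε m p K Λ ρ * (volume : Measure V).real (Metric.closedBall 0 ρ))
    (fun n => (hE.energy_identity hε hγ hγ0 hp (ηs_pos n) hζ h0 h12).1) (fun n => ?_) (fun n => ?_)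
    ?_ ?_ ?_
  · filter_upwards [hpos] with t ht
    exact energy_ineq (hE.adm t ht) hε hγ hγ0 hp hK hζ (ηs_pos n) (hδ1 n) hρ (hco t ht) hr hr1 hrK
  · filter_upwards [hpos] with t ht
    have hf := hE.adm t ht
    refine add_le_add (enH_le hf hε hγ0 hp hζ k₁0 k₂0 k₃0 (ηs_pos n)) ?_
    exact integral_le_of_bound_of_support (aesm_errD hf hε hγ hγ0 hp hζ (ηs_pos n))
      (fun x => abs_errD_le hf hε hγ hγ0 hp hK hζ (ηs_pos n) (hδ1 n) x hρ)
      (fun x hx => errD_eq_zero hζ hx)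
  · filter_upwards [hpos] with t ht
    have hf := hE.adm t ht
    have := (tendsto_enH hf hε hγ hγ0 hp hζ k₁ k₂ k₃).add
      (tendsto_integral_errD hf hε hγ hγ0 hp hK hζ hρ)
    rwa [add_zero] at this
  · have := (integral_cutoff_tendsto (hE.adm t₂ (h0.trans_le h12)) hε hγ hγ0 hp hζ).sub
      (integral_cutoff_tendsto (hE.adm t₁ h0) hε hγ hγ0 hp hζ)
    refine this.congr fun n => ?_
    exact (hE.energy_identity hε hγ hγ0 hp (ηs_pos n) hζ h0 h12).2
  · refine (integrable_const (k₁ * (ε⁻¹ ^ (3 * p - 1) * m) ^ (1 / 3 : ℝ) +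
      (k₂ + k₃) * (ε⁻¹ ^ (p - 1) * m))).mono' hmeas ?_
    filter_upwards [hpos] with t ht
    exact enH_bounds (hE.adm t ht) hε hγ0 hp hζ k₁0 k₂0 k₃0

/-- The standard bump function. -/
def η₀ : ContDiffBump (0 : V) := ⟨1, 2, one_pos, one_lt_two⟩

lemma exists_bound_η₀ : ∃ C : ℝ, 0 ≤ C ∧ ∀ i x, |pd i η₀ x| ≤ C := by
  have h1 : ContDiff ℝ 1 η₀ := η₀.contDiff
  have hb : ∀ i, ∃ D, ∀ x, ‖pd i η₀ x‖ ≤ D := fun i =>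
    (continuous_pd h1 i).bounded_above_of_compact_support
      (hasCompactSupport_pd η₀.hasCompactSupport i)
  choose D hD using hb
  have hD0 : ∀ i, 0 ≤ D i := fun i => (norm_nonneg _).trans (hD i 0)
  exact ⟨∑ i, D i, Finset.sum_nonneg fun i _ => hD0 i, fun i x =>
    (hD i x).trans (Finset.single_le_sum (fun i _ => hD0 i) (Finset.mem_univ i))⟩

/-- A bound for the gradient of the standard bump function. -/
def Cη : ℝ := exists_bound_η₀.choose
lemma Cη_nonneg : 0 ≤ Cη := exists_bound_η₀.choose_spec.1
lemma pd_η₀_le (i : Fin 3) (x : V) : |pd i η₀ x| ≤ Cη := exists_bound_η₀.choose_spec.2 i x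

/-- The dilated cutoff functions. -/
def ζs (R : ℝ) (x : V) : ℝ := η₀ (R⁻¹ • x)

/-- The annuli carrying the gradient of the cutoff functions. -/
def As (R : ℝ) : Set V := Metric.closedBall 0 (2 * R) \ Metric.ball 0 R

lemma pd_ζs (R : ℝ) (i : Fin 3) (x : V) : pd i (ζs R) x = R⁻¹ * pd i η₀ (R⁻¹ • x) := by
  have hd : DifferentiableAt ℝ η₀ (R⁻¹ • x) := (η₀.contDiff (n := 1)).differentiable (by simp) _
  have h1 : HasFDerivAt (fun y : V => R⁻¹ • y) (R⁻¹ • ContinuousLinearMap.id ℝ V) x :=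
    (hasFDerivAt_id x).const_smul R⁻¹
  have h2 := hd.hasFDerivAt.comp x h1
  rw [pd, show ζs R = (η₀ ∘ fun y => R⁻¹ • y) from rfl, h2.fderiv]
  simp [pd]

lemma ζs_one {R : ℝ} (hR : 0 < R) {x : V} (hx : ‖x‖ ≤ R) : ζs R x = 1 := by
  refine η₀.one_of_mem_closedBall ?_
  change R⁻¹ • x ∈ Metric.closedBall (0 : V) 1
  rw [mem_closedBall_zero_iff, norm_smul, Real.norm_of_nonneg (by positivity), ← div_eq_inv_mul,
    div_le_one hR]
  exact hx

lemma ζs_zero {R : ℝ} (hR : 0 < R) {x : V} (hx : x ∉ Metric.closedBall (0 : V) (2 * R)) :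
    ζs R x = 0 := by
  refine η₀.zero_of_le_dist ?_
  change (2 : ℝ) ≤ _
  rw [mem_closedBall_zero_iff, not_le] at hx
  rw [dist_zero_right, norm_smul, Real.norm_of_nonneg (by positivity), ← div_eq_inv_mul,
    le_div_iff₀ hR]
  exact hx.le

/-- The gradient is of order `R⁻¹` on an annulus where `⟨x⟩ ≤ 3 R`, so the weighted gradient is
bounded uniformly in `R`. It does not become small; its contribution vanishes because the annulus
escapes to infinity. -/
lemma cutoff_ζs {R : ℝ} (hR : 1 ≤ R) : Cutoff (ζs R) (As R) (2 * R) (3 * Cη) := by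
  have hR0 : 0 < R := by linarith
  refine ⟨η₀.contDiff.comp (contDiff_const_smul _), fun x hx => ζs_zero hR0 hx,
    fun x => η₀.nonneg, fun x => η₀.le_one,
    measurableSet_closedBall.diff measurableSet_ball, sdiff_subset, by have := Cη_nonneg; positivity,
    fun i x => ?_⟩
  by_cases hx : x ∈ As R
  · rw [indicator_of_mem hx, pd_ζs, abs_mul, abs_of_pos (inv_pos.2 hR0)]
    have h1 := pd_η₀_le i (R⁻¹ • x)
    have h2 : bracket x ≤ 3 * R := by
      have := mem_closedBall_zero_iff.1 hx.1
      have := bracket_le_one_add_norm x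
      linarith
    calc R⁻¹ * |pd i η₀ (R⁻¹ • x)| * bracket x ≤ R⁻¹ * Cη * (3 * R) := by
          have := Cη_nonneg
          have := (bracket_pos x).le
          gcongr
      _ = 3 * Cη := by field_simp
  · rw [indicator_of_notMem hx]
    have h0 : pd i (ζs R) x = 0 := by
      by_cases h1 : x ∈ Metric.ball (0 : V) R
      · have : ζs R =ᶠ[𝓝 x] fun _ => 1 := by
          filter_upwards [Metric.isOpen_ball.mem_nhds h1] with y hy
          exact ζs_one hR0 (mem_ball_zero_iff.1 hy).le
        rw [pd, this.fderiv_eq]; simp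
      · have h2 : x ∉ Metric.closedBall (0 : V) (2 * R) := fun h => hx ⟨h, h1⟩
        have : ζs R =ᶠ[𝓝 x] fun _ => 0 := by
          filter_upwards [Metric.isClosed_closedBall.isOpen_compl.mem_nhds h2] with y hy
          exact ζs_zero hR0 hy
        rw [pd, this.fderiv_eq]; simp
    rw [h0]; simp

/-- The right-hand side of the global energy inequality. -/
def enG (γ p k₁ k₂ : ℝ) (u : V → ℝ) : ℝ :=
  -k₁ * wL6 γ (fun x => u x ^ (p / 2)) + k₂ * ∫ x, bracket x ^ γ * u x ^ p

lemma ζs_eventually (x : V) : ∀ᶠ n : ℕ in atTop, ζs (n + 1) x = 1 ∧ x ∉ As (n + 1) := by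
  obtain ⟨N, hN⟩ := exists_nat_gt ‖x‖
  filter_upwards [eventually_ge_atTop N] with n hn
  have h1 : (N : ℝ) ≤ n := by exact_mod_cast hn
  refine ⟨ζs_one (by positivity) (by linarith), fun h => h.2 ?_⟩
  rw [mem_ball_zero_iff]; linarith

/-- Dominated convergence with majorants `g ^ (3 p)` and `g ^ p`. The annulus term tends to zero
whatever `k₃` is, which removes the only `ε`-dependent constant of the right-hand side. -/
lemma tendsto_enH_cutoff (hg : Adm ε⁻¹ m g) (hε : 0 < ε) (hγ0 : γ < 0) (hp : 2 ≤ p) :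
    Tendsto (fun n : ℕ => enH γ p k₁ k₂ k₃ (As (n + 1)) (ζs (n + 1)) g) atTop
      (𝓝 (enG γ p k₁ k₂ g)) := by
  obtain ⟨i1, -⟩ := hg.rpow_bounds hε (q := 3 * p) (by linarith)
  obtain ⟨i2, -⟩ := hg.rpow_bounds hε (q := p) (by linarith)
  have hζ : ∀ n : ℕ, Cutoff (ζs (n + 1)) (As (n + 1)) (2 * (n + 1)) (3 * Cη) := fun n =>
    cutoff_ζs (by linarith [Nat.cast_nonneg (α := ℝ) n])
  have hgm : ∀ q : ℝ, AEStronglyMeasurable (fun x => g x ^ q) volume := fun q =>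
    (hg.meas.aemeasurable.pow_const q).aestronglyMeasurable
  have hbm : ∀ q : ℝ, AEStronglyMeasurable (fun x : V => bracket x ^ q) volume := fun q =>
    (contDiff_bracket_rpow q (n := 0)).continuous.aestronglyMeasurable
  have hζm : ∀ n : ℕ, AEStronglyMeasurable (ζs (n + 1)) volume := fun n =>
    (hζ n).contDiff_one.continuous.aestronglyMeasurable
  have t1 : Tendsto (fun n : ℕ => ∫ x, (bracket x ^ (γ / 2) * (ζs (n + 1) x * g x ^ (p / 2))) ^ 6) atTop
      (𝓝 (∫ x, (bracket x ^ (γ / 2) * g x ^ (p / 2)) ^ 6)) := by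
    refine tendsto_integral_of_dominated_convergence _ (fun n =>
      ((hbm _).mul ((hζm n).mul (hgm _))).pow 6) i1 (fun n => ae_of_all _ fun x => ?_)
      (ae_of_all _ fun x => ?_)
    · have := integrand_six_le (γ := γ) (p := p) hγ0 ((hζ n).nonneg x) ((hζ n).le_one x) (hg.nonneg x) x
      rw [Real.norm_of_nonneg this.1]; exact this.2
    · refine tendsto_const_nhds.congr' ?_
      filter_upwards [ζs_eventually x] with n hn
      simp only [hn.1, one_mul]
  have t2 : Tendsto (fun n : ℕ => ∫ x, bracket x ^ γ * (ζs (n + 1) x ^ 2 * g x ^ p)) atTop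
      (𝓝 (∫ x, bracket x ^ γ * g x ^ p)) := by
    refine tendsto_integral_of_dominated_convergence _ (fun n =>
      ((hbm _).mul (((hζm n).pow 2).mul (hgm _)))) i2 (fun n => ae_of_all _ fun x => ?_)
      (ae_of_all _ fun x => ?_)
    · have := weight_cutoff_le (γ := γ) (p := p) hγ0 ((hζ n).nonneg x) ((hζ n).le_one x) (hg.nonneg x) x
      rw [Real.norm_of_nonneg this.1]; exact this.2
    · refine tendsto_const_nhds.congr' ?_
      filter_upwards [ζs_eventually x] with n hn
      simp only [hn.1, one_pow, one_mul]
  have t3 : Tendsto (fun n : ℕ => ∫ x, (As (n + 1)).indicator 1 x * g x ^ p) atTop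
      (𝓝 (∫ _ : V, (0 : ℝ))) := by
    refine tendsto_integral_of_dominated_convergence _ (fun n =>
      ((aestronglyMeasurable_const (b := (1 : ℝ)).indicator (hζ n).meas).mul (hgm p))) i2
      (fun n => ae_of_all _ fun x => ?_) (ae_of_all _ fun x => ?_)
    · have h3 := Real.rpow_nonneg (hg.nonneg x) p
      have := abs_indicator_one_le (As (n + 1)) x
      rw [norm_mul, Real.norm_of_nonneg h3]
      exact mul_le_of_le_one_left h3 this
    · refine tendsto_const_nhds.congr' ?_
      filter_upwards [ζs_eventually x] with n hn
      rw [indicator_of_notMem hn.2, zero_mul]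
  have := (((t1.rpow_const (Or.inr (by norm_num : (0 : ℝ) ≤ 1 / 3))).const_mul (-k₁)).add
    (t2.const_mul k₂)).add (t3.const_mul k₃)
  rw [integral_zero, mul_zero, add_zero] at this
  exact this

/-- The global energy inequality. -/
theorem Ev.energy (hE : Ev γ ε m f F) (hε : 0 < ε) (hγ : -2 < γ) (hγ0 : γ < 0)
    (hp : 2 ≤ p) (hK : 0 < K)
    (hco : ∀ t, 0 < t → ∀ x ξ : V, K * bracket x ^ γ * ‖ξ‖ ^ 2 ≤
      ∑ i, ∑ j, Sm γ (fl ε (f t)) i j x * ξ i * ξ j) (hr : 0 < r) (hr1 : r ≤ 1)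
    (hrK : 24 * (p - 1) * m * (radC (3 * γ / 2) ^ (2 / 3 : ℝ) * r ^ (2 + γ)) ≤ K / (12 * sobC))
    {t₁ t₂ : ℝ} (h0 : 0 < t₁) (h12 : t₁ ≤ t₂) :
    Integrable (fun t => enG γ p (K / (12 * sobC)) (3 / 2 * K + 24 * (p - 1) * m * r⁻¹ ^ 2) (f t))
      (volume.restrict (Ioc t₁ t₂)) ∧
    (∫ x, f t₂ x ^ p) - ∫ x, f t₁ x ^ p ≤
      ∫ t in Ioc t₁ t₂, enG γ p (K / (12 * sobC)) (3 / 2 * K + 24 * (p - 1) * m * r⁻¹ ^ 2) (f t) := by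
  have hpos : ∀ᵐ t ∂(volume.restrict (Ioc t₁ t₂)), 0 < t := by
    filter_upwards [ae_restrict_mem measurableSet_Ioc] with t ht using h0.trans ht.1
  have hm0 : 0 ≤ m := (hE.adm t₁ h0).m_nonneg
  have hgr := (hE.adm t₁ h0).growC_nonneg
  have hΛ := Cη_nonneg
  have hsC := sobC_pos
  have hp1 : 0 ≤ p - 1 := by linarith
  have hp0 : 0 ≤ p := by linarith
  set k₁ := K / (12 * sobC) with hk₁
  set k₂ := 3 / 2 * K + 24 * (p - 1) * m * r⁻¹ ^ 2 with hk₂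
  set k₃ := cutC p K (3 * Cη) ε⁻¹ m with hk₃
  have k₁0 : 0 ≤ k₁ := by positivity
  have k₂0 : 0 ≤ k₂ := by positivity
  have k₃0 : 0 ≤ k₃ := by rw [hk₃, cutC]; positivity
  have hζ : ∀ n : ℕ, Cutoff (ζs (n + 1)) (As (n + 1)) (2 * (n + 1)) (3 * Cη) := fun n =>
    cutoff_ζs (by linarith [Nat.cast_nonneg (α := ℝ) n])
  have hloc := fun n : ℕ => hE.energy_local hε hγ hγ0 hp (hζ n) (by positivity) hK hco hr hr1 hrK h0 h12
  set B := k₁ * (ε⁻¹ ^ (3 * p - 1) * m) ^ (1 / 3 : ℝ) + (k₂ + k₃) * (ε⁻¹ ^ (p - 1) * m) with hB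
  have hbd : ∀ n : ℕ, ∀ᵐ t ∂(volume.restrict (Ioc t₁ t₂)),
      ‖enH γ p k₁ k₂ k₃ (As (n + 1)) (ζs (n + 1)) (f t)‖ ≤ B := fun n => by
    filter_upwards [hpos] with t ht
    exact enH_bounds (hE.adm t ht) hε hγ0 hp (hζ n) k₁0 k₂0 k₃0
  have hlim : ∀ᵐ t ∂(volume.restrict (Ioc t₁ t₂)),
      Tendsto (fun n : ℕ => enH γ p k₁ k₂ k₃ (As (n + 1)) (ζs (n + 1)) (f t)) atTop
        (𝓝 (enG γ p k₁ k₂ (f t))) := by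
    filter_upwards [hpos] with t ht
    exact tendsto_enH_cutoff (hE.adm t ht) hε hγ0 hp
  have hm := aestronglyMeasurable_of_tendsto_ae atTop (fun n => (hloc n).1) hlim
  refine ⟨(integrable_const B).mono' hm ?_, ?_⟩
  · filter_upwards [hlim, ae_all_iff.2 hbd] with t h1 h2
    exact le_of_tendsto h1.norm (Eventually.of_forall h2)
  have hT := tendsto_integral_of_dominated_convergence (fun _ => B) (fun n => (hloc n).1)
    (integrable_const B) hbd hlim
  have hY : ∀ t, 0 < t → Tendsto (fun n : ℕ => ∫ x, ζs (n + 1) x ^ 2 * f t x ^ p) atTop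
      (𝓝 (∫ x, f t x ^ p)) := fun t ht => by
    have hg := hE.adm t ht
    obtain ⟨i2, -⟩ := hg.rpow_bounds hε (q := p) (by linarith)
    refine tendsto_integral_of_dominated_convergence _ (fun n =>
      (((hζ n).contDiff_one.continuous.aestronglyMeasurable.pow 2).mul
      (hg.meas.aemeasurable.pow_const p).aestronglyMeasurable)) i2 (fun n => ae_of_all _ fun x => ?_)
      (ae_of_all _ fun x => ?_)
    · have h3 := Real.rpow_nonneg (hg.nonneg x) p
      have h4 := (hζ n).nonneg x
      rw [Real.norm_of_nonneg (by positivity)]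
      exact mul_le_of_le_one_left h3 (pow_le_one₀ h4 ((hζ n).le_one x))
    · refine tendsto_const_nhds.congr' ?_
      filter_upwards [ζs_eventually x] with n hn
      simp only [hn.1, one_pow, one_mul]
  exact le_of_tendsto_of_tendsto' ((hY t₂ (h0.trans_le h12)).sub (hY t₁ h0)) hT fun n => (hloc n).2
end
end LFD
end

noncomputable section
namespace LFD
open MeasureTheory Set Filter Topology

/-! ### Weak solutions satisfy the mollified equation -/

lemma pd_const_mul (c : ℝ) {ψ : V → ℝ} (h : Differentiable ℝ ψ) (i : Fin 3) :
    pd i (fun v => c * ψ v) = fun v => c * pd i ψ v := by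
  ext v
  have := ((h v).hasFDerivAt.const_mul c).fderiv
  rw [pd, this]; simp [pd]

lemma isTestFunction_mul {T : ℝ} {θ : ℝ → ℝ} {ψ : V → ℝ} (h1 : ContDiff ℝ (⊤ : ℕ∞) θ)
    (h2 : HasCompactSupport θ) (h3 : tsupport θ ⊆ Ioo 0 T) (h4 : ContDiff ℝ (⊤ : ℕ∞) ψ)
    (h5 : HasCompactSupport ψ) : IsTestFunction T (fun p : ℝ × V => θ p.1 * ψ p.2) := by
  have hsub : tsupport (fun p : ℝ × V => θ p.1 * ψ p.2) ⊆ tsupport θ ×ˢ tsupport ψ := by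
    refine closure_minimal (fun p hp => ⟨subset_tsupport _ ?_, subset_tsupport _ ?_⟩)
      ((isClosed_tsupport _).prod (isClosed_tsupport _))
    · exact left_ne_zero_of_mul hp
    · exact right_ne_zero_of_mul hp
  refine ⟨?_, ?_, fun p hp => ⟨(h3 (hsub hp).1).2, mem_univ _⟩⟩
  · exact ((h1.comp contDiff_fst).mul (h4.comp contDiff_snd)).of_le
      (show ((2 : ℕ∞) : WithTop ℕ∞) ≤ _ from WithTop.coe_le_coe.2 le_top)
  · exact (h2.prod h5).of_isClosed_subset (isClosed_tsupport _) hsub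

section
variable {ε ε₀ γ m δ : ℝ} {fin g : V → ℝ} {f : ℝ → V → ℝ} {F : ℝ × V → ℝ}

lemma MemY.congr {g' : V → ℝ} (h : MemY ε fin g) (he : g =ᵐ[volume] g') : MemY ε fin g' := by
  refine ⟨⟨h.memL1.1.congr he, h.memL1.2.congr ?_⟩, ?_, ?_, fun i => ?_, ?_, ?_⟩
  · filter_upwards [he] with v hv; rw [hv]
  · filter_upwards [he, h.bounds] with v hv hb; rwa [← hv]
  · rw [← h.mass]; exact integral_congr_ae he.symm
  · rw [← h.momentum]; exact integral_congr_ae (by filter_upwards [he] with v hv; rw [hv])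
  · rw [← h.energy]; exact integral_congr_ae (by filter_upwards [he] with v hv; rw [hv])
  · refine h.entropy_le.trans (le_of_eq ?_)
    unfold fermiDiracEntropy
    congr 1
    exact integral_congr_ae (by filter_upwards [he] with v hv; rw [hv])

/-- Truncation to the interval `[0, ε⁻¹]`. -/
def trunc (ε z : ℝ) : ℝ := max 0 (min z ε⁻¹)

lemma trunc_nonneg (ε z : ℝ) : 0 ≤ trunc ε z := le_max_left _ _

lemma trunc_le (hε : 0 < ε) (z : ℝ) : trunc ε z ≤ ε⁻¹ :=
  max_le (inv_pos.2 hε).le (min_le_right _ _)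

lemma trunc_eq {z : ℝ} (h0 : 0 ≤ z) (h1 : z ≤ ε⁻¹) : trunc ε z = z := by
  rw [trunc, min_eq_left h1, max_eq_right h0]

/-- The bounds `0 ≤ f ≤ ε⁻¹` hold only almost everywhere, whereas `Adm` asks for them at every
point; truncation supplies this without changing the class. -/
lemma IsWeakSolution.trunc_ae (hW : IsWeakSolution γ ε fin f) {t : ℝ} (ht : 0 ≤ t) :
    f t =ᵐ[volume] fun v => trunc ε (f t v) := by
  filter_upwards [(hW.memY t ht).bounds] with v hv using (trunc_eq hv.1 hv.2).symm

lemma IsWeakSolution.memY_trunc (hW : IsWeakSolution γ ε fin f) {t : ℝ} (ht : 0 ≤ t) :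
    MemY ε fin (fun v => trunc ε (f t v)) := (hW.memY t ht).congr (hW.trunc_ae ht)

/-- The drift term of the weak formulation tested with a translate of the mollifier. -/
def driftMol (γ ε δ : ℝ) (i : Fin 3) (g : V → ℝ) (x : V) : ℝ :=
  -cv (fun v => g v * Bv γ (fl ε g) i v) (pd i (mol δ)) x
    - cv (fun v => fl ε g v * Bv γ g i v) (pd i (mol δ)) x

lemma integral_drift_mol (hg : Adm ε⁻¹ m g) (hε : 0 < ε) (hγ : -2 < γ) (hγ0 : γ < 0) (hδ : 0 < δ)
    (i : Fin 3) (x : V) :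
    ∫ p : V × V, g p.1 * g p.2 * (1 - ε * g p.2) * b γ i (p.1 - p.2) *
        (pd i (fun v => mol δ (x - v)) p.1 - pd i (fun v => mol δ (x - v)) p.2) =
      driftMol γ ε δ i g x := by
  have h1 : ContDiff ℝ 1 (fun v => mol δ (x - v)) :=
    (contDiff_mol_one δ).comp (contDiff_const.sub contDiff_id)
  have h2 := hasCompactSupport_comp_sub (hasCompactSupport_mol hδ) x
  rw [integral_drift_prod hg hε hγ hγ0 i (continuous_pd h1 i) (hasCompactSupport_pd h2 i),
    pd_mol_sub]
  simp only [mul_neg, integral_neg, cv, driftMol]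
  ring

/-- The weak formulation contains separate time integrals for the diffusion and each drift
component. Recombining them into one integral requires each to be integrable on its own. -/
lemma exists_driftMol_bound (γ ε m δ : ℝ) (x : V) : ∃ D : ℝ, ∀ (i : Fin 3) (g : V → ℝ),
    Adm ε⁻¹ m g → 0 < ε → -2 < γ → γ < 0 → 0 < δ → |driftMol γ ε δ i g x| ≤ D := by
  have : ∀ i : Fin 3, ∃ D : ℝ, ∀ (g : V → ℝ),
      Adm ε⁻¹ m g → 0 < ε → -2 < γ → γ < 0 → 0 < δ → |driftMol γ ε δ i g x| ≤ D := fun i => by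
    refine ⟨4 * (ε⁻¹ * (2 * growC ε⁻¹ m)) * (∫ y, bracket y ^ 2 * |pd i (mol δ) y|) * bracket x ^ 2 +
      4 * (ε⁻¹ * (2 * growC ε⁻¹ m)) * (∫ y, bracket y ^ 2 * |pd i (mol δ) y|) * bracket x ^ 2,
      fun g hf hε hγ hγ0 hδ => ?_⟩
    have hs := hasCompactSupport_mol hδ
    have hg := hf.fl hε
    have key : ∀ {g k : V → ℝ} {C : ℝ}, Adm ε⁻¹ m g → (∀ v, |k v| ≤ C * bracket v ^ 2) →
        ∀ v, |g v * k v| ≤ ε⁻¹ * C * bracket v ^ 2 := fun hg hk v => by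
      rw [abs_mul, abs_of_nonneg (hg.nonneg v), mul_assoc]
      exact mul_le_mul (hg.le v) (hk v) (abs_nonneg _) (inv_pos.2 hε).le
    have hB := abs_cv_le (key hf (hg.abs_Bv_le_sq hγ hγ0 i)) (continuous_pd (contDiff_mol_one δ) i)
      (hasCompactSupport_pd hs i) x
    have hc := abs_cv_le (key hg (hf.abs_Bv_le_sq hγ hγ0 i)) (continuous_pd (contDiff_mol_one δ) i)
      (hasCompactSupport_pd hs i) x
    refine (abs_sub _ _).trans ?_
    rw [abs_neg]
    exact add_le_add hB hc
  choose D hD using this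
  refine ⟨∑ i, |D i|, fun i g h1 h2 h3 h4 h5 => (hD i g h1 h2 h3 h4 h5).trans ?_⟩
  exact (le_abs_self _).trans
    (Finset.single_le_sum (f := fun i => |D i|) (fun i _ => abs_nonneg _) (Finset.mem_univ i))

lemma stronglyMeasurable_driftMol (hF : StronglyMeasurable F) (i : Fin 3) :
    StronglyMeasurable fun q : ℝ × V => driftMol γ ε δ i (fun v => F (q.1, v)) q.2 := by
  have hfl := stronglyMeasurable_fl (ε := ε) hF
  have h4 : Measurable (pd i (mol δ)) := (continuous_pd (contDiff_mol_one δ) i).measurable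
  exact (stronglyMeasurable_cv h4 (hF.mul (stronglyMeasurable_conv (measurable_b γ i) hfl))).neg.sub
    (stronglyMeasurable_cv h4 (hfl.mul (stronglyMeasurable_conv (measurable_b γ i) hF)))

lemma driftMol_congr {g' : V → ℝ} (h : g =ᵐ[volume] g') (i : Fin 3) :
    driftMol γ ε δ i g = driftMol γ ε δ i g' := by
  have hfl := fl_congr (ε := ε) h
  ext x
  rw [driftMol, driftMol, Bv_congr hfl, Bv_congr h,
    cv_congr (g := fun v => g v * Bv γ (fl ε g') i v) (g' := fun v => g' v * Bv γ (fl ε g') i v)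
      (by filter_upwards [h] with v hv; rw [hv]),
    cv_congr (g := fun v => fl ε g v * Bv γ g' i v) (g' := fun v => fl ε g' v * Bv γ g' i v)
      (by filter_upwards [hfl] with v hv; rw [hv])]

lemma integral_drift_congr {g' : V → ℝ} (h : g =ᵐ[volume] g') (k : V × V → ℝ) :
    ∫ p : V × V, g p.1 * g p.2 * (1 - ε * g p.2) * k p =
      ∫ p : V × V, g' p.1 * g' p.2 * (1 - ε * g' p.2) * k p := by
  have h1 : ∀ᵐ p : V × V, g p.1 = g' p.1 := Measure.quasiMeasurePreserving_fst.ae h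
  have h2 : ∀ᵐ p : V × V, g p.2 = g' p.2 := Measure.quasiMeasurePreserving_snd.ae h
  refine integral_congr_ae ?_
  filter_upwards [h1, h2] with p e1 e2
  rw [e1, e2]

/-- A weak solution, truncated on a null set, is an evolution. -/
theorem IsWeakSolution.exists_ev (hI : IsInitialDatum ε₀ fin) (hε : 0 < ε)
    (hγ : -2 < γ) (hγ0 : γ < 0) (hW : IsWeakSolution γ ε fin f) :
    ∃ F, Ev γ ε 4 (fun t v => trunc ε (f t v)) F := by
  set f' : ℝ → V → ℝ := fun t v => trunc ε (f t v) with hf'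
  have hadm : ∀ t, 0 ≤ t → Adm ε⁻¹ 4 (f' t) := fun t ht =>
    (hW.memY_trunc ht).adm hI (fun v => trunc_nonneg _ _) (fun v => trunc_le hε _)
  set F : ℝ × V → ℝ := fun q => trunc ε (hW.measurable.mk _ q) with hF
  have hFm : StronglyMeasurable F :=
    stronglyMeasurable_const.sup (hW.measurable.stronglyMeasurable_mk.inf stronglyMeasurable_const)
  have hFae : ∀ᵐ t : ℝ, 0 < t → (fun v => F (t, v)) =ᵐ[volume] f' t := by
    have h1 := Measure.ae_ae_of_ae_prod hW.measurable.ae_eq_mk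
    rw [ae_restrict_iff' measurableSet_Ici] at h1
    filter_upwards [h1] with t ht h0
    filter_upwards [ht h0.le] with v hv
    simp only [hF, hf']; rw [← hv]
  refine ⟨F, fun t ht => hadm t ht.le, hFm, hFae, fun δ hδ x t₁ t₂ h0 h12 => ?_⟩
  have hFT : ∀ T : ℝ, ∀ᵐ t ∂(volume.restrict (Ioo 0 T)), (fun v => F (t, v)) =ᵐ[volume] f' t := by
    intro T
    filter_upwards [ae_restrict_of_ae hFae, ae_restrict_mem measurableSet_Ioo] with t h1 h2
    exact h1 h2.1
  have hsec : Measurable fun t : ℝ => (t, x) := measurable_id.prodMk measurable_const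
  have hΛm : ∀ T : ℝ, AEStronglyMeasurable (fun t => mL γ ε (f' t) δ x)
      (volume.restrict (Ioo 0 T)) := fun T => by
    refine ((stronglyMeasurable_mLm (ε := ε) (δ := δ) hγ hFm).comp_measurable
      hsec).aestronglyMeasurable.congr ?_
    filter_upwards [hFT T, ae_restrict_mem measurableSet_Ioo] with t h1 h2
    simp only [Function.comp_def, mLm_congr h1, mLm_eq_mL (hadm t h2.1.le) hε hγ hγ0 hδ]
  have hΛ : ∀ T : ℝ, 0 < T → IntegrableOn (fun t => mL γ ε (f' t) δ x) (Ioo 0 T) := fun T _ => by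
    refine (integrable_const (mLB ε 4 δ * bracket x ^ 2)).mono' (hΛm T) ?_
    filter_upwards [ae_restrict_mem measurableSet_Ioo] with t h2
    exact abs_mL_le (hadm t h2.1.le) hε hγ hγ0 hδ x
  obtain ⟨D, hD⟩ := exists_driftMol_bound γ ε 4 δ x
  have hdr : ∀ (T : ℝ) (i : Fin 3), IntegrableOn (fun t => driftMol γ ε δ i (f' t) x) (Ioo 0 T) := by
    intro T i
    refine (integrable_const D).mono' ?_ ?_
    · refine ((stronglyMeasurable_driftMol (γ := γ) (ε := ε) (δ := δ) hFm i).comp_measurable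
        hsec).aestronglyMeasurable.congr ?_
      filter_upwards [hFT T] with t h1
      simp only [Function.comp_def, driftMol_congr h1]
    · filter_upwards [ae_restrict_mem measurableSet_Ioo] with t h2
      exact hD i _ (hadm t h2.1.le) hε hγ hγ0 hδ
  set ψ : V → ℝ := fun v => mol δ (x - v) with hψ
  have hψc : ContDiff ℝ (⊤ : ℕ∞) ψ := (contDiff_mol δ).comp (contDiff_const.sub contDiff_id)
  have hψs : HasCompactSupport ψ := hasCompactSupport_comp_sub (hasCompactSupport_mol hδ) x
  have hψd : Differentiable ℝ ψ := hψc.differentiable (by simp)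
  have hψd2 : ∀ j, Differentiable ℝ (pd j ψ) := fun j => (contDiff_pd hψc j).differentiable (by simp)
  have hmu : ∀ t, 0 ≤ t → ∫ v, f t v * ψ v = mu (f' t) δ x := fun t ht =>
    congrFun (cv_congr (k := mol δ) (hW.trunc_ae ht)) x
  refine sub_eq_integral_of_weak (μ := fun t => mu (f' t) δ x) (Λ := fun t => mL γ ε (f' t) δ x)
    ((hW.continuous ψ hψc hψs).congr fun t ht => (hmu t ht).symm) hΛ ?_ h0 h12
  intro T hT θ h1 h2 h3
  have hw := hW.weak T hT _ (isTestFunction_mul h1 h2 h3 hψc hψs)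
  -- Time tests supported in `(0, T)` make the initial term disappear; the evolution is used at
  -- positive times only.
  have hθ0 : θ 0 = 0 := image_eq_zero_of_notMem_tsupport fun h => lt_irrefl _ (h3 h).1
  unfold WeakForm at hw
  simp only [hθ0, zero_mul, mul_zero, integral_zero, sub_zero] at hw
  have e1 : ∫ t in Ioo 0 T, ∫ v, f t v * deriv (fun τ => θ τ * ψ v) t =
      ∫ t in Ioo 0 T, mu (f' t) δ x * deriv θ t := by
    refine setIntegral_congr_fun measurableSet_Ioo fun t ht => ?_
    have hd : DifferentiableAt ℝ θ t := h1.differentiable (by simp) t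
    simp only [deriv_mul_const hd]
    rw [← hmu t ht.1.le, ← integral_mul_const]
    congr 1; ext v; ring
  have e3 : ∀ i : Fin 3, ∫ t in Ioo 0 T, (∫ p : V × V, f t p.1 * f t p.2 * (1 - ε * f t p.2) *
      b γ i (p.1 - p.2) * (pd i (fun u => θ t * ψ u) p.1 - pd i (fun u => θ t * ψ u) p.2)) =
      ∫ t in Ioo 0 T, θ t * driftMol γ ε δ i (f' t) x := fun i => by
    refine setIntegral_congr_fun measurableSet_Ioo fun t ht => ?_
    simp only [pd_const_mul (θ t) hψd]
    rw [← integral_drift_mol (hadm t ht.1.le) hε hγ hγ0 hδ, ← integral_const_mul]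
    simp only [mul_assoc (_ * _ * _) (b γ i _) _]
    rw [integral_drift_congr (hW.trunc_ae ht.1.le)]
    congr 1; ext p; simp only [hf']; ring
  -- The diffusion term is expressed as the whole right-hand side minus the drift terms, so that its
  -- integrability in time follows from bounds already available.
  have e2 : ∫ t in Ioo 0 T, (∫ v, ∑ i, ∑ j, Sig γ ε i j (f t) v * f t v *
      pd i (pd j (fun u => θ t * ψ u)) v) =
      ∫ t in Ioo 0 T, θ t * (mL γ ε (f' t) δ x - ∑ i, driftMol γ ε δ i (f' t) x) := by
    refine setIntegral_congr_fun measurableSet_Ioo fun t ht => ?_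
    have h5 := (weak_rhs_mol (hadm t ht.1.le) hε hγ hγ0 hδ x).2
    simp only [integral_drift_mol (hadm t ht.1.le) hε hγ hγ0 hδ] at h5
    simp only [pd_const_mul (θ t) hψd, pd_const_mul (θ t) (hψd2 _)]
    rw [← h5, add_sub_cancel_right, ← integral_const_mul]
    refine integral_congr_ae ?_
    have hS : ∀ i j, Sig γ ε i j (f t) = Sig γ ε i j (f' t) := fun i j => by
      rw [Sig_eq, Sig_eq]; exact Sm_congr (fl_congr (hW.trunc_ae ht.1.le)) i j
    filter_upwards [hW.trunc_ae ht.1.le] with v hv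
    rw [Finset.mul_sum]
    refine Finset.sum_congr rfl fun i _ => ?_
    rw [Finset.mul_sum]
    refine Finset.sum_congr rfl fun j _ => ?_
    rw [hS, hv]; ring
  rw [e1, e2, Finset.sum_congr rfl fun i _ => e3 i] at hw
  obtain ⟨Cθ, hCθ⟩ := h1.continuous.bounded_above_of_compact_support h2
  have hmulθ : ∀ {G : ℝ → ℝ}, IntegrableOn G (Ioo 0 T) → IntegrableOn (fun t => θ t * G t) (Ioo 0 T) :=
    fun hG => hG.bdd_mul h1.continuous.aestronglyMeasurable (ae_of_all _ hCθ)
  have iS : IntegrableOn (fun t => ∑ i, driftMol γ ε δ i (f' t) x) (Ioo 0 T) :=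
    integrable_finsetSum _ fun i _ => hdr T i
  have iD : IntegrableOn (fun t => θ t * (mL γ ε (f' t) δ x - ∑ i, driftMol γ ε δ i (f' t) x))
    (Ioo 0 T) := hmulθ ((hΛ T hT).sub iS)
  rw [hw, ← integral_finsetSum _ fun i _ => hmulθ (hdr T i), ← integral_add iD
    (integrable_finsetSum _ fun i _ => hmulθ (hdr T i))]
  congr 1; ext t
  rw [← Finset.mul_sum]; ring

/-- The ellipticity bound along a weak solution depends only on `γ` and the Boltzmann entropy. -/
theorem exists_coercive (γ h : ℝ) (hγ : -2 < γ) (hγ0 : γ < 0) : ∃ K : ℝ, 0 < K ∧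
    ∀ (ε₀ ε : ℝ) (fin g : V → ℝ), IsInitialDatum ε₀ fin → boltzmannEntropy fin = h → 0 < ε → ε ≤ ε₀ →
      MemY ε fin g → (∀ v, 0 ≤ g v) → (∀ v, g v ≤ ε⁻¹) → ε ≤ 1 / (2 * Lev h) →
      ∀ x ξ : V, K * bracket x ^ γ * ‖ξ‖ ^ 2 ≤ ∑ i, ∑ j, Sm γ (fl ε g) i j x * ξ i * ξ j := by
  have hL := Lev_pos h
  have hη : 0 < 1 / (8 * Lev h) := by positivity
  -- The slabs must be thin enough to have volume at most `1 / (8 Lev h)`, the size of exceptional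
  -- sets allowed by `MemY.spread` with radius `4`. Using `N + 1` guarantees positivity.
  obtain ⟨N, hN⟩ := exists_nat_ge ((volume (Metric.ball (0 : V) (2 * 4))).toReal / (1 / (8 * Lev h)))
  have hN1 : volume (Metric.ball (0 : V) (2 * 4)) ≤ (N + 1 : ℕ) * ENNReal.ofReal (1 / (8 * Lev h)) := by
    rw [← ENNReal.ofReal_toReal (measure_ball_lt_top (μ := volume) (x := (0 : V)) (r := 2 * 4)).ne,
      ← ENNReal.ofReal_natCast, ← ENNReal.ofReal_mul (by positivity)]
    refine ENNReal.ofReal_le_ofReal ?_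
    rw [div_le_iff₀ hη] at hN
    push_cast
    linarith
  refine ⟨ellC γ 4 (1 / 8) (N + 1), by unfold ellC; positivity, ?_⟩
  intro ε₀ ε fin g hI hh hε hle hg h0 h1 hs x ξ
  have hsp := hg.spread hI hε hle h0 h1 (by rwa [hh])
  rw [hh] at hsp
  exact ((hg.adm hI h0 h1).fl hε).coercive hγ hγ0 (by norm_num) N.succ_pos hN1 hsp x ξ
end
end LFD
end

noncomputable section
namespace LFD
open MeasureTheory Set Filter Topology

/-! ### A differential inequality with superlinear damping -/

lemma hasDerivAt_barrier (a Λ ν : ℝ) {t : ℝ} (ht : a < t) :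
    HasDerivAt (fun t => Λ * (t - a) ^ (-ν)) (-(ν * (Λ * (t - a) ^ (-ν) / (t - a)))) t := by
  have h0 : 0 < t - a := by linarith
  have h1 := (((hasDerivAt_id t).sub_const a).rpow_const (p := -ν) (Or.inl h0.ne')).const_mul Λ
  refine h1.congr_deriv ?_
  simp only [id]
  rw [Real.rpow_sub_one h0.ne']
  ring

/-- Comparison with the barrier `z = Λ (t - a) ^ (-ν)`. The choice of `Λ` gives `A z ^ (1/ν) = (ν +
B) / (t - a)`, at least `ν / (t - a) + B` when `t - a ≤ 1`, so above the barrier `y` decreases at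
least as fast as `z`. Continuity of `y` is not assumed; the integrated inequality is used from the
last time at which `y ≤ z`. The a priori bound `Yb` does not enter the conclusion. -/
theorem le_of_superlinear_damping {y e : ℝ → ℝ} {a b A B ν Yb : ℝ} (hab : a < b) (hba : b ≤ a + 1)
    (hA : 0 < A) (hB : 0 ≤ B) (hν : 0 < ν)
    (hy : ∀ t ∈ Ioc a b, 0 ≤ y t ∧ y t ≤ Yb)
    (he : ∀ t₁ t₂, a < t₁ → t₁ ≤ t₂ → t₂ ≤ b → Integrable e (volume.restrict (Ioc t₁ t₂)) ∧
      y t₂ - y t₁ ≤ ∫ t in Ioc t₁ t₂, e t)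
    (hle : ∀ t ∈ Ioc a b, e t ≤ -A * y t ^ (1 + 1 / ν) + B * y t) :
    y b ≤ ((ν + B) / A) ^ ν * (b - a) ^ (-ν) := by
  have hq : 0 < (ν + B) / A := by positivity
  set Λ := ((ν + B) / A) ^ ν with hΛ
  have hΛ0 : 0 < Λ := Real.rpow_pos_of_pos hq ν
  set z : ℝ → ℝ := fun t => Λ * (t - a) ^ (-ν) with hz
  change y b ≤ z b
  have hzpos : ∀ t, a < t → 0 < z t := fun t ht =>
    mul_pos hΛ0 (Real.rpow_pos_of_pos (by linarith) _)
  have hYb0 : 0 ≤ Yb := (hy b ⟨hab, le_rfl⟩).1.trans (hy b ⟨hab, le_rfl⟩).2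
  set S : Set ℝ := {t | t ∈ Ioc a b ∧ y t ≤ z t} with hS
  have hSb : BddAbove S := ⟨b, fun t ht => ht.1.2⟩
  -- The barrier blows up at `a` while `y ≤ Yb`, so `y` lies below it at times close to `a`.
  obtain ⟨t₁, ht₁⟩ : ∃ t, t ∈ S := by
    set c := (Yb + 1) / Λ with hc
    have hc0 : 0 < c := by positivity
    set τ := min (b - a) (c ^ (-(1 / ν))) with hτ
    have hτ0 : 0 < τ := lt_min (by linarith) (Real.rpow_pos_of_pos hc0 _)
    have hmem : a + τ ∈ Ioc a b := ⟨by linarith, by linarith [min_le_left (b - a) (c ^ (-(1 / ν)))]⟩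
    refine ⟨a + τ, hmem, (hy _ hmem).2.trans ?_⟩
    have h1 : c ≤ τ ^ (-ν) := by
      have h2 : (c ^ (-(1 / ν))) ^ (-ν) = c := by
        rw [← Real.rpow_mul hc0.le]
        rw [show -(1 / ν) * -ν = 1 by field_simp, Real.rpow_one]
      calc c = (c ^ (-(1 / ν))) ^ (-ν) := h2.symm
        _ ≤ τ ^ (-ν) := Real.rpow_le_rpow_of_nonpos hτ0 (min_le_right _ _) (by linarith)
    simp only [hz, add_sub_cancel_left]
    calc Yb ≤ Λ * c := by rw [hc]; field_simp; linarith
      _ ≤ Λ * τ ^ (-ν) := by gcongr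
  set t₀ := sSup S with ht₀
  have ht1 : t₁ ≤ t₀ := le_csSup hSb ht₁
  have hat₀ : a < t₀ := ht₁.1.1.trans_le ht1
  have ht₀b : t₀ ≤ b := csSup_le ⟨t₁, ht₁⟩ fun t ht => ht.1.2
  have hzc : ContinuousAt z t₀ := (hasDerivAt_barrier a Λ ν hat₀).continuousAt
  -- The supremum belongs to the set: along times of the set approaching `t₀`, the upward increment
  -- of `y` is at most `B Yb` times the elapsed time, and `z` is continuous.
  have key1 : y t₀ ≤ z t₀ := by
    obtain ⟨s, -, hs, hsS⟩ := exists_seq_tendsto_sSup ⟨t₁, ht₁⟩ hSb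
    have h1 : ∀ n, y t₀ ≤ z (s n) + B * Yb * (t₀ - s n) := fun n => by
      have hsn : s n ≤ t₀ := le_csSup hSb (hsS n)
      obtain ⟨i1, l1⟩ := he (s n) t₀ (hsS n).1.1 hsn ht₀b
      have h2 : ∫ t in Ioc (s n) t₀, e t ≤ ∫ _t in Ioc (s n) t₀, B * Yb := by
        refine integral_mono_ae i1 (integrable_const _) ?_
        filter_upwards [ae_restrict_mem measurableSet_Ioc] with t ht
        have hm : t ∈ Ioc a b := ⟨(hsS n).1.1.trans ht.1, ht.2.trans ht₀b⟩
        have h3 := hle t hm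
        have h4 := Real.rpow_nonneg (hy t hm).1 (1 + 1 / ν)
        have h5 := mul_le_mul_of_nonneg_left (hy t hm).2 hB
        nlinarith
      rw [setIntegral_const, smul_eq_mul, Measure.real, Real.volume_Ioc,
        ENNReal.toReal_ofReal (by linarith)] at h2
      have := (hsS n).2
      linarith
    have h2 : Tendsto (fun n => z (s n) + B * Yb * (t₀ - s n)) atTop
        (𝓝 (z t₀ + B * Yb * (t₀ - t₀))) :=
      (hzc.tendsto.comp hs).add ((tendsto_const_nhds.sub hs).const_mul _)
    rw [sub_self, mul_zero, add_zero] at h2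
    exact ge_of_tendsto' h2 h1
  have hd : ∀ t ∈ uIcc t₀ b, HasDerivAt z (-(ν * (z t / (t - a)))) t := fun t ht => by
    rw [uIcc_of_le ht₀b] at ht
    exact hasDerivAt_barrier a Λ ν (hat₀.trans_le ht.1)
  have hcont : ContinuousOn (fun t => -(ν * (z t / (t - a)))) (uIcc t₀ b) := by
    refine (continuousOn_const.mul (ContinuousOn.div (fun t ht => (hd t ht).continuousAt.continuousWithinAt)
      (continuousOn_id.sub continuousOn_const) fun t ht => ?_)).neg
    rw [uIcc_of_le ht₀b] at ht
    have := hat₀.trans_le ht.1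
    exact (sub_pos.2 this).ne'
  have hint := hcont.intervalIntegrable (μ := volume)
  have hFTC := intervalIntegral.integral_eq_sub_of_hasDerivAt hd hint
  rw [intervalIntegral.integral_of_le ht₀b] at hFTC
  obtain ⟨i1, l1⟩ := he t₀ b hat₀ ht₀b le_rfl
  have h2 : ∫ t in Ioc t₀ b, e t ≤ ∫ t in Ioc t₀ b, -(ν * (z t / (t - a))) := by
    refine integral_mono_ae i1 ((intervalIntegrable_iff_integrableOn_Ioc_of_le ht₀b).1 hint) ?_
    filter_upwards [ae_restrict_mem measurableSet_Ioc] with t ht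
    have hta : a < t := hat₀.trans ht.1
    have hm : t ∈ Ioc a b := ⟨hta, ht.2⟩
    have hzy : z t < y t := by
      by_contra hcon
      exact absurd (le_csSup hSb (show t ∈ S from ⟨hm, not_lt.1 hcon⟩)) (not_le.2 ht.1)
    have hz0 := hzpos t hta
    have hτ0 : 0 < t - a := by linarith
    have hτ1 : t - a ≤ 1 := by linarith [ht.2]
    have hy0 : 0 < y t := hz0.trans hzy
    have e1 : z t ^ (1 / ν) = (ν + B) / A / (t - a) := by
      rw [hz]; simp only
      rw [Real.mul_rpow hΛ0.le (Real.rpow_nonneg hτ0.le _), hΛ, ← Real.rpow_mul hq.le,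
        ← Real.rpow_mul hτ0.le, mul_one_div_cancel hν.ne', Real.rpow_one,
        show -ν * (1 / ν) = -1 by field_simp, Real.rpow_neg_one]
      rfl
    have e2 : (ν + B) / (t - a) ≤ A * y t ^ (1 / ν) := by
      have := Real.rpow_le_rpow hz0.le hzy.le (z := 1 / ν) (by positivity)
      rw [e1] at this
      calc (ν + B) / (t - a) = A * ((ν + B) / A / (t - a)) := by field_simp
        _ ≤ _ := by gcongr
    have e3 : B ≤ B / (t - a) := by rw [le_div_iff₀ hτ0]; nlinarith
    have e4 : ν / (t - a) + B ≤ A * y t ^ (1 / ν) := by rw [add_div] at e2; linarith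
    refine (hle t hm).trans ?_
    rw [Real.rpow_add hy0, Real.rpow_one]
    have e5 : ν * (z t / (t - a)) ≤ y t * (ν / (t - a)) := by
      rw [show ν * (z t / (t - a)) = z t * (ν / (t - a)) by ring]
      gcongr
    have e6 := mul_le_mul_of_nonneg_left e4 hy0.le
    nlinarith
  linarith

/-! ### Interpolation -/

lemma lintegral_mul_three_rpow_le {u₁ u₂ u₃ : V → ENNReal} (h₁ : AEMeasurable u₁) (h₂ : AEMeasurable u₂)
    (h₃ : AEMeasurable u₃) {α β σ : ℝ} (hα : 0 ≤ α) (hβ : 0 ≤ β) (hσ : 0 ≤ σ) (hs : α + β + σ = 1) :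
    ∫⁻ x, u₁ x ^ α * u₂ x ^ β * u₃ x ^ σ ≤
      (∫⁻ x, u₁ x) ^ α * (∫⁻ x, u₂ x) ^ β * (∫⁻ x, u₃ x) ^ σ := by
  have h := ENNReal.lintegral_prod_norm_pow_le (μ := (volume : Measure V)) (Finset.univ : Finset (Fin 3))
    (f := ![u₁, u₂, u₃]) (p := ![α, β, σ])
    (fun i _ => by fin_cases i; exacts [h₁, h₂, h₃])
    (by simp [Fin.sum_univ_three, hs]) (fun i _ => by fin_cases i; exacts [hα, hβ, hσ])
  simpa [Fin.prod_univ_three] using h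

section
variable {ε γ m p q r s' K α β σ M Q : ℝ} {g : V → ℝ} {f : ℝ → V → ℝ} {F : ℝ × V → ℝ}

/-- Three-term Hölder for `g ^ p = (⟨x⟩ ^ (3γ) g ^ (3p)) ^ α (g ^ q) ^ β (g ⟨x⟩ ^ s') ^ σ`: `e1`
balances the powers of `g`, and `e2` makes the moment compensate the degenerate weight. The exponent
`3 α` arises because `wL6` is a cube root. -/
theorem Adm.interpolation (hg : Adm ε⁻¹ m g) (hε : 0 < ε) (hγ0 : γ < 0) (hp : 2 ≤ p) (hq : 1 ≤ q)
    (hα : 0 ≤ α) (hβ : 0 ≤ β) (hσ : 0 < σ) (hs : α + β + σ = 1) (e1 : p = 3 * p * α + q * β + σ)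
    (e2 : 3 * γ * α + s' * σ = 0) (hi : Integrable fun x => g x * bracket x ^ s') :
    ∫ x, g x ^ p ≤ wL6 γ (fun x => g x ^ (p / 2)) ^ (3 * α) * (∫ x, g x ^ q) ^ β *
      (∫ x, g x * bracket x ^ s') ^ σ := by
  obtain ⟨j1, -⟩ := hg.rpow_bounds hε (q := 3 * p) (by linarith)
  obtain ⟨jp, -⟩ := hg.rpow_bounds hε (q := p) (by linarith)
  obtain ⟨jq, -⟩ := hg.rpow_bounds hε (q := q) hq
  have hbm : ∀ q : ℝ, AEStronglyMeasurable (fun x : V => bracket x ^ q) volume := fun q =>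
    (contDiff_bracket_rpow q (n := 0)).continuous.aestronglyMeasurable
  have j6 : Integrable fun x => (bracket x ^ (γ / 2) * g x ^ (p / 2)) ^ 6 := by
    refine j1.mono' (((hbm _).mul
      (hg.meas.aemeasurable.pow_const _).aestronglyMeasurable).pow 6) (ae_of_all _ fun x => ?_)
    have := integrand_six_le (γ := γ) (p := p) hγ0 zero_le_one le_rfl (hg.nonneg x) x
    rw [one_mul] at this
    rw [Real.norm_of_nonneg this.1]; exact this.2
  have n6 : ∀ x, 0 ≤ (bracket x ^ (γ / 2) * g x ^ (p / 2)) ^ 6 := fun x => by positivity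
  have nq : ∀ q : ℝ, ∀ x, 0 ≤ g x ^ q := fun q x => Real.rpow_nonneg (hg.nonneg x) q
  have ns : ∀ x, 0 ≤ g x * bracket x ^ s' := fun x =>
    mul_nonneg (hg.nonneg x) (Real.rpow_nonneg (bracket_pos x).le _)
  have hpt : ∀ x, g x ^ p = ((bracket x ^ (γ / 2) * g x ^ (p / 2)) ^ 6) ^ α * (g x ^ q) ^ β *
      (g x * bracket x ^ s') ^ σ := fun x => by
    rcases (hg.nonneg x).eq_or_lt with h0 | h0
    · rw [← h0, Real.zero_rpow (by linarith), zero_mul, Real.zero_rpow hσ.ne', mul_zero]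
    · have hb := bracket_pos x
      rw [← Real.rpow_natCast, ← Real.rpow_mul (by positivity), Real.mul_rpow (by positivity) (by positivity),
        Real.mul_rpow (by positivity) (by positivity), ← Real.rpow_mul hb.le, ← Real.rpow_mul h0.le,
        ← Real.rpow_mul h0.le, ← Real.rpow_mul hb.le]
      have : bracket x ^ (γ / 2 * ((6 : ℕ) * α)) * g x ^ (p / 2 * ((6 : ℕ) * α)) * g x ^ (q * β) *
          (g x ^ σ * bracket x ^ (s' * σ)) =
          (bracket x ^ (γ / 2 * ((6 : ℕ) * α)) * bracket x ^ (s' * σ)) *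
          (g x ^ (p / 2 * ((6 : ℕ) * α)) * g x ^ (q * β) * g x ^ σ) := by ring
      rw [this, ← Real.rpow_add hb, ← Real.rpow_add h0, ← Real.rpow_add h0,
        show γ / 2 * ((6 : ℕ) * α) + s' * σ = 0 by push_cast; linarith, Real.rpow_zero, one_mul]
      congr 1; push_cast; linarith
  have i6 : 0 ≤ ∫ x, (bracket x ^ (γ / 2) * g x ^ (p / 2)) ^ 6 := integral_nonneg n6
  have iq : 0 ≤ ∫ x, g x ^ q := integral_nonneg (nq q)
  have is : 0 ≤ ∫ x, g x * bracket x ^ s' := integral_nonneg ns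
  have hw : wL6 γ (fun x => g x ^ (p / 2)) ^ (3 * α) =
      (∫ x, (bracket x ^ (γ / 2) * g x ^ (p / 2)) ^ 6) ^ α := by
    rw [wL6, ← Real.rpow_mul i6]; congr 1; ring
  have H := lintegral_mul_three_rpow_le (u₁ := fun x => ENNReal.ofReal ((bracket x ^ (γ / 2) * g x ^ (p / 2)) ^ 6))
    (u₂ := fun x => ENNReal.ofReal (g x ^ q)) (u₃ := fun x => ENNReal.ofReal (g x * bracket x ^ s'))
    j6.1.aemeasurable.ennreal_ofReal jq.1.aemeasurable.ennreal_ofReal hi.1.aemeasurable.ennreal_ofReal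
    hα hβ hσ.le hs
  rw [← ofReal_integral_eq_lintegral_ofReal j6 (ae_of_all _ n6),
    ← ofReal_integral_eq_lintegral_ofReal jq (ae_of_all _ (nq q)),
    ← ofReal_integral_eq_lintegral_ofReal hi (ae_of_all _ ns),
    ENNReal.ofReal_rpow_of_nonneg i6 hα, ENNReal.ofReal_rpow_of_nonneg iq hβ,
    ENNReal.ofReal_rpow_of_nonneg is hσ.le, ← ENNReal.ofReal_mul (by positivity),
    ← ENNReal.ofReal_mul (by positivity)] at H
  have e3 : ∀ x, ENNReal.ofReal ((bracket x ^ (γ / 2) * g x ^ (p / 2)) ^ 6) ^ α *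
      ENNReal.ofReal (g x ^ q) ^ β * ENNReal.ofReal (g x * bracket x ^ s') ^ σ =
      ENNReal.ofReal (g x ^ p) := fun x => by
    have h1 := n6 x
    have h2 := nq q x
    have h3 := ns x
    rw [ENNReal.ofReal_rpow_of_nonneg h1 hα, ENNReal.ofReal_rpow_of_nonneg h2 hβ,
      ENNReal.ofReal_rpow_of_nonneg h3 hσ.le, ← ENNReal.ofReal_mul (by positivity),
      ← ENNReal.ofReal_mul (by positivity), ← hpt x]
  simp only [e3] at H
  rw [← ofReal_integral_eq_lintegral_ofReal jp (ae_of_all _ (nq p)),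
    ENNReal.ofReal_le_ofReal_iff (by positivity)] at H
  rw [hw]; exact H

end
end LFD
end

noncomputable section
namespace LFD
open MeasureTheory Set Filter Topology

/-! ### Iteration over exponents -/

/-- The family of energy inequalities for the powers of `f`, with constants polynomial in the
exponent. -/
def EnergyIneq (γ A B k : ℝ) (f : ℝ → V → ℝ) : Prop :=
  ∀ p : ℝ, 2 ≤ p → ∃ e : ℝ → ℝ,
    (∀ t₁ t₂, 0 < t₁ → t₁ ≤ t₂ → Integrable e (volume.restrict (Ioc t₁ t₂)) ∧
      (∫ x, f t₂ x ^ p) - ∫ x, f t₁ x ^ p ≤ ∫ t in Ioc t₁ t₂, e t) ∧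
    ∀ t, 0 < t → e t ≤ -A * wL6 γ (fun x => f t x ^ (p / 2)) + B * p ^ k * ∫ x, f t x ^ p

section
variable {ε γ m p q r s s' K α β σ ν M Q A B k T : ℝ} {g : V → ℝ} {f : ℝ → V → ℝ} {F : ℝ × V → ℝ}

/-- The radius is `min 1 (c / p)` to the power `1 / (2 + γ)`. The price `r⁻²` is polynomial in `p`,
which the iteration tolerates. -/
lemma exists_radius {c γ : ℝ} (hc : 0 < c) (hγ : -2 < γ) (hp : 1 ≤ p) : ∃ r : ℝ, 0 < r ∧ r ≤ 1 ∧
    r ^ (2 + γ) ≤ c / p ∧ r⁻¹ ^ 2 ≤ (1 + 1 / c) ^ (2 / (2 + γ)) * p ^ (2 / (2 + γ)) := by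
  have hg : 0 < 2 + γ := by linarith
  have hp0 : 0 < p := by linarith
  set w := min 1 (c / p) with hw
  have hw0 : 0 < w := lt_min one_pos (by positivity)
  have hw1 : w ≤ 1 := min_le_left _ _
  refine ⟨w ^ (1 / (2 + γ)), Real.rpow_pos_of_pos hw0 _, Real.rpow_le_one hw0.le hw1 (by positivity),
    ?_, ?_⟩
  · rw [← Real.rpow_mul hw0.le, one_div_mul_cancel hg.ne', Real.rpow_one]
    exact min_le_right _ _
  · have h1 : w⁻¹ ≤ (1 + 1 / c) * p := by
      rw [inv_le_comm₀ hw0 (by positivity)]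
      refine le_min ?_ ?_
      · refine inv_le_one_of_one_le₀ ?_
        have : 0 < 1 / c := by positivity
        nlinarith
      · rw [inv_le_comm₀ (by positivity) (by positivity), inv_div]
        have : p / c = 1 / c * p := by ring
        nlinarith
    rw [← Real.inv_rpow hw0.le, ← Real.rpow_natCast, ← Real.rpow_mul (by positivity),
      ← Real.mul_rpow (by positivity) hp0.le]
    rw [show 1 / (2 + γ) * ((2 : ℕ) : ℝ) = 2 / (2 + γ) by push_cast; ring]
    exact Real.rpow_le_rpow (by positivity) h1 (by positivity)

/-- The constants are fixed before `ε` and the solution: the drift coefficient is linear in `p` and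
involves only the mass-energy bound `4`, and the radius contributes the further power `2 / (2 + γ)`.
-/
theorem exists_energyIneq (hγ : -2 < γ) (hγ0 : γ < 0) (hK : 0 < K) : ∃ A B k : ℝ, 0 < A ∧ 0 < B ∧
    0 ≤ k ∧ ∀ (ε : ℝ) (f : ℝ → V → ℝ) (F : ℝ × V → ℝ), 0 < ε → Ev γ ε 4 f F →
      (∀ t, 0 < t → ∀ x ξ : V, K * bracket x ^ γ * ‖ξ‖ ^ 2 ≤
        ∑ i, ∑ j, Sm γ (fl ε (f t)) i j x * ξ i * ξ j) → EnergyIneq γ A B k f := by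
  have hsC := sobC_pos
  have hg : 0 < 2 + γ := by linarith
  set R₀ := radC (3 * γ / 2) ^ (2 / 3 : ℝ) with hR₀
  have hR₀0 : 0 ≤ R₀ := Real.rpow_nonneg (radC_nonneg (by linarith)) _
  -- Here `96 = 24 · 4`, with `4` the bound for mass plus energy; the `+ 1` avoids division by a
  -- possibly vanishing `R₀`.
  set c := K / (12 * sobC) / (96 * (R₀ + 1)) with hc
  have hc0 : 0 < c := by positivity
  set k := 2 / (2 + γ) with hk
  have hk0 : 0 < k := by positivity
  refine ⟨K / (12 * sobC), 3 / 2 * K + 96 * (1 + 1 / c) ^ k, 1 + k, by positivity, by positivity,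
    by positivity, fun ε f F hε hE hco p hp => ?_⟩
  have hp1 : 1 ≤ p := by linarith
  have hp0 : 0 < p := by linarith
  obtain ⟨r, hr0, hr1, hr2, hr3⟩ := exists_radius hc0 hγ hp1
  have hrK : 24 * (p - 1) * 4 * (R₀ * r ^ (2 + γ)) ≤ K / (12 * sobC) := by
    have h1 : 0 ≤ r ^ (2 + γ) := by positivity
    have hcp : 0 ≤ c / p := by positivity
    calc 24 * (p - 1) * 4 * (R₀ * r ^ (2 + γ)) ≤ 24 * p * 4 * ((R₀ + 1) * (c / p)) := by
          gcongr
          · linarith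
          · linarith
      _ = K / (12 * sobC) := by rw [hc]; field_simp; ring
  refine ⟨_, fun t₁ t₂ h0 h12 => hE.energy hε hγ hγ0 hp hK hco hr0 hr1 hrK h0 h12, fun t ht => ?_⟩
  have ha := hE.adm t ht
  have hY : ∫ x, bracket x ^ γ * f t x ^ p ≤ ∫ x, f t x ^ p := by
    obtain ⟨j, -⟩ := ha.rpow_bounds hε (q := p) hp1
    refine integral_mono_of_nonneg (ae_of_all _ fun x => ?_) j (ae_of_all _ fun x => ?_)
    · have := bracket_pos x
      have := Real.rpow_nonneg (ha.nonneg x) p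
      simp only [Pi.zero_apply]; positivity
    · exact mul_le_of_le_one_left (Real.rpow_nonneg (ha.nonneg x) p) (bracket_rpow_le_one hγ0 x)
  have hY0 : 0 ≤ ∫ x, f t x ^ p := integral_nonneg fun x => Real.rpow_nonneg (ha.nonneg x) p
  have hk2 : 3 / 2 * K + 24 * (p - 1) * 4 * r⁻¹ ^ 2 ≤
      (3 / 2 * K + 96 * (1 + 1 / c) ^ k) * p ^ (1 + k) := by
    have h1 : 1 ≤ p ^ (1 + k) := Real.one_le_rpow hp1 (by positivity)
    have h2 : 24 * (p - 1) * 4 * r⁻¹ ^ 2 ≤ 24 * p * 4 * ((1 + 1 / c) ^ k * p ^ k) := by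
      gcongr; linarith
    have h3 : p ^ (1 + k) = p * p ^ k := by rw [Real.rpow_add hp0, Real.rpow_one]
    have h4 : 24 * p * 4 * ((1 + 1 / c) ^ k * p ^ k) = 96 * (1 + 1 / c) ^ k * p ^ (1 + k) := by
      rw [h3]; ring
    nlinarith
  have hk20 : 0 ≤ 3 / 2 * K + 24 * (p - 1) * 4 * r⁻¹ ^ 2 := by
    have : 0 ≤ p - 1 := by linarith
    positivity
  unfold enG
  have := mul_le_mul_of_nonneg_left hY hk20
  have := mul_le_mul_of_nonneg_right hk2 hY0
  linarith

/-- Gain of integrability over a time window. -/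
lemma EnergyIneq.gain (hEI : EnergyIneq γ A B k f) (hadm : ∀ t, 0 < t → Adm ε⁻¹ m (f t))
    (hε : 0 < ε) (hγ0 : γ < 0) (hA : 0 < A) (hB : 0 ≤ B) (hp : 2 ≤ p) (hq : 1 ≤ q)
    (hα : 0 < α) (hα1 : 3 * α < 1) (hβ : 0 ≤ β) (hσ : 0 < σ) (hs : α + β + σ = 1)
    (e1 : p = 3 * p * α + q * β + σ) (e2 : 3 * γ * α + s' * σ = 0) (hν : ν * (1 - 3 * α) = 3 * α)
    {a b : ℝ} (ha : 0 ≤ a) (hab : a < b) (hba : b ≤ a + 1) (hM : 0 < M) (hQ : 0 < Q)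
    (hiM : ∀ t ∈ Ioc a b, Integrable fun x => f t x * bracket x ^ s')
    (hbM : ∀ t ∈ Ioc a b, ∫ x, f t x * bracket x ^ s' ≤ M)
    (hbQ : ∀ t ∈ Ioc a b, ∫ x, f t x ^ q ≤ Q) :
    ∫ x, f b x ^ p ≤ ((ν + B * p ^ k) / A) ^ ν * (Q ^ β * M ^ σ) ^ (1 / (1 - 3 * α)) *
      (b - a) ^ (-ν) := by
  have h3α : 0 < 1 - 3 * α := by linarith
  have hν' : ν = 3 * α / (1 - 3 * α) := by rw [eq_div_iff h3α.ne']; exact hν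
  have hν0 : 0 < ν := by rw [hν']; positivity
  have hν1 : 1 + 1 / ν = 1 / (3 * α) := by rw [hν']; field_simp; ring
  have hp0 : 0 < p := by linarith
  set W := Q ^ β * M ^ σ with hW
  have hW0 : 0 < W := by positivity
  set c := 1 / (3 * α) with hc
  have hc0 : 0 < c := by positivity
  obtain ⟨e, he1, he2⟩ := hEI p hp
  have hpos : ∀ t ∈ Ioc a b, 0 < t := fun t ht => ha.trans_lt ht.1
  have hY0 : ∀ t, 0 < t → 0 ≤ ∫ x, f t x ^ p := fun t ht =>
    integral_nonneg fun x => Real.rpow_nonneg ((hadm t ht).nonneg x) p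
  -- Interpolation, inverted, bounds the dissipation below by `W ^ (-c) (∫ f ^ p) ^ c` with `c = 1 /
  -- (3α) = 1 + 1/ν`, which is the required damping. Raising `W ^ c` to the power `ν` produces the
  -- exponent `1 / (1 - 3α)`.
  have H := le_of_superlinear_damping (y := fun t => ∫ x, f t x ^ p) (e := e) (A := A * (W ^ c)⁻¹)
    (B := B * p ^ k) (ν := ν) (Yb := ε⁻¹ ^ (p - 1) * m) hab hba (by positivity) (by positivity) hν0
    (fun t ht => ⟨hY0 t (hpos t ht), ((hadm t (hpos t ht)).rpow_bounds hε (by linarith)).2⟩)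
    (fun t₁ t₂ h1 h2 _ => he1 t₁ t₂ (ha.trans_lt h1) h2) ?_
  · refine H.trans (le_of_eq ?_)
    congr 1
    have hN : 0 ≤ (ν + B * p ^ k) / A := by positivity
    have hWc : 0 ≤ W ^ c := by positivity
    rw [show (ν + B * p ^ k) / (A * (W ^ c)⁻¹) = (ν + B * p ^ k) / A * W ^ c by field_simp,
      Real.mul_rpow hN hWc, ← Real.rpow_mul hW0.le]
    congr 2
    rw [hc, hν']; field_simp
  · intro t ht
    have hat := hadm t (hpos t ht)
    refine (he2 t (hpos t ht)).trans ?_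
    have hI := hat.interpolation hε hγ0 hp hq hα.le hβ hσ hs e1 e2 (hiM t ht)
    set D := wL6 γ (fun x => f t x ^ (p / 2)) with hD
    have hD0 : 0 ≤ D := wL6_nonneg _ _
    have n1 : 0 ≤ ∫ x, f t x ^ q := integral_nonneg fun x => Real.rpow_nonneg (hat.nonneg x) q
    have n2 : 0 ≤ ∫ x, f t x * bracket x ^ s' := integral_nonneg fun x =>
      mul_nonneg (hat.nonneg x) (Real.rpow_nonneg (bracket_pos x).le _)
    have h1 : ∫ x, f t x ^ p ≤ D ^ (3 * α) * W := by
      refine hI.trans ?_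
      rw [mul_assoc, hW]
      have h2 := Real.rpow_le_rpow n1 (hbQ t ht) hβ
      have h3 := Real.rpow_le_rpow n2 (hbM t ht) hσ.le
      have h4 : 0 ≤ D ^ (3 * α) := by positivity
      have h5 : 0 ≤ (∫ x, f t x * bracket x ^ s') ^ σ := by positivity
      gcongr
    have h2 := Real.rpow_le_rpow (hY0 t (hpos t ht)) h1 hc0.le
    rw [Real.mul_rpow (by positivity) hW0.le, ← Real.rpow_mul hD0,
      show 3 * α * c = 1 by rw [hc]; field_simp, Real.rpow_one] at h2
    rw [hν1]
    have h3 : A * (W ^ c)⁻¹ * (∫ x, f t x ^ p) ^ c ≤ A * D := by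
      have hWc : 0 < W ^ c := by positivity
      calc A * (W ^ c)⁻¹ * (∫ x, f t x ^ p) ^ c ≤ A * (W ^ c)⁻¹ * (D * W ^ c) := by gcongr
        _ = A * D := by field_simp
    linarith

/-- A bound for all the norms along a geometric sequence of exponents gives a uniform bound. -/
lemma Adm.ae_le_of_integral_rpow_le (hg : Adm ε⁻¹ m g) (hε : 0 < ε) {κ X H : ℝ} (hκ : 0 ≤ κ)
    (hX : 0 < X) (hH : 0 < H)
    (h : ∀ n : ℕ, ∫ x, g x ^ ((2 : ℝ) ^ n * (2 + κ) - κ) ≤ X ^ (2 ^ n) / H) :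
    ∀ᵐ x, g x ≤ X ^ (1 / (2 + κ)) := by
  set L := X ^ (1 / (2 + κ)) with hL
  have hL0 : 0 < L := by positivity
  have hLX : L ^ (2 + κ) = X := by
    rw [hL, ← Real.rpow_mul hX.le, one_div_mul_cancel (by positivity), Real.rpow_one]
  -- By Chebyshev the set where `g ≥ l` has measure at most a fixed multiple of `(X / l ^ (2 + κ)) ^
  -- (2 ^ n)`, which tends to zero since `l ^ (2 + κ) > X`.
  have key : ∀ l, L < l → ∀ᵐ x, g x ≤ l := fun l hl => by
    have hl0 : 0 < l := hL0.trans hl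
    have hXl : X < l ^ (2 + κ) := by
      rw [← hLX]; exact Real.rpow_lt_rpow hL0.le hl (by positivity)
    have hlp : 0 < l ^ (2 + κ) := by positivity
    set S := {x | l ≤ g x} with hS
    have h1 : ∀ n : ℕ, (volume : Measure V).real S ≤ l ^ κ / H * (X / l ^ (2 + κ)) ^ (2 ^ n) := fun n => by
      set p := (2 : ℝ) ^ n * (2 + κ) - κ with hp
      have hn : (1 : ℝ) ≤ 2 ^ n := one_le_pow₀ one_le_two
      have hp1 : 1 ≤ p := by rw [hp]; nlinarith
      obtain ⟨j, -⟩ := hg.rpow_bounds hε hp1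
      have h2 := mul_meas_ge_le_integral_of_nonneg (μ := (volume : Measure V)) (f := fun x => g x ^ p)
        (ae_of_all _ fun x => Real.rpow_nonneg (hg.nonneg x) p) j (l ^ p)
      have h3 : {x | l ^ p ≤ g x ^ p} = S := by
        ext x
        exact Real.rpow_le_rpow_iff hl0.le (hg.nonneg x) (by linarith)
      rw [h3] at h2
      have h4 := h2.trans (h n)
      have h5 : l ^ p = (l ^ (2 + κ)) ^ (2 ^ n) / l ^ κ := by
        rw [hp, Real.rpow_sub hl0, mul_comm ((2 : ℝ) ^ n), Real.rpow_mul hl0.le]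
        congr 1
        rw [← Real.rpow_natCast (l ^ (2 + κ)) (2 ^ n)]; push_cast; rfl
      rw [h5] at h4
      have hlk : 0 < l ^ κ := by positivity
      rw [div_pow]
      have h6 : 0 < (l ^ (2 + κ)) ^ (2 ^ n) := by positivity
      rw [div_mul_eq_mul_div, div_le_iff₀ hlk] at h4
      rw [div_mul_div_comm, le_div_iff₀ (by positivity)]
      rw [div_mul_eq_mul_div, le_div_iff₀ hH] at h4
      linarith
    have h2 : Tendsto (fun n : ℕ => l ^ κ / H * (X / l ^ (2 + κ)) ^ (2 ^ n)) atTop (𝓝 (l ^ κ / H * 0)) := by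
      refine Tendsto.const_mul _ ((tendsto_pow_atTop_nhds_zero_of_lt_one (by positivity)
        ((div_lt_one hlp).2 hXl)).comp (tendsto_pow_atTop_atTop_of_one_lt one_lt_two))
    rw [mul_zero] at h2
    have h3 : (volume : Measure V).real S = 0 :=
      le_antisymm (ge_of_tendsto' h2 h1) measureReal_nonneg
    have h4 : volume S < ⊤ := by
      refine (measure_mono ?_).trans_lt (hg.integrable.measure_norm_ge_lt_top hl0)
      intro x hx
      have hx' : l ≤ g x := hx
      exact hx'.trans (le_abs_self _)
    rw [measureReal_eq_zero_iff h4.ne] at h3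
    refine measure_mono_null (fun x hx => ?_) h3
    have hx' : ¬g x ≤ l := hx
    exact (not_le.1 hx').le
  have h2 := ae_all_iff.2 fun n : ℕ => key (L + 1 / (n + 1)) (by
    have : (0 : ℝ) < 1 / (n + 1) := by positivity
    linarith)
  filter_upwards [h2] with x hx
  have h3 : Tendsto (fun n : ℕ => L + 1 / ((n : ℝ) + 1)) atTop (𝓝 (L + 0)) :=
    tendsto_const_nhds.add tendsto_one_div_add_atTop_nhds_zero_nat
  rw [add_zero] at h3
  exact ge_of_tendsto' h3 hx

end
end LFD
end

noncomputable section
namespace LFD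
open MeasureTheory Set Filter Topology

section
variable {ε γ m p q r s K α β σ ν κ M Q A B k T τ : ℝ} {f : ℝ → V → ℝ}

/-- The starting point of the iteration uses `q = 1` with `β = 0`. The moment that then balances the
weight has order `-3γ/4 < 2` and is controlled by mass and energy, so `m_s` is not spent here. -/
lemma EnergyIneq.sq_bound (hEI : EnergyIneq γ A B k f) (hadm : ∀ t, 0 < t → Adm ε⁻¹ 4 (f t))
    (hε : 0 < ε) (hγ : -2 < γ) (hγ0 : γ < 0) (hA : 0 < A) (hB : 0 ≤ B) {t : ℝ} (hτ : 0 < τ)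
    (hτ1 : τ ≤ 1) (ht : τ ≤ t) :
    ∫ x, f t x ^ (2 : ℝ) ≤ ((3 / 2 + B * 2 ^ k) / A) ^ (3 / 2 : ℝ) *
      ((4 : ℝ) ^ (0 : ℝ) * 4 ^ (4 / 5 : ℝ)) ^ (1 / (1 - 3 * (1 / 5)) : ℝ) * τ ^ (-(3 / 2) : ℝ) := by
  have hpos : ∀ r ∈ Ioc (t - τ) t, 0 < r := fun r hr => by linarith [hr.1]
  have hle : ∀ x : V, bracket x ^ (-3 * γ / 4) ≤ bracket x ^ 2 := fun x => by
    rw [← Real.rpow_natCast]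
    exact Real.rpow_le_rpow_of_exponent_le (one_le_bracket x) (by push_cast; linarith)
  have hi : ∀ r ∈ Ioc (t - τ) t, Integrable fun x => f r x * bracket x ^ (-3 * γ / 4) := fun r hr => by
    have ha := hadm r (hpos r hr)
    refine ha.int.mono' (ha.meas.mul
      (contDiff_bracket_rpow _ (n := 0)).continuous.aestronglyMeasurable) (ae_of_all _ fun x => ?_)
    have h1 := Real.rpow_nonneg (bracket_pos x).le (-3 * γ / 4)
    rw [Real.norm_of_nonneg (mul_nonneg (ha.nonneg x) h1)]
    exact mul_le_mul_of_nonneg_left (hle x) (ha.nonneg x)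
  have H := hEI.gain (p := 2) (q := 1) (α := 1 / 5) (β := 0) (σ := 4 / 5) (s' := -3 * γ / 4)
    (ν := 3 / 2) (M := 4) (Q := 4) (a := t - τ) (b := t) hadm hε hγ0 hA hB le_rfl le_rfl (by norm_num)
    (by norm_num) le_rfl (by norm_num) (by norm_num) (by norm_num) (by ring) (by norm_num)
    (by linarith) (by linarith) (by linarith) (by norm_num) (by norm_num) hi
    (fun r hr => ?_) (fun r hr => ?_)
  · rwa [sub_sub_cancel] at H
  · have ha := hadm r (hpos r hr)
    exact (integral_mono (hi r hr) ha.int fun x =>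
      mul_le_mul_of_nonneg_left (hle x) (ha.nonneg x)).trans ha.int_le
  · simp only [Real.rpow_one]
    exact (hadm r (hpos r hr)).integral_le

/-- The constants of the iteration. -/
lemma iterate_const_le (hA : 0 < A) (hB : 0 ≤ B) (hk : 0 ≤ k) (hν : 0 < ν) (hκ : 0 ≤ κ) (hτ : 0 < τ)
    (hM : 0 < M) {Z : ℝ} (hZ : 0 < Z) (h3α : 0 < 1 - 3 * α) (hβ : β = 2 * (1 - 3 * α))
    (hσ : σ = κ * (1 - 3 * α)) (n : ℕ) :
    ((ν + B * ((2 : ℝ) ^ (n + 1) * (2 + κ) - κ) ^ k) / A) ^ ν *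
      (Z ^ β * M ^ σ) ^ (1 / (1 - 3 * α)) * (τ / 2 ^ (n + 1)) ^ (-ν) ≤
    (((ν + B) * (2 + κ) ^ k / A) ^ ν * τ ^ (-ν) * M ^ κ) * ((2 : ℝ) ^ ((k + 1) * ν)) ^ (n + 1) * Z ^ 2 := by
  set E : ℝ := 2 ^ (n + 1) with hE
  have hE0 : 0 < E := by positivity
  have hE1 : 1 ≤ E := one_le_pow₀ one_le_two
  set p := E * (2 + κ) - κ with hp
  have hp1 : 1 ≤ p := by rw [hp]; nlinarith
  have hp0 : 0 < p := by linarith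
  have hpk : 1 ≤ p ^ k := Real.one_le_rpow hp1 hk
  have h1 : (ν + B * p ^ k) / A ≤ (ν + B) * (2 + κ) ^ k / A * E ^ k := by
    have h2 : p ^ k ≤ (2 + κ) ^ k * E ^ k := by
      rw [← Real.mul_rpow (by positivity) hE0.le]
      exact Real.rpow_le_rpow hp0.le (by rw [hp]; linarith) hk
    rw [div_mul_eq_mul_div, div_le_div_iff_of_pos_right hA, mul_assoc]
    calc ν + B * p ^ k ≤ (ν + B) * p ^ k := by nlinarith
      _ ≤ _ := by gcongr
  have h2 : ((ν + B * p ^ k) / A) ^ ν ≤ ((ν + B) * (2 + κ) ^ k / A) ^ ν * E ^ (k * ν) := by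
    rw [Real.rpow_mul hE0.le, ← Real.mul_rpow (by positivity) (by positivity)]
    exact Real.rpow_le_rpow (by positivity) h1 hν.le
  have h3 : (Z ^ β * M ^ σ) ^ (1 / (1 - 3 * α)) = Z ^ 2 * M ^ κ := by
    rw [Real.mul_rpow (by positivity) (by positivity), ← Real.rpow_mul hZ.le, ← Real.rpow_mul hM.le,
      hβ, hσ, mul_assoc, mul_assoc, mul_one_div_cancel h3α.ne', mul_one, mul_one]
    norm_num
  have h4 : (τ / E) ^ (-ν) = τ ^ (-ν) * E ^ ν := by
    rw [Real.div_rpow hτ.le hE0.le, Real.rpow_neg hE0.le, div_inv_eq_mul]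
  have h5 : ((2 : ℝ) ^ ((k + 1) * ν)) ^ (n + 1) = E ^ (k * ν) * E ^ ν := by
    rw [← Real.rpow_add hE0, hE, ← Real.rpow_natCast, ← Real.rpow_natCast, ← Real.rpow_mul (by norm_num),
      ← Real.rpow_mul (by norm_num)]
    congr 1; ring
  rw [h3, h4, h5]
  calc _ ≤ ((ν + B) * (2 + κ) ^ k / A) ^ ν * E ^ (k * ν) * (Z ^ 2 * M ^ κ) * (τ ^ (-ν) * E ^ ν) := by
        gcongr
    _ = _ := by ring

/-- Uniform bound from the energy inequalities. -/
theorem EnergyIneq.ae_le (hEI : EnergyIneq γ A B k f) (hadm : ∀ t, 0 < t → Adm ε⁻¹ 4 (f t))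
    (hε : 0 < ε) (hγ0 : γ < 0) (hA : 0 < A) (hB : 0 ≤ B) (hk : 0 ≤ k)
    (hs : -(3 / 2 * γ) < s) (hM : 0 < M) (hτ : 0 < τ) (hτ1 : τ ≤ 1)
    (hmom : ∀ t, 0 < t → t < T → Integrable (fun x => f t x * bracket x ^ s) ∧
      ∫ x, f t x * bracket x ^ s ≤ M) {Z₀ : ℝ} (hZ₀ : 0 < Z₀)
    (h2 : ∀ t, τ ≤ t → t < T → ∫ x, f t x ^ (2 : ℝ) ≤ Z₀) (hν : ν = 3 * s / (2 * s + 3 * γ))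
    (hκ : κ = -(3 * γ) / (2 * s + 3 * γ)) {t : ℝ} (ht : 2 * τ ≤ t) (htT : t < T) :
    ∀ᵐ x, f t x ≤ (((ν + B) * (2 + κ) ^ k / A) ^ ν * τ ^ (-ν) * M ^ κ *
      ((2 : ℝ) ^ ((k + 1) * ν)) ^ 2 * Z₀) ^ (1 / (2 + κ)) := by
  have hd : 0 < 2 * s + 3 * γ := by linarith
  have hs0 : 0 < s := by linarith
  have hd5 : 0 < 5 * s + 3 * γ := by linarith
  have hd' := hd.ne'
  have hd5' := hd5.ne'
  have hν0 : 0 < ν := by rw [hν]; positivity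
  have hκ0 : 0 < κ := by rw [hκ]; exact div_pos (by linarith) hd
  set H := ((ν + B) * (2 + κ) ^ k / A) ^ ν * τ ^ (-ν) * M ^ κ with hH
  set b := (2 : ℝ) ^ ((k + 1) * ν) with hb
  have hb1 : 1 ≤ b := Real.one_le_rpow one_le_two (by positivity)
  have hb0 : 0 < b := by positivity
  have hH0 : 0 < H := by positivity
  set X := H * b ^ 2 * Z₀ with hX
  have hX0 : 0 < X := by positivity
  -- With `β = 2 (1 - 3α)` and `σ = κ (1 - 3α)` the exponent relations hold for `p = 2 q + κ` for
  -- every `q`. Thus `ν` and the power of `M` are the same at every step, and each step squares the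
  -- previous norm.
  set α := s / (5 * s + 3 * γ) with hα
  have hα0 : 0 < α := by positivity
  have hα' : α * (5 * s + 3 * γ) = s := div_mul_cancel₀ _ hd5'
  have hκ' : κ * (2 * s + 3 * γ) = -(3 * γ) := by rw [hκ]; exact div_mul_cancel₀ _ hd'
  have hν' : ν * (2 * s + 3 * γ) = 3 * s := by rw [hν]; exact div_mul_cancel₀ _ hd'
  have h3α : 1 - 3 * α = (2 * s + 3 * γ) / (5 * s + 3 * γ) := by
    rw [eq_div_iff hd5']; linear_combination -3 * hα'
  have h3α0 : 0 < 1 - 3 * α := by rw [h3α]; positivity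
  have h3' : (1 - 3 * α) * (5 * s + 3 * γ) = 2 * s + 3 * γ := by rw [h3α]; exact div_mul_cancel₀ _ hd5'
  -- The right-hand side solves the recursion `Z (n + 1) = H b ^ (n + 1) Z n ^ 2` started at `Z₀`.
  -- The windows have length `τ / 2 ^ (n + 1)`, so all of them fit between `τ` and `2 τ`.
  have key : ∀ n : ℕ, ∀ t, τ * (2 - 1 / 2 ^ n) ≤ t → t < T →
      ∫ x, f t x ^ ((2 : ℝ) ^ n * (2 + κ) - κ) ≤ X ^ (2 ^ n) / (H * b ^ (n + 2)) := by
    intro n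
    induction n with
    | zero =>
      intro t h1 h3
      have e1 : (2 : ℝ) ^ 0 * (2 + κ) - κ = 2 := by ring
      rw [e1]
      refine (h2 t (by norm_num at h1; linarith) h3).trans (le_of_eq ?_)
      rw [hX]; field_simp; simp
    | succ n ih =>
      intro t h1 h3
      set Z := X ^ (2 ^ n) / (H * b ^ (n + 2)) with hZ
      have hZ0 : 0 < Z := by positivity
      have hn : (1 : ℝ) ≤ 2 ^ n := one_le_pow₀ one_le_two
      have hn1 : (2 : ℝ) ^ (n + 1) = 2 * 2 ^ n := by ring
      set w := τ / 2 ^ (n + 1) with hw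
      have hw0 : 0 < w := by positivity
      have hw1 : w ≤ 1 := by
        rw [hw, div_le_one (by positivity), hn1]; linarith
      have hstart : τ * (2 - 1 / 2 ^ n) = τ * (2 - 1 / 2 ^ (n + 1)) - w := by
        rw [hw, hn1]; field_simp; ring
      have hst0 : 0 ≤ τ * (2 - 1 / 2 ^ n) := by
        have : (1 : ℝ) / 2 ^ n ≤ 1 := by rw [div_le_one (by positivity)]; exact hn
        exact mul_nonneg hτ.le (by linarith)
      have ha0 : 0 ≤ t - w := by linarith
      have hG := hEI.gain (p := (2 : ℝ) ^ (n + 1) * (2 + κ) - κ) (q := (2 : ℝ) ^ n * (2 + κ) - κ)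
        (α := α) (β := 2 * (1 - 3 * α)) (σ := κ * (1 - 3 * α)) (s' := s) (ν := ν) (M := M) (Q := Z)
        (a := t - w) (b := t) hadm hε hγ0 hA hB (by rw [hn1]; nlinarith) (by nlinarith) hα0
        (by linarith) (by positivity) (by positivity)
        (mul_right_cancel₀ hd5' (by linear_combination hα' + (2 + κ) * h3' + hκ')) ?_
        (mul_right_cancel₀ hd5' (by linear_combination 3 * γ * hα' + s * κ * h3' + s * hκ'))
        (mul_right_cancel₀ hd5' (by linear_combination ν * h3' + hν' - 3 * hα')) ha0 (by linarith) (by linarith) hM hZ0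
        (fun r hr => (hmom r (ha0.trans_lt hr.1) (hr.2.trans_lt h3)).1)
        (fun r hr => (hmom r (ha0.trans_lt hr.1) (hr.2.trans_lt h3)).2)
        (fun r hr => ih r (by linarith [hr.1]) (hr.2.trans_lt h3))
      · rw [sub_sub_cancel] at hG
        refine hG.trans ((iterate_const_le hA hB hk hν0 hκ0.le hτ hM hZ0 h3α0 rfl rfl n).trans
          (le_of_eq ?_))
        rw [← hH, ← hb, hZ, pow_succ 2 n, pow_mul, div_pow]
        field_simp
        ring
      · have : (2 : ℝ) ^ (n + 1) * (2 + κ) - κ = 2 * ((2 : ℝ) ^ n * (2 + κ) - κ) + κ := by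
          rw [hn1]; ring
        have h6 : ∀ P q' : ℝ, P = 2 * q' + κ → P = 3 * P * α + q' * (2 * (1 - 3 * α)) + κ * (1 - 3 * α) :=
          fun P q' h => by rw [h]; ring
        exact h6 _ _ this
  have ht0 : 0 < t := by linarith
  refine (hadm t ht0).ae_le_of_integral_rpow_le hε hκ0.le hX0 hH0 fun n => ?_
  refine (key n t ?_ htT).trans ?_
  · have : (0 : ℝ) < 1 / 2 ^ n := by positivity
    nlinarith
  · refine div_le_div_of_nonneg_left (by positivity) hH0 ?_
    exact le_mul_of_one_le_right hH0.le (one_le_pow₀ hb1)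

/-- Smoothing estimate in terms of the moment bound. -/
theorem exists_sup_const (hγ : -2 < γ) (hγ0 : γ < 0) (hA : 0 < A) (hB : 0 ≤ B) (hk : 0 ≤ k)
    (hs : -(3 / 2 * γ) < s) : ∃ C : ℝ, 0 < C ∧ ∀ (ε : ℝ) (f : ℝ → V → ℝ) (M T tstar : ℝ),
      EnergyIneq γ A B k f → (∀ t, 0 < t → Adm ε⁻¹ 4 (f t)) → 0 < ε → 0 < M → 0 < tstar →
      (∀ t, 0 < t → t < T → Integrable (fun x => f t x * bracket x ^ s) ∧
        ∫ x, f t x * bracket x ^ s ≤ M) →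
      ∀ t, tstar ≤ t → t < T → ∀ᵐ x, f t x ≤
        C * (1 + tstar ^ (-(3 * s / (4 * s + 3 * γ)) - 3 / 4)) * M ^ (-(3 * γ) / (4 * s + 3 * γ)) := by
  have hd : 0 < 2 * s + 3 * γ := by linarith
  have hd4 : 0 < 4 * s + 3 * γ := by linarith
  have hd' := hd.ne'
  have hd4' := hd4.ne'
  have hs0 : 0 < s := by linarith
  obtain ⟨ν, hν⟩ : ∃ ν, ν = 3 * s / (2 * s + 3 * γ) := ⟨_, rfl⟩
  obtain ⟨κ, hκ⟩ : ∃ κ, κ = -(3 * γ) / (2 * s + 3 * γ) := ⟨_, rfl⟩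
  have hν0 : 0 < ν := by rw [hν]; positivity
  have hκ0 : 0 < κ := by rw [hκ]; exact div_pos (by linarith) hd
  have h2κ : 2 + κ = (4 * s + 3 * γ) / (2 * s + 3 * γ) := by
    rw [hκ, eq_div_iff hd', add_mul, div_mul_cancel₀ _ hd']; ring
  set C₀ : ℝ := ((3 / 2 + B * 2 ^ k) / A) ^ (3 / 2 : ℝ) *
      ((4 : ℝ) ^ (0 : ℝ) * 4 ^ (4 / 5 : ℝ)) ^ (1 / (1 - 3 * (1 / 5)) : ℝ) with hC₀
  have hC₀0 : 0 < C₀ := by positivity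
  set H₁ := ((ν + B) * (2 + κ) ^ k / A) ^ ν with hH₁
  have hH₁0 : 0 < H₁ := by positivity
  set b := (2 : ℝ) ^ ((k + 1) * ν) with hb
  have hb0 : 0 < b := by positivity
  set Θ := 3 * s / (4 * s + 3 * γ) + 3 / 4 with hΘ
  have hΘ0 : 0 < Θ := by positivity
  refine ⟨(H₁ * b ^ 2 * C₀) ^ (1 / (2 + κ)) * 2 ^ Θ, by positivity, ?_⟩
  intro ε f M T tstar hEI hadm hε hM hts hmom t ht htT
  -- Half of the available time produces the `L²` bound, the other half feeds the iteration; the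
  -- minimum with `1` keeps every window short.
  set τ := min tstar 1 / 2 with hτ
  have hmin : 0 < min tstar 1 := lt_min hts one_pos
  have hτ0 : 0 < τ := by positivity
  have hτ1 : τ ≤ 1 := by linarith [min_le_right tstar 1]
  have hτt : 2 * τ ≤ t := by linarith [min_le_left tstar 1]
  have h2 : ∀ r, τ ≤ r → r < T → ∫ x, f r x ^ (2 : ℝ) ≤ C₀ * τ ^ (-(3 / 2) : ℝ) := fun r hr _ =>
    hEI.sq_bound hadm hε hγ hγ0 hA hB hτ0 hτ1 hr
  have H := hEI.ae_le hadm hε hγ0 hA hB hk hs hM hτ0 hτ1 hmom (by positivity) h2 hν hκ hτt htT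
  filter_upwards [H] with x hx
  refine hx.trans ?_
  have e1 : H₁ * τ ^ (-ν) * M ^ κ * b ^ 2 * (C₀ * τ ^ (-(3 / 2) : ℝ)) =
      H₁ * b ^ 2 * C₀ * τ ^ (-(ν + 3 / 2)) * M ^ κ := by
    rw [show -(ν + 3 / 2) = -ν + -(3 / 2) by ring, Real.rpow_add hτ0]; ring
  rw [e1, Real.mul_rpow (by positivity) (by positivity), Real.mul_rpow (by positivity) (by positivity),
    ← Real.rpow_mul hτ0.le, ← Real.rpow_mul hM.le]
  have e2 : κ * (1 / (2 + κ)) = -(3 * γ) / (4 * s + 3 * γ) := by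
    rw [h2κ, hκ, one_div_div, div_mul_div_cancel₀ hd']
  rw [e2]
  have e3 : τ ^ (-(ν + 3 / 2) * (1 / (2 + κ))) ≤ 2 ^ Θ * (1 + tstar ^ (-Θ)) := by
    -- The term `ν / (2 + κ)` is exactly `3 s / (4 s + 3 γ)`. The `L²` bound contributes `(3/2) / (2
    -- + κ) ≤ 3/4`, the source of the summand `3/4` in the final exponent.
    have h5 : -Θ ≤ -(ν + 3 / 2) * (1 / (2 + κ)) := by
      have h6 : ν * (1 / (2 + κ)) = 3 * s / (4 * s + 3 * γ) := by
        rw [h2κ, hν, one_div_div, div_mul_div_cancel₀ hd']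
      have h7 : (1 / (2 + κ)) ≤ 1 / 2 := one_div_le_one_div_of_le two_pos (by linarith)
      rw [hΘ]; nlinarith
    refine (Real.rpow_le_rpow_of_exponent_ge hτ0 hτ1 h5).trans ?_
    rw [hτ, Real.div_rpow hmin.le two_pos.le, Real.rpow_neg two_pos.le, div_inv_eq_mul, mul_comm]
    gcongr
    rcases min_choice tstar 1 with h | h
    · rw [h]; linarith
    · rw [h, Real.one_rpow]; linarith [Real.rpow_nonneg hts.le (-Θ)]
  rw [show -(3 * s / (4 * s + 3 * γ)) - 3 / 4 = -Θ by rw [hΘ]; ring,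
    mul_assoc ((H₁ * b ^ 2 * C₀) ^ (1 / (2 + κ))) (2 ^ Θ)]
  gcongr
end
end LFD
end

/-! ### Conclusion: moments in `[0, ∞]` and the dichotomy in `ε`. -/

noncomputable section
namespace LFD
open MeasureTheory Set Filter Topology

section
variable {ε ε₀ γ s T : ℝ} {fin g : V → ℝ} {f : ℝ → V → ℝ}

lemma moment_congr {g' : V → ℝ} (h : g =ᵐ[volume] g') : moment s g = moment s g' :=
  lintegral_congr_ae (by filter_upwards [h] with v hv; rw [hv])

lemma integrable_and_integral_le_of_moment {m M : ℝ} (hg : Adm m M g) {D : ENNReal} (hD : D ≠ ⊤)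
    (h : moment s g ≤ D) : Integrable (fun v => g v * bracket v ^ s) ∧
      ∫ v, g v * bracket v ^ s ≤ D.toReal := by
  have h0 : ∀ v, 0 ≤ g v * bracket v ^ s := fun v =>
    mul_nonneg (hg.nonneg v) (Real.rpow_nonneg (bracket_pos v).le _)
  have hm : AEStronglyMeasurable (fun v => g v * bracket v ^ s) volume :=
    hg.meas.mul (contDiff_bracket_rpow s (n := 0)).continuous.aestronglyMeasurable
  refine ⟨⟨hm, ?_⟩, ?_⟩
  · rw [hasFiniteIntegral_iff_ofReal (ae_of_all _ h0)]
    exact h.trans_lt hD.lt_top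
  · rw [integral_eq_lintegral_of_nonneg_ae (ae_of_all _ h0) hm]
    exact ENNReal.toReal_mono hD h

/-- The moment dominates the unit mass. Hence its positive powers are at least `1`, and a bound by a
constant alone is also of the required form. -/
lemma one_le_moment (hs : 0 ≤ s) (hg : MemL1 2 g) (h0 : ∀ᵐ v, 0 ≤ g v) (h1 : ∫ v, g v = 1) :
    1 ≤ moment s g := by
  have h2 : ∫⁻ v, ENNReal.ofReal (g v) = 1 := by
    rw [← ofReal_integral_eq_lintegral_ofReal hg.integrable h0, h1, ENNReal.ofReal_one]
  rw [← h2]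
  refine lintegral_mono_ae ?_
  filter_upwards [h0] with v hv
  exact ENNReal.ofReal_le_ofReal
    (le_mul_of_one_le_right hv (Real.one_le_rpow (one_le_bracket v) hs))
end

/-- The pointwise bound for the truncated solution at a fixed time. -/
theorem exists_trunc_bound (γ s h : ℝ) (hγ : -2 < γ) (hγ0 : γ < 0) (hs : -(3 / 2 * γ) < s) :
    ∃ C : ℝ, 0 < C ∧ ∀ (ε₀ ε : ℝ) (fin : V → ℝ) (f : ℝ → V → ℝ),
      IsInitialDatum ε₀ fin → boltzmannEntropy fin = h → 0 < ε → ε ≤ ε₀ → IsWeakSolution γ ε fin f →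
      ∀ tstar T : ℝ, ∀ D : ENNReal, 0 < tstar → 1 ≤ D → D ≠ ⊤ →
        (∀ t ∈ Ico 0 T, moment s (f t) ≤ D) →
        ∀ t ∈ Ico tstar T, ∀ᵐ v, trunc ε (f t v) ≤
          C * (1 + tstar ^ (-(3 * s / (4 * s + 3 * γ)) - 3 / 4)) *
            D.toReal ^ (-(3 * γ) / (4 * s + 3 * γ)) := by
  obtain ⟨K, hK, hco⟩ := exists_coercive γ h hγ hγ0
  obtain ⟨A, B, k, hA, hB, hk, hEI⟩ := exists_energyIneq hγ hγ0 hK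
  obtain ⟨C, hC, hsup⟩ := exists_sup_const hγ hγ0 hA hB.le hk hs
  have hL := Lev_pos h
  refine ⟨C + 2 * Lev h, by positivity, ?_⟩
  intro ε₀ ε fin f hI hh hε hle hW tstar T D hts hD1 hD hmom t ht
  have hDr : 1 ≤ D.toReal := by
    have := ENNReal.toReal_mono hD hD1
    rwa [ENNReal.toReal_one] at this
  have he : 0 ≤ -(3 * γ) / (4 * s + 3 * γ) := div_nonneg (by linarith) (by linarith)
  have h1 : 1 ≤ D.toReal ^ (-(3 * γ) / (4 * s + 3 * γ)) := Real.one_le_rpow hDr he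
  have h2 := Real.rpow_nonneg hts.le (-(3 * s / (4 * s + 3 * γ)) - 3 / 4)
  -- Small `ε` gives ellipticity and the smoothing estimate. Otherwise `ε⁻¹ < 2 Lev h`, and the
  -- Pauli bound `f ≤ ε⁻¹` suffices; the constant `C + 2 Lev h` covers both cases.
  by_cases hsmall : ε ≤ 1 / (2 * Lev h)
  · obtain ⟨F, hE⟩ := hW.exists_ev hI hε hγ hγ0
    have hEn := hEI ε _ F hε hE fun t ht x ξ =>
      hco ε₀ ε fin _ hI hh hε hle (hW.memY_trunc ht.le) (fun v => trunc_nonneg _ _)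
        (fun v => trunc_le hε _) hsmall x ξ
    have H := hsup ε _ D.toReal T tstar hEn hE.adm hε (by linarith) hts (fun r hr hrT =>
      integrable_and_integral_le_of_moment (hE.adm r hr) hD
        ((moment_congr (hW.trunc_ae hr.le)).symm.le.trans (hmom r ⟨hr.le, hrT⟩))) t ht.1 ht.2
    filter_upwards [H] with v hv
    refine hv.trans ?_
    gcongr
    linarith
  · refine ae_of_all _ fun v => (trunc_le hε _).trans ?_
    have h3 : ε⁻¹ ≤ 2 * Lev h := by
      rw [inv_le_comm₀ hε (by positivity), ← one_div]; exact (not_le.1 hsmall).le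
    have h4 : 2 * Lev h ≤ (C + 2 * Lev h) *
        (1 + tstar ^ (-(3 * s / (4 * s + 3 * γ)) - 3 / 4)) := by nlinarith
    have h5 : 0 ≤ (C + 2 * Lev h) * (1 + tstar ^ (-(3 * s / (4 * s + 3 * γ)) - 3 / 4)) := by
      positivity
    nlinarith
end LFD
end

theorem theorem1p10 (γ s m h : ℝ) (hγ : -2 < γ) (hγ0 : γ < 0) (hs : 3 / 2 * |γ| < s) :
    ∃ C : ℝ, 0 < C ∧
      ∀ (ε₀ ε : ℝ) (fin : LFD.V → ℝ) (f : ℝ → LFD.V → ℝ),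
        LFD.IsInitialDatum ε₀ fin → LFD.MemL1 s fin →
        LFD.normL1 2 fin = m → LFD.boltzmannEntropy fin = h →
        0 < ε → ε ≤ ε₀ → LFD.IsWeakSolution γ ε fin f →
        ∀ tstar T : ℝ, 0 < tstar → tstar < T →
          (⨆ t ∈ Set.Ico tstar T, MeasureTheory.eLpNorm (f t) ⊤ MeasureTheory.volume)
            ≤ ENNReal.ofReal
                (C * (1 + tstar ^ (-(3 * s / (4 * s - 3 * |γ|)) - 3 / 4)))
              * (⨆ t ∈ Set.Ico 0 T, LFD.moment s (f t))
                  ^ (3 * |γ| / (4 * s - 3 * |γ|)) := by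
  rw [abs_of_neg hγ0] at hs
  obtain ⟨C, hC, hbound⟩ := LFD.exists_trunc_bound γ s h hγ hγ0 (by linarith)
  refine ⟨C, hC, fun ε₀ ε fin f hI _ _ hh hε hle hW tstar T hts hT => ?_⟩
  rw [abs_of_neg hγ0, show 4 * s - 3 * -γ = 4 * s + 3 * γ by ring, show 3 * -γ = -(3 * γ) by ring]
  set D := ⨆ t ∈ Set.Ico 0 T, LFD.moment s (f t) with hD
  have hDt : ∀ t ∈ Set.Ico 0 T, LFD.moment s (f t) ≤ D := fun t ht =>
    le_iSup₂ (f := fun t (_ : t ∈ Set.Ico 0 T) => LFD.moment s (f t)) t ht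
  have hY := hW.memY 0 le_rfl
  have hD1 : 1 ≤ D := (LFD.one_le_moment (by linarith) hY.memL1 (hY.bounds.mono fun v hv => hv.1)
    (hY.mass.trans hI.mass)).trans (hDt 0 ⟨le_rfl, hts.trans hT⟩)
  have he : 0 < -(3 * γ) / (4 * s + 3 * γ) := div_pos (by linarith) (by linarith)
  have hpos : 0 < C * (1 + tstar ^ (-(3 * s / (4 * s + 3 * γ)) - 3 / 4)) := by positivity
  -- An infinite moment makes the right-hand side infinite, since both the exponent and the
  -- prefactor are positive.
  by_cases hDtop : D = ⊤
  · rw [hDtop, ENNReal.top_rpow_of_pos he, ENNReal.mul_top (ENNReal.ofReal_pos.2 hpos).ne']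
    exact le_top
  · have hDr : ENNReal.ofReal D.toReal = D := ENNReal.ofReal_toReal hDtop
    rw [← hDr, ENNReal.ofReal_rpow_of_nonneg ENNReal.toReal_nonneg he.le,
      ← ENNReal.ofReal_mul hpos.le]
    refine iSup₂_le fun t ht => ?_
    have hb := hbound ε₀ ε fin f hI hh hε hle hW tstar T D hts hD1 hDtop hDt t ht
    rw [MeasureTheory.eLpNorm_congr_ae (hW.trunc_ae (hts.le.trans ht.1)),
      MeasureTheory.eLpNorm_exponent_top]
    refine MeasureTheory.eLpNormEssSup_le_of_ae_bound ?_
    filter_upwards [hb] with v hv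
    rwa [Real.norm_of_nonneg (LFD.trunc_nonneg _ _)]
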